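/- **Setting.** Fix finite sets $\mathcal S$ (states) and $\mathcal A\neq\emptyset$ (actions), a horizon $H\ge 1$, a partition $\mathcal S=\mathcal S_1\sqcup\dots\sqcup\mathcal S_H$, an initial state $s_1\in\mathcal S_1$, and a $\sigma$-finite base measure $\nu$ on $\mathbb R$ (e.g. Lebesgue measure). Let $\mathcal R$ be a family of probability densities with respect to $\nu$ with finite means $\mu(g)$; write $D_{\rm TV}$ for total variation. Assume the following (the log-ratio is infinite where a density vanishes). (a) For every $f\in\mathcal R$ there are $c_7\in(0,1]$, $C>0$, $k\in\mathbb N$ such that for all $\delta\in(0,1)$ $$\Pr_{x\sim f}\Big(\exists g,g'\in\mathcal R:\ \Big|\ln\tfrac{g(x)}{g'(x)}\Big|>D_{\rm TV}(g\|g')^{c_7}\,C\,(1+\ln\tfrac1\delta)^k\Big)\le\delta .$$ (b) There are $c_8\in(0,1]$ and $C$ with $|\mu(g)-\mu(g')|\le C\,D_{\rm TV}(g\|g')^{c_8}$ for all $g,g'\in\mathcal R$. (c) There is $c_M>0$ with $\mathbb E_{x\sim g}\big[(\ln\frac{g(x)}{g'(x)})^4\big]\le c_M^4$ for all $g,g'\in\mathcal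 R$. (d) There is $K$ such that for every $\epsilon\in(0,1/2]$ some finite $\mathcal C\subseteq\mathcal R$ with $\ln|\mathcal C|\le K\ln(1/\epsilon)$ satisfies: every $g\in\mathcal R$ has a $g'\in\mathcal C$ with $D_{\rm TV}(g\|g')\le\epsilon$. Assume also that maximum likelihood over $\mathcal R$ is well posed: for all $f\in\mathcal R$ and $k$, for almost every i.i.d. sample $x_1,\dots,x_k$ from $f$, the maximum of $\prod_i g(x_i)$ over $g\in\mathcal R$ is attained. An instance $f$ consists of transition probabilities $p[s,a]$ with $\operatorname{supp}p[s,a]\subseteq\mathcal S_{h+1}$ for $s\in\mathcal S_h$, $h<H$, and reward densities $r[s,a]\in\mathcal R$. A decision is a map $\pi:\mathcal S\to\mathcal A$; $\Pi=\mathcal A^{\mathcal S}$. Let $f[\pi]$ be the law of the trajectory $o=(s_1,a_1,r_1,\dots,s_H,a_H,r_H)$ with $a_h=\pi(s_h)$, $r_h\sim r[s_h,a_h]$, $s_{h+1}\sim p[s_h,a_h]$ (and also its density), $R(o)=\sum_h r_h$, and $R_f(\pi)=\mathbb E_{o\sim f[\pi]}R(o)$. Let $\mathcal F$ be the set of all instances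 that have a unique maximiser $\pi^\star(f)$ of $R_f$, and $\Delta(f,\pi)=R_f(\pi^\star(f))-R_f(\pi)$. For $M\ge0$ let $$\mathcal C(f,M)=\inf\Big\{\sum_\pi w_\pi\Delta(f,\pi):\ w\in[0,M]^\Pi,\ \sum_\pi w_\pi D_{\rm KL}(f[\pi]\|g[\pi])\ge1\ \ \forall g\in\mathcal F,\ \pi^\star(g)\ne\pi^\star(f)\Big\},$$ and $\mathcal C(f)=\lim_{n\to\infty}\mathcal C(f,n)\in[0,\infty]$. In round $t=1,\dots,n$ an algorithm picks $\pi_t$ from the past and observes $o_t\sim f[\pi_t]$; its expected regret is $\mathrm{Reg}_{f,n}=\mathbb E_f\big[\sum_{t\le n}\Delta(f,\pi_t)\big]$. **Test-to-Commit** with horizon $n$. *Step 1.* Play each decision $\lceil\ln n/\ln\ln n\rceil$ times; let $\hat f\in\mathcal F$ maximise the likelihood of the observations over $\mathcal F$ (arbitrary tie-breaking; an arbitrary element of $\mathcal F$ if there is no maximiser). *Step 2.* Let $\hat w\in[0,(\ln\ln n)^{1/4}]^\Pi$ be an optimal solution of the program defining $\mathcal C(\hat f,(\ln\ln n)^{1/4})$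 (an arbitrary point of this box if there is none), and play each $\pi$ exactly $\lceil\bar w_\pi\ln n\rceil$ times, where $\bar w_\pi=(1+(\ln\ln n)^{-1/4})\hat w_\pi+(\ln\ln n)^{-1/4}$. With these decisions and observations $(\pi_i,o_i)_{i\le m}$, accept $\hat f$ if $\sum_{i\le m}\ln\frac{\hat f[\pi_i](o_i)}{g[\pi_i](o_i)}\ge\ln n$ for all $g\in\mathcal F$ with $\pi^\star(g)\ne\pi^\star(\hat f)$. *Step 3.* If $\hat f$ is accepted, play $\pi^\star(\hat f)$ in all remaining rounds; otherwise run a UCB algorithm afresh on the remaining rounds, with the decisions as arms and $R(o_t)$ as rewards. (All choices are assumed measurable.) **Theorem.** For every $f^\star\in\mathcal F$, Test-to-Commit satisfies $$\limsup_{n\to\infty}\frac{\mathrm{Reg}_{f^\star,n}}{\ln n}\le\mathcal C(f^\star)$$ in each of the following two cases. 1. For some $V,b\ge0$, $\mathbb E_{o\sim f[\pi]}e^{\lambda(R(o)-R_f(\pi))}\le e^{V\lambda^2/2}$ for all $f\in\mathcal F$, $\pi\in\Pi$ and $|\lambda|b\le1$ (sub-exponential rewards; sub-Gaussian, e.g.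 for Gaussian $\mathcal R$, if $b=0$), and the UCB algorithm plays, after $t$ rounds of its own, a decision that maximises (empirical mean) $+\sqrt{2Vx/N}+2bx/N$, where $x=4\ln(t+1)$ and $N$ is the number of plays of the decision (the index is $+\infty$ if $N=0$). 2. The UCB algorithm is any non-randomised bandit algorithm whose expected regret on every $f\in\mathcal F$ is $O(\ln n)$. -/

import Mathlib

open MeasureTheory Filter Topology InformationTheory
open scoped ENNReal NNReal

noncomputable section

namespace T2C

/-! ### Reward distributions -/

/-- A probability distribution on `ℝ` given by a density with respect to the base measure `ν`. -/
structure RewardDensity (ν : Measure ℝ) where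
  dens : ℝ → ℝ≥0
  measurable_dens : Measurable dens
  lintegral_dens : ∫⁻ x, (dens x : ℝ≥0∞) ∂ν = 1

namespace RewardDensity

variable {ν : Measure ℝ}

/-- The distribution with density `g`. -/
def law (g : RewardDensity ν) : Measure ℝ := ν.withDensity fun x => (g.dens x : ℝ≥0∞)

/-- The mean `μ(g)`. -/
def mean (g : RewardDensity ν) : ℝ := ∫ x, x ∂g.law

/-- The total variation distance. -/
def tv (g g' : RewardDensity ν) : ℝ := (1 / 2) * ∫ x, |(g.dens x : ℝ) - (g'.dens x : ℝ)| ∂ν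

/-- `|ln (g(x) / g'(x))|`, with value `∞` as soon as one of the two densities vanishes at `x`. -/
def absLogRatio (g g' : RewardDensity ν) (x : ℝ) : ℝ≥0∞ :=
  (ENNReal.log ((g.dens x : ℝ≥0∞) / (g'.dens x : ℝ≥0∞))).abs

end RewardDensity

/-- The four requirements on the reward distribution family `𝓡`. -/
structure RewardCondition {ν : Measure ℝ} (𝓡 : Set (RewardDensity ν)) : Prop where
  /-- With probability at least `1 - δ` over `x ∼ f`, all log-ratios at `x` are at most
  `D_TV(g, g') ^ c₇ * polylog (1 / δ)`. The event is measured by the outer measure of the law. -/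
  tail : ∀ f ∈ 𝓡, ∃ c₇ : ℝ, 0 < c₇ ∧ c₇ ≤ 1 ∧ ∃ C : ℝ, 0 < C ∧ ∃ k : ℕ,
    ∀ δ : ℝ, 0 < δ → δ < 1 →
      f.law {x | ∃ g ∈ 𝓡, ∃ g' ∈ 𝓡,
        ENNReal.ofReal (g.tv g' ^ c₇ * (C * (1 + Real.log (1 / δ)) ^ k)) < g.absLogRatio g' x}
        ≤ ENNReal.ofReal δ
  /-- The mean is Hölder continuous in total variation. -/
  mean_tv : ∃ c₈ : ℝ, 0 < c₈ ∧ c₈ ≤ 1 ∧ ∃ C : ℝ, ∀ g ∈ 𝓡, ∀ g' ∈ 𝓡,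
    |g.mean - g'.mean| ≤ C * g.tv g' ^ c₈
  /-- The fourth moments of the log-ratios are uniformly bounded. -/
  moment : ∃ cM : ℝ, 0 < cM ∧ ∀ g ∈ 𝓡, ∀ g' ∈ 𝓡,
    ∫⁻ x, g.absLogRatio g' x ^ 4 ∂g.law ≤ ENNReal.ofReal (cM ^ 4)
  /-- There are proper total variation covers of log-size `O(log (1 / ε))`. -/
  cover : ∃ K : ℝ, ∀ ε : ℝ, 0 < ε → ε ≤ 1 / 2 → ∃ 𝓒 : Finset (RewardDensity ν),
    (∀ g ∈ 𝓒, g ∈ 𝓡) ∧ (∀ g ∈ 𝓡, ∃ g' ∈ 𝓒, g.tv g' ≤ ε) ∧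
      Real.log (𝓒.card : ℝ) ≤ K * Real.log (1 / ε)

/-- Maximum likelihood estimation within the reward family is well posed: for i.i.d. samples from
a member of the family, the likelihood almost surely attains its maximum over the family. -/
def HasRewardMLE {ν : Measure ℝ} (𝓡 : Set (RewardDensity ν)) : Prop :=
  ∀ f ∈ 𝓡, ∀ k : ℕ, ∀ᵐ x ∂(Measure.pi fun _ : Fin k => f.law),
    ∃ g ∈ 𝓡, ∀ g' ∈ 𝓡, ∏ i, g'.dens (x i) ≤ ∏ i, g.dens (x i)

/-! ### Tabular episodic reinforcement learning -/

/-- The known part of the problem: the partition of the states into the layers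
`0, …, H - 1` and the fixed initial state, which lies in the first layer. -/
structure Skeleton (S : Type*) (H : ℕ) [NeZero H] where
  layer : S → Fin H
  init : S
  layer_init : layer init = 0

/-- A deterministic policy (a decision). -/
abbrev Policy (S A : Type*) := S → A

/-- A trajectory `(s₁, a₁, r₁, …, s_H, a_H, r_H)` (an observation). -/
abbrev Traj (S A : Type*) (H : ℕ) := Fin H → S × A × ℝ

/-- The reward `R(o) = r₁ + ⋯ + r_H` of a trajectory. -/
def totalReward {S A : Type*} {H : ℕ} (o : Traj S A H) : ℝ := ∑ h, (o h).2.2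

/-- An instance: transitions that lead from each layer to the next one, and reward densities.
(Transitions out of the last layer play no role.) -/
structure MDP {S : Type*} (A : Type*) {H : ℕ} [NeZero H] (sk : Skeleton S H)
    (ν : Measure ℝ) where
  trans : S → A → PMF S
  reward : S → A → RewardDensity ν
  layered : ∀ s a s', (sk.layer s : ℕ) + 1 < H → trans s a s' ≠ 0 →
    (sk.layer s' : ℕ) = (sk.layer s : ℕ) + 1

section Model

variable {S A : Type*} [Fintype S] [DecidableEq S] [MeasurableSpace S] [MeasurableSingletonClass S]
  [Fintype A] [DecidableEq A] [MeasurableSpace A] [MeasurableSingletonClass A] [Nonempty A]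
  {H : ℕ} [NeZero H] {sk : Skeleton S H} {ν : Measure ℝ}

/-- The density `f[π](o)` of a trajectory. -/
def trajDensity (f : MDP A sk ν) (π : Policy S A) (o : Traj S A H) : ℝ≥0∞ :=
  (if (o 0).1 = sk.init then 1 else 0) *
  (∏ h, if (o h).2.1 = π (o h).1 then 1 else 0) *
  (∏ h, ((f.reward (o h).1 (o h).2.1).dens (o h).2.2 : ℝ≥0∞)) *
  ∏ h : Fin H, if hh : (h : ℕ) + 1 < H then
    f.trans (o h).1 (o h).2.1 (o ⟨(h : ℕ) + 1, hh⟩).1 else 1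

/-- The distribution `f[π]` of the trajectory; states and actions have the counting measure, and
rewards the measure `ν`, as base measure. -/
def trajLaw (f : MDP A sk ν) (π : Policy S A) : Measure (Traj S A H) :=
  (Measure.pi fun _ : Fin H =>
    (Measure.count : Measure S).prod ((Measure.count : Measure A).prod ν)).withDensity
    (trajDensity f π)

/-- The expected reward `R_f(π)`. -/
def value (f : MDP A sk ν) (π : Policy S A) : ℝ := ∫ o, totalReward o ∂(trajLaw f π)

/-- An optimal decision `π⋆(f)` (the only one, for an instance of the class below). -/
def optPolicy (f : MDP A sk ν) : Policy S A := Classical.choose (Finite.exists_max (value f))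

/-- The sub-optimality gap `Δ(f, π)`. -/
def gap (f : MDP A sk ν) (π : Policy S A) : ℝ := value f (optPolicy f) - value f π

/-- The hypothesis class: all instances whose reward distributions lie in `𝓡` and that have a
unique optimal decision. -/
def instances (A : Type*) [Fintype A] [DecidableEq A] [MeasurableSpace A] (sk : Skeleton S H)
    (𝓡 : Set (RewardDensity ν)) : Set (MDP A sk ν) :=
  {f | (∀ s a, f.reward s a ∈ 𝓡) ∧ ∃! π : Policy S A, ∀ π', value f π' ≤ value f π}

/-- The instances of the class whose optimal decision differs from that of `f`. -/
def alternatives (𝓡 : Set (RewardDensity ν)) (f : MDP A sk ν) : Set (MDP A sk ν) :=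
  {g | g ∈ instances A sk 𝓡 ∧ optPolicy g ≠ optPolicy f}

/-! ### The complexity measure -/

/-- The constraints of the program that defines `𝒞(f, M)`. -/
def Feasible (𝓡 : Set (RewardDensity ν)) (f : MDP A sk ν) (M : ℝ) (w : Policy S A → ℝ) : Prop :=
  (∀ π, 0 ≤ w π ∧ w π ≤ M) ∧
  ∀ g ∈ alternatives 𝓡 f,
    1 ≤ ∑ π, ENNReal.ofReal (w π) * klDiv (trajLaw f π) (trajLaw g π)

/-- The objective of the program. -/
def cost (f : MDP A sk ν) (w : Policy S A → ℝ) : ℝ := ∑ π, w π * gap f π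

/-- `w` solves the program that defines `𝒞(f, M)`. -/
def IsSolution (𝓡 : Set (RewardDensity ν)) (f : MDP A sk ν) (M : ℝ) (w : Policy S A → ℝ) : Prop :=
  Feasible 𝓡 f M w ∧ ∀ w', Feasible 𝓡 f M w' → cost f w ≤ cost f w'

/-- The value `𝒞(f, M)` of the program (`∞` if there is no feasible point). -/
def complexityAt (𝓡 : Set (RewardDensity ν)) (f : MDP A sk ν) (M : ℝ) : ℝ≥0∞ :=
  ⨅ (w : Policy S A → ℝ) (_ : Feasible 𝓡 f M w), ENNReal.ofReal (cost f w)

/-- `𝒞(f) = lim 𝒞(f, n)`; the limit exists, because `𝒞(f, n)` is non-increasing in `n`. -/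
def complexity (𝓡 : Set (RewardDensity ν)) (f : MDP A sk ν) : ℝ≥0∞ :=
  limUnder atTop fun n : ℕ => complexityAt 𝓡 f n

/-! ### Interaction and regret -/

/-- A (non-randomised) algorithm chooses the decision of round `t` from the decisions and
observations of the `t` rounds before. -/
abbrev Algorithm (S A : Type*) (H : ℕ) :=
  (t : ℕ) → (Fin t → Policy S A × Traj S A H) → Policy S A

/-- The law of the first `t` decisions and observations when the algorithm interacts with `f`:
the next observation is drawn from `f[π]`, where `π` is the decision chosen by the algorithm. -/
def historyLaw (alg : Algorithm S A H) (f : MDP A sk ν) :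
    (t : ℕ) → Measure (Fin t → Policy S A × Traj S A H)
  | 0 => Measure.dirac Fin.elim0
  | t + 1 => (historyLaw alg f t).bind fun h =>
      (trajLaw f (alg t h)).map fun o => Fin.snoc h (alg t h, o)

/-- The expected regret of `n` rounds. -/
def regret (alg : Algorithm S A H) (f : MDP A sk ν) (n : ℕ) : ℝ≥0∞ :=
  ∑ t ∈ Finset.range n, ∫⁻ h, ENNReal.ofReal (gap f (alg t h)) ∂(historyLaw alg f t)

/-! ### The upper confidence bound algorithm -/

/-- Upper confidence bound of a decision that was played `N > 0` times within `t` rounds: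
empirical mean plus `√(2Vx/N) + 2bx/N` with `x = 4 ln (t + 1)`. Decisions that were not played
have an infinite bound. -/
def ucbIndex (V b : ℝ) {t : ℕ} (hist : Fin t → Policy S A × Traj S A H) (π : Policy S A) : EReal :=
  let plays : Finset (Fin t) := Finset.univ.filter fun i => (hist i).1 = π
  let N : ℝ := plays.card
  if plays.card = 0 then ⊤
  else (((∑ i ∈ plays, totalReward (hist i).2) / N
    + Real.sqrt (2 * V * (4 * Real.log (t + 1)) / N)
    + 2 * b * (4 * Real.log (t + 1)) / N : ℝ) : EReal)

/-- `alg` always plays a decision of largest upper confidence bound (ties are broken in any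
measurable way). -/
def IsUCB (V b : ℝ) (alg : Algorithm S A H) : Prop :=
  (∀ t, Measurable (alg t)) ∧
  ∀ (t : ℕ) (hist : Fin t → Policy S A × Traj S A H) (π : Policy S A),
    ucbIndex V b hist π ≤ ucbIndex V b hist (alg t hist)

/-- Under every instance and decision, the reward `R(o)` is sub-exponential with variance
proxy `V` and scale `b` (sub-Gaussian for `b = 0`). -/
def SubExponentialRewards (sk : Skeleton S H) (𝓡 : Set (RewardDensity ν)) (V b : ℝ) : Prop :=
  ∀ f ∈ instances A sk 𝓡, ∀ (π : Policy S A) (l : ℝ), |l| * b ≤ 1 →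
    ∫⁻ o, ENNReal.ofReal (Real.exp (l * (totalReward o - value f π))) ∂(trajLaw f π)
      ≤ ENNReal.ofReal (Real.exp (V * l ^ 2 / 2))

/-- The expected regret on `f` is `O(ln n)`. -/
def HasLogRegret (alg : Algorithm S A H) (f : MDP A sk ν) : Prop :=
  ∃ C : ℝ, ∀ᶠ n : ℕ in atTop, regret alg f n ≤ ENNReal.ofReal (C * Real.log n)

/-! ### Test-to-Commit -/

/-- The list of decisions in which each decision `π` occurs `c π` times. -/
def playList (c : Policy S A → ℕ) : List (Policy S A) :=
  (Finset.univ : Finset (Policy S A)).toList.flatMap fun π => List.replicate (c π) π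

/-- The decisions of the initialization step: each decision `⌈ln n / ln ln n⌉` times. -/
def initList (S A : Type*) [Fintype S] [DecidableEq S] [Fintype A] (n : ℕ) : List (Policy S A) :=
  playList fun _ => ⌈Real.log n / Real.log (Real.log n)⌉₊

/-- The bound `(ln ln n) ^ (1/4)` of the program solved in the identification step. -/
def bound (n : ℕ) : ℝ := Real.log (Real.log n) ^ (1 / 4 : ℝ)

/-- The decisions of the identification step: decision `π` is played `⌈w̄_π ln n⌉` times, where
`w̄_π = (1 + 1 / (ln ln n)^(1/4)) w_π + 1 / (ln ln n)^(1/4)`. -/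
def identList (n : ℕ) (w : Policy S A → ℝ) : List (Policy S A) :=
  playList fun π => ⌈((1 + 1 / bound n) * w π + 1 / bound n) * Real.log n⌉₊

/-- The likelihood `∏ i, f[πᵢ](oᵢ)` (the exponential of the log-likelihood). -/
def likelihood (f : MDP A sk ν) {m : ℕ} (x : Fin m → Policy S A × Traj S A H) : ℝ≥0∞ :=
  ∏ i, trajDensity f (x i).1 (x i).2

/-- The log-likelihood ratio test accepts `f`: for all instances `g` with another optimal decision,
`∑ i, ln (f[πᵢ](oᵢ) / g[πᵢ](oᵢ)) ≥ ln n`, written multiplicatively. -/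
def Accepts (𝓡 : Set (RewardDensity ν)) (n : ℕ) (f : MDP A sk ν) {m : ℕ}
    (x : Fin m → Policy S A × Traj S A H) : Prop :=
  ∀ g ∈ alternatives 𝓡 f, (n : ℝ≥0∞) * likelihood g x ≤ likelihood f x

/-- Estimators: maps from the data of the initialization step to instances. -/
abbrev Estimator {S : Type*} (A : Type*) [Fintype S] [DecidableEq S] [Fintype A] {H : ℕ} [NeZero H]
    (sk : Skeleton S H) (ν : Measure ℝ) (n : ℕ) :=
  (Fin (initList S A n).length → Policy S A × Traj S A H) → MDP A sk ν

/-- Maximum likelihood estimation over the class with arbitrary tie-breaking. If the likelihood has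
no maximiser (the class is not compact), any member of the class may be returned. -/
def IsMLE (𝓡 : Set (RewardDensity ν)) {n : ℕ} (est : Estimator A sk ν n) : Prop :=
  ∀ x, est x ∈ instances A sk 𝓡 ∧
    ((∃ f ∈ instances A sk 𝓡, ∀ g ∈ instances A sk 𝓡, likelihood g x ≤ likelihood f x) →
      ∀ g ∈ instances A sk 𝓡, likelihood g x ≤ likelihood (est x) x)

/-- `plan f` is a solution of the program that defines `𝒞(f, (ln ln n)^(1/4))`. If there is no
solution (the program is infeasible), it is any point of the box `[0, (ln ln n)^(1/4)]^Π`. -/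
def IsPlan (𝓡 : Set (RewardDensity ν)) (n : ℕ) (plan : MDP A sk ν → Policy S A → ℝ) : Prop :=
  ∀ f ∈ instances A sk 𝓡, (∀ π, 0 ≤ plan f π ∧ plan f π ≤ bound n) ∧
    ((∃ w, IsSolution 𝓡 f (bound n) w) → IsSolution 𝓡 f (bound n) (plan f))

/-- What the algorithm computes from data is measurable: the solution of the program, the decision
it may commit to, and the outcome of the test. -/
def MeasurableChoices (𝓡 : Set (RewardDensity ν)) (n : ℕ) (est : Estimator A sk ν n)
    (plan : MDP A sk ν → Policy S A → ℝ) : Prop :=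
  (∀ π, Measurable fun x => plan (est x) π) ∧
  (Measurable fun x => optPolicy (est x)) ∧
  ∀ m : ℕ, MeasurableSet
    {x : (Fin (initList S A n).length → Policy S A × Traj S A H) ×
        (Fin m → Policy S A × Traj S A H) | Accepts 𝓡 n (est x.1) x.2}

open Classical in
/-- Test-to-Commit with horizon `n`: initialization and estimation, identification and test, then
commitment to the optimal decision of the estimate if the test accepts it, and otherwise a fresh
run of the bandit algorithm `ucb` for the remaining rounds. -/
def testToCommit (𝓡 : Set (RewardDensity ν)) (n : ℕ) (est : Estimator A sk ν n)
    (plan : MDP A sk ν → Policy S A → ℝ) (ucb : Algorithm S A H) : Algorithm S A H :=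
  fun t hist =>
    if h₁ : t < (initList S A n).length then (initList S A n)[t]
    else
      let fhat : MDP A sk ν := est fun i => hist ⟨i, by omega⟩
      let w : List (Policy S A) := identList n (plan fhat)
      let m₁ : ℕ := (initList S A n).length
      if h₂ : t < m₁ + w.length then w[t - m₁]
      else if Accepts 𝓡 n fhat (fun i : Fin w.length => hist ⟨m₁ + i, by omega⟩) then
        optPolicy fhat
      else ucb (t - (m₁ + w.length)) fun i => hist ⟨m₁ + w.length + i, by omega⟩

end Model

end T2C

end

set_option linter.unusedSectionVars false
set_option linter.unusedSimpArgs false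

noncomputable section

namespace T2C

/-! ### Reward densities -/

namespace RewardDensity

variable {ν : Measure ℝ}

/-! Write `M` for `bound n`, the fourth root of `ln ln n`. The regret is charged to what can happen
in the three steps; `regret_testToCommit_le` is this accounting, made independently of any estimate.
Initialization lasts about `ln n / M ^ 4` rounds up to a constant factor, hence costs `o(ln n)`.
Suppose that the estimate has the wrong optimal decision. Then the true instance is itself one of
the alternatives in the test, and Markov's inequality for the likelihood ratio, a supermartingale of
mean at most one, makes acceptance an event of probability at most `1 / n`
(`measure_likelihood_ratio_le`). Committing wrongly for `n` rounds thus costs `O(1)` in expectation,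
whatever the estimate was. It remains to see that the estimate is good with high probability, that a
good estimate has an almost optimal plan, and that it is then accepted with high probability; in the
exceptional events one pays for a plan, at most `O(M ln n)`, and for the fallback algorithm, `O(ln
n)`.

All three points rest on the factorization over pairs of a state and an action. Because of the
layers a trajectory visits a state at most once, so log-likelihoods are sums over pairs, and so is
the relative entropy, weighted by visit probabilities (`klDiv_trajLaw`). A history is good if, for
every pair, the counts of moves and the empirical log-ratios of all densities in the family are
close to their conditional expectations. Orthogonality of martingale differences and Chebyshev's
inequality give this for one function and any algorithm; finite covers, and a square-integrable
envelope `Y` with `|ln (g / g')| ≤ D_TV(g, g') ^ c * Y`, make it uniform over the family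
(`exists_measure_not_goodHist_le`). The failure probability is only of order `η ^ (-p) / t` for
accuracy `η` and `t` rounds. This suffices: with `η` a small negative power of `ln n`, the
probability times `O(M ln n)` is `o(ln n)`.

On a good history the unconstrained likelihood maximum splits into empirical transitions and one
reward estimate per pair. Gibbs' and Hellinger's inequalities show that it is close to the truth
(`exists_isClose_of_goodHist`): transitions agree up to factors near one, rewards in total
variation. Each pair is visited often enough because, with two actions available, uniqueness of the
optimal decision forces it to reach every state, and changing its action at one state reaches every
pair. Being close, the unconstrained maximizer lies in the class, so the class estimate attains the
same maximum.

Relative entropies may be unbounded or infinite, so closeness is transferred with a relative error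
plus an additive one, uniformly in the alternative (`exists_klDiv_ge`). Mixing a little of the true
transitions into an alternative shows that alternatives at finite divergence already determine the
program (`feasible_iff`); the feasible set is therefore compact. A feasible point for the truth,
scaled by `1 + θ`, is feasible for every close instance, which bounds the cost of the plan by any
`K` above the complexity, up to `o(1)` (`exists_cost_le`). Finally the extra factor `1 + 1 / M` in
the numbers of plays beats the errors of order `M * η ^ r`-type in the test, simultaneously for all
alternatives (`exists_accepts`). The optimistic algorithm of the first case has logarithmic regret
by the usual confidence interval argument (`hasLogRegret_of_isUCB`), so both cases follow from one
estimate. With a single action every gap is zero. -/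

/-- The real-valued log-ratio `ln (g(x) / g'(x))`. -/
def logRatio (g g' : RewardDensity ν) (x : ℝ) : ℝ := Real.log (g.dens x) - Real.log (g'.dens x)

theorem measurable_logRatio (g g' : RewardDensity ν) : Measurable (g.logRatio g') :=
  (Real.measurable_log.comp g.measurable_dens.coe_nnreal_real).sub
    (Real.measurable_log.comp g'.measurable_dens.coe_nnreal_real)

instance (g : RewardDensity ν) : IsProbabilityMeasure g.law :=
  ⟨by rw [law, withDensity_apply _ MeasurableSet.univ, Measure.restrict_univ, g.lintegral_dens]⟩

theorem integrable_dens (g : RewardDensity ν) : Integrable (fun x => (g.dens x : ℝ)) ν := by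
  refine ⟨g.measurable_dens.coe_nnreal_real.aestronglyMeasurable, ?_⟩
  rw [hasFiniteIntegral_iff_enorm]
  have : ∀ x, ‖(g.dens x : ℝ)‖ₑ = (g.dens x : ℝ≥0∞) := fun x => by
    simp [enorm_eq_nnnorm]
  simp [this, g.lintegral_dens]

theorem integral_dens (g : RewardDensity ν) : ∫ x, (g.dens x : ℝ) ∂ν = 1 := by
  have h0 : 0 ≤ᵐ[ν] fun x => (g.dens x : ℝ) := ae_of_all _ fun x => (g.dens x).2
  rw [integral_eq_lintegral_of_nonneg_ae h0
    g.measurable_dens.coe_nnreal_real.aestronglyMeasurable]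
  simp [g.lintegral_dens]

theorem integral_law (g : RewardDensity ν) (φ : ℝ → ℝ) :
    ∫ x, φ x ∂g.law = ∫ x, (g.dens x : ℝ) * φ x ∂ν := by
  rw [law, integral_withDensity_eq_integral_smul g.measurable_dens]
  rfl

theorem integrable_law_iff (g : RewardDensity ν) {φ : ℝ → ℝ} :
    Integrable φ g.law ↔ Integrable (fun x => (g.dens x : ℝ) * φ x) ν := by
  rw [law, integrable_withDensity_iff_integrable_smul g.measurable_dens]
  rfl

theorem ae_law_iff (g : RewardDensity ν) {p : ℝ → Prop} :
    (∀ᵐ x ∂g.law, p x) ↔ ∀ᵐ x ∂ν, g.dens x ≠ 0 → p x := by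
  rw [law, ae_withDensity_iff g.measurable_dens.coe_nnreal_ennreal]
  simp

theorem tv_nonneg (g g' : RewardDensity ν) : 0 ≤ g.tv g' := by
  unfold tv
  have : 0 ≤ ∫ x, |(g.dens x : ℝ) - (g'.dens x : ℝ)| ∂ν := integral_nonneg fun x => abs_nonneg _
  linarith

theorem integrable_abs_sub (g g' : RewardDensity ν) :
    Integrable (fun x => |(g.dens x : ℝ) - (g'.dens x : ℝ)|) ν :=
  (g.integrable_dens.sub g'.integrable_dens).abs

theorem tv_le_one (g g' : RewardDensity ν) : g.tv g' ≤ 1 := by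
  unfold tv
  have : ∫ x, |(g.dens x : ℝ) - (g'.dens x : ℝ)| ∂ν ≤ ∫ x, ((g.dens x : ℝ) + g'.dens x) ∂ν := by
    refine integral_mono (integrable_abs_sub g g') (g.integrable_dens.add g'.integrable_dens)
      fun x => ?_
    have h1 := (g.dens x).2
    have h2 := (g'.dens x).2
    simp only [NNReal.val_eq_coe] at h1 h2
    exact abs_le.2 ⟨by dsimp only; linarith, by dsimp only; linarith⟩
  rw [integral_add g.integrable_dens g'.integrable_dens, integral_dens, integral_dens] at this
  linarith

theorem tv_comm (g g' : RewardDensity ν) : g.tv g' = g'.tv g := by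
  unfold tv
  simp only [abs_sub_comm]

theorem absLogRatio_of_ne_top {g g' : RewardDensity ν} {x : ℝ} (h : g.absLogRatio g' x ≠ ⊤) :
    0 < g.dens x ∧ 0 < g'.dens x ∧
      g.absLogRatio g' x = ENNReal.ofReal |g.logRatio g' x| := by
  have h1 : 0 < g.dens x := by
    by_contra h0
    exact h (by simp [absLogRatio, nonpos_iff_eq_zero.1 (not_lt.1 h0)])
  have h2 : 0 < g'.dens x := by
    by_contra h0
    refine h ?_
    have : (g'.dens x : ℝ≥0∞) = 0 := by simpa using h0
    rw [absLogRatio, this, ENNReal.div_zero (by simpa using h1.ne')]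
    simp
  refine ⟨h1, h2, ?_⟩
  have e : (g.dens x : ℝ≥0∞) / (g'.dens x : ℝ≥0∞)
      = ENNReal.ofReal ((g.dens x : ℝ) / (g'.dens x : ℝ)) := by
    rw [ENNReal.ofReal_div_of_pos (by exact_mod_cast h2)]
    simp
  rw [absLogRatio, e, ENNReal.log_ofReal_of_pos (by positivity), EReal.abs_def, logRatio,
    Real.log_div (by positivity) (by positivity)]

/-- The Hellinger bound on the relative entropy. -/
theorem integral_logRatio_le {f g : RewardDensity ν} (hpos : ∀ᵐ x ∂f.law, 0 < g.dens x)
    (hi : Integrable (g.logRatio f) f.law) :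
    ∫ x, g.logRatio f x ∂f.law ≤ -(g.tv f) ^ 2 := by
  set t := g.tv f with ht
  have ht0 : 0 ≤ t := tv_nonneg g f
  have hi' := (integrable_law_iff f).1 hi
  rw [integral_law]
  -- Let `a` and `b` be the square roots of the two densities. From `ln y ≤ y - 1` the left side is
  -- at most `2ab - 2a²`, which is `(b² - a²) - (a - b)²`. The squared Hellinger term absorbs `t |b²
  -- - a²|` up to `(t² / 2)(a² + b²)`, and integration leaves `-2t² + t²`.
  have key : ∀ᵐ x ∂ν, (f.dens x : ℝ) * g.logRatio f x ≤
      (g.dens x - f.dens x : ℝ) - t * |(g.dens x : ℝ) - f.dens x|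
        + t ^ 2 / 2 * ((g.dens x : ℝ) + f.dens x) := by
    filter_upwards [(ae_law_iff f).1 hpos] with x hx
    set a : ℝ := Real.sqrt (f.dens x) with ha
    set b : ℝ := Real.sqrt (g.dens x) with hb
    have ha0 : 0 ≤ a := Real.sqrt_nonneg _
    have hb0 : 0 ≤ b := Real.sqrt_nonneg _
    have ea : (f.dens x : ℝ) = a ^ 2 := (Real.sq_sqrt (f.dens x).2).symm
    have eb : (g.dens x : ℝ) = b ^ 2 := (Real.sq_sqrt (g.dens x).2).symm
    have h1 : (f.dens x : ℝ) * g.logRatio f x ≤ 2 * (a * b) - 2 * a ^ 2 := by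
      by_cases hf : f.dens x = 0
      · have : a = 0 := by rw [ha, hf]; simp
        simp [hf, this]
      · have hg := hx hf
        have hfp : 0 < f.dens x := pos_iff_ne_zero.2 hf
        have ha1 : 0 < a := Real.sqrt_pos.2 (by exact_mod_cast hfp)
        have hb1 : 0 < b := Real.sqrt_pos.2 (by exact_mod_cast hg)
        have h2 : g.logRatio f x = 2 * Real.log (b / a) := by
          rw [logRatio, ea, eb, Real.log_pow, Real.log_pow, Real.log_div hb1.ne' ha1.ne']
          push_cast; ring
        have h3 : Real.log (b / a) ≤ b / a - 1 := Real.log_le_sub_one_of_pos (by positivity)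
        rw [h2, ea]
        calc a ^ 2 * (2 * Real.log (b / a)) ≤ a ^ 2 * (2 * (b / a - 1)) := by gcongr
          _ = _ := by field_simp
    have h2 : t * |(g.dens x : ℝ) - f.dens x| ≤ (a - b) ^ 2 + t ^ 2 / 2 * (a ^ 2 + b ^ 2) := by
      rw [ea, eb]
      have e : |b ^ 2 - a ^ 2| = |a - b| * (a + b) := by
        rw [show b ^ 2 - a ^ 2 = (b - a) * (a + b) by ring, abs_mul, abs_sub_comm,
          abs_of_nonneg (add_nonneg ha0 hb0)]
      rw [e, ← sq_abs (a - b)]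
      nlinarith [sq_nonneg (|a - b| - t / 2 * (a + b)), sq_nonneg (t * (a - b))]
    rw [ea, eb] at *
    nlinarith
  have hd := integrable_abs_sub g f
  have I1 : Integrable (fun x => (g.dens x - f.dens x : ℝ)) ν :=
    g.integrable_dens.sub f.integrable_dens
  have I3 : Integrable (fun x => ((g.dens x : ℝ) + f.dens x)) ν :=
    g.integrable_dens.add f.integrable_dens
  have h := integral_mono_ae hi' ((I1.sub (hd.const_mul t)).add (I3.const_mul (t ^ 2 / 2))) key
  refine h.trans (le_of_eq ?_)
  have e1 : ∫ x, |(g.dens x : ℝ) - f.dens x| ∂ν = 2 * t := by rw [ht, tv]; ring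
  simp only [Pi.add_apply, Pi.sub_apply]
  have I2 : Integrable (fun x => (g.dens x - f.dens x : ℝ) - t * |(g.dens x : ℝ) - f.dens x|) ν :=
    I1.sub (hd.const_mul t)
  rw [integral_add I2 (I3.const_mul _), integral_sub I1 (hd.const_mul t),
    integral_const_mul, integral_const_mul, e1,
    integral_sub g.integrable_dens f.integrable_dens,
    integral_add g.integrable_dens f.integrable_dens, integral_dens, integral_dens]
  ring

/-- Change of measure between two reward distributions. -/
theorem abs_integral_sub_le {a b : RewardDensity ν} {Z : ℝ → ℝ} (hZ : Measurable Z)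
    (ha : Integrable (fun x => Z x ^ 2) a.law) (hb : Integrable (fun x => Z x ^ 2) b.law) {τ V : ℝ}
    (hτ : 0 < τ) (htv : a.tv b ≤ τ) (hV : ∫ x, Z x ^ 2 ∂a.law + ∫ x, Z x ^ 2 ∂b.law ≤ V) :
    |∫ x, Z x ∂a.law - ∫ x, Z x ∂b.law| ≤ Real.sqrt τ * (1 + V) := by
  have ia : Integrable Z a.law :=
    ((memLp_two_iff_integrable_sq hZ.aestronglyMeasurable).2 ha).integrable one_le_two
  have ib : Integrable Z b.law :=
    ((memLp_two_iff_integrable_sq hZ.aestronglyMeasurable).2 hb).integrable one_le_two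
  have hV0 : 0 ≤ V := le_trans (add_nonneg (integral_nonneg fun x => sq_nonneg _)
    (integral_nonneg fun x => sq_nonneg _)) hV
  have ja := (integrable_law_iff a).1 ha
  have jb := (integrable_law_iff b).1 hb
  rw [integral_law, integral_law] at hV ⊢
  rw [← integral_sub ((integrable_law_iff a).1 ia) ((integrable_law_iff b).1 ib)]
  set s := Real.sqrt τ with hs
  have hs0 : 0 < s := Real.sqrt_pos.2 hτ
  have hss : s ^ 2 = τ := Real.sq_sqrt hτ.le
  refine (abs_integral_le_integral_abs).trans ?_
  -- Young's inequality with weight `s = √τ`, which balances the mass `2τ` of the density difference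
  -- against the second moments.
  have key : ∀ x, |(a.dens x : ℝ) * Z x - b.dens x * Z x| ≤
      (1 / (2 * s)) * |(a.dens x : ℝ) - b.dens x|
        + s / 2 * (a.dens x * Z x ^ 2 + b.dens x * Z x ^ 2) := fun x => by
    rw [← sub_mul, abs_mul]
    set d := |(a.dens x : ℝ) - b.dens x|
    have hd : d ≤ a.dens x + b.dens x := by
      have h1 := (a.dens x).2
      have h2 := (b.dens x).2
      simp only [NNReal.val_eq_coe] at h1 h2
      exact abs_le.2 ⟨by linarith, by linarith⟩
    have hd0 : 0 ≤ d := abs_nonneg _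
    have h1 : |Z x| ≤ 1 / (2 * s) + s / 2 * Z x ^ 2 := by
      rw [← sq_abs, ← sub_nonneg]
      have : 1 / (2 * s) + s / 2 * |Z x| ^ 2 - |Z x| = (s * |Z x| - 1) ^ 2 / (2 * s) := by
        field_simp; ring
      rw [this]; positivity
    calc d * |Z x| ≤ d * (1 / (2 * s) + s / 2 * Z x ^ 2) := by gcongr
      _ = (1 / (2 * s)) * d + s / 2 * (d * Z x ^ 2) := by ring
      _ ≤ (1 / (2 * s)) * d + s / 2 * ((a.dens x + b.dens x) * Z x ^ 2) := by gcongr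
      _ = _ := by ring
  have hd := integrable_abs_sub a b
  have J : Integrable (fun x => (a.dens x : ℝ) * Z x ^ 2 + b.dens x * Z x ^ 2) ν := ja.add jb
  refine (integral_mono (((integrable_law_iff a).1 ia).sub ((integrable_law_iff b).1 ib)).abs
    ((hd.const_mul (1 / (2 * s))).add (J.const_mul (s / 2))) key).trans ?_
  simp only [Pi.add_apply]
  rw [integral_add (hd.const_mul _) (J.const_mul _), integral_const_mul, integral_const_mul,
    integral_add ja jb]
  have e1 : ∫ x, |(a.dens x : ℝ) - b.dens x| ∂ν ≤ 2 * s ^ 2 := by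
    have : a.tv b = 1 / 2 * ∫ x, |(a.dens x : ℝ) - b.dens x| ∂ν := rfl
    rw [hss]; linarith
  calc _ ≤ 1 / (2 * s) * (2 * s ^ 2) + s / 2 * V := by gcongr
    _ = s + s / 2 * V := by field_simp
    _ ≤ _ := by nlinarith

end RewardDensity

/-! ### Second moments and envelopes of log-ratios -/

section Family

variable {ν : Measure ℝ} {𝓡 : Set (RewardDensity ν)}

/-- The log-ratios have uniformly bounded second moments. -/
theorem RewardCondition.exists_moment (h : RewardCondition 𝓡) :
    ∃ B : ℝ, 0 ≤ B ∧ ∀ g ∈ 𝓡, ∀ g' ∈ 𝓡, (∀ᵐ x ∂g.law, 0 < g.dens x ∧ 0 < g'.dens x) ∧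
      Integrable (fun x => g.logRatio g' x ^ 2) g.law ∧ ∫ x, g.logRatio g' x ^ 2 ∂g.law ≤ B := by
  obtain ⟨cM, hc, hm⟩ := h.moment
  refine ⟨1 + cM ^ 4, by positivity, fun g hg g' hg' => ?_⟩
  have hfin := (hm g hg g' hg').trans_lt ENNReal.ofReal_lt_top
  have hmeas : Measurable (g.absLogRatio g') := by
    unfold RewardDensity.absLogRatio
    have h1 : Measurable fun x => (g.dens x : ℝ≥0∞) / (g'.dens x : ℝ≥0∞) :=
      g.measurable_dens.coe_nnreal_ennreal.div g'.measurable_dens.coe_nnreal_ennreal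
    have h2 : Measurable EReal.abs := by
      refine measurable_of_isOpen fun s hs => ?_
      have : Measurable fun x : EReal => if x = ⊤ then (⊤ : ℝ≥0∞) else if x = ⊥ then ⊤ else
          ENNReal.ofReal |x.toReal| := by
        refine Measurable.ite (measurableSet_singleton _) measurable_const
          (Measurable.ite (measurableSet_singleton _) measurable_const ?_)
        exact (measurable_ereal_toReal.norm).ennreal_ofReal
      have e : EReal.abs = fun x : EReal => if x = ⊤ then (⊤ : ℝ≥0∞) else if x = ⊥ then ⊤ else
          ENNReal.ofReal |x.toReal| := by
        funext x
        induction x <;> simp [EReal.abs_def]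
      rw [e]
      exact this hs.measurableSet
    exact h2.comp (ENNReal.measurable_log.comp h1)
  have hae : ∀ᵐ x ∂g.law, g.absLogRatio g' x ≠ ⊤ := by
    have := ae_lt_top (hmeas.pow_const 4) hfin.ne
    filter_upwards [this] with x hx h0
    simp [h0] at hx
  have hle : ∫⁻ x, ENNReal.ofReal (g.logRatio g' x ^ 2) ∂g.law ≤ ENNReal.ofReal (1 + cM ^ 4) := by
    calc _ ≤ ∫⁻ x, (1 + g.absLogRatio g' x ^ 4) ∂g.law := by
          refine lintegral_mono_ae ?_
          filter_upwards [hae] with x hx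
          rw [(RewardDensity.absLogRatio_of_ne_top hx).2.2, ← ENNReal.ofReal_pow (abs_nonneg _),
            ← ENNReal.ofReal_one, ← ENNReal.ofReal_add zero_le_one (by positivity)]
          refine ENNReal.ofReal_le_ofReal ?_
          rw [← sq_abs]
          nlinarith [sq_nonneg (|g.logRatio g' x| ^ 2 - 1), sq_nonneg (|g.logRatio g' x| ^ 2)]
      _ = 1 + ∫⁻ x, g.absLogRatio g' x ^ 4 ∂g.law := by
          rw [lintegral_add_left measurable_const]; simp
      _ ≤ _ := by
          rw [ENNReal.ofReal_add zero_le_one (by positivity), ENNReal.ofReal_one]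
          gcongr
          exact hm g hg g' hg'
  have hms : AEStronglyMeasurable (fun x => g.logRatio g' x ^ 2) g.law :=
    ((RewardDensity.measurable_logRatio g g').pow_const 2).aestronglyMeasurable
  have hint : Integrable (fun x => g.logRatio g' x ^ 2) g.law := by
    refine ⟨hms, ?_⟩
    rw [hasFiniteIntegral_iff_ofReal (ae_of_all _ fun x => sq_nonneg _)]
    exact hle.trans_lt ENNReal.ofReal_lt_top
  refine ⟨?_, hint, ?_⟩
  · filter_upwards [hae] with x hx
    exact ⟨(RewardDensity.absLogRatio_of_ne_top hx).1, (RewardDensity.absLogRatio_of_ne_top hx).2.1⟩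
  · rw [integral_eq_lintegral_of_nonneg_ae (ae_of_all _ fun x => sq_nonneg _) hms]
    exact ENNReal.toReal_le_of_le_ofReal (by positivity) hle

/-- A square-integrable envelope for the Hölder constants of the log-ratios. -/
structure IsEnvelope (𝓡 : Set (RewardDensity ν)) (f : RewardDensity ν) (c : ℝ) (Y : ℝ → ℝ) :
    Prop where
  c_pos : 0 < c
  measurable : Measurable Y
  nonneg : ∀ x, 0 ≤ Y x
  integrable_sq : Integrable (fun x => Y x ^ 2) f.law
  ae_le : ∀ᵐ x ∂f.law, ∀ g ∈ 𝓡, ∀ g' ∈ 𝓡, 0 < g.dens x ∧ |g.logRatio g' x| ≤ g.tv g' ^ c * Y x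

/-- Apply the tail condition at the levels `δ j = exp (-(j + 1))`. If `j` is the first level whose
exceptional set misses `x`, then all log-ratios at `x` have Hölder constant at most `C (j + 2) ^ k`.
Reaching level `j + 1` means lying in an exceptional set of mass `δ j`, so these polynomial
constants have a finite second moment. -/
theorem RewardCondition.exists_envelope (h : RewardCondition 𝓡) {f : RewardDensity ν}
    (hf : f ∈ 𝓡) : ∃ (c : ℝ) (Y : ℝ → ℝ), IsEnvelope 𝓡 f c Y := by
  obtain ⟨c, hc, -, C, hC, k, ht⟩ := h.tail f hf
  let δ : ℕ → ℝ := fun j => Real.exp (-(j + 1))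
  have hδ : ∀ j, Real.log (1 / δ j) = j + 1 := fun j => by simp [δ]
  let Bad : ℕ → Set ℝ := fun j => {x | ∃ g ∈ 𝓡, ∃ g' ∈ 𝓡,
        ENNReal.ofReal (g.tv g' ^ c * (C * (1 + Real.log (1 / δ j)) ^ k)) < g.absLogRatio g' x}
  -- The exceptional event ranges over the whole family and is controlled only in outer measure,
  -- hence the measurable hull.
  let B : ℕ → Set ℝ := fun j => toMeasurable f.law (Bad j)
  have hB : ∀ j, f.law (B j) ≤ ENNReal.ofReal (δ j) := fun j => by
    rw [measure_toMeasurable]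
    refine ht _ (Real.exp_pos _) ?_
    rw [← Real.exp_zero]
    exact Real.exp_lt_exp.2 (by have : (0 : ℝ) ≤ j := j.cast_nonneg; linarith)
  have hBm : ∀ j, MeasurableSet (B j) := fun j => measurableSet_toMeasurable _ _
  let v : ℕ → ℝ := fun j => (C * (j + 2) ^ k) ^ 2
  let W : ℝ → ℝ≥0∞ := fun x => ENNReal.ofReal (v 0) +
    ∑' j, (B j).indicator (fun _ => ENNReal.ofReal (v (j + 1))) x
  have hWm : Measurable W := by
    refine measurable_const.add (Measurable.ennreal_tsum fun j => ?_)
    exact measurable_const.indicator (hBm j)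
  have hWint : ∫⁻ x, W x ∂f.law ≠ ⊤ := by
    rw [lintegral_add_left measurable_const,
      lintegral_tsum fun j => (measurable_const.indicator (hBm j)).aemeasurable]
    simp only [lintegral_const, measure_univ, mul_one]
    refine ENNReal.add_ne_top.2 ⟨ENNReal.ofReal_ne_top, ?_⟩
    have hs : Summable fun j : ℕ => v (j + 1) * δ j := by
      have h1 := Real.summable_pow_mul_exp_neg_nat_mul (2 * k) one_pos
      have h2 := (summable_nat_add_iff 3).2 h1
      refine (h2.mul_left (C ^ 2 * Real.exp 2)).congr fun j => ?_
      simp only [v, δ]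
      rw [show (-(1 : ℝ) * ((j + 3 : ℕ) : ℝ)) = -2 + -((j : ℝ) + 1) by push_cast; ring,
        Real.exp_add, mul_pow, ← pow_mul, mul_comm k 2]
      push_cast
      rw [show ((j : ℝ) + 1 + 2) = j + 3 by ring, Real.exp_neg 2]
      field_simp
    refine ne_top_of_le_ne_top (b := ∑' j, ENNReal.ofReal (v (j + 1) * δ j)) ?_ ?_
    · exact hs.tsum_ofReal_ne_top
    · refine ENNReal.tsum_le_tsum fun j => ?_
      rw [lintegral_indicator (hBm j), lintegral_const, Measure.restrict_apply_univ,
        ENNReal.ofReal_mul (by positivity)]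
      gcongr
      exact hB j
  have hWtop : ∀ᵐ x ∂f.law, W x < ⊤ := ae_lt_top hWm hWint
  have hnot : ∀ᵐ x ∂f.law, ∃ j, x ∉ B j := by
    rw [ae_iff]
    have : {x | ¬∃ j, x ∉ B j} = ⋂ j, B j := by ext; simp
    rw [this]
    refine le_antisymm (ge_of_tendsto' (x := atTop) (f := fun j : ℕ => ENNReal.ofReal (δ j)) ?_
      fun j => (measure_mono (Set.iInter_subset _ j)).trans (hB j)) zero_le
    rw [← ENNReal.ofReal_zero]
    refine ENNReal.tendsto_ofReal ?_
    refine Real.tendsto_exp_neg_atTop_nhds_zero.comp ?_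
    exact tendsto_atTop_add_const_right _ _ tendsto_natCast_atTop_atTop
  refine ⟨c, fun x => Real.sqrt (W x).toReal, hc, hWm.ennreal_toReal.sqrt,
    fun x => Real.sqrt_nonneg _, ?_, ?_⟩
  · simp only [Real.sq_sqrt ENNReal.toReal_nonneg]
    exact integrable_toReal_of_lintegral_ne_top hWm.aemeasurable hWint
  · classical
    filter_upwards [hWtop, hnot] with x hx hex g hg g' hg'
    -- For `j > 0`, minimality puts `x` into the exceptional set of level `j - 1`, whose summand in
    -- `W x` is exactly `v j`; for `j = 0` the constant `v 0` serves.
    set j := Nat.find hex with hj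
    have hjx : x ∉ B j := Nat.find_spec hex
    have hvW : ENNReal.ofReal (v j) ≤ W x := by
      rcases Nat.eq_zero_or_pos j with h0 | h0
      · rw [h0]; exact le_self_add
      · obtain ⟨i, hi⟩ : ∃ i, j = i + 1 := ⟨j - 1, by omega⟩
        have hxi : x ∈ B i := by
          by_contra hcon
          have := Nat.find_min' hex hcon
          omega
        refine le_trans ?_ le_add_self
        refine le_trans (le_of_eq ?_) (ENNReal.le_tsum i)
        rw [Set.indicator_of_mem hxi, hi]
    have hxbad : x ∉ Bad j := fun hb => hjx (subset_toMeasurable _ _ hb)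
    have hle : g.absLogRatio g' x ≤ ENNReal.ofReal (g.tv g' ^ c * (C * (1 + Real.log (1 / δ j)) ^ k)) := by
      by_contra hcon
      exact hxbad ⟨g, hg, g', hg', not_le.1 hcon⟩
    have hfin := ne_top_of_le_ne_top ENNReal.ofReal_ne_top hle
    obtain ⟨hp, hp', he⟩ := RewardDensity.absLogRatio_of_ne_top hfin
    refine ⟨hp, ?_⟩
    have htv := Real.rpow_nonneg (RewardDensity.tv_nonneg g g') c
    rw [he, ENNReal.ofReal_le_ofReal_iff (by rw [hδ]; positivity), hδ] at hle
    refine hle.trans (mul_le_mul_of_nonneg_left ?_ htv)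
    refine Real.le_sqrt_of_sq_le ?_
    have := (ENNReal.ofReal_le_iff_le_toReal hx.ne).1 hvW
    refine le_trans (le_of_eq ?_) this
    simp only [v]
    ring

end Family

/-! ### The law of a trajectory -/

section Chain

variable {S A : Type*} [Fintype S] [DecidableEq S] [MeasurableSpace S] [MeasurableSingletonClass S]
  [Fintype A] [DecidableEq A] [MeasurableSpace A] [MeasurableSingletonClass A] {ν : Measure ℝ}

/-- The law of the state after `h` steps. -/
def stateLaw (p : S → A → PMF S) (s₀ : S) (π : Policy S A) : ℕ → S → ℝ≥0∞
  | 0 => fun s => if s = s₀ then 1 else 0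
  | h + 1 => fun s' => ∑ s, stateLaw p s₀ π h s * p s (π s) s'

/-- The density of the next step of a trajectory after the step `y`. -/
def stepDens (p : S → A → PMF S) (r : S → A → RewardDensity ν) (π : Policy S A)
    (y x : S × A × ℝ) : ℝ≥0∞ :=
  p y.1 y.2.1 x.1 * ((if x.2.1 = π x.1 then 1 else 0) * ((r x.1 x.2.1).dens x.2.2 : ℝ≥0∞))

/-- The density of the first `k + 1` steps of a trajectory. -/
def chainDens (p : S → A → PMF S) (r : S → A → RewardDensity ν) (s₀ : S) (π : Policy S A) :
    (k : ℕ) → (Fin (k + 1) → S × A × ℝ) → ℝ≥0∞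
  | 0, o => (if (o 0).1 = s₀ then 1 else 0) *
      ((if (o 0).2.1 = π (o 0).1 then 1 else 0) * ((r (o 0).1 (o 0).2.1).dens (o 0).2.2 : ℝ≥0∞))
  | k + 1, o => chainDens p r s₀ π k (Fin.init o) *
      stepDens p r π (o (Fin.last k).castSucc) (o (Fin.last (k + 1)))

variable (p : S → A → PMF S) (r : S → A → RewardDensity ν) (s₀ : S) (π : Policy S A)

/-- The recursive form peels off the last step, which suits induction on the length; the product
form is the one of `trajDensity`. -/
theorem chainDens_eq (k : ℕ) (o : Fin (k + 1) → S × A × ℝ) :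
    chainDens p r s₀ π k o = (if (o 0).1 = s₀ then 1 else 0) *
      (∏ h, if (o h).2.1 = π (o h).1 then 1 else 0) *
      (∏ h, ((r (o h).1 (o h).2.1).dens (o h).2.2 : ℝ≥0∞)) *
      ∏ h : Fin k, p (o h.castSucc).1 (o h.castSucc).2.1 (o h.succ).1 := by
  induction k with
  | zero => simp [chainDens, mul_assoc]
  | succ k ih =>
    have hi : chainDens p r s₀ π k (Fin.init o) = (if (o 0).1 = s₀ then 1 else 0) *
        (∏ h : Fin (k + 1), if (o h.castSucc).2.1 = π (o h.castSucc).1 then 1 else 0) *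
        (∏ h : Fin (k + 1),
          ((r (o h.castSucc).1 (o h.castSucc).2.1).dens (o h.castSucc).2.2 : ℝ≥0∞)) *
        ∏ h : Fin k, p (o h.castSucc.castSucc).1 (o h.castSucc.castSucc).2.1
          (o h.castSucc.succ).1 := ih (Fin.init o)
    rw [chainDens, hi, stepDens]
    conv_rhs => rw [Fin.prod_univ_castSucc (n := k + 1), Fin.prod_univ_castSucc (n := k + 1),
      Fin.prod_univ_castSucc (n := k)
        (fun h : Fin (k + 1) => p (o h.castSucc).1 (o h.castSucc).2.1 (o h.succ).1)]
    rw [Fin.succ_last]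
    ring

theorem measurable_rewardDens :
    Measurable fun x : S × A × ℝ => ((r x.1 x.2.1).dens x.2.2 : ℝ≥0∞) := by
  refine measurable_from_prod_countable_right fun s => ?_
  refine measurable_from_prod_countable_right fun a => ?_
  exact (r s a).measurable_dens.coe_nnreal_ennreal

theorem measurable_stepDens :
    Measurable fun z : (S × A × ℝ) × (S × A × ℝ) => stepDens p r π z.1 z.2 := by
  unfold stepDens
  refine Measurable.mul ?_ (Measurable.mul ?_ ?_)
  · exact (Measurable.of_discrete (f := fun u : S × A × S => p u.1 u.2.1 u.2.2)).comp
      (by fun_prop : Measurable fun z : (S × A × ℝ) × (S × A × ℝ) => (z.1.1, z.1.2.1, z.2.1))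
  · exact (Measurable.of_discrete
      (f := fun u : S × A => if u.2 = π u.1 then (1 : ℝ≥0∞) else 0)).comp
      (by fun_prop : Measurable fun z : (S × A × ℝ) × (S × A × ℝ) => (z.2.1, z.2.2.1))
  · exact (measurable_rewardDens r).comp measurable_snd

theorem measurable_chainDens (k : ℕ) : Measurable (chainDens p r s₀ π k) := by
  induction k with
  | zero =>
    refine Measurable.mul ?_ (Measurable.mul ?_ ?_)
    · exact (Measurable.of_discrete (f := fun u : S => if u = s₀ then (1 : ℝ≥0∞) else 0)).comp
        (by fun_prop : Measurable fun z : Fin 1 → (S × A × ℝ) => (z 0).1)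
    · exact (Measurable.of_discrete
        (f := fun u : S × A => if u.2 = π u.1 then (1 : ℝ≥0∞) else 0)).comp
        (by fun_prop : Measurable fun z : Fin 1 → (S × A × ℝ) => ((z 0).1, (z 0).2.1))
    · exact (measurable_rewardDens r).comp (measurable_pi_apply 0)
  | succ k ih =>
    refine Measurable.mul (ih.comp ?_) ?_
    · exact measurable_pi_lambda _ fun i => measurable_pi_apply _
    · exact (measurable_stepDens p r π).comp (f := fun o : Fin (k + 2) → S × A × ℝ =>
        (o (Fin.last k).castSucc, o (Fin.last (k + 1)))) (by fun_prop)

variable [SigmaFinite ν]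

/-- The base measure of a step. -/
def stepBase (S A : Type*) [MeasurableSpace S] [MeasurableSpace A] (ν : Measure ℝ) :
    Measure (S × A × ℝ) :=
  (Measure.count : Measure S).prod ((Measure.count : Measure A).prod ν)

instance : SigmaFinite (stepBase S A ν) := by unfold stepBase; infer_instance

theorem lintegral_stepBase {φ : S × A × ℝ → ℝ≥0∞} (hφ : Measurable φ) :
    ∫⁻ x, φ x ∂(stepBase S A ν) = ∑ s, ∑ a, ∫⁻ y, φ (s, a, y) ∂ν := by
  rw [stepBase, lintegral_prod _ hφ.aemeasurable, lintegral_count, tsum_fintype]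
  refine Finset.sum_congr rfl fun s _ => ?_
  have h : Measurable fun y => φ (s, y) := hφ.comp measurable_prodMk_left
  rw [lintegral_prod _ h.aemeasurable, lintegral_count, tsum_fintype]

theorem lintegral_law (g : RewardDensity ν) {φ : ℝ → ℝ≥0∞} (hφ : Measurable φ) :
    ∫⁻ x, φ x ∂g.law = ∫⁻ x, g.dens x * φ x ∂ν := by
  rw [RewardDensity.law, lintegral_withDensity_eq_lintegral_mul _
    g.measurable_dens.coe_nnreal_ennreal hφ]
  rfl

theorem lintegral_policy_dens {φ : S × A × ℝ → ℝ≥0∞} (hφ : Measurable φ) (c : S → ℝ≥0∞) :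
    ∫⁻ x, c x.1 * ((if x.2.1 = π x.1 then 1 else 0) * ((r x.1 x.2.1).dens x.2.2 : ℝ≥0∞)) * φ x
        ∂(stepBase S A ν) =
      ∑ s, c s * ∫⁻ y, φ (s, π s, y) ∂(r s (π s)).law := by
  have hm : Measurable fun x : S × A × ℝ =>
      c x.1 * ((if x.2.1 = π x.1 then 1 else 0) * ((r x.1 x.2.1).dens x.2.2 : ℝ≥0∞)) * φ x := by
    refine Measurable.mul (Measurable.mul ?_ (Measurable.mul ?_ ?_)) hφ
    · exact (Measurable.of_discrete (f := c)).comp measurable_fst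
    · exact (Measurable.of_discrete
        (f := fun u : S × A => if u.2 = π u.1 then (1 : ℝ≥0∞) else 0)).comp
        (by fun_prop : Measurable fun z : S × A × ℝ => (z.1, z.2.1))
    · exact measurable_rewardDens r
  rw [lintegral_stepBase hm]
  refine Finset.sum_congr rfl fun s _ => ?_
  rw [Finset.sum_eq_single (π s)]
  · have hφ' : Measurable fun y => φ (s, π s, y) :=
      hφ.comp (measurable_prodMk_left.comp measurable_prodMk_left)
    have h2 : Measurable fun y => ((r s (π s)).dens y : ℝ≥0∞) * φ (s, π s, y) :=
      (r s (π s)).measurable_dens.coe_nnreal_ennreal.mul hφ'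
    rw [lintegral_law _ hφ', ← lintegral_const_mul _ h2]
    simp [mul_assoc]
  · intro a _ ha
    simp [ha]
  · simp

theorem lintegral_stepDens (y : S × A × ℝ) {φ : S × A × ℝ → ℝ≥0∞} (hφ : Measurable φ) :
    ∫⁻ x, stepDens p r π y x * φ x ∂(stepBase S A ν) =
      ∑ s, p y.1 y.2.1 s * ∫⁻ x, φ (s, π s, x) ∂(r s (π s)).law :=
  lintegral_policy_dens r π hφ fun s => p y.1 y.2.1 s

/-- The law of the first `k + 1` steps of a trajectory. -/
def chainLaw (k : ℕ) : Measure (Fin (k + 1) → S × A × ℝ) :=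
  (Measure.pi fun _ : Fin (k + 1) => stepBase S A ν).withDensity (chainDens p r s₀ π k)

/-- The Markov property: the base measure splits off its last coordinate by Tonelli, and the new
density factor depends on the past only through the last step. -/
theorem lintegral_chainLaw_succ (k : ℕ) {F : (Fin (k + 2) → S × A × ℝ) → ℝ≥0∞}
    (hF : Measurable F) :
    ∫⁻ o, F o ∂(chainLaw p r s₀ π (k + 1)) =
      ∫⁻ o, ∫⁻ x, stepDens p r π (o (Fin.last k)) x *
        F (Fin.snoc (α := fun _ => S × A × ℝ) o x) ∂(stepBase S A ν)
        ∂(chainLaw p r s₀ π k) := by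
  have hs : Measurable fun z : (Fin (k + 1) → S × A × ℝ) × (S × A × ℝ) =>
      (Fin.snoc (α := fun _ => S × A × ℝ) z.1 z.2 : Fin (k + 2) → S × A × ℝ) := by
    refine measurable_pi_lambda _ fun i => ?_
    refine Fin.lastCases ?_ (fun j => ?_) i
    · simpa using measurable_snd
    · simp only [Fin.snoc_castSucc]
      fun_prop
  have hst : Measurable fun z : (Fin (k + 1) → S × A × ℝ) × (S × A × ℝ) =>
      stepDens p r π (z.1 (Fin.last k)) z.2 :=
    (measurable_stepDens p r π).comp
      (f := fun z : (Fin (k + 1) → S × A × ℝ) × (S × A × ℝ) => (z.1 (Fin.last k), z.2))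
      (by fun_prop)
  have hG : Measurable fun z : (Fin (k + 1) → S × A × ℝ) × (S × A × ℝ) =>
      stepDens p r π (z.1 (Fin.last k)) z.2 * F (Fin.snoc (α := fun _ => S × A × ℝ) z.1 z.2) :=
    hst.mul (hF.comp hs)
  have hGi : Measurable fun o : Fin (k + 1) → S × A × ℝ =>
      ∫⁻ x, stepDens p r π (o (Fin.last k)) x *
        F (Fin.snoc (α := fun _ => S × A × ℝ) o x) ∂(stepBase S A ν) :=
    hG.lintegral_prod_right'
  rw [chainLaw, lintegral_withDensity_eq_lintegral_mul _ (measurable_chainDens p r s₀ π _) hF,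
    chainLaw, lintegral_withDensity_eq_lintegral_mul _ (measurable_chainDens p r s₀ π _) hGi]
  have hmp := (measurePreserving_piFinSuccAbove (fun _ : Fin (k + 2) => stepBase S A ν)
    (Fin.last (k + 1))).symm
  have := hmp.lintegral_comp ((measurable_chainDens p r s₀ π (k + 1)).mul hF)
  rw [← this, lintegral_prod_symm']
  · refine lintegral_congr fun o => ?_
    simp only [Pi.mul_apply]
    have hGo : Measurable fun x => stepDens p r π (o (Fin.last k)) x *
        F (Fin.snoc (α := fun _ => S × A × ℝ) o x) := hG.comp measurable_prodMk_left
    rw [← lintegral_const_mul _ hGo]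
    refine lintegral_congr fun x => ?_
    have e : (MeasurableEquiv.piFinSuccAbove (fun _ : Fin (k + 2) => S × A × ℝ)
        (Fin.last (k + 1))).symm (x, o) = Fin.snoc (α := fun _ => S × A × ℝ) o x := by
      simp [MeasurableEquiv.piFinSuccAbove, Fin.insertNthEquiv, Fin.insertNth_last']
    rw [e, chainDens]
    simp only [Fin.init_snoc, Fin.snoc_last, Fin.snoc_castSucc]
    ring
  · exact ((measurable_chainDens p r s₀ π (k + 1)).mul hF).comp hmp.measurable

/-- If the step in question is the last one, integrating it out leaves a function of the step
before, and the recursion of `stateLaw` appears. If it is earlier, the last step integrates to one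
and disappears. The formula for two consecutive steps is proved in the same way. -/
theorem lintegral_chainLaw_eval (k : ℕ) (h : Fin (k + 1)) {φ : S × A × ℝ → ℝ≥0∞}
    (hφ : Measurable φ) :
    ∫⁻ o, φ (o h) ∂(chainLaw p r s₀ π k) =
      ∑ s, stateLaw p s₀ π h s * ∫⁻ x, φ (s, π s, x) ∂(r s (π s)).law := by
  induction k generalizing φ with
  | zero =>
    have hh : h = 0 := Fin.ext (by omega)
    have h0 : Measurable fun o : Fin (0 + 1) → S × A × ℝ => φ (o 0) :=
      hφ.comp (measurable_pi_apply 0)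
    subst hh
    rw [chainLaw, lintegral_withDensity_eq_lintegral_mul _ (measurable_chainDens p r s₀ π _) h0]
    have hmp := (measurePreserving_funUnique (stepBase S A ν) (Fin 1))
    rw [← lintegral_policy_dens r π hφ, ← hmp.lintegral_comp]
    · rfl
    · refine Measurable.mul (Measurable.mul ?_ (Measurable.mul ?_ ?_)) hφ
      · exact (Measurable.of_discrete (f := fun u : S => if u = s₀ then (1 : ℝ≥0∞) else 0)).comp
          measurable_fst
      · exact (Measurable.of_discrete
          (f := fun u : S × A => if u.2 = π u.1 then (1 : ℝ≥0∞) else 0)).comp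
          (by fun_prop : Measurable fun z : S × A × ℝ => (z.1, z.2.1))
      · exact measurable_rewardDens r
  | succ k ih =>
    have h0 : Measurable fun o : Fin (k + 2) → S × A × ℝ => φ (o h) :=
      hφ.comp (measurable_pi_apply h)
    rw [lintegral_chainLaw_succ _ _ _ _ _ h0]
    refine Fin.lastCases ?_ (fun j => ?_) h
    · simp only [Fin.snoc_last, Fin.val_last]
      simp only [lintegral_stepDens p r π _ hφ]
      have hm : Measurable fun x : S × A × ℝ => ∑ s, p x.1 x.2.1 s *
          ∫⁻ x, φ (s, π s, x) ∂(r s (π s)).law :=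
        (Measurable.of_discrete (f := fun u : S × A => ∑ s, p u.1 u.2 s *
          ∫⁻ x, φ (s, π s, x) ∂(r s (π s)).law)).comp
          (by fun_prop : Measurable fun z : S × A × ℝ => (z.1, z.2.1))
      rw [ih (Fin.last k) hm]
      simp only [lintegral_const, measure_univ, mul_one, stateLaw, Finset.sum_mul, Fin.val_last,
        Finset.mul_sum]
      rw [Finset.sum_comm]
      simp only [mul_assoc]
    · simp only [Fin.snoc_castSucc, Fin.val_castSucc]
      rw [← ih j hφ]
      refine lintegral_congr fun o => ?_
      rw [lintegral_stepDens p r π _ measurable_const]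
      simp only [lintegral_const, measure_univ, mul_one]
      rw [← Finset.sum_mul, ← tsum_fintype (L := .unconditional S), PMF.tsum_coe, one_mul]

theorem lintegral_chainLaw_pair (k : ℕ) (h : Fin k) (ψ : S → S → ℝ≥0∞) :
    ∫⁻ o, ψ (o h.castSucc).1 (o h.succ).1 ∂(chainLaw p r s₀ π k) =
      ∑ s, stateLaw p s₀ π h s * ∑ s', p s (π s) s' * ψ s s' := by
  have hψ : Measurable fun u : S × S => ψ u.1 u.2 := Measurable.of_discrete
  induction k with
  | zero => exact h.elim0
  | succ k ih =>
    have h0 : Measurable fun o : Fin (k + 2) → S × A × ℝ =>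
        ψ (o h.castSucc).1 (o h.succ).1 :=
      hψ.comp (f := fun o : Fin (k + 2) → S × A × ℝ => ((o h.castSucc).1, (o h.succ).1))
        (by fun_prop)
    rw [lintegral_chainLaw_succ _ _ _ _ _ h0]
    refine Fin.lastCases ?_ (fun j => ?_) h
    · simp only [Fin.snoc_castSucc, Fin.succ_last, Fin.snoc_last, Fin.val_last]
      have hm : Measurable fun x : S × A × ℝ => ∑ s', p x.1 x.2.1 s' * ψ x.1 s' :=
        (Measurable.of_discrete (f := fun u : S × A => ∑ s', p u.1 u.2 s' * ψ u.1 s')).comp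
          (by fun_prop : Measurable fun z : S × A × ℝ => (z.1, z.2.1))
      have := lintegral_chainLaw_eval p r s₀ π k (Fin.last k) hm
      simp only [lintegral_const, measure_univ, mul_one, Fin.val_last] at this
      rw [← this]
      refine lintegral_congr fun o => ?_
      have h1 : Measurable fun x : S × A × ℝ => ψ (o (Fin.last k)).1 x.1 :=
        hψ.comp (f := fun x : S × A × ℝ => ((o (Fin.last k)).1, x.1)) (by fun_prop)
      rw [lintegral_stepDens p r π _ h1]
      simp
    · simp only [Fin.snoc_castSucc, Fin.val_castSucc, Fin.succ_castSucc]
      rw [← ih j]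
      refine lintegral_congr fun o => ?_
      rw [lintegral_stepDens p r π _ measurable_const]
      simp only [lintegral_const, measure_univ, mul_one]
      rw [← Finset.sum_mul, ← tsum_fintype (L := .unconditional S), PMF.tsum_coe, one_mul]

end Chain

/-! ### The trajectory law of an instance as the law of a chain -/

section Model

variable {S A : Type*} [Fintype S] [DecidableEq S] [MeasurableSpace S] [MeasurableSingletonClass S]
  [Fintype A] [DecidableEq A] [MeasurableSpace A] [MeasurableSingletonClass A]
  {H : ℕ} [NeZero H] {sk : Skeleton S H} {ν : Measure ℝ}

/-- The law of the state after `h` steps of the policy `π` in the instance `f`. -/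
def MDP.stateLaw (f : MDP A sk ν) (π : Policy S A) : ℕ → S → ℝ≥0∞ :=
  T2C.stateLaw f.trans sk.init π

theorem trajDensity_eq_chainDens {k : ℕ} [NeZero (k + 1)] {sk : Skeleton S (k + 1)}
    (f : MDP A sk ν) (π : Policy S A) :
    trajDensity f π = chainDens f.trans f.reward sk.init π k := by
  funext o
  rw [chainDens_eq, trajDensity]
  congr 1
  rw [Fin.prod_univ_castSucc]
  simp only [Fin.val_last, lt_self_iff_false, dite_false, mul_one, Fin.val_castSucc]
  refine Finset.prod_congr rfl fun h _ => ?_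
  rw [dif_pos (by omega)]
  rfl

theorem measurable_trajDensity (f : MDP A sk ν) (π : Policy S A) :
    Measurable (trajDensity f π) := by
  obtain ⟨k, rfl⟩ := Nat.exists_eq_succ_of_ne_zero (NeZero.ne H)
  rw [trajDensity_eq_chainDens]
  exact measurable_chainDens _ _ _ _ _

variable [SigmaFinite ν]

theorem trajLaw_eq_chainLaw {k : ℕ} [NeZero (k + 1)] {sk : Skeleton S (k + 1)}
    (f : MDP A sk ν) (π : Policy S A) :
    trajLaw f π = chainLaw f.trans f.reward sk.init π k := by
  rw [trajLaw, chainLaw, trajDensity_eq_chainDens]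
  rfl

theorem lintegral_trajLaw_eval (f : MDP A sk ν) (π : Policy S A) (h : Fin H)
    {φ : S × A × ℝ → ℝ≥0∞} (hφ : Measurable φ) :
    ∫⁻ o, φ (o h) ∂(trajLaw f π) =
      ∑ s, f.stateLaw π h s * ∫⁻ x, φ (s, π s, x) ∂(f.reward s (π s)).law := by
  obtain ⟨k, rfl⟩ := Nat.exists_eq_succ_of_ne_zero (NeZero.ne H)
  rw [trajLaw_eq_chainLaw]
  exact lintegral_chainLaw_eval _ _ _ _ _ _ hφ

theorem lintegral_trajLaw_pair (f : MDP A sk ν) (π : Policy S A) {h h' : Fin H}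
    (hh : (h' : ℕ) = h + 1) (ψ : S → S → ℝ≥0∞) :
    ∫⁻ o, ψ (o h).1 (o h').1 ∂(trajLaw f π) =
      ∑ s, f.stateLaw π h s * ∑ s', f.trans s (π s) s' * ψ s s' := by
  obtain ⟨k, rfl⟩ := Nat.exists_eq_succ_of_ne_zero (NeZero.ne H)
  rw [trajLaw_eq_chainLaw]
  have hk : (h : ℕ) < k := by have := h'.2; omega
  have := lintegral_chainLaw_pair f.trans f.reward sk.init π k ⟨h, hk⟩ ψ
  have e1 : (⟨h, hk⟩ : Fin k).castSucc = h := rfl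
  have e2 : (⟨h, hk⟩ : Fin k).succ = h' := Fin.ext hh.symm
  rw [e1, e2] at this
  exact this

theorem sum_stateLaw (p : S → A → PMF S) (s₀ : S) (π : Policy S A) (h : ℕ) :
    ∑ s, stateLaw p s₀ π h s = 1 := by
  induction h with
  | zero => simp [stateLaw]
  | succ h ih =>
    simp only [stateLaw]
    rw [Finset.sum_comm, ← ih]
    refine Finset.sum_congr rfl fun s _ => ?_
    rw [← Finset.mul_sum, ← tsum_fintype (L := .unconditional S), PMF.tsum_coe, mul_one]

instance (f : MDP A sk ν) (π : Policy S A) : IsProbabilityMeasure (trajLaw f π) := by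
  constructor
  have := lintegral_trajLaw_eval f π 0 (φ := fun _ => 1) measurable_const
  simpa [MDP.stateLaw, sum_stateLaw] using this

/-- Transitions of positive probability raise the layer by one, so a state can be occupied only at
the time given by its layer. This is why one number, `MDP.visitProb`, records everything about the
visits to a state. -/
theorem MDP.stateLaw_layer (f : MDP A sk ν) (π : Policy S A) {h : ℕ} (hH : h < H) {s : S}
    (hs : f.stateLaw π h s ≠ 0) : (sk.layer s : ℕ) = h := by
  induction h generalizing s with
  | zero =>
    have : s = sk.init := by
      by_contra hne
      exact hs (by simp [MDP.stateLaw, T2C.stateLaw, hne])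
    rw [this, sk.layer_init]
    simp
  | succ h ih =>
    simp only [MDP.stateLaw, T2C.stateLaw] at hs
    obtain ⟨s₁, -, h1⟩ := Finset.exists_ne_zero_of_sum_ne_zero hs
    have h2 := ih (by omega) (left_ne_zero_of_mul h1)
    have h3 := f.layered s₁ (π s₁) s (by omega) (right_ne_zero_of_mul h1)
    omega

end Model

section Model

variable {S A : Type*} [Fintype S] [DecidableEq S] [MeasurableSpace S] [MeasurableSingletonClass S]
  [Fintype A] [DecidableEq A] [MeasurableSpace A] [MeasurableSingletonClass A]
  {H : ℕ} [NeZero H] {sk : Skeleton S H} {ν : Measure ℝ}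

/-! ### Trajectories of positive density -/

theorem trajDensity_ne_zero_iff {f : MDP A sk ν} {π : Policy S A} {o : Traj S A H} :
    trajDensity f π o ≠ 0 ↔ (o 0).1 = sk.init ∧ (∀ h, (o h).2.1 = π (o h).1) ∧
      (∀ h, (f.reward (o h).1 (o h).2.1).dens (o h).2.2 ≠ 0) ∧
      ∀ (h : Fin H) (hh : (h : ℕ) + 1 < H),
        f.trans (o h).1 (o h).2.1 (o ⟨(h : ℕ) + 1, hh⟩).1 ≠ 0 := by
  unfold trajDensity
  simp only [ne_eq, mul_eq_zero, not_or, Finset.prod_eq_zero_iff, Finset.mem_univ, true_and,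
    not_exists, ite_eq_right_iff, one_ne_zero, imp_false, not_not, ENNReal.coe_eq_zero, and_assoc]
  refine and_congr_right fun _ => and_congr_right fun _ => and_congr_right fun _ => ?_
  refine forall_congr' fun h => ?_
  by_cases hh : (h : ℕ) + 1 < H <;> simp [hh]

theorem layer_of_trajDensity_ne_zero {f : MDP A sk ν} {π : Policy S A} {o : Traj S A H}
    (ho : trajDensity f π o ≠ 0) (h : Fin H) : sk.layer (o h).1 = h := by
  obtain ⟨h0, -, -, h3⟩ := trajDensity_ne_zero_iff.1 ho
  obtain ⟨k, hk⟩ := h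
  induction k with
  | zero =>
    have e : (⟨0, hk⟩ : Fin H) = 0 := Fin.ext (by simp)
    rw [e, h0, sk.layer_init]
  | succ k ih =>
    have h1 := ih (by omega)
    have h2 := f.layered _ _ _ (by rw [h1]; exact hk) (h3 ⟨k, by omega⟩ hk)
    rw [h1] at h2
    exact Fin.ext h2

/-- The trajectory visits the state `s` and plays the action `a` there. -/
def Visits (sk : Skeleton S H) (s : S) (a : A) (o : Traj S A H) : Prop :=
  (o (sk.layer s)).1 = s ∧ (o (sk.layer s)).2.1 = a

/-- The trajectory plays the action `a` in the state `s`, and moves to the state `s'`. -/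
def Moves (sk : Skeleton S H) (s : S) (a : A) (s' : S) (o : Traj S A H) : Prop :=
  Visits sk s a o ∧ ∃ hh : (sk.layer s : ℕ) + 1 < H, (o ⟨(sk.layer s : ℕ) + 1, hh⟩).1 = s'

instance (s : S) (a : A) : DecidablePred (Visits (A := A) sk s a) := fun o =>
  inferInstanceAs (Decidable ((o (sk.layer s)).1 = s ∧ (o (sk.layer s)).2.1 = a))

instance (s : S) (a : A) (s' : S) : DecidablePred (Moves (A := A) sk s a s') := fun o => by
  unfold Moves; infer_instance

/-- The reward that the trajectory collects in the layer of `s`. -/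
def rewardAt (sk : Skeleton S H) (s : S) (o : Traj S A H) : ℝ := (o (sk.layer s)).2.2

theorem measurable_rewardAt (s : S) : Measurable (rewardAt (A := A) sk s) := by
  unfold rewardAt; fun_prop

theorem measurableSet_visits (s : S) (a : A) : MeasurableSet {o | Visits (A := A) sk s a o} := by
  have : Measurable fun o : Traj S A H => ((o (sk.layer s)).1, (o (sk.layer s)).2.1) := by fun_prop
  have h := this (measurableSet_singleton (s, a))
  convert h using 1
  ext o
  simp [Visits, Prod.ext_iff]

theorem measurableSet_moves (s : S) (a : A) (s' : S) :
    MeasurableSet {o | Moves (A := A) sk s a s' o} := by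
  by_cases hh : (sk.layer s : ℕ) + 1 < H
  · have : Measurable fun o : Traj S A H => (o ⟨(sk.layer s : ℕ) + 1, hh⟩).1 := by fun_prop
    have h := (measurableSet_visits (sk := sk) s a).inter (this (measurableSet_singleton s'))
    convert h using 1
    ext o
    simp [Moves, hh]
  · simp [Moves, hh]

variable [SigmaFinite ν]

theorem ae_trajDensity_ne_zero (f : MDP A sk ν) (π : Policy S A) :
    ∀ᵐ o ∂(trajLaw f π), trajDensity f π o ≠ 0 := by
  rw [trajLaw, ae_withDensity_iff (measurable_trajDensity f π)]
  exact ae_of_all _ fun o h => h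

theorem map_eval_trajLaw (f : MDP A sk ν) (π : Policy S A) (h : Fin H) :
    (trajLaw f π).map (fun o => o h) =
      ∑ s, f.stateLaw π h s • ((f.reward s (π s)).law.map fun x => (s, π s, x)) := by
  refine Measure.ext_of_lintegral _ fun φ hφ => ?_
  rw [lintegral_map hφ (by fun_prop), lintegral_trajLaw_eval f π h hφ, lintegral_finsetSum_measure]
  refine Finset.sum_congr rfl fun s _ => ?_
  rw [lintegral_smul_measure, lintegral_map hφ (by fun_prop), smul_eq_mul]

theorem stateLaw_le_one (f : MDP A sk ν) (π : Policy S A) (h : ℕ) (s : S) :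
    f.stateLaw π h s ≤ 1 := by
  rw [← sum_stateLaw f.trans sk.init π h]
  exact Finset.single_le_sum (f := fun s => T2C.stateLaw f.trans sk.init π h s)
    (fun _ _ => zero_le) (Finset.mem_univ s)

theorem stateLaw_ne_top (f : MDP A sk ν) (π : Policy S A) (h : ℕ) (s : S) :
    f.stateLaw π h s ≠ ⊤ := ne_top_of_le_ne_top ENNReal.one_ne_top (stateLaw_le_one f π h s)

theorem integral_trajLaw_eval (f : MDP A sk ν) (π : Policy S A) (h : Fin H)
    {φ : S × A × ℝ → ℝ} (hφ : Measurable φ)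
    (hi : ∀ s, Integrable (fun x => φ (s, π s, x)) (f.reward s (π s)).law) :
    Integrable (fun o => φ (o h)) (trajLaw f π) ∧
    ∫ o, φ (o h) ∂(trajLaw f π) =
      ∑ s, (f.stateLaw π h s).toReal * ∫ x, φ (s, π s, x) ∂(f.reward s (π s)).law := by
  have hm : Measurable fun o : Traj S A H => o h := by fun_prop
  have hi' : ∀ s, Integrable φ
      (f.stateLaw π h s • ((f.reward s (π s)).law.map fun x => (s, π s, x))) := fun s => by
    refine Integrable.smul_measure ?_ (stateLaw_ne_top f π h s)
    rw [integrable_map_measure hφ.aestronglyMeasurable (by fun_prop)]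
    exact hi s
  have hs : Integrable φ ((trajLaw f π).map (fun o => o h)) := by
    rw [map_eval_trajLaw, integrable_finsetSum_measure]
    exact fun s _ => hi' s
  refine ⟨(integrable_map_measure hφ.aestronglyMeasurable hm.aemeasurable).1 hs, ?_⟩
  rw [← integral_map hm.aemeasurable hφ.aestronglyMeasurable, map_eval_trajLaw,
    integral_finsetSum_measure fun s _ => hi' s]
  refine Finset.sum_congr rfl fun s _ => ?_
  rw [integral_smul_measure, integral_map (by fun_prop) hφ.aestronglyMeasurable, smul_eq_mul]

/-- The probability that the policy `π` visits the state `s`. -/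
def MDP.visitProb (f : MDP A sk ν) (π : Policy S A) (s : S) : ℝ :=
  (f.stateLaw π (sk.layer s) s).toReal

/-- The probability that the policy `π` visits `s` and plays `a` there. -/
def MDP.occ (f : MDP A sk ν) (π : Policy S A) (s : S) (a : A) : ℝ :=
  if π s = a then f.visitProb π s else 0

theorem visitProb_nonneg (f : MDP A sk ν) (π : Policy S A) (s : S) : 0 ≤ f.visitProb π s :=
  ENNReal.toReal_nonneg

theorem visitProb_le_one (f : MDP A sk ν) (π : Policy S A) (s : S) : f.visitProb π s ≤ 1 :=
  ENNReal.toReal_le_of_le_ofReal zero_le_one (by simpa using stateLaw_le_one f π _ s)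

theorem occ_nonneg (f : MDP A sk ν) (π : Policy S A) (s : S) (a : A) : 0 ≤ f.occ π s a := by
  unfold MDP.occ; split_ifs <;> simp [visitProb_nonneg]

theorem occ_le_one (f : MDP A sk ν) (π : Policy S A) (s : S) (a : A) : f.occ π s a ≤ 1 := by
  unfold MDP.occ; split_ifs <;> simp [visitProb_le_one]

theorem integral_visits (f : MDP A sk ν) (π : Policy S A) (s : S) (a : A) {ψ : ℝ → ℝ}
    (hψ : Measurable ψ) (hi : Integrable ψ (f.reward s a).law) :
    Integrable (fun o => if Visits sk s a o then ψ (rewardAt sk s o) else 0) (trajLaw f π) ∧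
    ∫ o, (if Visits sk s a o then ψ (rewardAt sk s o) else 0) ∂(trajLaw f π) =
      f.occ π s a * ∫ x, ψ x ∂(f.reward s a).law := by
  have hm : Measurable fun x : S × A × ℝ => if x.1 = s ∧ x.2.1 = a then ψ x.2.2 else 0 := by
    refine Measurable.ite ?_ (hψ.comp (measurable_snd.comp measurable_snd)) measurable_const
    have : Measurable fun o : S × A × ℝ => (o.1, o.2.1) := by fun_prop
    convert this (measurableSet_singleton (s, a)) using 1
    ext o; simp [Prod.ext_iff]
  have := integral_trajLaw_eval f π (sk.layer s) hm (fun s' => ?_)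
  · refine ⟨this.1, this.2.trans ?_⟩
    rw [Finset.sum_eq_single s]
    · by_cases ha : π s = a
      · simp [ha, MDP.occ, MDP.visitProb]
      · simp [ha, MDP.occ]
    · intro s' _ hs'
      simp [hs']
    · simp
  · by_cases h : s' = s ∧ π s' = a
    · obtain ⟨rfl, rfl⟩ := h
      simpa using hi
    · simp [h]

theorem integral_moves (f : MDP A sk ν) (π : Policy S A) (s : S) (a : A) (s' : S)
    (hh : (sk.layer s : ℕ) + 1 < H) :
    ∫ o, (if Moves sk s a s' o then (1 : ℝ) else 0) ∂(trajLaw f π) =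
      f.occ π s a * (f.trans s a s').toReal := by
  have hae : ∀ᵐ o ∂(trajLaw f π), (if Moves sk s a s' o then (1 : ℝ) else 0) =
      if π s = a ∧ (o (sk.layer s)).1 = s ∧ (o ⟨(sk.layer s : ℕ) + 1, hh⟩).1 = s' then 1 else 0 := by
    filter_upwards [ae_trajDensity_ne_zero f π] with o ho
    obtain ⟨-, h1, -, -⟩ := trajDensity_ne_zero_iff.1 ho
    have := h1 (sk.layer s)
    refine if_congr ?_ rfl rfl
    simp only [Moves, Visits, hh, exists_true_left]
    constructor
    · rintro ⟨⟨h2, h3⟩, h4⟩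
      exact ⟨by rw [← h3, this, h2], h2, h4⟩
    · rintro ⟨h2, h3, h4⟩
      exact ⟨⟨h3, by rw [this, h3, h2]⟩, h4⟩
  rw [integral_congr_ae hae]
  by_cases ha : π s = a
  · have h := lintegral_trajLaw_pair f π (h := sk.layer s) (h' := ⟨(sk.layer s : ℕ) + 1, hh⟩) rfl
      (fun u u' => if u = s ∧ u' = s' then 1 else 0)
    simp only [ha, true_and]
    rw [integral_eq_lintegral_of_nonneg_ae (ae_of_all _ fun o => by split_ifs <;> simp)]
    · have e : ∀ o : Traj S A H, ENNReal.ofReal (if (o (sk.layer s)).1 = s ∧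
          (o ⟨(sk.layer s : ℕ) + 1, hh⟩).1 = s' then 1 else 0) = if (o (sk.layer s)).1 = s ∧
          (o ⟨(sk.layer s : ℕ) + 1, hh⟩).1 = s' then 1 else 0 := fun o => by
        split_ifs <;> simp
      simp only [e]
      rw [h, Finset.sum_eq_single s, Finset.sum_eq_single s']
      · simp [ha, MDP.occ, MDP.visitProb, ENNReal.toReal_mul]
      · intro u _ hu; simp [hu]
      · simp
      · intro u _ hu; simp [hu]
      · simp
    · refine Measurable.aestronglyMeasurable (Measurable.ite ?_ measurable_const measurable_const)
      have : Measurable fun o : Traj S A H =>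
          ((o (sk.layer s)).1, (o ⟨(sk.layer s : ℕ) + 1, hh⟩).1) := by fun_prop
      convert this (measurableSet_singleton (s, s')) using 1
      ext o; simp [Prod.ext_iff]
  · simp [ha, MDP.occ]

/-! ### Values -/

/-- In the double sum over times and states, only the time `sk.layer s` contributes for the state
`s`. -/
theorem value_eq (f : MDP A sk ν) (hf : ∀ s a, Integrable (fun x => x) (f.reward s a).law)
    (π : Policy S A) :
    value f π = ∑ s, f.visitProb π s * (f.reward s (π s)).mean := by
  have h := fun h : Fin H => integral_trajLaw_eval f π h (φ := fun x => x.2.2) (by fun_prop)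
    (fun s => hf s (π s))
  unfold value totalReward
  rw [integral_finsetSum _ fun i _ => (h i).1]
  simp only [(h _).2]
  rw [Finset.sum_comm]
  refine Finset.sum_congr rfl fun s _ => ?_
  rw [Finset.sum_eq_single (sk.layer s)]
  · rfl
  · intro i _ hi
    have : f.stateLaw π i s = 0 := by
      by_contra h0
      exact hi (Fin.ext (f.stateLaw_layer π i.2 h0)).symm
    simp [this]
  · simp

/-- The transitions of `g` are at least `c` times those of `f`. -/
def TransLE (c : ℝ≥0∞) (f g : MDP A sk ν) : Prop :=
  ∀ s a s', (sk.layer s : ℕ) + 1 < H → c * f.trans s a s' ≤ g.trans s a s'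

/-- Each step costs one factor `c`. The assumption excludes sources in the last layer, and this is
enough: a state with mass at time `h` lies in layer `h`, and `h + 1 < H` whenever a further step is
taken. -/
theorem TransLE.stateLaw_le {c : ℝ≥0∞} {f g : MDP A sk ν} (hc : TransLE c f g) (π : Policy S A)
    {h : ℕ} (hH : h < H) (s : S) : c ^ h * f.stateLaw π h s ≤ g.stateLaw π h s := by
  induction h generalizing s with
  | zero => simp [MDP.stateLaw, stateLaw]
  | succ h ih =>
    simp only [MDP.stateLaw, stateLaw, Finset.mul_sum]
    refine Finset.sum_le_sum fun s₁ _ => ?_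
    by_cases h0 : f.stateLaw π h s₁ = 0
    · have : stateLaw f.trans sk.init π h s₁ = 0 := h0
      simp [this]
    · have h1 := f.stateLaw_layer π (by omega) h0
      have h2 := hc s₁ (π s₁) s (by omega)
      calc c ^ (h + 1) * (stateLaw f.trans sk.init π h s₁ * f.trans s₁ (π s₁) s)
          = (c ^ h * f.stateLaw π h s₁) * (c * f.trans s₁ (π s₁) s) := by
            rw [MDP.stateLaw]; ring
        _ ≤ g.stateLaw π h s₁ * g.trans s₁ (π s₁) s := by
            gcongr
            exact ih (by omega) s₁
        _ = _ := rfl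

theorem TransLE.visitProb_le {c : ℝ} (hc0 : 0 ≤ c) (hc1 : c ≤ 1) {f g : MDP A sk ν}
    (hc : TransLE (ENNReal.ofReal c) f g) (π : Policy S A) (s : S) :
    c ^ H * f.visitProb π s ≤ g.visitProb π s := by
  have h := hc.stateLaw_le π (sk.layer s).2 s
  have h2 := ENNReal.toReal_mono (stateLaw_ne_top g π _ s) h
  rw [ENNReal.toReal_mul, ENNReal.toReal_pow, ENNReal.toReal_ofReal hc0] at h2
  refine le_trans ?_ h2
  refine mul_le_mul_of_nonneg_right ?_ ENNReal.toReal_nonneg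
  exact pow_le_pow_of_le_one hc0 hc1 (sk.layer s).2.le

theorem sum_stateLaw_toReal (f : MDP A sk ν) (π : Policy S A) (h : ℕ) :
    ∑ s, (f.stateLaw π h s).toReal = 1 := by
  rw [← ENNReal.toReal_sum fun s _ => stateLaw_ne_top f π h s, MDP.stateLaw, sum_stateLaw]
  simp

/-- One-sided domination gives a two-sided bound because both state laws have total mass one: if no
state loses more than the fraction `1 - c ^ H`, none can gain more than `1 - c ^ H`. Bernoulli's
inequality bounds this by `H (1 - c)`. -/
theorem TransLE.abs_visitProb_sub_le {c : ℝ} (hc0 : 0 ≤ c) (hc1 : c ≤ 1) {f g : MDP A sk ν}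
    (hc : TransLE (ENNReal.ofReal c) f g) (π : Policy S A) (s : S) :
    |f.visitProb π s - g.visitProb π s| ≤ H * (1 - c) := by
  have hb : 1 - (H : ℝ) * (1 - c) ≤ c ^ H := by
    have := one_add_mul_le_pow (a := c - 1) (by linarith) H
    have e : 1 + (c - 1) = c := by ring
    rw [e] at this
    linarith
  have hpow1 : c ^ H ≤ 1 := pow_le_one₀ hc0 hc1
  have key : ∀ s', c ^ H * (f.stateLaw π (sk.layer s) s').toReal ≤
      (g.stateLaw π (sk.layer s) s').toReal := fun s' => by
    have h2 := ENNReal.toReal_mono (stateLaw_ne_top g π _ s') (hc.stateLaw_le π (sk.layer s).2 s')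
    rw [ENNReal.toReal_mul, ENNReal.toReal_pow, ENNReal.toReal_ofReal hc0] at h2
    exact le_trans (mul_le_mul_of_nonneg_right (pow_le_pow_of_le_one hc0 hc1 (sk.layer s).2.le)
      ENNReal.toReal_nonneg) h2
  have h1 := sum_stateLaw_toReal f π (sk.layer s)
  have h2 := sum_stateLaw_toReal g π (sk.layer s)
  rw [← Finset.add_sum_erase _ _ (Finset.mem_univ s)] at h1 h2
  have h3 : c ^ H * ∑ x ∈ Finset.univ.erase s, (f.stateLaw π (sk.layer s) x).toReal ≤
      ∑ x ∈ Finset.univ.erase s, (g.stateLaw π (sk.layer s) x).toReal := by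
    rw [Finset.mul_sum]
    exact Finset.sum_le_sum fun x _ => key x
  have h4 := key s
  have h5 := visitProb_nonneg f π s
  have h6 := visitProb_le_one f π s
  unfold MDP.visitProb at *
  rw [abs_le]
  constructor <;> nlinarith

theorem TransLE.abs_value_sub_le {c κ m : ℝ} (hc0 : 0 ≤ c) (hc1 : c ≤ 1) {f g : MDP A sk ν}
    (hf : ∀ s a, Integrable (fun x => x) (f.reward s a).law)
    (hg : ∀ s a, Integrable (fun x => x) (g.reward s a).law)
    (hc : TransLE (ENNReal.ofReal c) f g) (hm : ∀ s a, |(f.reward s a).mean| ≤ m)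
    (hκ : ∀ s a, |(f.reward s a).mean - (g.reward s a).mean| ≤ κ) (π : Policy S A) :
    |value f π - value g π| ≤ Fintype.card S * (H * (1 - c) * m + κ) := by
  rw [value_eq f hf, value_eq g hg, ← Finset.sum_sub_distrib]
  refine (Finset.abs_sum_le_sum_abs _ _).trans ?_
  rw [← nsmul_eq_mul, ← Finset.card_univ]
  refine Finset.sum_le_card_nsmul _ _ _ fun s _ => ?_
  have h1 := hc.abs_visitProb_sub_le hc0 hc1 π s
  have h2 := visitProb_nonneg g π s
  have h3 := visitProb_le_one g π s
  have e : f.visitProb π s * (f.reward s (π s)).mean - g.visitProb π s * (g.reward s (π s)).mean =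
    (f.visitProb π s - g.visitProb π s) * (f.reward s (π s)).mean +
      g.visitProb π s * ((f.reward s (π s)).mean - (g.reward s (π s)).mean) := by ring
  rw [e]
  refine (abs_add_le _ _).trans ?_
  rw [abs_mul, abs_mul, abs_of_nonneg h2]
  have hκ0 : 0 ≤ κ := (abs_nonneg _).trans (hκ s (π s))
  have h4 : 0 ≤ (H : ℝ) * (1 - c) := (abs_nonneg _).trans h1
  refine add_le_add (mul_le_mul h1 (hm s _) (abs_nonneg _) h4) ?_
  calc _ ≤ 1 * κ := mul_le_mul h3 (hκ s _) (abs_nonneg _) zero_le_one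
    _ = κ := one_mul _

/-! ### Optimal decisions and reachability -/

variable [Nonempty A] {𝓡 : Set (RewardDensity ν)}

theorem value_le_optPolicy (f : MDP A sk ν) (π : Policy S A) :
    value f π ≤ value f (optPolicy f) :=
  Classical.choose_spec (Finite.exists_max (value f)) π

theorem gap_nonneg (f : MDP A sk ν) (π : Policy S A) : 0 ≤ gap f π :=
  sub_nonneg.2 (value_le_optPolicy f π)

theorem eq_optPolicy {f : MDP A sk ν} (hf : f ∈ instances A sk 𝓡) {π : Policy S A}
    (h : value f (optPolicy f) ≤ value f π) : π = optPolicy f :=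
  hf.2.unique (fun π' => (value_le_optPolicy f π').trans h) (value_le_optPolicy f)

/-- There are finitely many decisions, so a unique maximizer has a positive margin over the others;
perturbing every value by less than half of the margin preserves it. The smallest gap divided by
three is used, or any number if there is only one decision. -/
theorem exists_stability {f : MDP A sk ν} (hf : f ∈ instances A sk 𝓡) :
    ∃ ρ : ℝ, 0 < ρ ∧ ∀ g : MDP A sk ν, (∀ s a, g.reward s a ∈ 𝓡) →
      (∀ π, |value f π - value g π| ≤ ρ) → g ∈ instances A sk 𝓡 ∧ optPolicy g = optPolicy f := by
  classical
  have : ∃ ρ : ℝ, 0 < ρ ∧ ∀ π, π ≠ optPolicy f → 2 * ρ < gap f π := by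
    rcases (Finset.univ.filter fun π : Policy S A => π ≠ optPolicy f).eq_empty_or_nonempty with h | h
    · refine ⟨1, one_pos, fun π hπ => ?_⟩
      have : π ∈ Finset.univ.filter fun π : Policy S A => π ≠ optPolicy f := by simpa using hπ
      rw [h] at this
      simp at this
    · obtain ⟨π₀, h0, hmin⟩ := Finset.exists_min_image _ (gap f) h
      simp only [Finset.mem_filter, Finset.mem_univ, true_and] at h0 hmin
      have hpos : 0 < gap f π₀ := by
        refine lt_of_le_of_ne (gap_nonneg f π₀) fun he => h0 (eq_optPolicy hf ?_)
        unfold gap at he; linarith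
      exact ⟨gap f π₀ / 3, by positivity, fun π hπ => by have := hmin π hπ; linarith⟩
  obtain ⟨ρ, hρ, hgap⟩ := this
  refine ⟨ρ, hρ, fun g hg hv => ?_⟩
  have key : ∀ π, π ≠ optPolicy f → value g π < value g (optPolicy f) := fun π hπ => by
    have h1 := hgap π hπ
    have h2 := abs_le.1 (hv π)
    have h3 := abs_le.1 (hv (optPolicy f))
    unfold gap at h1
    linarith
  have hopt : optPolicy g = optPolicy f := by
    by_contra hne
    exact absurd (value_le_optPolicy g (optPolicy f)) (not_le.2 (key _ hne))
  refine ⟨⟨hg, optPolicy f, fun π' => ?_, fun π' hπ' => ?_⟩, hopt⟩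
  · rw [← hopt]; exact value_le_optPolicy g π'
  · by_contra hne
    exact absurd (hπ' (optPolicy f)) (not_le.2 (key _ hne))

/-- The action at a state cannot matter before the state has been reached. -/
theorem stateLaw_update (f : MDP A sk ν) (π : Policy S A) (s : S) (a : A) {h : ℕ} (hH : h < H)
    (hs : ∀ i < h, f.stateLaw π i s = 0) :
    f.stateLaw (Function.update π s a) h = f.stateLaw π h := by
  induction h with
  | zero => rfl
  | succ h ih =>
    have h1 := ih (by omega) fun i hi => hs i (by omega)
    funext s'
    simp only [MDP.stateLaw, stateLaw] at *
    refine Finset.sum_congr rfl fun u _ => ?_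
    rw [h1]
    by_cases hu : u = s
    · subst hu
      rw [hs h (by omega)]
      simp
    · rw [Function.update_of_ne hu]

theorem visitProb_update_self (f : MDP A sk ν) (π : Policy S A) (s : S) (a : A) :
    f.visitProb (Function.update π s a) s = f.visitProb π s := by
  unfold MDP.visitProb
  rw [stateLaw_update f π s a (sk.layer s).2 fun i hi => ?_]
  by_contra h0
  have := f.stateLaw_layer π (hi.trans (sk.layer s).2) h0
  omega

/-- If the optimal decision never reached `s`, changing its action there to another one would leave
the value unchanged, against uniqueness. This is where a second action is needed. -/
theorem visitProb_optPolicy_pos [Nontrivial A] {f : MDP A sk ν}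
    (hint : ∀ s a, Integrable (fun x => x) (f.reward s a).law)
    (hf : f ∈ instances A sk 𝓡) (s : S) : 0 < f.visitProb (optPolicy f) s := by
  refine lt_of_le_of_ne (visitProb_nonneg _ _ _) fun h0 => ?_
  obtain ⟨a, ha⟩ := exists_ne (optPolicy f s)
  have hz : ∀ i < H, f.stateLaw (optPolicy f) i s = 0 := fun i hi => by
    by_contra hne
    have h1 := f.stateLaw_layer (optPolicy f) hi hne
    have h2 : f.stateLaw (optPolicy f) (sk.layer s) s = 0 := by
      rcases (ENNReal.toReal_eq_zero_iff _).1 h0.symm with h | h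
      · exact h
      · exact absurd h (stateLaw_ne_top _ _ _ _)
    rw [h1] at h2
    exact hne h2
  have hv : value f (Function.update (optPolicy f) s a) = value f (optPolicy f) := by
    rw [value_eq f hint, value_eq f hint]
    refine Finset.sum_congr rfl fun u _ => ?_
    have e : f.visitProb (Function.update (optPolicy f) s a) u = f.visitProb (optPolicy f) u := by
      unfold MDP.visitProb
      rw [stateLaw_update f _ s a (sk.layer u).2 fun i hi => hz i (hi.trans (sk.layer u).2)]
    rw [e]
    by_cases hu : u = s
    · subst hu
      rw [← h0]; simp
    · rw [Function.update_of_ne hu]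
  have := eq_optPolicy hf (π := Function.update (optPolicy f) s a) hv.ge
  have h3 := congrFun this s
  rw [Function.update_self] at h3
  exact ha h3

/-- Every pair of a state and an action is visited by some decision. -/
theorem exists_occ_pos [Nontrivial A] {f : MDP A sk ν}
    (hint : ∀ s a, Integrable (fun x => x) (f.reward s a).law)
    (hf : f ∈ instances A sk 𝓡) :
    ∃ q : ℝ, 0 < q ∧ ∀ s a, ∃ π, q ≤ f.occ π s a := by
  have hne : (Finset.univ : Finset S).Nonempty := ⟨sk.init, Finset.mem_univ _⟩
  obtain ⟨s₀, -, hs₀⟩ := Finset.exists_min_image Finset.univ (f.visitProb (optPolicy f)) hne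
  refine ⟨f.visitProb (optPolicy f) s₀, visitProb_optPolicy_pos hint hf s₀, fun s a => ?_⟩
  -- The optimal decision with its action at `s` replaced by `a` still reaches `s` with the same
  -- probability.
  refine ⟨Function.update (optPolicy f) s a, ?_⟩
  rw [MDP.occ, Function.update_self, if_pos rfl, visitProb_update_self]
  exact hs₀ s (Finset.mem_univ _)

theorem gap_eq_zero_of_subsingleton [Subsingleton A] (f : MDP A sk ν) (π : Policy S A) :
    gap f π = 0 := by
  rw [gap, Subsingleton.elim (optPolicy f) π, sub_self]

end Model

section Model

variable {S A : Type*} [Fintype S] [DecidableEq S] [MeasurableSpace S] [MeasurableSingletonClass S]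
  [Fintype A] [DecidableEq A] [MeasurableSpace A] [MeasurableSingletonClass A]
  {H : ℕ} [NeZero H] {sk : Skeleton S H} {ν : Measure ℝ}

/-! ### Factorization of the likelihood over states and actions -/

/-- At time `h` the trajectory is in a state of layer `h`, so each pair of a state and an action
occurs at most once, and the product over times becomes a product over pairs. -/
theorem prod_layers {M : Type*} [CommMonoid M] {o : Traj S A H}
    (ho : ∀ h, sk.layer (o h).1 = h) (K : Fin H → S → A → M) :
    ∏ h, K h (o h).1 (o h).2.1 =
      ∏ s, ∏ a, if Visits sk s a o then K (sk.layer s) s a else 1 := by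
  have h1 : ∀ h, K h (o h).1 (o h).2.1 =
      ∏ s, ∏ a, if (o h).1 = s ∧ (o h).2.1 = a then K h s a else 1 := fun h => by
    rw [Finset.prod_eq_single (o h).1, Finset.prod_eq_single (o h).2.1]
    · simp
    · intro a _ ha; simp [Ne.symm ha]
    · simp
    · intro s _ hs; simp [Ne.symm hs]
    · simp
  simp only [h1]
  rw [Finset.prod_comm]
  refine Finset.prod_congr rfl fun s _ => ?_
  rw [Finset.prod_comm]
  refine Finset.prod_congr rfl fun a _ => ?_
  rw [Finset.prod_eq_single (sk.layer s)]
  · rfl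
  · intro h _ hh
    rw [if_neg]
    rintro ⟨h2, -⟩
    exact hh (by rw [← h2, ho h])
  · simp

/-- Positivity under `f` is all that is needed to factor the density of `g`: the initial state, the
layers and the decision are common to both, so the indicator factors of `g` equal one as well. -/
theorem trajDensity_eq_prod {f g : MDP A sk ν} {π : Policy S A} {o : Traj S A H}
    (ho : trajDensity f π o ≠ 0) :
    trajDensity g π o =
      (∏ s, ∏ a, if Visits sk s a o then ((g.reward s a).dens (rewardAt sk s o) : ℝ≥0∞) else 1) *
      ∏ s, ∏ a, ∏ s', if Moves sk s a s' o then g.trans s a s' else 1 := by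
  have hl := layer_of_trajDensity_ne_zero ho
  obtain ⟨h0, h1, -, -⟩ := trajDensity_ne_zero_iff.1 ho
  unfold trajDensity
  simp only [h0, h1, if_true, one_mul, Finset.prod_const_one, mul_one]
  congr 1
  · have := prod_layers hl fun h s a => ((g.reward s a).dens (o h).2.2 : ℝ≥0∞)
    simp only [h1] at this
    exact this
  · have := prod_layers hl fun h s a => if hh : (h : ℕ) + 1 < H then
      g.trans s a (o ⟨(h : ℕ) + 1, hh⟩).1 else 1
    simp only [h1] at this
    rw [this]
    refine Finset.prod_congr rfl fun s _ => Finset.prod_congr rfl fun a _ => ?_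
    by_cases hv : Visits sk s a o
    · by_cases hh : (sk.layer s : ℕ) + 1 < H
      · simp [Moves, hv, hh]
      · simp [Moves, hv, hh]
    · simp [Moves, hv]

theorem trajDensity_ne_top (f : MDP A sk ν) (π : Policy S A) (o : Traj S A H) :
    trajDensity f π o ≠ ⊤ := by
  unfold trajDensity
  refine ENNReal.mul_ne_top (ENNReal.mul_ne_top (ENNReal.mul_ne_top ?_ ?_) ?_) ?_
  · split_ifs <;> simp
  · exact ENNReal.prod_ne_top fun h _ => by split_ifs <;> simp
  · exact ENNReal.prod_ne_top fun h _ => by simp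
  · refine ENNReal.prod_ne_top fun h _ => ?_
    split_ifs
    · exact PMF.apply_ne_top _ _
    · simp

theorem log_trajDensity {g : MDP A sk ν} {π : Policy S A} {o : Traj S A H}
    (ho : trajDensity g π o ≠ 0) :
    Real.log (trajDensity g π o).toReal =
      (∑ s, ∑ a, if Visits sk s a o then Real.log ((g.reward s a).dens (rewardAt sk s o)) else 0) +
      ∑ s, ∑ a, ∑ s', if Moves sk s a s' o then Real.log (g.trans s a s').toReal else 0 := by
  have h := trajDensity_eq_prod (g := g) ho
  rw [h] at ho
  rw [h]
  simp only [ne_eq, mul_eq_zero, not_or, Finset.prod_eq_zero_iff, Finset.mem_univ, true_and,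
    not_exists] at ho
  obtain ⟨h1, h2⟩ := ho
  rw [ENNReal.toReal_mul, Real.log_mul]
  · simp only [ENNReal.toReal_prod]
    congr 1
    · rw [Real.log_prod fun s _ => ?_]
      · refine Finset.sum_congr rfl fun s _ => ?_
        rw [Real.log_prod fun a _ => ?_]
        · refine Finset.sum_congr rfl fun a _ => ?_
          split_ifs <;> simp
        · have := h1 s a
          split_ifs at this ⊢ with hv
          · simpa using this
          · simp
      · refine Finset.prod_ne_zero_iff.2 fun a _ => ?_
        have := h1 s a
        split_ifs at this ⊢ with hv
        · simpa using this
        · simp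
    · have h3 : ∀ s a s', (if Moves sk s a s' o then g.trans s a s' else 1).toReal ≠ 0 :=
        fun s a s' => by
          have := h2 s a s'
          split_ifs at this ⊢ with hv
          · exact ENNReal.toReal_ne_zero.2 ⟨this, PMF.apply_ne_top _ _⟩
          · simp
      rw [Real.log_prod fun s _ => Finset.prod_ne_zero_iff.2 fun a _ =>
        Finset.prod_ne_zero_iff.2 fun s' _ => h3 s a s']
      refine Finset.sum_congr rfl fun s _ => ?_
      rw [Real.log_prod fun a _ => Finset.prod_ne_zero_iff.2 fun s' _ => h3 s a s']
      refine Finset.sum_congr rfl fun a _ => ?_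
      rw [Real.log_prod fun s' _ => h3 s a s']
      refine Finset.sum_congr rfl fun s' _ => ?_
      split_ifs <;> simp
  · simp only [ENNReal.toReal_prod]
    refine Finset.prod_ne_zero_iff.2 fun s _ => Finset.prod_ne_zero_iff.2 fun a _ => ?_
    have := h1 s a
    split_ifs at this ⊢ with hv
    · simpa using this
    · simp
  · simp only [ENNReal.toReal_prod]
    refine Finset.prod_ne_zero_iff.2 fun s _ => Finset.prod_ne_zero_iff.2 fun a _ =>
      Finset.prod_ne_zero_iff.2 fun s' _ => ?_
    have := h2 s a s'
    split_ifs at this ⊢ with hv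
    · exact ENNReal.toReal_ne_zero.2 ⟨this, PMF.apply_ne_top _ _⟩
    · simp

/-! ### The relative entropy of two instances -/

/-- The relative entropy of the rewards of `f` and `g` at `(s, a)`. -/
def klReward (f g : MDP A sk ν) (s : S) (a : A) : ℝ :=
  ∫ x, (f.reward s a).logRatio (g.reward s a) x ∂(f.reward s a).law

/-- The relative entropy of the transitions of `f` and `g` at `(s, a)`, provided it is finite. -/
def klTrans (f g : MDP A sk ν) (s : S) (a : A) : ℝ :=
  if (sk.layer s : ℕ) + 1 < H then ∑ s', (f.trans s a s').toReal *
    (Real.log (f.trans s a s').toReal - Real.log (g.trans s a s').toReal) else 0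

/-- No transition that `f` makes under `π` is impossible under `g`. -/
def TransAC (f g : MDP A sk ν) (π : Policy S A) : Prop :=
  ∀ s, f.visitProb π s ≠ 0 → (sk.layer s : ℕ) + 1 < H → ∀ s', f.trans s (π s) s' ≠ 0 →
    g.trans s (π s) s' ≠ 0

variable [SigmaFinite ν]

theorem ae_visitProb_ne_zero (f : MDP A sk ν) (π : Policy S A) :
    ∀ᵐ o ∂(trajLaw f π), ∀ h, f.visitProb π (o h).1 ≠ 0 := by
  have key : ∀ h : Fin H, ∀ᵐ o ∂(trajLaw f π), f.stateLaw π h (o h).1 ≠ 0 := fun h => by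
    have hm : Measurable fun x : S × A × ℝ => if f.stateLaw π h x.1 = 0 then (1 : ℝ≥0∞) else 0 :=
      (Measurable.of_discrete (f := fun u : S => if f.stateLaw π h u = 0 then (1 : ℝ≥0∞) else 0)
        ).comp measurable_fst
    have h1 := lintegral_trajLaw_eval f π h hm
    have h2 : ∑ s, f.stateLaw π h s * ∫⁻ (_ : ℝ), (if f.stateLaw π h s = 0 then (1 : ℝ≥0∞) else 0)
        ∂(f.reward s (π s)).law = 0 := by
      refine Finset.sum_eq_zero fun s _ => ?_
      by_cases h0 : f.stateLaw π h s = 0 <;> simp [h0]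
    filter_upwards [(lintegral_eq_zero_iff (hm.comp (f := fun o : Traj S A H => o h)
      (by fun_prop))).1 (h1.trans h2)] with o ho h0
    simp [h0] at ho
  filter_upwards [ae_all_iff.2 key, ae_trajDensity_ne_zero f π] with o ho ho2 h
  rw [MDP.visitProb, layer_of_trajDensity_ne_zero ho2 h]
  exact ENNReal.toReal_ne_zero.2 ⟨ho h, stateLaw_ne_top _ _ _ _⟩

/-- A move that `f[π]` makes with positive probability and `g` forbids would be an event that is
null for `g[π]` but not for `f[π]`. By contraposition, a failure of `TransAC` makes the relative
entropy infinite. -/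
theorem transAC_of_ac {f g : MDP A sk ν} {π : Policy S A} (h : trajLaw f π ≪ trajLaw g π) :
    TransAC f g π := by
  intro s hs hh s' hp hq
  have h1 : ∀ᵐ o ∂(trajLaw g π), ¬ Moves sk s (π s) s' o := by
    filter_upwards [ae_trajDensity_ne_zero g π] with o ho hm
    obtain ⟨⟨e1, e2⟩, hh', e3⟩ := hm
    have := (trajDensity_ne_zero_iff.1 ho).2.2.2 (sk.layer s) hh
    rw [e1, e2, e3] at this
    exact this hq
  have h2 := h.ae_le h1
  have h3 := integral_moves f π s (π s) s' hh
  rw [integral_eq_zero_of_ae] at h3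
  · rw [MDP.occ, if_pos rfl] at h3
    rcases mul_eq_zero.1 h3.symm with h4 | h4
    · exact hs h4
    · exact ENNReal.toReal_ne_zero.2 ⟨hp, PMF.apply_ne_top _ _⟩ h4
  · filter_upwards [h2] with o ho
    simp [ho]

theorem ae_of_ae_rewards {f : MDP A sk ν} {p : S → A → ℝ → Prop} (π : Policy S A)
    (hp : ∀ s a, ∀ᵐ x ∂(f.reward s a).law, p s a x) :
    ∀ᵐ o ∂(trajLaw f π), ∀ h, p (o h).1 (o h).2.1 (o h).2.2 := by
  rw [ae_all_iff]
  intro h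
  have hm : ∀ s a, ∃ N, MeasurableSet N ∧ {x | ¬ p s a x} ⊆ N ∧ (f.reward s a).law N = 0 :=
    fun s a => ⟨toMeasurable _ _, measurableSet_toMeasurable _ _, subset_toMeasurable _ _, by
      rw [measure_toMeasurable]; exact hp s a⟩
  choose N hN hsub hzero using hm
  have hE : Measurable fun x : S × A × ℝ => (N x.1 x.2.1).indicator (fun _ => (1 : ℝ≥0∞)) x.2.2 :=
    measurable_from_prod_countable_right fun s => measurable_from_prod_countable_right fun a =>
      measurable_const.indicator (hN s a)
  have h1 := lintegral_trajLaw_eval f π h hE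
  have h2 : ∑ s, f.stateLaw π h s * ∫⁻ x, (N s (π s)).indicator (fun _ => (1 : ℝ≥0∞)) x
      ∂(f.reward s (π s)).law = 0 := by
    refine Finset.sum_eq_zero fun s _ => ?_
    rw [lintegral_indicator (hN _ _)]
    simp [hzero]
  filter_upwards [(lintegral_eq_zero_iff (hE.comp (f := fun o : Traj S A H => o h)
    (by fun_prop))).1 (h1.trans h2)] with o ho
  by_contra hcon
  have := hsub _ _ hcon
  simp [this] at ho

variable {𝓡 : Set (RewardDensity ν)}

/-- The moment condition already makes any two reward distributions of the family mutually
absolutely continuous, so only transitions can obstruct absolute continuity. -/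
theorem ae_trajDensity_ne_zero_of_transAC (hR : RewardCondition 𝓡) {f g : MDP A sk ν}
    (hf : ∀ s a, f.reward s a ∈ 𝓡) (hg : ∀ s a, g.reward s a ∈ 𝓡) {π : Policy S A}
    (hac : TransAC f g π) : ∀ᵐ o ∂(trajLaw f π), trajDensity g π o ≠ 0 := by
  obtain ⟨B, -, hB⟩ := hR.exists_moment
  have h1 := ae_of_ae_rewards (f := f) (p := fun s a x => 0 < (g.reward s a).dens x) π
    fun s a => by filter_upwards [(hB _ (hf s a) _ (hg s a)).1] with x hx using hx.2
  filter_upwards [h1, ae_trajDensity_ne_zero f π, ae_visitProb_ne_zero f π] with o ho1 ho2 ho3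
  obtain ⟨e1, e2, e3, e4⟩ := trajDensity_ne_zero_iff.1 ho2
  refine trajDensity_ne_zero_iff.2 ⟨e1, e2, fun h => (ho1 h).ne', fun h hh => ?_⟩
  rw [e2]
  have h5 := e4 h hh
  rw [e2] at h5
  exact hac _ (ho3 h) (by rw [layer_of_trajDensity_ne_zero ho2 h]; exact hh) _ h5

theorem integrable_moves (f : MDP A sk ν) (π : Policy S A) (s : S) (a : A) (s' : S) (c : ℝ) :
    Integrable (fun o => if Moves sk s a s' o then c else 0) (trajLaw f π) := by
  refine Integrable.of_bound (C := |c|) ?_ (ae_of_all _ fun o => ?_)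
  · exact (Measurable.ite (measurableSet_moves s a s') measurable_const
      measurable_const).aestronglyMeasurable
  · split_ifs <;> simp

/-- The chain rule. Almost surely the log-likelihood ratio is the sum `L` of the contributions of
the pairs that are visited, and each contribution has expectation occupancy times divergence. -/
theorem klDiv_trajLaw (hR : RewardCondition 𝓡) {f g : MDP A sk ν}
    (hf : ∀ s a, f.reward s a ∈ 𝓡) (hg : ∀ s a, g.reward s a ∈ 𝓡) {π : Policy S A}
    (hac : TransAC f g π) :
    klDiv (trajLaw f π) (trajLaw g π) =
      ENNReal.ofReal (∑ s, ∑ a, f.occ π s a * (klReward f g s a + klTrans f g s a)) := by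
  obtain ⟨B, -, hB⟩ := hR.exists_moment
  have hne := ae_trajDensity_ne_zero_of_transAC hR hf hg hac
  have hFm := measurable_trajDensity f π
  have hGm := measurable_trajDensity g π
  -- The quotient of the densities is a derivative of `f[π]` with respect to `g[π]`: where the
  -- density of `g` vanishes, that of `f` vanishes for almost every trajectory of the base measure.
  have hw : trajLaw f π = (trajLaw g π).withDensity (trajDensity f π / trajDensity g π) := by
    have h1 := hne
    rw [trajLaw, ae_withDensity_iff hFm] at h1
    rw [trajLaw, trajLaw, ← withDensity_mul _ hGm (hFm.div hGm)]
    refine withDensity_congr_ae ?_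
    filter_upwards [h1] with o ho
    rw [Pi.mul_apply, Pi.div_apply]
    by_cases h0 : trajDensity f π o = 0
    · simp [h0]
    · rw [ENNReal.mul_div_cancel (ho h0) (trajDensity_ne_top _ _ _)]
  have habs : trajLaw f π ≪ trajLaw g π := by
    rw [hw]; exact withDensity_absolutelyContinuous _ _
  have hrn : (trajLaw f π).rnDeriv (trajLaw g π) =ᵐ[trajLaw f π]
      fun o => trajDensity f π o / trajDensity g π o := by
    refine habs.ae_le ?_
    have := Measure.rnDeriv_withDensity (trajLaw g π) (hFm.div hGm)
    rw [← hw] at this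
    exact this
  let L : Traj S A H → ℝ := fun o =>
    (∑ s, ∑ a, if Visits sk s a o then
      (f.reward s a).logRatio (g.reward s a) (rewardAt sk s o) else 0) +
    ∑ s, ∑ a, ∑ s', if Moves sk s a s' o then
      Real.log (f.trans s a s').toReal - Real.log (g.trans s a s').toReal else 0
  have hL : llr (trajLaw f π) (trajLaw g π) =ᵐ[trajLaw f π] L := by
    filter_upwards [hrn, hne, ae_trajDensity_ne_zero f π] with o h1 h2 h3
    rw [llr, h1, ENNReal.toReal_div, Real.log_div
      (ENNReal.toReal_ne_zero.2 ⟨h3, trajDensity_ne_top _ _ _⟩)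
      (ENNReal.toReal_ne_zero.2 ⟨h2, trajDensity_ne_top _ _ _⟩), log_trajDensity h2,
      log_trajDensity h3, add_sub_add_comm]
    simp only [L, ← Finset.sum_sub_distrib]
    congr 1
    · refine Finset.sum_congr rfl fun s _ => Finset.sum_congr rfl fun a _ => ?_
      split_ifs <;> simp [RewardDensity.logRatio]
    · refine Finset.sum_congr rfl fun s _ => Finset.sum_congr rfl fun a _ =>
        Finset.sum_congr rfl fun s' _ => ?_
      split_ifs <;> simp
  have hint : ∀ s a, Integrable ((f.reward s a).logRatio (g.reward s a)) (f.reward s a).law :=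
    fun s a => ((memLp_two_iff_integrable_sq
      (RewardDensity.measurable_logRatio _ _).aestronglyMeasurable).2
        (hB _ (hf s a) _ (hg s a)).2.1).integrable one_le_two
  have hv := fun s a => integral_visits f π s a
    (RewardDensity.measurable_logRatio (f.reward s a) (g.reward s a)) (hint s a)
  have hm := fun s a s' => integrable_moves f π s a s'
    (Real.log (f.trans s a s').toReal - Real.log (g.trans s a s').toReal)
  have i1 : Integrable (fun o => ∑ s, ∑ a, if Visits sk s a o then
      (f.reward s a).logRatio (g.reward s a) (rewardAt sk s o) else 0) (trajLaw f π) :=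
    integrable_finsetSum _ fun s _ => integrable_finsetSum _ fun a _ => (hv s a).1
  have i2 : Integrable (fun o => ∑ s, ∑ a, ∑ s', if Moves sk s a s' o then
      Real.log (f.trans s a s').toReal - Real.log (g.trans s a s').toReal else 0) (trajLaw f π) :=
    integrable_finsetSum _ fun s _ => integrable_finsetSum _ fun a _ =>
      integrable_finsetSum _ fun s' _ => hm s a s'
  have hLi : Integrable L (trajLaw f π) := i1.add i2
  have hLe : ∫ o, L o ∂(trajLaw f π) =
      ∑ s, ∑ a, f.occ π s a * (klReward f g s a + klTrans f g s a) := by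
    rw [integral_add i1 i2, integral_finsetSum _ fun s _ => integrable_finsetSum _ fun a _ =>
      (hv s a).1, integral_finsetSum _ fun s _ => integrable_finsetSum _ fun a _ =>
      integrable_finsetSum _ fun s' _ => hm s a s', ← Finset.sum_add_distrib]
    refine Finset.sum_congr rfl fun s _ => ?_
    rw [integral_finsetSum _ fun a _ => (hv s a).1, integral_finsetSum _ fun a _ =>
      integrable_finsetSum _ fun s' _ => hm s a s', ← Finset.sum_add_distrib]
    refine Finset.sum_congr rfl fun a _ => ?_
    rw [(hv s a).2, integral_finsetSum _ fun s' _ => hm s a s', mul_add, klReward]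
    congr 1
    rw [klTrans]
    split_ifs with hh
    · rw [Finset.mul_sum]
      refine Finset.sum_congr rfl fun s' _ => ?_
      rw [← mul_assoc, ← integral_moves f π s a s' hh, ← integral_mul_const]
      refine integral_congr_ae (ae_of_all _ fun o => ?_)
      simp
    · simp [Moves, hh]
  rw [klDiv_of_ac_of_integrable habs ((integrable_congr hL).2 hLi), integral_congr_ae hL, hLe]
  simp

end Model

section Model

variable {S A : Type*} [Fintype S] [DecidableEq S] [MeasurableSpace S] [MeasurableSingletonClass S]
  [Fintype A] [DecidableEq A] [MeasurableSpace A] [MeasurableSingletonClass A]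
  {H : ℕ} [NeZero H] {sk : Skeleton S H} {ν : Measure ℝ}

/-! ### Histories -/

/-- The decisions and observations of `t` rounds. -/
abbrev Hist (S A : Type*) (H t : ℕ) := Fin t → Policy S A × Traj S A H

theorem measurable_snoc {X : Type*} [MeasurableSpace X] (t : ℕ) :
    Measurable fun z : (Fin t → X) × X => (Fin.snoc (α := fun _ => X) z.1 z.2 : Fin (t + 1) → X) := by
  refine measurable_pi_lambda _ fun i => ?_
  refine Fin.lastCases ?_ (fun j => ?_) i
  · simpa using measurable_snd
  · simp only [Fin.snoc_castSucc]
    fun_prop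

theorem measurable_append {X : Type*} [MeasurableSpace X] (m t : ℕ) :
    Measurable fun z : (Fin m → X) × (Fin t → X) => (Fin.append z.1 z.2 : Fin (m + t) → X) := by
  refine measurable_pi_lambda _ fun i => ?_
  refine Fin.addCases (fun j => ?_) (fun j => ?_) i
  · simp only [Fin.append_left]
    fun_prop
  · simp only [Fin.append_right]
    fun_prop

variable [SigmaFinite ν]

/-- Decisions form a finite set, so the law chosen by the past can be split into finitely many fixed
laws. -/
theorem measurable_lintegral_trajLaw (f : MDP A sk ν) {X : Type*} [MeasurableSpace X]
    {a : X → Policy S A} (ha : Measurable a) {G : X → Policy S A × Traj S A H → ℝ≥0∞}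
    (hG : Measurable fun z : X × (Policy S A × Traj S A H) => G z.1 z.2) :
    Measurable fun x => ∫⁻ o, G x (a x, o) ∂(trajLaw f (a x)) := by
  have h1 : ∀ π, Measurable fun x => ∫⁻ o, G x (π, o) ∂(trajLaw f π) := fun π => by
    have : Measurable fun z : X × Traj S A H => G z.1 (π, z.2) :=
      hG.comp (f := fun z : X × Traj S A H => (z.1, (π, z.2))) (by fun_prop)
    exact this.lintegral_prod_right' (ν := trajLaw f π)
  have h2 : ∀ x, ∫⁻ o, G x (a x, o) ∂(trajLaw f (a x)) =
      ∑ π, if a x = π then ∫⁻ o, G x (π, o) ∂(trajLaw f π) else 0 := fun x => by simp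
  simp only [h2]
  exact Finset.measurable_sum _ fun π _ =>
    Measurable.ite (ha (measurableSet_singleton π)) (h1 π) measurable_const

/-- The tower property for one round. Measurability of the algorithm is what makes the transition a
measurable kernel, so that the integral against `bind` can be evaluated; the inductions over rounds
rely on it. -/
theorem lintegral_historyLaw_succ {alg : Algorithm S A H} {t : ℕ} (ha : Measurable (alg t))
    (f : MDP A sk ν) {F : Hist S A H (t + 1) → ℝ≥0∞} (hF : Measurable F) :
    ∫⁻ h, F h ∂(historyLaw alg f (t + 1)) =
      ∫⁻ h, ∫⁻ o, F (Fin.snoc (α := fun _ => Policy S A × Traj S A H) h (alg t h, o))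
        ∂(trajLaw f (alg t h)) ∂(historyLaw alg f t) := by
  have hs : ∀ h : Hist S A H t, Measurable fun o =>
      (Fin.snoc (α := fun _ => Policy S A × Traj S A H) h (alg t h, o) : Hist S A H (t + 1)) :=
    fun h => (measurable_snoc t).comp (f := fun o : Traj S A H => (h, (alg t h, o))) (by fun_prop)
  have hk : Measurable fun h : Hist S A H t => (trajLaw f (alg t h)).map fun o =>
      (Fin.snoc (α := fun _ => Policy S A × Traj S A H) h (alg t h, o) : Hist S A H (t + 1)) := by
    refine Measure.measurable_of_measurable_coe _ fun E hE => ?_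
    have h1 := measurable_lintegral_trajLaw f ha (G := fun h z => E.indicator (fun _ => 1)
      (Fin.snoc (α := fun _ => Policy S A × Traj S A H) h z : Hist S A H (t + 1)))
      ((measurable_const.indicator hE).comp (measurable_snoc t))
    refine (congrArg Measurable (funext fun h => ?_)).mpr h1
    rw [Measure.map_apply (hs h) hE, ← lintegral_indicator_one ((hs h) hE)]
    rfl
  rw [historyLaw, Measure.lintegral_bind hk.aemeasurable hF.aemeasurable]
  refine lintegral_congr fun h => ?_
  rw [lintegral_map hF (hs h)]

theorem isProbabilityMeasure_historyLaw {alg : Algorithm S A H} (ha : ∀ t, Measurable (alg t))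
    (f : MDP A sk ν) (t : ℕ) : IsProbabilityMeasure (historyLaw alg f t) := by
  induction t with
  | zero => rw [historyLaw]; infer_instance
  | succ t ih =>
    constructor
    have := lintegral_historyLaw_succ (ha t) f (F := fun _ => 1) measurable_const
    simpa using this

theorem ae_historyLaw_succ {alg : Algorithm S A H} {t : ℕ} (ha : Measurable (alg t))
    (f : MDP A sk ν) {E : Set (Hist S A H (t + 1))} (hE : MeasurableSet E)
    (h : ∀ᵐ h ∂(historyLaw alg f t), ∀ᵐ o ∂(trajLaw f (alg t h)),
      (Fin.snoc (α := fun _ => Policy S A × Traj S A H) h (alg t h, o) : Hist S A H (t + 1)) ∈ E) :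
    ∀ᵐ h ∂(historyLaw alg f (t + 1)), h ∈ E := by
  have h1 := lintegral_historyLaw_succ ha f (F := Eᶜ.indicator 1)
    (measurable_one.indicator hE.compl)
  rw [lintegral_indicator_one hE.compl] at h1
  rw [ae_iff]
  refine h1.trans ?_
  rw [← lintegral_zero (μ := historyLaw alg f t)]
  refine lintegral_congr_ae ?_
  filter_upwards [h] with x hx
  rw [← lintegral_zero (μ := trajLaw f (alg t x))]
  refine lintegral_congr_ae ?_
  filter_upwards [hx] with o ho
  simp [ho]

theorem ae_historyLaw_forall {alg : Algorithm S A H} (ha : ∀ t, Measurable (alg t))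
    (f : MDP A sk ν) {p : Policy S A → Traj S A H → Prop}
    (hp : ∀ π, ∀ᵐ o ∂(trajLaw f π), p π o) (t : ℕ) :
    ∀ᵐ h ∂(historyLaw alg f t), ∀ i, p (h i).1 (h i).2 := by
  -- The property `p` need not be measurable; it is replaced by the complement of the measurable
  -- hulls of the exceptional null sets.
  let Q : Set (Policy S A × Traj S A H) := {z | z.2 ∉ toMeasurable (trajLaw f z.1) {o | ¬ p z.1 o}}
  have hQ : MeasurableSet Q := by
    have : Q = ⋃ π : Policy S A, ({π} : Set (Policy S A)) ×ˢ
        (toMeasurable (trajLaw f π) {o | ¬ p π o})ᶜ := by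
      ext ⟨π, o⟩; simp [Q]
    rw [this]
    exact MeasurableSet.iUnion fun π =>
      (measurableSet_singleton π).prod (measurableSet_toMeasurable _ _).compl
  have hQae : ∀ π, ∀ᵐ o ∂(trajLaw f π), (π, o) ∈ Q := fun π => by
    rw [ae_iff]
    simp only [Q, Set.mem_ofPred_eq, not_not]
    rw [Set.ofPred_mem_eq, measure_toMeasurable]
    exact hp π
  have hall : ∀ᵐ h ∂(historyLaw alg f t), ∀ i, h i ∈ Q := by
    induction t with
    | zero => exact ae_of_all _ fun h i => i.elim0
    | succ t ih =>
      have hE : MeasurableSet {h : Hist S A H (t + 1) | ∀ i, h i ∈ Q} := by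
        simp only [Set.ofPred_forall]
        exact MeasurableSet.iInter fun i => measurable_pi_apply i hQ
      refine ae_historyLaw_succ (ha t) f hE ?_
      filter_upwards [ih] with h hh
      filter_upwards [hQae (alg t h)] with o ho
      intro i
      refine Fin.lastCases ?_ (fun j => ?_) i
      · simpa using ho
      · simpa using hh j
  filter_upwards [hall] with h hh i
  by_contra hcon
  exact hh i (subset_toMeasurable _ _ hcon)

theorem ae_historyLaw_fst {alg : Algorithm S A H} (ha : ∀ t, Measurable (alg t))
    (f : MDP A sk ν) (w : ℕ → Policy S A) (t : ℕ) (hw : ∀ s < t, ∀ h, alg s h = w s) :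
    ∀ᵐ h ∂(historyLaw alg f t), ∀ i : Fin t, (h i).1 = w i := by
  induction t with
  | zero => exact ae_of_all _ fun h i => i.elim0
  | succ t ih =>
    have hE : MeasurableSet {h : Hist S A H (t + 1) | ∀ i : Fin (t + 1), (h i).1 = w i} := by
      simp only [Set.ofPred_forall]
      exact MeasurableSet.iInter fun i =>
        (measurable_fst.comp (measurable_pi_apply i)) (measurableSet_singleton _)
    refine ae_historyLaw_succ (ha t) f hE ?_
    filter_upwards [ih fun s hs => hw s (by omega)] with h hh
    refine ae_of_all _ fun o i => ?_
    refine Fin.lastCases ?_ (fun j => ?_) i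
    · simpa using hw t (by omega) h
    · simpa using hh j

/-! ### Restarting an algorithm -/

/-- The algorithm that continues `alg` after the history `h`. -/
def shift (alg : Algorithm S A H) (m : ℕ) (h : Hist S A H m) : Algorithm S A H :=
  fun s h' => alg (m + s) (Fin.append h h')

theorem measurable_shift {alg : Algorithm S A H} (ha : ∀ t, Measurable (alg t)) (m : ℕ)
    (h : Hist S A H m) (t : ℕ) : Measurable (shift alg m h t) :=
  (ha (m + t)).comp ((measurable_append m t).comp (measurable_const.prodMk measurable_id))

theorem measurable_lintegral_shift {alg : Algorithm S A H} (ha : ∀ t, Measurable (alg t))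
    (f : MDP A sk ν) (m s : ℕ) {F : Hist S A H m × Hist S A H s → ℝ≥0∞} (hF : Measurable F) :
    Measurable fun h => ∫⁻ h', F (h, h') ∂(historyLaw (shift alg m h) f s) := by
  induction s with
  | zero =>
    simp only [historyLaw]
    have h0 : Measurable fun h : Hist S A H m => F (h, Fin.elim0) :=
      hF.comp (measurable_id.prodMk measurable_const)
    refine (congrArg Measurable (funext fun h => ?_)).mpr h0
    have h1 : Measurable fun h' : Hist S A H 0 => F (h, h') := hF.comp measurable_prodMk_left
    rw [lintegral_dirac' _ h1]
  | succ s ih =>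
    have h1 := measurable_lintegral_trajLaw f
      (X := Hist S A H m × Hist S A H s) (a := fun x => alg (m + s) (Fin.append x.1 x.2))
      ((ha (m + s)).comp (measurable_append m s))
      (G := fun x z => F (x.1, Fin.snoc (α := fun _ => Policy S A × Traj S A H) x.2 z))
      (hF.comp (f := fun z : (Hist S A H m × Hist S A H s) × (Policy S A × Traj S A H) =>
        (z.1.1, Fin.snoc (α := fun _ => Policy S A × Traj S A H) z.1.2 z.2))
        ((measurable_fst.comp measurable_fst).prodMk ((measurable_snoc s).comp
          ((measurable_snd.comp measurable_fst).prodMk measurable_snd))))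
    refine (congrArg Measurable (funext fun h => ?_)).mpr (ih h1)
    have h2 : Measurable fun h' : Hist S A H (s + 1) => F (h, h') := hF.comp measurable_prodMk_left
    rw [lintegral_historyLaw_succ (measurable_shift ha m h s) f h2]
    rfl

/-- Conditionally on the first `m` rounds, the remaining ones are a fresh interaction of the
algorithm `shift alg m h`. This lets each step of Test-to-Commit be analysed separately, given the
data of the previous ones. -/
theorem lintegral_historyLaw_add {alg : Algorithm S A H} (ha : ∀ t, Measurable (alg t))
    (f : MDP A sk ν) (m s : ℕ) {F : Hist S A H (m + s) → ℝ≥0∞} (hF : Measurable F) :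
    ∫⁻ h, F h ∂(historyLaw alg f (m + s)) =
      ∫⁻ h, ∫⁻ h', F (Fin.append h h') ∂(historyLaw (shift alg m h) f s)
        ∂(historyLaw alg f m) := by
  induction s with
  | zero =>
    refine lintegral_congr fun h => ?_
    have h1 : Measurable fun h' : Hist S A H 0 => F (Fin.append h h') :=
      hF.comp ((measurable_append m 0).comp measurable_prodMk_left)
    rw [historyLaw, lintegral_dirac' _ h1]
    congr 1
    funext i
    exact (Fin.append_left h _ i).symm
  | succ s ih =>
    have h0 : Measurable fun h : Hist S A H (m + s) =>
        ∫⁻ o, F (Fin.snoc (α := fun _ => Policy S A × Traj S A H) h (alg (m + s) h, o))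
        ∂(trajLaw f (alg (m + s) h)) :=
      measurable_lintegral_trajLaw f (ha (m + s)) (G := fun h z =>
        F (Fin.snoc (α := fun _ => Policy S A × Traj S A H) h z)) (hF.comp (measurable_snoc (m + s)))
    have h1 := lintegral_historyLaw_succ (alg := alg) (t := m + s) (ha _) f hF
    refine h1.trans ?_
    rw [ih h0]
    refine lintegral_congr fun h => ?_
    have h2 : Measurable fun h' : Hist S A H (s + 1) => F (Fin.append h h') :=
      hF.comp ((measurable_append m (s + 1)).comp measurable_prodMk_left)
    rw [lintegral_historyLaw_succ (measurable_shift ha m h s) f h2]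
    refine lintegral_congr fun h' => ?_
    refine lintegral_congr fun o => ?_
    rw [Fin.append_snoc]
    rfl

variable [Nonempty A]

theorem measurable_gap_alg {alg : Algorithm S A H} {t : ℕ} (ha : Measurable (alg t))
    (f : MDP A sk ν) : Measurable fun h => ENNReal.ofReal (gap f (alg t h)) :=
  (Measurable.of_discrete (f := fun π : Policy S A => ENNReal.ofReal (gap f π))).comp ha

theorem regret_add {alg : Algorithm S A H} (ha : ∀ t, Measurable (alg t))
    (f : MDP A sk ν) (m s : ℕ) :
    regret alg f (m + s) =
      regret alg f m + ∫⁻ h, regret (shift alg m h) f s ∂(historyLaw alg f m) := by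
  unfold regret
  rw [Finset.sum_range_add]
  congr 1
  have hm : ∀ t, Measurable fun h => ∫⁻ h', ENNReal.ofReal (gap f (shift alg m h t h'))
      ∂(historyLaw (shift alg m h) f t) := fun t => measurable_lintegral_shift ha f m t
    (F := fun z => ENNReal.ofReal (gap f (alg (m + t) (Fin.append z.1 z.2))))
    ((measurable_gap_alg (ha _) f).comp (measurable_append m t))
  rw [lintegral_finsetSum _ fun t _ => hm t]
  refine Finset.sum_congr rfl fun t _ => ?_
  exact lintegral_historyLaw_add ha f m t (measurable_gap_alg (ha _) f)

theorem regret_mono (alg : Algorithm S A H) (f : MDP A sk ν) : Monotone (regret alg f) := by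
  intro m n hmn
  exact Finset.sum_le_sum_of_subset (Finset.range_mono hmn)

/-! ### Second moments of sums over rounds -/

/-- Martingale orthogonality: given the past, the decision is fixed and the new summand is centred,
so the cross term vanishes and each round adds at most `v`. -/
theorem lintegral_sum_sq_le {alg : Algorithm S A H} (ha : ∀ t, Measurable (alg t))
    (f : MDP A sk ν) {ψ : Policy S A → Traj S A H → ℝ} (hψ : ∀ π, Measurable (ψ π)) {v : ℝ}
    (hv : 0 ≤ v)
    (hi : ∀ π, Integrable (fun o => ψ π o ^ 2) (trajLaw f π))
    (h0 : ∀ π, ∫ o, ψ π o ∂(trajLaw f π) = 0) (h2 : ∀ π, ∫ o, ψ π o ^ 2 ∂(trajLaw f π) ≤ v) (t : ℕ) :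
    ∫⁻ h, ENNReal.ofReal ((∑ i, ψ (h i).1 (h i).2) ^ 2) ∂(historyLaw alg f t) ≤
      ENNReal.ofReal (t * v) := by
  have hψm : Measurable fun z : Policy S A × Traj S A H => ψ z.1 z.2 :=
    measurable_from_prod_countable_right hψ
  have hm : ∀ t, Measurable fun h : Hist S A H t =>
      ENNReal.ofReal ((∑ i, ψ (h i).1 (h i).2) ^ 2) := fun t => by
    refine Measurable.ennreal_ofReal (Measurable.pow_const ?_ 2)
    exact Finset.measurable_sum _ fun i _ => hψm.comp (measurable_pi_apply i)
  induction t with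
  | zero =>
    simp
  | succ t ih =>
    have := isProbabilityMeasure_historyLaw ha f t
    rw [lintegral_historyLaw_succ (ha t) f (hm (t + 1))]
    have key : ∀ h : Hist S A H t, ∫⁻ o, ENNReal.ofReal ((∑ i,
        ψ (Fin.snoc (α := fun _ => Policy S A × Traj S A H) h (alg t h, o) i).1
          (Fin.snoc (α := fun _ => Policy S A × Traj S A H) h (alg t h, o) i).2) ^ 2)
        ∂(trajLaw f (alg t h)) ≤
        ENNReal.ofReal ((∑ i, ψ (h i).1 (h i).2) ^ 2) + ENNReal.ofReal v := fun h => by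
      simp only [Fin.sum_univ_castSucc, Fin.snoc_castSucc, Fin.snoc_last]
      set c := ∑ i, ψ (h i).1 (h i).2
      set π := alg t h
      have i1 : Integrable (ψ π) (trajLaw f π) :=
        ((memLp_two_iff_integrable_sq (hψ π).aestronglyMeasurable).2 (hi π)).integrable one_le_two
      have i2 : Integrable (fun o => 2 * c * ψ π o) (trajLaw f π) := i1.const_mul _
      have i3 : Integrable (fun o => c ^ 2 + 2 * c * ψ π o) (trajLaw f π) :=
        (integrable_const _).add i2
      have e : ∀ o, (c + ψ π o) ^ 2 = c ^ 2 + 2 * c * ψ π o + ψ π o ^ 2 := fun o => by ring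
      have i4 : Integrable (fun o => (c + ψ π o) ^ 2) (trajLaw f π) := by
        simp only [e]; exact i3.add (hi π)
      rw [← ofReal_integral_eq_lintegral_ofReal i4 (ae_of_all _ fun o => sq_nonneg _),
        ← ENNReal.ofReal_add (sq_nonneg _) hv]
      refine ENNReal.ofReal_le_ofReal ?_
      simp only [e]
      rw [integral_add i3 (hi π), integral_add (integrable_const _) i2, integral_const_mul, h0]
      simp only [integral_const, probReal_univ, smul_eq_mul, one_mul, mul_zero, add_zero]
      have := h2 π
      linarith
    refine (lintegral_mono key).trans ?_
    rw [lintegral_add_right _ measurable_const, lintegral_const, measure_univ, mul_one]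
    refine (add_le_add_left ih _).trans ?_
    rw [← ENNReal.ofReal_add (by positivity) hv]
    refine ENNReal.ofReal_le_ofReal ?_
    push_cast
    linarith

/-- Chebyshev's inequality after centring by the conditional means. The second moment dominates the
variance, and no property of the algorithm beyond measurability enters, so the bound also applies to
adaptive data. -/
theorem measure_sum_sub_integral_le {alg : Algorithm S A H} (ha : ∀ t, Measurable (alg t))
    (f : MDP A sk ν) {ψ : Policy S A → Traj S A H → ℝ} (hψ : ∀ π, Measurable (ψ π)) {v : ℝ}
    (hi : ∀ π, Integrable (fun o => ψ π o ^ 2) (trajLaw f π))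
    (h2 : ∀ π, ∫ o, ψ π o ^ 2 ∂(trajLaw f π) ≤ v) (t : ℕ) {c : ℝ} (hc : 0 < c) :
    historyLaw alg f t {h | c < |∑ i, ψ (h i).1 (h i).2 -
      ∑ i, ∫ o, ψ (h i).1 o ∂(trajLaw f (h i).1)|} ≤ ENNReal.ofReal (t * v / c ^ 2) := by
  by_cases hne : Nonempty (Policy S A)
  swap
  · exact absurd ⟨fun _ => Classical.arbitrary A⟩ hne
  have hv : 0 ≤ v := (integral_nonneg fun o => sq_nonneg _).trans (h2 (Classical.arbitrary _))
  let χ : Policy S A → Traj S A H → ℝ := fun π o => ψ π o - ∫ o, ψ π o ∂(trajLaw f π)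
  have hχ : ∀ π, Measurable (χ π) := fun π => (hψ π).sub_const _
  have hL : ∀ π, MemLp (ψ π) 2 (trajLaw f π) := fun π =>
    (memLp_two_iff_integrable_sq (hψ π).aestronglyMeasurable).2 (hi π)
  have i1 : ∀ π, Integrable (ψ π) (trajLaw f π) := fun π => (hL π).integrable one_le_two
  have hχi : ∀ π, Integrable (fun o => χ π o ^ 2) (trajLaw f π) := fun π =>
    (memLp_two_iff_integrable_sq (hχ π).aestronglyMeasurable).1 ((hL π).sub (memLp_const _))
  have hχ0 : ∀ π, ∫ o, χ π o ∂(trajLaw f π) = 0 := fun π => by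
    simp only [χ]
    rw [integral_sub (i1 π) (integrable_const _)]
    simp
  have hχ2 : ∀ π, ∫ o, χ π o ^ 2 ∂(trajLaw f π) ≤ v := fun π => by
    set m := ∫ o, ψ π o ∂(trajLaw f π) with hm
    have e : ∀ o, χ π o ^ 2 = ψ π o ^ 2 - 2 * m * ψ π o + m ^ 2 := fun o => by
      simp only [χ]; ring
    have i2 : Integrable (fun o => 2 * m * ψ π o) (trajLaw f π) := (i1 π).const_mul _
    have i3 : Integrable (fun o => ψ π o ^ 2 - 2 * m * ψ π o) (trajLaw f π) := (hi π).sub i2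
    simp only [e]
    rw [integral_add i3 (integrable_const _), integral_sub (hi π) i2, integral_const_mul, ← hm]
    simp only [integral_const, probReal_univ, smul_eq_mul, one_mul]
    nlinarith [h2 π, sq_nonneg m]
  have hs := lintegral_sum_sq_le ha f hχ hv hχi hχ0 hχ2 t
  have hsub : {h : Hist S A H t | c < |∑ i, ψ (h i).1 (h i).2 -
      ∑ i, ∫ o, ψ (h i).1 o ∂(trajLaw f (h i).1)|} ⊆
      {h | ENNReal.ofReal (c ^ 2) ≤ ENNReal.ofReal ((∑ i, χ (h i).1 (h i).2) ^ 2)} := by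
    intro h hh
    simp only [Set.mem_ofPred_eq] at hh ⊢
    refine ENNReal.ofReal_le_ofReal ?_
    simp only [χ, Finset.sum_sub_distrib]
    rw [← sq_abs (_ - _)]
    exact pow_le_pow_left₀ hc.le hh.le 2
  have hmeas : Measurable fun h : Hist S A H t =>
      ENNReal.ofReal ((∑ i, χ (h i).1 (h i).2) ^ 2) := by
    refine Measurable.ennreal_ofReal (Measurable.pow_const ?_ 2)
    exact Finset.measurable_sum _ fun i _ =>
      (measurable_from_prod_countable_right (f := fun z : Policy S A × Traj S A H => χ z.1 z.2)
        hχ).comp (measurable_pi_apply i)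
  refine (measure_mono hsub).trans ?_
  refine (meas_ge_le_lintegral_div hmeas.aemeasurable (by simp [hc.ne'])
    ENNReal.ofReal_ne_top).trans ?_
  rw [ENNReal.ofReal_div_of_pos (by positivity)]
  gcongr

/-! ### Likelihood ratios -/

theorem likelihood_snoc (f : MDP A sk ν) {t : ℕ} (h : Hist S A H t) (z : Policy S A × Traj S A H) :
    likelihood f (Fin.snoc (α := fun _ => Policy S A × Traj S A H) h z : Hist S A H (t + 1)) =
      likelihood f h * trajDensity f z.1 z.2 := by
  simp [likelihood, Fin.prod_univ_castSucc]

theorem measurable_likelihood (f : MDP A sk ν) (t : ℕ) :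
    Measurable fun h : Hist S A H t => likelihood f h := by
  unfold likelihood
  refine Finset.measurable_prod _ fun i _ => ?_
  have : Measurable fun z : Policy S A × Traj S A H => trajDensity f z.1 z.2 :=
    measurable_from_prod_countable_right fun π => measurable_trajDensity f π
  exact this.comp (measurable_pi_apply i)

theorem likelihood_ne_top (f : MDP A sk ν) {t : ℕ} (h : Hist S A H t) : likelihood f h ≠ ⊤ :=
  ENNReal.prod_ne_top fun _ _ => trajDensity_ne_top _ _ _

theorem lintegral_trajDensity_div_le (f g : MDP A sk ν) (π : Policy S A) :
    ∫⁻ o, trajDensity g π o / trajDensity f π o ∂(trajLaw f π) ≤ 1 := by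
  have hm : Measurable fun o => trajDensity g π o / trajDensity f π o :=
    (measurable_trajDensity g π).div (measurable_trajDensity f π)
  have h1 : ∫⁻ o, trajDensity g π o / trajDensity f π o ∂(trajLaw f π) =
      ∫⁻ o, trajDensity f π o * (trajDensity g π o / trajDensity f π o)
        ∂(Measure.pi fun _ : Fin H => stepBase S A ν) := by
    rw [trajLaw, lintegral_withDensity_eq_lintegral_mul _ (measurable_trajDensity f π) hm]
    rfl
  have h2 : ∫⁻ o, trajDensity g π o ∂(Measure.pi fun _ : Fin H => stepBase S A ν) = 1 := by
    have : (trajLaw g π) Set.univ = 1 := measure_univ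
    rw [trajLaw, withDensity_apply _ MeasurableSet.univ, Measure.restrict_univ] at this
    exact this
  rw [h1, ← h2]
  exact lintegral_mono fun o => ENNReal.mul_div_le

/-- The likelihood ratio is a nonnegative supermartingale under `f`. There is an inequality rather
than equality because mass of `g` where the density of `f` vanishes is lost. -/
theorem lintegral_likelihood_div_le {alg : Algorithm S A H} (ha : ∀ t, Measurable (alg t))
    (f g : MDP A sk ν) (t : ℕ) :
    ∫⁻ h, likelihood g h / likelihood f h ∂(historyLaw alg f t) ≤ 1 := by
  induction t with
  | zero =>
    have := isProbabilityMeasure_historyLaw ha f 0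
    simp [likelihood]
  | succ t ih =>
    have hm : Measurable fun h : Hist S A H (t + 1) => likelihood g h / likelihood f h :=
      (measurable_likelihood g _).div (measurable_likelihood f _)
    rw [lintegral_historyLaw_succ (ha t) f hm]
    refine le_trans (lintegral_mono fun h => ?_) ih
    simp only [likelihood_snoc]
    have hm : Measurable fun o => trajDensity g (alg t h) o / trajDensity f (alg t h) o :=
      (measurable_trajDensity g (alg t h)).div (measurable_trajDensity f (alg t h))
    calc _ = ∫⁻ o, likelihood g h / likelihood f h *
          (trajDensity g (alg t h) o / trajDensity f (alg t h) o) ∂(trajLaw f (alg t h)) := by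
          refine lintegral_congr fun o => ?_
          simp only [div_eq_mul_inv]
          rw [ENNReal.mul_inv (Or.inr (trajDensity_ne_top _ _ _)) (Or.inl (likelihood_ne_top _ _))]
          ring
      _ = likelihood g h / likelihood f h *
          ∫⁻ o, trajDensity g (alg t h) o / trajDensity f (alg t h) o ∂(trajLaw f (alg t h)) :=
          lintegral_const_mul _ hm
      _ ≤ likelihood g h / likelihood f h * 1 := by
          gcongr
          exact lintegral_trajDensity_div_le f g _
      _ = _ := mul_one _

theorem ae_likelihood_ne_zero {alg : Algorithm S A H} (ha : ∀ t, Measurable (alg t))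
    (f : MDP A sk ν) (t : ℕ) : ∀ᵐ h ∂(historyLaw alg f t), likelihood f h ≠ 0 := by
  filter_upwards [ae_historyLaw_forall ha f (fun π => ae_trajDensity_ne_zero f π) t] with h hh
  exact Finset.prod_ne_zero_iff.2 fun i _ => hh i

/-- The true instance is rejected in favour of `g` only with probability `1 / n`. -/
theorem measure_likelihood_ratio_le {alg : Algorithm S A H} (ha : ∀ t, Measurable (alg t))
    (f g : MDP A sk ν) (t : ℕ) (n : ℕ) :
    (n : ℝ≥0∞) * historyLaw alg f t {h | (n : ℝ≥0∞) * likelihood f h ≤ likelihood g h} ≤ 1 := by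
  have hm : Measurable fun h : Hist S A H t => likelihood g h / likelihood f h :=
    (measurable_likelihood g _).div (measurable_likelihood f _)
  refine le_trans ?_ (lintegral_likelihood_div_le ha f g t)
  refine le_trans ?_ (mul_meas_ge_le_lintegral hm (n : ℝ≥0∞))
  refine mul_le_mul_right ?_ _
  refine measure_mono_ae ?_
  filter_upwards [ae_likelihood_ne_zero ha f t] with h h0 hh
  exact (ENNReal.le_div_iff_mul_le (Or.inl h0) (Or.inl (likelihood_ne_top _ _))).2 hh

/-! ### The rewards collected at a fixed state and action -/

theorem lintegral_visits_le (f : MDP A sk ν) (π : Policy S A) (s : S) (a : A) {φ : ℝ → ℝ≥0∞}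
    (hφ : Measurable φ) :
    ∫⁻ o, (if Visits sk s a o then φ (rewardAt sk s o) else 0) ∂(trajLaw f π) ≤
      ∫⁻ x, φ x ∂(f.reward s a).law := by
  have hm : Measurable fun x : S × A × ℝ => if x.1 = s ∧ x.2.1 = a then φ x.2.2 else 0 := by
    refine Measurable.ite ?_ (hφ.comp (measurable_snd.comp measurable_snd)) measurable_const
    have : Measurable fun o : S × A × ℝ => (o.1, o.2.1) := by fun_prop
    convert this (measurableSet_singleton (s, a)) using 1
    ext o; simp [Prod.ext_iff]
  refine (lintegral_trajLaw_eval f π (sk.layer s) hm).le.trans ?_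
  rw [Finset.sum_eq_single s]
  · by_cases ha : π s = a
    · simp only [ha, and_self, if_true]
      calc _ ≤ 1 * ∫⁻ x, φ x ∂(f.reward s a).law := by
            gcongr
            exact stateLaw_le_one f π _ s
        _ = _ := one_mul _
    · simp [ha]
  · intro s' _ hs'
    simp [hs']
  · simp

theorem lintegral_pi_snoc (μ : Measure ℝ) [SigmaFinite μ] (k : ℕ) {F : (Fin (k + 1) → ℝ) → ℝ≥0∞}
    (hF : Measurable F) :
    ∫⁻ x, F x ∂(Measure.pi fun _ : Fin (k + 1) => μ) =
      ∫⁻ x, ∫⁻ y, F (Fin.snoc (α := fun _ => ℝ) x y) ∂μ ∂(Measure.pi fun _ : Fin k => μ) := by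
  have hmp := (measurePreserving_piFinSuccAbove (fun _ : Fin (k + 1) => μ) (Fin.last k)).symm
  have hm : Measurable fun z : ℝ × (Fin k → ℝ) =>
      F ((MeasurableEquiv.piFinSuccAbove (fun _ : Fin (k + 1) => ℝ) (Fin.last k)).symm z) :=
    hF.comp hmp.measurable
  rw [← hmp.lintegral_comp hF, lintegral_prod_symm' _ hm]
  refine lintegral_congr fun x => lintegral_congr fun y => ?_
  congr 1
  simp [MeasurableEquiv.piFinSuccAbove, Fin.insertNthEquiv, Fin.insertNth_last']

/-- For a fixed set of rounds, the rewards collected on the event that all of them visit `(s, a)`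
have a joint law dominated by an i.i.d. law. In the induction the last round is either selected, and
then supplies the last coordinate, or is integrated out. The point is to carry null sets of i.i.d.
samples over to adaptive data. -/
theorem lintegral_select_le {alg : Algorithm S A H} (ha : ∀ t, Measurable (alg t))
    (f : MDP A sk ν) (s : S) (a : A) (t k : ℕ) (ι : Fin k → Fin t) (hι : StrictMono ι)
    {F : (Fin k → ℝ) → ℝ≥0∞} (hF : Measurable F) :
    ∫⁻ h, (if ∀ j, Visits sk s a (h (ι j)).2 then F (fun j => rewardAt sk s (h (ι j)).2) else 0)
      ∂(historyLaw alg f t) ≤ ∫⁻ x, F x ∂(Measure.pi fun _ : Fin k => (f.reward s a).law) := by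
  have hvis : MeasurableSet {z : Policy S A × Traj S A H | Visits sk s a z.2} :=
    measurable_snd (measurableSet_visits s a)
  have hmeas : ∀ (t k : ℕ) (ι : Fin k → Fin t) (F : (Fin k → ℝ) → ℝ≥0∞), Measurable F →
      Measurable fun h : Hist S A H t => if ∀ j, Visits sk s a (h (ι j)).2 then
        F (fun j => rewardAt sk s (h (ι j)).2) else 0 := fun t k ι F hF => by
    refine Measurable.ite ?_ (hF.comp ?_) measurable_const
    · simp only [Set.ofPred_forall]
      exact MeasurableSet.iInter fun j =>
        (show Measurable fun h : Hist S A H t => h (ι j) from measurable_pi_apply _) hvis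
    · exact measurable_pi_lambda _ fun j => (measurable_rewardAt s).comp
        (measurable_snd.comp (measurable_pi_apply (ι j)))
  induction t generalizing k with
  | zero =>
    obtain rfl : k = 0 := by
      rcases Nat.eq_zero_or_pos k with h | h
      · exact h
      · exact (ι ⟨0, h⟩).elim0
    have h0 : ∀ x : Fin 0 → ℝ, F x = F Fin.elim0 := fun x => by
      congr 1; exact Subsingleton.elim _ _
    have := isProbabilityMeasure_historyLaw ha f 0
    simp [h0]
  | succ t ih =>
    rw [lintegral_historyLaw_succ (ha t) f (hmeas _ _ ι F hF)]
    by_cases hlast : ∃ j, ι j = Fin.last t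
    · obtain ⟨j, hj⟩ := hlast
      obtain ⟨k, rfl⟩ : ∃ k', k = k' + 1 := ⟨k - 1, by have := j.2; omega⟩
      have hjl : j = Fin.last k := by
        by_contra hne
        have h1 : j < Fin.last k := lt_of_le_of_ne (Fin.le_last j) hne
        have h2 := hι h1
        rw [hj] at h2
        exact absurd (Fin.le_last _) (not_le.2 h2)
      subst hjl
      have hlt : ∀ i : Fin k, (ι i.castSucc : ℕ) < t := fun i => by
        have h1 := hι (Fin.castSucc_lt_last i)
        rw [hj] at h1
        exact h1
      let ι' : Fin k → Fin t := fun i => ⟨ι i.castSucc, hlt i⟩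
      have hι' : StrictMono ι' := fun i i' hii => hι (Fin.castSucc_lt_castSucc_iff.2 hii)
      have he : ∀ i : Fin k, ι i.castSucc = (ι' i).castSucc := fun i => rfl
      have hF' : Measurable fun x : Fin k → ℝ =>
          ∫⁻ y, F (Fin.snoc (α := fun _ => ℝ) x y) ∂(f.reward s a).law :=
        (hF.comp (measurable_snoc k)).lintegral_prod_right'
      rw [lintegral_pi_snoc _ _ hF]
      refine le_trans (lintegral_mono fun h => ?_) (ih k ι' hι' hF')
      simp only [Fin.forall_fin_succ', he, hj, Fin.snoc_castSucc, Fin.snoc_last]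
      by_cases hall : ∀ i, Visits sk s a (h (ι' i)).2
      · rw [if_pos hall]
        simp only [hall, implies_true, true_and]
        have hm : Measurable fun y =>
            F (Fin.snoc (α := fun _ => ℝ) (fun j => rewardAt sk s (h (ι' j)).2) y) :=
          (hF.comp (measurable_snoc k)).comp measurable_prodMk_left
        refine le_trans (lintegral_mono fun o => ?_) (lintegral_visits_le f (alg t h) s a hm)
        split_ifs
        · refine le_of_eq ?_
          congr 1
          funext i
          refine Fin.lastCases ?_ (fun i => ?_) i
          · simp [hj]
          · simp [he]
        · exact le_rfl
      · simp [hall]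
    · push Not at hlast
      have hlt : ∀ i : Fin k, (ι i : ℕ) < t := fun i => by
        have h1 := hlast i
        have h2 := (ι i).2
        have h3 : (ι i : ℕ) ≠ t := fun h => h1 (Fin.ext h)
        omega
      let ι' : Fin k → Fin t := fun i => ⟨ι i, hlt i⟩
      have he : ∀ i : Fin k, ι i = (ι' i).castSucc := fun i => rfl
      refine le_trans (lintegral_mono fun h => ?_) (ih k ι' (fun i i' hii => hι hii) hF)
      simp only [he, Fin.snoc_castSucc]
      simp

end Model

section Model

variable {S A : Type*} [Fintype S] [DecidableEq S] [MeasurableSpace S] [MeasurableSingletonClass S]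
  [Fintype A] [DecidableEq A] [MeasurableSpace A] [MeasurableSingletonClass A]
  {H : ℕ} [NeZero H] {sk : Skeleton S H} {ν : Measure ℝ}

/-! ### Uniform concentration -/

/-- The number of moves from `s` to `s'` by the action `a`. -/
def numMoves (sk : Skeleton S H) {t : ℕ} (h : Hist S A H t) (s : S) (a : A) (s' : S) : ℝ :=
  ∑ i, if Moves sk s a s' (h i).2 then 1 else 0

/-- The sum of `ψ` over the rewards collected by the action `a` in the state `s`. -/
def sumVisits (sk : Skeleton S H) {t : ℕ} (h : Hist S A H t) (s : S) (a : A) (ψ : ℝ → ℝ) : ℝ :=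
  ∑ i, if Visits sk s a (h i).2 then ψ (rewardAt sk s (h i).2) else 0

/-- The expected number of visits to `(s, a)`, given the decisions. -/
def expVisits (f : MDP A sk ν) {t : ℕ} (h : Hist S A H t) (s : S) (a : A) : ℝ :=
  ∑ i, f.occ (h i).1 s a

/-- All empirical averages over the history are close to their expectations under `f`. -/
structure GoodHist (𝓡 : Set (RewardDensity ν)) (f : MDP A sk ν) (η : ℝ) {t : ℕ}
    (h : Hist S A H t) : Prop where
  dens : ∀ i, trajDensity f (h i).1 (h i).2 ≠ 0
  pos : ∀ i s a, Visits sk s a (h i).2 → ∀ g ∈ 𝓡, 0 < g.dens (rewardAt sk s (h i).2)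
  moves : ∀ s a s', (sk.layer s : ℕ) + 1 < H →
    |numMoves sk h s a s' - expVisits f h s a * (f.trans s a s').toReal| ≤ η * t
  rewards : ∀ s a, ∀ g ∈ 𝓡, |sumVisits sk h s a (g.logRatio (f.reward s a)) -
    expVisits f h s a * ∫ x, g.logRatio (f.reward s a) x ∂(f.reward s a).law| ≤ η * t

variable [SigmaFinite ν]

theorem expVisits_nonneg (f : MDP A sk ν) {t : ℕ} (h : Hist S A H t) (s : S) (a : A) :
    0 ≤ expVisits f h s a := Finset.sum_nonneg fun _ _ => occ_nonneg _ _ _ _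

theorem expVisits_le (f : MDP A sk ν) {t : ℕ} (h : Hist S A H t) (s : S) (a : A) :
    expVisits f h s a ≤ t := by
  unfold expVisits
  calc _ ≤ ∑ _i : Fin t, (1 : ℝ) := Finset.sum_le_sum fun _ _ => occ_le_one _ _ _ _
    _ = t := by simp

variable [Nonempty A]

theorem measure_sumVisits_le {alg : Algorithm S A H} (ha : ∀ t, Measurable (alg t))
    (f : MDP A sk ν) (s : S) (a : A) {ψ : ℝ → ℝ} (hψ : Measurable ψ)
    (hi : Integrable (fun x => ψ x ^ 2) (f.reward s a).law) {v : ℝ}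
    (hv : ∫ x, ψ x ^ 2 ∂(f.reward s a).law ≤ v) (t : ℕ) {c : ℝ} (hc : 0 < c) :
    historyLaw alg f t {h | c < |sumVisits sk h s a ψ -
      expVisits f h s a * ∫ x, ψ x ∂(f.reward s a).law|} ≤ ENNReal.ofReal (t * v / c ^ 2) := by
  have hψi : Integrable ψ (f.reward s a).law :=
    ((memLp_two_iff_integrable_sq hψ.aestronglyMeasurable).2 hi).integrable one_le_two
  have h1 := fun π => integral_visits f π s a hψ hψi
  have h2 := fun π => integral_visits f π s a (hψ.pow_const 2) hi
  have hsq : ∀ o : Traj S A H, (if Visits sk s a o then ψ (rewardAt sk s o) else 0) ^ 2 =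
      if Visits sk s a o then ψ (rewardAt sk s o) ^ 2 else 0 := fun o => by split_ifs <;> simp
  have key := measure_sum_sub_integral_le ha f
    (ψ := fun _ o => if Visits sk s a o then ψ (rewardAt sk s o) else 0) (v := v)
    (fun π => Measurable.ite (measurableSet_visits s a) (hψ.comp (measurable_rewardAt s))
      measurable_const)
    (fun π => by simp only [hsq]; exact (h2 π).1)
    (fun π => by
      simp only [hsq]
      rw [(h2 π).2]
      have h0 : 0 ≤ ∫ x, ψ x ^ 2 ∂(f.reward s a).law := integral_nonneg fun x => sq_nonneg _
      calc _ ≤ 1 * ∫ x, ψ x ^ 2 ∂(f.reward s a).law := by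
            gcongr
            exact occ_le_one _ _ _ _
        _ ≤ v := by rw [one_mul]; exact hv) t hc
  refine le_trans (le_of_eq ?_) key
  congr 1
  ext h
  simp only [Set.mem_ofPred_eq, (h1 _).2, sumVisits, expVisits, Finset.sum_mul]

theorem measure_numMoves_le {alg : Algorithm S A H} (ha : ∀ t, Measurable (alg t))
    (f : MDP A sk ν) (s : S) (a : A) (s' : S) (hh : (sk.layer s : ℕ) + 1 < H) (t : ℕ) {c : ℝ}
    (hc : 0 < c) :
    historyLaw alg f t {h | c < |numMoves sk h s a s' -
      expVisits f h s a * (f.trans s a s').toReal|} ≤ ENNReal.ofReal (t * 1 / c ^ 2) := by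
  have hsq : ∀ o : Traj S A H, (if Moves sk s a s' o then (1 : ℝ) else 0) ^ 2 =
      if Moves sk s a s' o then 1 else 0 := fun o => by split_ifs <;> simp
  have key := measure_sum_sub_integral_le ha f
    (ψ := fun _ o => if Moves sk s a s' o then (1 : ℝ) else 0) (v := 1)
    (fun π => Measurable.ite (measurableSet_moves s a s') measurable_const measurable_const)
    (fun π => by simp only [hsq]; exact integrable_moves f π s a s' 1)
    (fun π => by
      simp only [hsq]
      rw [integral_moves f π s a s' hh]
      have h1 : (f.trans s a s').toReal ≤ 1 :=
        ENNReal.toReal_le_of_le_ofReal zero_le_one (by simpa using PMF.coe_le_one _ _)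
      exact mul_le_one₀ (occ_le_one _ _ _ _) ENNReal.toReal_nonneg h1) t hc
  refine le_trans (le_of_eq ?_) key
  congr 1
  ext h
  simp only [Set.mem_ofPred_eq, integral_moves f _ s a s' hh, numMoves, expVisits, Finset.sum_mul]

variable {𝓡 : Set (RewardDensity ν)}

theorem sumVisits_mono {t : ℕ} {h : Hist S A H t} {s : S} {a : A} {ψ ψ' : ℝ → ℝ}
    (hle : ∀ i, Visits sk s a (h i).2 → |ψ (rewardAt sk s (h i).2)| ≤ ψ' (rewardAt sk s (h i).2)) :
    |sumVisits sk h s a ψ| ≤ sumVisits sk h s a ψ' := by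
  unfold sumVisits
  refine (Finset.abs_sum_le_sum_abs _ _).trans (Finset.sum_le_sum fun i _ => ?_)
  by_cases hv : Visits sk s a (h i).2
  · simpa [hv] using hle i hv
  · simp [hv]

theorem sumVisits_sub {t : ℕ} (h : Hist S A H t) (s : S) (a : A) (ψ ψ' : ℝ → ℝ) :
    sumVisits sk h s a (fun x => ψ x - ψ' x) = sumVisits sk h s a ψ - sumVisits sk h s a ψ' := by
  unfold sumVisits
  rw [← Finset.sum_sub_distrib]
  refine Finset.sum_congr rfl fun i _ => ?_
  split_ifs <;> simp

theorem sumVisits_const_mul {t : ℕ} (h : Hist S A H t) (s : S) (a : A) (c : ℝ) (ψ : ℝ → ℝ) :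
    sumVisits sk h s a (fun x => c * ψ x) = c * sumVisits sk h s a ψ := by
  unfold sumVisits
  rw [Finset.mul_sum]
  refine Finset.sum_congr rfl fun i _ => ?_
  split_ifs <;> simp

/-- Covers have polynomial size. -/
theorem RewardCondition.exists_cover_pow (hR : RewardCondition 𝓡) (hne : 𝓡.Nonempty) :
    ∃ k : ℕ, ∀ ε : ℝ, 0 < ε → ε ≤ 1 / 2 → ∃ 𝓒 : Finset (RewardDensity ν),
      (∀ g ∈ 𝓒, g ∈ 𝓡) ∧ (∀ g ∈ 𝓡, ∃ g' ∈ 𝓒, g.tv g' ≤ ε) ∧ (𝓒.card : ℝ) ≤ (1 / ε) ^ k := by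
  obtain ⟨K, hK⟩ := hR.cover
  obtain ⟨k, hk⟩ := exists_nat_ge K
  refine ⟨k, fun ε h0 h1 => ?_⟩
  obtain ⟨𝓒, hc1, hc2, hc3⟩ := hK ε h0 h1
  refine ⟨𝓒, hc1, hc2, ?_⟩
  obtain ⟨g, hg⟩ := hne
  obtain ⟨g', hg', -⟩ := hc2 g hg
  have hpos : (0 : ℝ) < 𝓒.card := by exact_mod_cast Finset.card_pos.2 ⟨g', hg'⟩
  have hlog : 0 ≤ Real.log (1 / ε) := Real.log_nonneg (by rw [le_div_iff₀ h0]; linarith)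
  rw [← Real.log_le_log_iff hpos (by positivity), Real.log_pow]
  exact hc3.trans (mul_le_mul_of_nonneg_right hk hlog)

/-- A chaining argument with a single scale. Chebyshev's inequality controls the densities of a
finite cover, and the log-ratio between a density and its cover point is at most a small multiple of
the envelope, whose empirical sum is controlled too. The domination by the envelope is included in
the event because it holds only almost surely. -/
theorem measure_rewards_le (hR : RewardCondition 𝓡) (f : MDP A sk ν) (s : S) (a : A)
    (hr : f.reward s a ∈ 𝓡) {c : ℝ} {Y : ℝ → ℝ} (hY : IsEnvelope 𝓡 (f.reward s a) c Y) :
    ∃ (C : ℝ) (p : ℕ), 0 ≤ C ∧ ∀ (alg : Algorithm S A H), (∀ t, Measurable (alg t)) →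
      ∀ (t : ℕ), 0 < t → ∀ η : ℝ, 0 < η → η ≤ 1 →
      historyLaw alg f t {h | (∀ i, Visits sk s a (h i).2 → ∀ g ∈ 𝓡, ∀ g' ∈ 𝓡,
          |g.logRatio g' (rewardAt sk s (h i).2)| ≤ g.tv g' ^ c * Y (rewardAt sk s (h i).2)) ∧
        ∃ g ∈ 𝓡, η * t < |sumVisits sk h s a (g.logRatio (f.reward s a)) -
          expVisits f h s a * ∫ x, g.logRatio (f.reward s a) x ∂(f.reward s a).law|} ≤
        ENNReal.ofReal (C * (1 / η) ^ p / t) := by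
  obtain ⟨k, hk⟩ := hR.exists_cover_pow ⟨_, hr⟩
  set r := f.reward s a with hrdef
  set B := ∫ x, Y x ^ 2 ∂r.law with hB
  set m := 2 * ∫ x, Y x ∂r.law + 1 with hm
  have hYi : Integrable Y r.law :=
    ((memLp_two_iff_integrable_sq hY.measurable.aestronglyMeasurable).2
      hY.integrable_sq).integrable one_le_two
  have hEY : 0 ≤ ∫ x, Y x ∂r.law := integral_nonneg hY.nonneg
  have hB0 : 0 ≤ B := integral_nonneg fun x => sq_nonneg _
  have hm1 : 1 ≤ m := by rw [hm]; linarith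
  have hm0 : 0 < m := one_pos.trans_le hm1
  -- Since `N c ≥ 1`, a cover of radius `b ^ N` has Hölder factor at most `b`.
  obtain ⟨N, hN⟩ := exists_nat_ge (1 / c)
  have hc := hY.c_pos
  have hN1 : 1 ≤ N * c := by
    rw [div_le_iff₀ hc] at hN; exact hN
  have hN0 : N ≠ 0 := by rintro rfl; norm_num at hN1
  have htvc : ∀ g g' : RewardDensity ν, g.tv g' ^ c ≤ 1 := fun g g' =>
    Real.rpow_le_one (RewardDensity.tv_nonneg _ _) (RewardDensity.tv_le_one _ _) hc.le
  -- log-ratios are dominated by the envelope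
  have hdom : ∀ g ∈ 𝓡, ∀ g' ∈ 𝓡, ∀ᵐ x ∂r.law, |g.logRatio g' x| ≤ g.tv g' ^ c * Y x :=
    fun g hg g' hg' => by
      filter_upwards [hY.ae_le] with x hx using (hx g hg g' hg').2
  have hint : ∀ g ∈ 𝓡, ∀ g' ∈ 𝓡, Integrable (g.logRatio g') r.law := fun g hg g' hg' => by
    refine Integrable.mono' (hYi.const_mul (g.tv g' ^ c))
      (RewardDensity.measurable_logRatio _ _).aestronglyMeasurable ?_
    exact hdom g hg g' hg'
  have hsq : ∀ g ∈ 𝓡, ∀ᵐ x ∂r.law, g.logRatio r x ^ 2 ≤ Y x ^ 2 := fun g hg => by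
    filter_upwards [hdom g hg r hr] with x hx
    refine sq_le_sq' ?_ ?_ <;> have h1 := abs_le.1 hx <;>
      have h2 := mul_le_mul_of_nonneg_right (htvc g r) (hY.nonneg x) <;> linarith
  have hsqi : ∀ g ∈ 𝓡, Integrable (fun x => g.logRatio r x ^ 2) r.law := fun g hg => by
    refine Integrable.mono' hY.integrable_sq
      ((RewardDensity.measurable_logRatio _ _).pow_const 2).aestronglyMeasurable ?_
    filter_upwards [hsq g hg] with x hx
    rwa [Real.norm_of_nonneg (sq_nonneg _)]
  have hsqB : ∀ g ∈ 𝓡, ∫ x, g.logRatio r x ^ 2 ∂r.law ≤ B := fun g hg =>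
    integral_mono_ae (hsqi g hg) hY.integrable_sq (hsq g hg)
  refine ⟨(2 * m) ^ (N * k) * (4 * B) + B, N * k + 2, by positivity,
    fun alg ha t ht η hη hη1 => ?_⟩
  have htr : (0 : ℝ) < t := by exact_mod_cast ht
  -- Replacing a density by its cover point costs at most `b t (E Y + 1)` in the empirical sum and
  -- `b t E Y` in the mean, together `b m t = η t / 2`. The other half of `η t` is left for the
  -- fluctuation at the cover point.
  set b := η / (2 * m) with hb
  have hb0 : 0 < b := by positivity
  have hb1 : b ≤ 1 / 2 := by
    rw [hb, div_le_iff₀ (by positivity)]; linarith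
  have hε : 0 < b ^ N := by positivity
  have hε1 : b ^ N ≤ 1 / 2 :=
    (pow_le_of_le_one hb0.le (by linarith) hN0).trans hb1
  obtain ⟨𝓒, hc1, hc2, hc3⟩ := hk _ hε hε1
  have hεc : ((b : ℝ) ^ N) ^ c ≤ b := by
    rw [← Real.rpow_natCast, ← Real.rpow_mul hb0.le]
    calc b ^ ((N : ℝ) * c) ≤ b ^ (1 : ℝ) :=
          Real.rpow_le_rpow_of_exponent_ge hb0 (by linarith) hN1
      _ = b := Real.rpow_one b
  let D : (ℝ → ℝ) → Set (Hist S A H t) := fun ψ => {h | η * t / 2 <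
    |sumVisits sk h s a ψ - expVisits f h s a * ∫ x, ψ x ∂r.law|}
  -- A crude deviation of order `t` is enough for the envelope, since it enters multiplied by `b`.
  let E : Set (Hist S A H t) := {h | (t : ℝ) <
    |sumVisits sk h s a Y - expVisits f h s a * ∫ x, Y x ∂r.law|}
  have hsub : {h : Hist S A H t | (∀ i, Visits sk s a (h i).2 → ∀ g ∈ 𝓡, ∀ g' ∈ 𝓡,
      |g.logRatio g' (rewardAt sk s (h i).2)| ≤ g.tv g' ^ c * Y (rewardAt sk s (h i).2)) ∧
      ∃ g ∈ 𝓡, η * t < |sumVisits sk h s a (g.logRatio r) -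
        expVisits f h s a * ∫ x, g.logRatio r x ∂r.law|} ⊆ (⋃ g ∈ 𝓒, D (g.logRatio r)) ∪ E := by
    rintro h ⟨h1, g, hg, h2⟩
    by_contra hcon
    simp only [Set.mem_union, Set.mem_iUnion, not_or, not_exists, D, E, Set.mem_ofPred_eq,
      not_lt] at hcon
    obtain ⟨hD, hE⟩ := hcon
    obtain ⟨g', hg', htv⟩ := hc2 g hg
    have hD' := hD g' hg'
    have hgR := hc1 g' hg'
    have htvb : g.tv g' ^ c ≤ b :=
      (Real.rpow_le_rpow (RewardDensity.tv_nonneg _ _) htv hc.le).trans hεc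
    have hlr : ∀ x, g.logRatio r x - g'.logRatio r x = g.logRatio g' x := fun x => by
      simp [RewardDensity.logRatio]
    have e0 := expVisits_nonneg f h s a
    have e1 := expVisits_le f h s a
    have hYs : sumVisits sk h s a Y ≤ t * (∫ x, Y x ∂r.law + 1) := by
      have := (abs_le.1 hE).2
      have := mul_le_mul_of_nonneg_right e1 hEY
      linarith
    have hA : |sumVisits sk h s a (g.logRatio r) - sumVisits sk h s a (g'.logRatio r)| ≤
        b * (t * (∫ x, Y x ∂r.law + 1)) := by
      rw [← sumVisits_sub]
      simp only [hlr]
      refine (sumVisits_mono (ψ' := fun x => b * Y x) fun i hi => ?_).trans ?_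
      · exact (h1 i hi g hg g' hgR).trans (mul_le_mul_of_nonneg_right htvb (hY.nonneg _))
      · rw [sumVisits_const_mul]
        exact mul_le_mul_of_nonneg_left hYs hb0.le
    have hBd : |∫ x, g.logRatio r x ∂r.law - ∫ x, g'.logRatio r x ∂r.law| ≤
        b * ∫ x, Y x ∂r.law := by
      rw [← integral_sub (hint g hg r hr) (hint g' hgR r hr)]
      simp only [hlr]
      refine (abs_integral_le_integral_abs).trans ?_
      rw [← integral_const_mul]
      refine integral_mono_ae (hint g hg g' hgR).abs (hYi.const_mul b) ?_
      filter_upwards [hdom g hg g' hgR] with x hx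
      exact hx.trans (mul_le_mul_of_nonneg_right htvb (hY.nonneg _))
    have hBd' : |expVisits f h s a * (∫ x, g.logRatio r x ∂r.law - ∫ x, g'.logRatio r x ∂r.law)| ≤
        t * (b * ∫ x, Y x ∂r.law) := by
      rw [abs_mul, abs_of_nonneg e0]
      exact mul_le_mul e1 hBd (abs_nonneg _) htr.le
    have hfin : b * (t * (∫ x, Y x ∂r.law + 1)) + t * (b * ∫ x, Y x ∂r.law) = η * t / 2 := by
      have : b * m = η / 2 := by rw [hb]; field_simp
      calc _ = t * (b * m) := by rw [hm]; ring
        _ = _ := by rw [this]; ring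
    have a1 := abs_le.1 hA
    have a2 := abs_le.1 hBd'
    have a3 := abs_le.1 hD'
    refine absurd h2 (not_lt.2 (abs_le.2 ⟨?_, ?_⟩)) <;> nlinarith
  have hDm : ∀ g ∈ 𝓒, historyLaw alg f t (D (g.logRatio r)) ≤
      ENNReal.ofReal (4 * B * (1 / η) ^ 2 / t) := fun g hg => by
    have := measure_sumVisits_le ha f s a (RewardDensity.measurable_logRatio g r)
      (hsqi g (hc1 g hg)) (hsqB g (hc1 g hg)) t (c := η * t / 2) (by positivity)
    refine this.trans (ENNReal.ofReal_le_ofReal (le_of_eq ?_))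
    field_simp
    ring
  have hEm : historyLaw alg f t E ≤ ENNReal.ofReal (B / t) := by
    have := measure_sumVisits_le ha f s a hY.measurable hY.integrable_sq le_rfl t (c := (t : ℝ)) htr
    refine this.trans (ENNReal.ofReal_le_ofReal (le_of_eq ?_))
    rw [← hB]; field_simp
  refine (measure_mono hsub).trans ((measure_union_le _ _).trans ?_)
  refine (add_le_add ((measure_biUnion_finset_le _ _).trans (Finset.sum_le_sum hDm)) hEm).trans ?_
  rw [Finset.sum_const, nsmul_eq_mul, ← ENNReal.ofReal_natCast,
    ← ENNReal.ofReal_mul (by positivity), ← ENNReal.ofReal_add (by positivity) (by positivity)]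
  refine ENNReal.ofReal_le_ofReal ?_
  have hη2 : 1 ≤ (1 / η) := by rw [le_div_iff₀ hη]; linarith
  have e : (1 / b ^ N) ^ k = (2 * m) ^ (N * k) * (1 / η) ^ (N * k) := by
    rw [← one_div_pow, ← pow_mul, ← mul_pow, hb]
    congr 1
    field_simp
  have hone : (1 : ℝ) ≤ (1 / η) ^ (N * k + 2) := one_le_pow₀ hη2
  calc (𝓒.card : ℝ) * (4 * B * (1 / η) ^ 2 / t) + B / t
      ≤ (2 * m) ^ (N * k) * (1 / η) ^ (N * k) * (4 * B * (1 / η) ^ 2 / t) +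
        B * (1 / η) ^ (N * k + 2) / t := by
        rw [← e]
        gcongr
        exact le_mul_of_one_le_right hB0 hone
    _ = _ := by rw [pow_add]; ring

/-- A history is good with high probability, whatever the algorithm. -/
theorem exists_measure_not_goodHist_le (hR : RewardCondition 𝓡) (f : MDP A sk ν)
    (hf : ∀ s a, f.reward s a ∈ 𝓡) :
    ∃ (C : ℝ) (p : ℕ), 0 ≤ C ∧ ∀ (alg : Algorithm S A H), (∀ t, Measurable (alg t)) →
      ∀ (t : ℕ), 0 < t → ∀ η : ℝ, 0 < η → η ≤ 1 →
      historyLaw alg f t {h | ¬ GoodHist 𝓡 f η h} ≤ ENNReal.ofReal (C * (1 / η) ^ p / t) := by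
  choose c Y hY using fun s a => hR.exists_envelope (hf s a)
  choose C p hC hmain using fun s a => measure_rewards_le hR f s a (hf s a) (hY s a)
  -- The sum serves as a common upper bound for all exponents; the powers of `1 / η ≥ 1` can then be
  -- compared.
  set q := ∑ s, ∑ a, p s a with hq
  have hpq : ∀ s a, p s a ≤ q := fun s a =>
    (Finset.single_le_sum (f := fun a => p s a) (fun _ _ => Nat.zero_le _)
      (Finset.mem_univ a)).trans (Finset.single_le_sum (f := fun s => ∑ a, p s a)
      (fun _ _ => Nat.zero_le _) (Finset.mem_univ s))
  refine ⟨∑ s, ∑ a, (C s a + Fintype.card S), q + 2,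
    Finset.sum_nonneg fun s _ => Finset.sum_nonneg fun a _ =>
      add_nonneg (hC s a) (Nat.cast_nonneg _), fun alg ha t ht η hη hη1 => ?_⟩
  have htr : (0 : ℝ) < t := by exact_mod_cast ht
  have hη2 : 1 ≤ (1 / η) := by rw [le_div_iff₀ hη]; linarith
  let P : S → A → ℝ → Prop := fun s a x => ∀ g ∈ 𝓡, ∀ g' ∈ 𝓡, 0 < g.dens x ∧
    |g.logRatio g' x| ≤ g.tv g' ^ c s a * Y s a x
  have hae1 := ae_historyLaw_forall ha f (fun π => ae_trajDensity_ne_zero f π) t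
  have hae2 := ae_historyLaw_forall ha f
    (fun π => ae_of_ae_rewards (f := f) (p := P) π fun s a => (hY s a).ae_le) t
  let E1 : S → A → Set (Hist S A H t) := fun s a => {h | (∀ i, Visits sk s a (h i).2 →
    ∀ g ∈ 𝓡, ∀ g' ∈ 𝓡, |g.logRatio g' (rewardAt sk s (h i).2)| ≤
      g.tv g' ^ c s a * Y s a (rewardAt sk s (h i).2)) ∧
    ∃ g ∈ 𝓡, η * t < |sumVisits sk h s a (g.logRatio (f.reward s a)) -
      expVisits f h s a * ∫ x, g.logRatio (f.reward s a) x ∂(f.reward s a).law|}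
  let E2 : S → A → S → Set (Hist S A H t) := fun s a s' =>
    if (sk.layer s : ℕ) + 1 < H then {h | η * t <
      |numMoves sk h s a s' - expVisits f h s a * (f.trans s a s').toReal|} else ∅
  have hE1 : ∀ s a, historyLaw alg f t (E1 s a) ≤
      ENNReal.ofReal (C s a * (1 / η) ^ (q + 2) / t) := fun s a => by
    refine (hmain s a alg ha t ht η hη hη1).trans (ENNReal.ofReal_le_ofReal ?_)
    have := pow_le_pow_right₀ hη2 ((hpq s a).trans (Nat.le_add_right q 2))
    have := hC s a
    gcongr
  have hE2 : ∀ s a s', historyLaw alg f t (E2 s a s') ≤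
      ENNReal.ofReal (1 * (1 / η) ^ (q + 2) / t) := fun s a s' => by
    simp only [E2]
    split_ifs with hh
    · refine (measure_numMoves_le ha f s a s' hh t (by positivity)).trans
        (ENNReal.ofReal_le_ofReal ?_)
      have h1 : (t : ℝ) * 1 / (η * t) ^ 2 = 1 * (1 / η) ^ 2 / t := by field_simp
      rw [h1]
      have := pow_le_pow_right₀ hη2 (Nat.le_add_left 2 q)
      gcongr
    · simp
  have hsub : {h : Hist S A H t | ¬ GoodHist 𝓡 f η h} ≤ᵐ[historyLaw alg f t]
      (⋃ s, ⋃ a, (E1 s a ∪ ⋃ s', E2 s a s') : Set (Hist S A H t)) := by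
    filter_upwards [hae1, hae2] with h h1 h2 hbad
    by_contra hcon
    have hcon' : ∀ s a, h ∉ E1 s a ∧ ∀ s', h ∉ E2 s a s' := fun s a => by
      refine ⟨fun hh => hcon ?_, fun s' hh => hcon ?_⟩
      · exact Set.mem_iUnion.2 ⟨s, Set.mem_iUnion.2 ⟨a, Or.inl hh⟩⟩
      · exact Set.mem_iUnion.2 ⟨s, Set.mem_iUnion.2 ⟨a, Or.inr (Set.mem_iUnion.2 ⟨s', hh⟩)⟩⟩
    have hP : ∀ i s a, Visits sk s a (h i).2 → P s a (rewardAt sk s (h i).2) := by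
      rintro i s a ⟨hv1, hv2⟩
      have := h2 i (sk.layer s)
      rw [hv1, hv2] at this
      exact this
    refine hbad ⟨h1, fun i s a hv g hg => (hP i s a hv g hg g hg).1, fun s a s' hh => ?_,
      fun s a g hg => ?_⟩
    · by_contra hlt
      refine (hcon' s a).2 s' ?_
      simp only [E2, if_pos hh]
      exact not_le.1 hlt
    · by_contra hlt
      exact (hcon' s a).1 ⟨fun i hv g hg g' hg' => (hP i s a hv g hg g' hg').2, g, hg,
        not_le.1 hlt⟩
  refine (measure_mono_ae hsub).trans ?_
  calc _ ≤ ∑ s, ∑ a, (historyLaw alg f t (E1 s a) + ∑ s', historyLaw alg f t (E2 s a s')) := by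
        refine (measure_iUnion_fintype_le _ _).trans (Finset.sum_le_sum fun s _ => ?_)
        refine (measure_iUnion_fintype_le _ _).trans (Finset.sum_le_sum fun a _ => ?_)
        refine (measure_union_le _ _).trans (add_le_add le_rfl ?_)
        exact measure_iUnion_fintype_le _ _
    _ ≤ ∑ s, ∑ a, ENNReal.ofReal ((C s a + Fintype.card S) * (1 / η) ^ (q + 2) / t) := by
        refine Finset.sum_le_sum fun s _ => Finset.sum_le_sum fun a _ => ?_
        refine (add_le_add (hE1 s a) (Finset.sum_le_sum fun s' _ => hE2 s a s')).trans ?_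
        have := hC s a
        rw [Finset.sum_const, nsmul_eq_mul, ← ENNReal.ofReal_natCast,
          ← ENNReal.ofReal_mul (by positivity), ← ENNReal.ofReal_add (by positivity)
          (by positivity), Finset.card_univ]
        refine ENNReal.ofReal_le_ofReal (le_of_eq ?_)
        ring
    _ = _ := by
        have h0 : ∀ s a, 0 ≤ (C s a + Fintype.card S) * (1 / η) ^ (q + 2) / t := fun s a => by
          have := hC s a
          positivity
        simp only [← ENNReal.ofReal_sum_of_nonneg fun a _ => h0 _ a]
        rw [← ENNReal.ofReal_sum_of_nonneg fun s _ => Finset.sum_nonneg fun a _ => h0 s a]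
        simp only [Finset.sum_mul, Finset.sum_div]

end Model

/-! ### Auxiliary facts on products and on the Gibbs inequality -/

/-- If each factor is at most its optimum and the product still reaches the product of the optima,
no factor can fall short. In this way a maximum of the total likelihood becomes a maximum of every
factor. -/
theorem ENNReal_le_of_mul_le_mul {a b a' b' : ℝ≥0∞} (ha : a' ≤ a) (hb : b' ≤ b)
    (h : a * b ≤ a' * b') (hne : a * b ≠ 0) (hat : a ≠ ⊤) (hbt : b ≠ ⊤) : a ≤ a' ∧ b ≤ b' := by
  have ha0 := left_ne_zero_of_mul hne
  have hb0 := right_ne_zero_of_mul hne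
  constructor
  · have h1 : a * b ≤ a' * b := h.trans (mul_le_mul_right hb a')
    exact (ENNReal.mul_le_mul_iff_left hb0 hbt).1 h1
  · have h1 : a * b ≤ a * b' := h.trans (mul_le_mul_left ha b')
    exact (ENNReal.mul_le_mul_iff_right ha0 hat).1 h1

theorem ENNReal_le_of_prod_le_prod {ι : Type*} [Fintype ι] [DecidableEq ι] {a a' : ι → ℝ≥0∞}
    (ha : ∀ i, a' i ≤ a i) (h : ∏ i, a i ≤ ∏ i, a' i) (hne : ∏ i, a i ≠ 0) (hat : ∀ i, a i ≠ ⊤)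
    (i : ι) : a i ≤ a' i := by
  rw [← Finset.mul_prod_erase _ _ (Finset.mem_univ i)] at h hne
  rw [← Finset.mul_prod_erase _ _ (Finset.mem_univ i)] at h
  exact (ENNReal_le_of_mul_le_mul (ha i) (Finset.prod_le_prod' fun j _ => ha j) h hne (hat i)
    (ENNReal.prod_ne_top fun j _ => hat j)).1

/-- The frequencies are the only maximum likelihood estimate of a discrete distribution. -/
theorem eq_of_prod_pow_le {ι : Type*} [Fintype ι] (n : ι → ℕ) {N : ℝ} (hN0 : 0 < N)
    (hN : ∑ i, (n i : ℝ) = N) {p : ι → ℝ} (hp : ∀ i, 0 ≤ p i) (hp1 : ∑ i, p i ≤ 1)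
    (h : ∏ i, ((n i : ℝ) / N) ^ n i ≤ ∏ i, p i ^ n i) (i : ι) : p i = n i / N := by
  have hpos : ∀ i, 0 < ((n i : ℝ) / N) ^ n i := fun i => by
    rcases Nat.eq_zero_or_pos (n i) with h0 | h0
    · simp [h0]
    · have : (0 : ℝ) < n i := by exact_mod_cast h0
      positivity
  have hp0 : ∀ i, n i ≠ 0 → 0 < p i := fun i hi => by
    refine lt_of_le_of_ne (hp i) fun h0 => ?_
    have : ∏ i, p i ^ n i = 0 := Finset.prod_eq_zero (Finset.mem_univ i) (by
      rw [← h0, zero_pow hi])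
    rw [this] at h
    exact absurd h (not_le.2 (Finset.prod_pos fun i _ => hpos i))
  have hpp : ∀ i, 0 < p i ^ n i := fun i => by
    by_cases hi : n i = 0
    · simp [hi]
    · exact pow_pos (hp0 i hi) _
  have hlog : ∑ i, (n i : ℝ) * Real.log ((n i : ℝ) / N) ≤ ∑ i, (n i : ℝ) * Real.log (p i) := by
    have := Real.log_le_log (Finset.prod_pos fun i _ => hpos i) h
    rw [Real.log_prod fun i _ => (hpos i).ne', Real.log_prod fun i _ => (hpp i).ne'] at this
    simpa only [Real.log_pow] using this
  -- every summand is at most `N pᵢ - nᵢ`, with equality only for `pᵢ = nᵢ / N`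
  have hle : ∀ i, (n i : ℝ) * Real.log (p i) - n i * Real.log ((n i : ℝ) / N) ≤ N * p i - n i :=
    fun i => by
      by_cases hi : n i = 0
      · simp [hi]; exact mul_nonneg hN0.le (hp i)
      · have hn : (0 : ℝ) < n i := by exact_mod_cast Nat.pos_of_ne_zero hi
        have h1 := Real.log_le_sub_one_of_pos (div_pos (hp0 i hi) (div_pos hn hN0))
        rw [Real.log_div (hp0 i hi).ne' (div_pos hn hN0).ne'] at h1
        calc _ = n i * (Real.log (p i) - Real.log ((n i : ℝ) / N)) := by ring
          _ ≤ n i * (p i / (n i / N) - 1) := by gcongr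
          _ = _ := by field_simp
  have hlt : ∀ i, p i ≠ n i / N →
      (n i : ℝ) * Real.log (p i) - n i * Real.log ((n i : ℝ) / N) < N * p i - n i := fun i hne => by
    by_cases hi : n i = 0
    · simp only [hi, Nat.cast_zero, zero_mul, sub_zero, zero_div] at hne ⊢
      exact mul_pos hN0 (lt_of_le_of_ne (hp i) (Ne.symm hne))
    · have hn : (0 : ℝ) < n i := by exact_mod_cast Nat.pos_of_ne_zero hi
      have hne1 : p i / (n i / N) ≠ 1 := fun h1 => hne ((div_eq_one_iff_eq (by positivity)).1 h1)
      have h1 := Real.log_lt_sub_one_of_pos (div_pos (hp0 i hi) (div_pos hn hN0)) hne1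
      rw [Real.log_div (hp0 i hi).ne' (div_pos hn hN0).ne'] at h1
      calc _ = n i * (Real.log (p i) - Real.log ((n i : ℝ) / N)) := by ring
        _ < n i * (p i / (n i / N) - 1) := by gcongr
        _ = _ := by field_simp
  by_contra hne
  have hsum := Finset.sum_lt_sum (fun i _ => hle i) ⟨i, Finset.mem_univ i, hlt i hne⟩
  rw [Finset.sum_sub_distrib, Finset.sum_sub_distrib, ← Finset.mul_sum, hN] at hsum
  nlinarith

section Model

variable {S A : Type*} [Fintype S] [DecidableEq S] [MeasurableSpace S] [MeasurableSingletonClass S]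
  [Fintype A] [DecidableEq A] [MeasurableSpace A] [MeasurableSingletonClass A]
  {H : ℕ} [NeZero H] {sk : Skeleton S H} {ν : Measure ℝ}

/-! ### Maximum likelihood estimation -/

/-- The likelihood of the rewards collected at `(s, a)`. -/
def rewardLik (sk : Skeleton S H) {t : ℕ} (h : Hist S A H t) (s : S) (a : A) (g : RewardDensity ν) :
    ℝ≥0∞ :=
  ∏ i, if Visits sk s a (h i).2 then (g.dens (rewardAt sk s (h i).2) : ℝ≥0∞) else 1

/-- The number of moves from `s` to `s'` by the action `a`. -/
def cntMoves (sk : Skeleton S H) {t : ℕ} (h : Hist S A H t) (s : S) (a : A) (s' : S) : ℕ :=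
  (Finset.univ.filter fun i => Moves sk s a s' (h i).2).card

/-- The likelihood of the transitions at `(s, a)`. -/
def transLik (sk : Skeleton S H) {t : ℕ} (h : Hist S A H t) (s : S) (a : A) (p : PMF S) : ℝ≥0∞ :=
  ∏ s', p s' ^ cntMoves sk h s a s'

theorem numMoves_eq_cntMoves {t : ℕ} (h : Hist S A H t) (s : S) (a : A) (s' : S) :
    numMoves sk h s a s' = cntMoves sk h s a s' := by
  simp [numMoves, cntMoves]

theorem likelihood_eq {f g : MDP A sk ν} {t : ℕ} {h : Hist S A H t}
    (hd : ∀ i, trajDensity f (h i).1 (h i).2 ≠ 0) :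
    likelihood g h =
      ∏ z : S × A, rewardLik sk h z.1 z.2 (g.reward z.1 z.2) *
        transLik sk h z.1 z.2 (g.trans z.1 z.2) := by
  unfold likelihood
  simp only [trajDensity_eq_prod (g := g) (hd _)]
  rw [Finset.prod_mul_distrib, Finset.prod_mul_distrib]
  congr 1
  · rw [Finset.prod_comm, Fintype.prod_prod_type]
    refine Finset.prod_congr rfl fun s _ => ?_
    rw [Finset.prod_comm]
    rfl
  · rw [Finset.prod_comm, Fintype.prod_prod_type]
    refine Finset.prod_congr rfl fun s _ => ?_
    rw [Finset.prod_comm]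
    refine Finset.prod_congr rfl fun a _ => ?_
    rw [Finset.prod_comm]
    refine Finset.prod_congr rfl fun s' _ => ?_
    rw [Finset.prod_ite]
    simp [cntMoves]

theorem rewardLik_ne_top {t : ℕ} (h : Hist S A H t) (s : S) (a : A) (g : RewardDensity ν) :
    rewardLik sk h s a g ≠ ⊤ :=
  ENNReal.prod_ne_top fun i _ => by split_ifs <;> simp

theorem transLik_ne_top {t : ℕ} (h : Hist S A H t) (s : S) (a : A) (p : PMF S) :
    transLik sk h s a p ≠ ⊤ :=
  ENNReal.prod_ne_top fun _ _ => ENNReal.pow_ne_top (PMF.apply_ne_top _ _)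

theorem trans_ne_zero_of_moves {f : MDP A sk ν} {π : Policy S A} {o : Traj S A H}
    (ho : trajDensity f π o ≠ 0) {s : S} {a : A} {s' : S} (hm : Moves sk s a s' o) :
    f.trans s a s' ≠ 0 := by
  obtain ⟨⟨h1, h2⟩, hh, h3⟩ := hm
  have := (trajDensity_ne_zero_iff.1 ho).2.2.2 (sk.layer s) hh
  rwa [h1, h2, h3] at this

/-- There are finitely many transition probabilities, so the nonzero ones are bounded below. This
bound turns additive errors of counts into relative ones. -/
theorem exists_min_trans (f : MDP A sk ν) :
    ∃ q : ℝ, 0 < q ∧ q ≤ 1 ∧ ∀ s a s', f.trans s a s' ≠ 0 → q ≤ (f.trans s a s').toReal := by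
  rcases isEmpty_or_nonempty A with hA | hA
  · exact ⟨1, one_pos, le_rfl, fun s a => (IsEmpty.false a).elim⟩
  let F : S × A × S → ℝ := fun z => if f.trans z.1 z.2.1 z.2.2 = 0 then 1 else
    (f.trans z.1 z.2.1 z.2.2).toReal
  have hne : Nonempty (S × A × S) := ⟨(sk.init, Classical.arbitrary A, sk.init)⟩
  obtain ⟨z, hz⟩ := Finite.exists_min F
  have hpos : ∀ z, 0 < F z := fun z => by
    simp only [F]
    split_ifs with h
    · exact one_pos
    · exact ENNReal.toReal_pos h (PMF.apply_ne_top _ _)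
  refine ⟨min (F z) 1, lt_min (hpos z) one_pos, min_le_right _ _, fun s a s' h => ?_⟩
  refine (min_le_left _ _).trans ((hz (s, a, s')).trans (le_of_eq ?_))
  simp [F, h]

theorem PMF.sum_toReal {X : Type*} [Fintype X] (p : PMF X) : ∑ x, (p x).toReal = 1 := by
  rw [← ENNReal.toReal_sum fun x _ => PMF.apply_ne_top p x, ← tsum_fintype (L := .unconditional X),
    PMF.tsum_coe]
  simp

/-- The instance `g` is close to `f`. -/
structure IsClose (f g : MDP A sk ν) (δ ε : ℝ) : Prop where
  tv_le : ∀ s a, (g.reward s a).tv (f.reward s a) ≤ δ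
  trans_le : TransLE (ENNReal.ofReal (1 - ε)) f g
  trans_ge : TransLE (ENNReal.ofReal (1 - ε)) g f

variable [SigmaFinite ν] [Nonempty A] {𝓡 : Set (RewardDensity ν)}

/-- The empirical frequencies respect the layers because every counted move was possible under `f`.
In the last layer, where nothing is observed, the transitions of `f` are kept. -/
theorem exists_empirical {f : MDP A sk ν} {t : ℕ} {h : Hist S A H t}
    (hd : ∀ i, trajDensity f (h i).1 (h i).2 ≠ 0)
    (hN : ∀ s a, (sk.layer s : ℕ) + 1 < H → 0 < ∑ s', cntMoves sk h s a s')
    (r : S → A → RewardDensity ν) :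
    ∃ g : MDP A sk ν, g.reward = r ∧ ∀ s a, (sk.layer s : ℕ) + 1 < H → ∀ s',
      (g.trans s a s').toReal = (cntMoves sk h s a s' : ℝ) / ∑ s', (cntMoves sk h s a s' : ℝ) := by
  classical
  have hsum : ∀ s a, (sk.layer s : ℕ) + 1 < H →
      ∑ s', (cntMoves sk h s a s' : ℝ≥0∞) / (∑ s', cntMoves sk h s a s' : ℕ) = 1 := fun s a hh => by
    simp only [div_eq_mul_inv]
    rw [← Finset.sum_mul, ← Nat.cast_sum]
    exact ENNReal.mul_inv_cancel (by exact_mod_cast (hN s a hh).ne') (ENNReal.natCast_ne_top _)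
  refine ⟨⟨fun s a => if hh : (sk.layer s : ℕ) + 1 < H then
    PMF.ofFintype _ (hsum s a hh) else f.trans s a, r, fun s a s' hh hne => ?_⟩, rfl,
    fun s a hh s' => ?_⟩
  · rw [dif_pos hh, PMF.ofFintype_apply] at hne
    have h1 : cntMoves sk h s a s' ≠ 0 := fun h0 => hne (by simp [h0])
    obtain ⟨i, hi⟩ := Finset.card_pos.1 (Nat.pos_of_ne_zero h1)
    exact f.layered s a s' hh (trans_ne_zero_of_moves (hd i) (Finset.mem_filter.1 hi).2)
  · simp only [dif_pos hh, PMF.ofFintype_apply]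
    rw [ENNReal.toReal_div, ENNReal.toReal_natCast, ENNReal.toReal_natCast, Nat.cast_sum]

theorem toReal_transLik {t : ℕ} (h : Hist S A H t) (s : S) (a : A) (p : PMF S) :
    (transLik sk h s a p).toReal = ∏ s', (p s').toReal ^ cntMoves sk h s a s' := by
  simp [transLik, ENNReal.toReal_prod]

theorem eq_of_transLik_le {t : ℕ} {h : Hist S A H t} {s : S} {a : A} {p q : PMF S}
    (hN : 0 < ∑ s', cntMoves sk h s a s')
    (hq : ∀ s', (q s').toReal = (cntMoves sk h s a s' : ℝ) / ∑ s', (cntMoves sk h s a s' : ℝ))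
    (hle : transLik sk h s a q ≤ transLik sk h s a p) : p = q := by
  have h1 := ENNReal.toReal_mono (transLik_ne_top h s a p) hle
  rw [toReal_transLik, toReal_transLik] at h1
  simp only [hq] at h1
  ext s'
  have h2 := eq_of_prod_pow_le (cntMoves sk h s a) (by exact_mod_cast hN) rfl
    (p := fun s' => (p s').toReal) (fun _ => ENNReal.toReal_nonneg) (PMF.sum_toReal p).le h1 s'
  rw [← hq] at h2
  exact (ENNReal.toReal_eq_toReal_iff' (PMF.apply_ne_top _ _) (PMF.apply_ne_top _ _)).1 h2

theorem transLik_le {t : ℕ} {h : Hist S A H t} {s : S} {a : A} {q : PMF S}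
    (hN : 0 < ∑ s', cntMoves sk h s a s')
    (hq : ∀ s', (q s').toReal = (cntMoves sk h s a s' : ℝ) / ∑ s', (cntMoves sk h s a s' : ℝ))
    (p : PMF S) : transLik sk h s a p ≤ transLik sk h s a q := by
  by_contra hcon
  have := eq_of_transLik_le hN hq (not_le.1 hcon).le
  rw [this] at hcon
  exact hcon le_rfl

theorem cntMoves_eq_zero {t : ℕ} {h : Hist S A H t} {s : S} (hh : ¬ (sk.layer s : ℕ) + 1 < H)
    (a : A) (s' : S) : cntMoves sk h s a s' = 0 := by
  simp [cntMoves, Moves, hh]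

theorem log_rewardLik {t : ℕ} {h : Hist S A H t} {s : S} {a : A} {g : RewardDensity ν}
    (hp : ∀ i, Visits sk s a (h i).2 → 0 < g.dens (rewardAt sk s (h i).2)) :
    0 < (rewardLik sk h s a g).toReal ∧ Real.log (rewardLik sk h s a g).toReal =
      sumVisits sk h s a fun x => Real.log (g.dens x) := by
  have h1 : ∀ i, (if Visits sk s a (h i).2 then
      (g.dens (rewardAt sk s (h i).2) : ℝ≥0∞) else 1).toReal =
      if Visits sk s a (h i).2 then (g.dens (rewardAt sk s (h i).2) : ℝ) else 1 := fun i => by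
    split_ifs <;> simp
  have h2 : ∀ i, 0 < if Visits sk s a (h i).2 then (g.dens (rewardAt sk s (h i).2) : ℝ) else 1 :=
    fun i => by
      split_ifs with hv
      · exact_mod_cast hp i hv
      · exact one_pos
  simp only [rewardLik, ENNReal.toReal_prod, h1]
  refine ⟨Finset.prod_pos fun i _ => h2 i, ?_⟩
  rw [Real.log_prod fun i _ => (h2 i).ne', sumVisits]
  refine Finset.sum_congr rfl fun i _ => ?_
  split_ifs <;> simp

/-- Reward densities that are at least as likely as the true one are close to it. -/
theorem tv_sq_le_of_rewardLik_le (hR : RewardCondition 𝓡) {f : MDP A sk ν} {η : ℝ} {t : ℕ}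
    {h : Hist S A H t} (hg : GoodHist 𝓡 f η h) {s : S} {a : A} (hf : f.reward s a ∈ 𝓡)
    {g : RewardDensity ν} (hgR : g ∈ 𝓡)
    (hle : rewardLik sk h s a (f.reward s a) ≤ rewardLik sk h s a g) :
    expVisits f h s a * g.tv (f.reward s a) ^ 2 ≤ η * t := by
  obtain ⟨B, -, hB⟩ := hR.exists_moment
  obtain ⟨p1, l1⟩ := log_rewardLik (g := f.reward s a) fun i hv => hg.pos i s a hv _ hf
  obtain ⟨p2, l2⟩ := log_rewardLik (g := g) fun i hv => hg.pos i s a hv _ hgR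
  have h1 := Real.log_le_log p1 (ENNReal.toReal_mono (rewardLik_ne_top _ _ _ _) hle)
  rw [l1, l2] at h1
  have h2 : 0 ≤ sumVisits sk h s a (g.logRatio (f.reward s a)) := by
    have := sumVisits_sub (sk := sk) h s a (fun x => Real.log (g.dens x))
      (fun x => Real.log ((f.reward s a).dens x))
    have e : g.logRatio (f.reward s a) =
      fun x => Real.log (g.dens x) - Real.log ((f.reward s a).dens x) := rfl
    rw [e, this]
    linarith
  obtain ⟨b1, b2, -⟩ := hB _ hf _ hgR
  have hflip : ∀ x, g.logRatio (f.reward s a) x = -((f.reward s a).logRatio g x) := fun x => by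
    simp [RewardDensity.logRatio]
  have hi : Integrable (g.logRatio (f.reward s a)) (f.reward s a).law := by
    have : Integrable ((f.reward s a).logRatio g) (f.reward s a).law :=
      ((memLp_two_iff_integrable_sq
        (RewardDensity.measurable_logRatio _ _).aestronglyMeasurable).2 b2).integrable one_le_two
    refine (this.neg).congr (ae_of_all _ fun x => ?_)
    simp [hflip]
  have h3 := RewardDensity.integral_logRatio_le (b1.mono fun x hx => hx.2) hi
  have h4 := (abs_le.1 (hg.rewards s a g hgR)).2
  have h5 := mul_le_mul_of_nonneg_left h3 (expVisits_nonneg f h s a)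
  linarith

/-- Divide a count with relative error `u` by a total with relative error `v`. What is used is `(1 -
(u + v)) (1 + v) ≤ 1 - u`, and the same with `u` and `v` exchanged. -/
theorem ratio_close {e n N p u v : ℝ} (he : 0 < e) (hp : 0 ≤ p) (hu : 0 ≤ u) (hv : 0 ≤ v)
    (huv : u + v < 1) (c1 : |n - e * p| ≤ e * (u * p)) (c2 : |N - e| ≤ e * v) :
    0 < N ∧ (1 - (u + v)) * p ≤ n / N ∧ (1 - (u + v)) * (n / N) ≤ p := by
  have d1 := abs_le.1 c1
  have d2 := abs_le.1 c2
  have ev : e * v < e * 1 := mul_lt_mul_of_pos_left (by linarith) he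
  have hN : 0 < N := by linarith [d2.1]
  have ep : 0 ≤ e * p := mul_nonneg he.le hp
  have huv0 : 0 ≤ u * v := mul_nonneg hu hv
  have hu2 := mul_nonneg hu hu
  have hv2 := mul_nonneg hv hv
  refine ⟨hN, ?_, ?_⟩
  · rw [le_div_iff₀ hN]
    calc (1 - (u + v)) * p * N ≤ (1 - (u + v)) * p * (e * (1 + v)) := by
          refine mul_le_mul_of_nonneg_left (by linarith [d2.2]) ?_
          exact mul_nonneg (by linarith) hp
      _ = e * p * ((1 - (u + v)) * (1 + v)) := by ring
      _ ≤ e * p * (1 - u) := by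
          refine mul_le_mul_of_nonneg_left ?_ ep
          linarith [show (1 - (u + v)) * (1 + v) = 1 - u - u * v - v * v by ring]
      _ ≤ n := by linarith [d1.1]
  · rw [mul_div_assoc', div_le_iff₀ hN]
    calc (1 - (u + v)) * n ≤ (1 - (u + v)) * (e * p * (1 + u)) := by
          refine mul_le_mul_of_nonneg_left (by linarith [d1.2]) (by linarith)
      _ = e * p * ((1 - (u + v)) * (1 + u)) := by ring
      _ ≤ e * p * (1 - v) := by
          refine mul_le_mul_of_nonneg_left ?_ ep
          linarith [show (1 - (u + v)) * (1 + u) = 1 - v - u * v - u * u by ring]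
      _ = p * (e * (1 - v)) := by ring
      _ ≤ p * N := mul_le_mul_of_nonneg_left (by linarith [d2.1]) hp

/-- At least `κ t` expected visits make an error `η t` relative to the number of visits, and the
lower bound `q` makes it relative to the transition probability. Impossible moves need no such
bound: their count is exactly zero. -/
theorem GoodHist.abs_cntMoves_sub_le {f : MDP A sk ν} {η κ q : ℝ} {t : ℕ} {h : Hist S A H t}
    (hg : GoodHist 𝓡 f η h) (hκ : 0 < κ) (hη : 0 ≤ η) (hq0 : 0 < q)
    (hq : ∀ s a s', f.trans s a s' ≠ 0 → q ≤ (f.trans s a s').toReal)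
    {s : S} {a : A} (he : κ * t ≤ expVisits f h s a) (hh : (sk.layer s : ℕ) + 1 < H) :
    (∀ s', |(cntMoves sk h s a s' : ℝ) - expVisits f h s a * (f.trans s a s').toReal| ≤
      expVisits f h s a * (η / (κ * q) * (f.trans s a s').toReal)) ∧
    |∑ s', (cntMoves sk h s a s' : ℝ) - expVisits f h s a| ≤
      expVisits f h s a * (Fintype.card S * η / κ) := by
  have hcnt : ∀ s',
      |(cntMoves sk h s a s' : ℝ) - expVisits f h s a * (f.trans s a s').toReal| ≤ η * t :=
    fun s' => by rw [← numMoves_eq_cntMoves]; exact hg.moves s a s' hh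
  have hηe : η * t ≤ expVisits f h s a * (η / κ) := by
    calc η * t = (κ * t) * (η / κ) := by field_simp
      _ ≤ _ := mul_le_mul_of_nonneg_right he (by positivity)
  constructor
  · intro s'
    by_cases h0 : f.trans s a s' = 0
    · have hn0 : cntMoves sk h s a s' = 0 := by
        rw [cntMoves, Finset.card_eq_zero, Finset.filter_eq_empty_iff]
        intro i _ hm
        exact trans_ne_zero_of_moves (hg.dens i) hm h0
      simp [h0, hn0]
    · refine (hcnt s').trans (hηe.trans (mul_le_mul_of_nonneg_left ?_ (expVisits_nonneg f h s a)))
      calc η / κ = η / (κ * q) * q := by field_simp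
        _ ≤ _ := mul_le_mul_of_nonneg_left (hq s a s' h0) (by positivity)
  · have e1 : ∑ s', (cntMoves sk h s a s' : ℝ) - expVisits f h s a = ∑ s',
        ((cntMoves sk h s a s' : ℝ) - expVisits f h s a * (f.trans s a s').toReal) := by
      rw [Finset.sum_sub_distrib, ← Finset.mul_sum, PMF.sum_toReal, mul_one]
    rw [e1]
    refine (Finset.abs_sum_le_sum_abs _ _).trans ((Finset.sum_le_sum fun s' _ =>
      hcnt s').trans ?_)
    rw [Finset.sum_const, Finset.card_univ, nsmul_eq_mul]
    calc (Fintype.card S : ℝ) * (η * t) ≤ Fintype.card S * (expVisits f h s a * (η / κ)) :=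
          mul_le_mul_of_nonneg_left hηe (Nat.cast_nonneg _)
      _ = _ := by ring

/-- The unconstrained maximum of the likelihood, and how its factors compare. -/
theorem exists_likelihood_max {f : MDP A sk ν} (hf : ∀ s a, f.reward s a ∈ 𝓡) {t : ℕ}
    {h : Hist S A H t} (hd : ∀ i, trajDensity f (h i).1 (h i).2 ≠ 0)
    (hN : ∀ s a, (sk.layer s : ℕ) + 1 < H → 0 < ∑ s', cntMoves sk h s a s')
    (hml : ∀ s a, ∃ g ∈ 𝓡, ∀ g' ∈ 𝓡, rewardLik sk h s a g' ≤ rewardLik sk h s a g) :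
    ∃ f' : MDP A sk ν, (∀ s a, f'.reward s a ∈ 𝓡) ∧
      (∀ g : MDP A sk ν, (∀ s a, g.reward s a ∈ 𝓡) → likelihood g h ≤ likelihood f' h) ∧
      ∀ g : MDP A sk ν, (∀ s a, g.reward s a ∈ 𝓡) → likelihood f' h ≤ likelihood g h →
        (∀ s a, rewardLik sk h s a (f.reward s a) ≤ rewardLik sk h s a (g.reward s a)) ∧
        ∀ s a, (sk.layer s : ℕ) + 1 < H → ∀ s', (g.trans s a s').toReal =
          (cntMoves sk h s a s' : ℝ) / ∑ s', (cntMoves sk h s a s' : ℝ) := by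
  choose r hrR hr using hml
  obtain ⟨f', hf'r, hf't⟩ := exists_empirical hd hN r
  have hR' : ∀ g : MDP A sk ν, (∀ s a, g.reward s a ∈ 𝓡) → ∀ s a,
      rewardLik sk h s a (g.reward s a) ≤ rewardLik sk h s a (f'.reward s a) := fun g hg s a => by
    rw [hf'r]; exact hr s a _ (hg s a)
  have hT' : ∀ (g : MDP A sk ν) s a,
      transLik sk h s a (g.trans s a) ≤ transLik sk h s a (f'.trans s a) := fun g s a => by
    by_cases hh : (sk.layer s : ℕ) + 1 < H
    · exact transLik_le (hN s a hh) (hf't s a hh) _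
    · simp [transLik, cntMoves_eq_zero hh]
  have hmax : ∀ g : MDP A sk ν, (∀ s a, g.reward s a ∈ 𝓡) → likelihood g h ≤ likelihood f' h :=
    fun g hg => by
      rw [likelihood_eq hd, likelihood_eq hd]
      exact Finset.prod_le_prod' fun z _ => mul_le_mul' (hR' g hg _ _) (hT' g _ _)
  have hpos : likelihood f' h ≠ 0 := fun h0 => by
    have h1 : likelihood f h ≠ 0 := Finset.prod_ne_zero_iff.2 fun i _ => hd i
    exact h1 (le_antisymm ((hmax f hf).trans h0.le) zero_le)
  refine ⟨f', fun s a => by rw [hf'r]; exact hrR s a, hmax, fun g hgR hle => ?_⟩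
  rw [likelihood_eq hd] at hpos
  rw [likelihood_eq hd, likelihood_eq hd] at hle
  -- The factors of `f'` dominate those of `g` pair by pair, while the product for `g` is not
  -- smaller; hence every factor of `g` is maximal.
  have hfac : ∀ z : S × A, rewardLik sk h z.1 z.2 (f'.reward z.1 z.2) *
      transLik sk h z.1 z.2 (f'.trans z.1 z.2) ≤ rewardLik sk h z.1 z.2 (g.reward z.1 z.2) *
      transLik sk h z.1 z.2 (g.trans z.1 z.2) := by
    refine ENNReal_le_of_prod_le_prod (fun z => ?_) hle hpos fun z => ?_
    · exact mul_le_mul' (hR' g hgR z.1 z.2) (hT' g z.1 z.2)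
    · exact ENNReal.mul_ne_top (rewardLik_ne_top _ _ _ _) (transLik_ne_top _ _ _ _)
  have hfac2 : ∀ s a, rewardLik sk h s a (f'.reward s a) ≤ rewardLik sk h s a (g.reward s a) ∧
      transLik sk h s a (f'.trans s a) ≤ transLik sk h s a (g.trans s a) := fun s a =>
    ENNReal_le_of_mul_le_mul (hR' g hgR s a) (hT' g s a) (hfac (s, a))
      (Finset.prod_ne_zero_iff.1 hpos (s, a) (Finset.mem_univ _))
      (rewardLik_ne_top _ _ _ _) (transLik_ne_top _ _ _ _)
  refine ⟨fun s a => (hR' f hf s a).trans (hfac2 s a).1, fun s a hh s' => ?_⟩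
  rw [eq_of_transLik_le (hN s a hh) (hf't s a hh) (hfac2 s a).2]
  exact hf't s a hh s'

/-- On good histories, every maximum likelihood estimate is close to the truth. -/
theorem exists_isClose_of_goodHist (hR : RewardCondition 𝓡) {f : MDP A sk ν}
    (hf : ∀ s a, f.reward s a ∈ 𝓡) {κ : ℝ} (hκ : 0 < κ) :
    ∃ C : ℝ, 0 < C ∧ ∀ η : ℝ, 0 < η → C * η < 1 → ∀ (t : ℕ), 0 < t → ∀ h : Hist S A H t,
      GoodHist 𝓡 f η h → (∀ s a, κ * t ≤ expVisits f h s a) →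
      (∀ s a, ∃ g ∈ 𝓡, ∀ g' ∈ 𝓡, rewardLik sk h s a g' ≤ rewardLik sk h s a g) →
      ∃ f' : MDP A sk ν, (∀ s a, f'.reward s a ∈ 𝓡) ∧
        (∀ g : MDP A sk ν, (∀ s a, g.reward s a ∈ 𝓡) → likelihood g h ≤ likelihood f' h) ∧
        ∀ g : MDP A sk ν, (∀ s a, g.reward s a ∈ 𝓡) → likelihood f' h ≤ likelihood g h →
          IsClose f g (Real.sqrt (η / κ)) (C * η) := by
  obtain ⟨q, hq0, hq1, hq⟩ := exists_min_trans f
  have hS : (0 : ℝ) ≤ Fintype.card S := Nat.cast_nonneg _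
  -- The two summands are the relative errors, per unit of `η`, of the individual counts and of
  -- their total.
  refine ⟨1 / (κ * q) + Fintype.card S / κ, by positivity, fun η hη hη1 t ht h hg he hml => ?_⟩
  have htr : (0 : ℝ) < t := by exact_mod_cast ht
  have huv : (1 / (κ * q) + Fintype.card S / κ) * η = η / (κ * q) + Fintype.card S * η / κ := by
    ring
  rw [huv] at hη1 ⊢
  have hu0 : 0 ≤ η / (κ * q) := by positivity
  have hv0 : 0 ≤ Fintype.card S * η / κ := by positivity
  have hepos : ∀ s a, 0 < expVisits f h s a := fun s a =>
    lt_of_lt_of_le (by positivity) (he s a)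
  have hrat := fun s a s' hh => ratio_close (hepos s a) ENNReal.toReal_nonneg hu0 hv0 hη1
    ((hg.abs_cntMoves_sub_le hκ hη.le hq0 hq (he s a) hh).1 s')
    (hg.abs_cntMoves_sub_le hκ hη.le hq0 hq (he s a) hh).2
  have hN : ∀ s a, (sk.layer s : ℕ) + 1 < H → 0 < ∑ s', cntMoves sk h s a s' := fun s a hh => by
    exact_mod_cast (hrat s a s hh).1
  obtain ⟨f', hf'R, hmax, hcl⟩ := exists_likelihood_max hf hg.dens hN hml
  refine ⟨f', hf'R, hmax, fun g hgR hle => ?_⟩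
  obtain ⟨hrew, hgt⟩ := hcl g hgR hle
  have hlift : ∀ x y : ℝ≥0∞, x ≠ ⊤ → y ≠ ⊤ →
      (1 - (η / (κ * q) + Fintype.card S * η / κ)) * x.toReal ≤ y.toReal →
      ENNReal.ofReal (1 - (η / (κ * q) + Fintype.card S * η / κ)) * x ≤ y :=
    fun x y hx hy hxy => by
      rw [← ENNReal.ofReal_toReal hx, ← ENNReal.ofReal_toReal hy,
        ← ENNReal.ofReal_mul (by linarith)]
      exact ENNReal.ofReal_le_ofReal hxy
  refine ⟨fun s a => ?_, fun s a s' hh => ?_, fun s a s' hh => ?_⟩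
  · have h1 := tv_sq_le_of_rewardLik_le hR hg (hf s a) (hgR s a) (hrew s a)
    refine Real.le_sqrt_of_sq_le ?_
    rw [le_div_iff₀ hκ]
    have h2 := mul_le_mul_of_nonneg_right (he s a) (sq_nonneg ((g.reward s a).tv (f.reward s a)))
    have h3 : (g.reward s a).tv (f.reward s a) ^ 2 * κ * t ≤ η * t := by linarith
    exact le_of_mul_le_mul_right h3 htr
  · refine hlift _ _ (PMF.apply_ne_top _ _) (PMF.apply_ne_top _ _) ?_
    rw [hgt s a hh s']
    exact (hrat s a s' hh).2.1
  · refine hlift _ _ (PMF.apply_ne_top _ _) (PMF.apply_ne_top _ _) ?_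
    rw [hgt s a hh s']
    exact (hrat s a s' hh).2.2

/-- Almost surely, the likelihood of the rewards at `(s, a)` attains its maximum. -/
theorem ae_exists_rewardLik_max (hmle : HasRewardMLE 𝓡) {alg : Algorithm S A H}
    (ha : ∀ t, Measurable (alg t)) {f : MDP A sk ν} (hf : ∀ s a, f.reward s a ∈ 𝓡) (t : ℕ) :
    ∀ᵐ h ∂(historyLaw alg f t), ∀ s a, ∃ g ∈ 𝓡, ∀ g' ∈ 𝓡,
      rewardLik sk h s a g' ≤ rewardLik sk h s a g := by
  rw [ae_all_iff]
  intro s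
  rw [ae_all_iff]
  intro a
  let Bad : (k : ℕ) → Set (Fin k → ℝ) := fun k =>
    {x | ¬ ∃ g ∈ 𝓡, ∀ g' ∈ 𝓡, ∏ i, g'.dens (x i) ≤ ∏ i, g.dens (x i)}
  let N : (k : ℕ) → Set (Fin k → ℝ) := fun k =>
    toMeasurable (Measure.pi fun _ : Fin k => (f.reward s a).law) (Bad k)
  have hN : ∀ k, (Measure.pi fun _ : Fin k => (f.reward s a).law) (N k) = 0 := fun k => by
    rw [measure_toMeasurable]; exact hmle _ (hf s a) k
  have hNm : ∀ k, MeasurableSet (N k) := fun k => measurableSet_toMeasurable _ _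
  have key : ∀ (k : Fin (t + 1)) (ι : Fin k ↪o Fin t), ∀ᵐ h ∂(historyLaw alg f t),
      (∀ j, Visits sk s a (h (ι j)).2) → (fun j => rewardAt sk s (h (ι j)).2) ∉ N k :=
    fun k ι => by
      have h1 := lintegral_select_le ha f s a t k ι ι.strictMono
        (F := (N k).indicator 1) (measurable_one.indicator (hNm k))
      rw [lintegral_indicator_one (hNm k), hN, nonpos_iff_eq_zero, lintegral_eq_zero_iff] at h1
      · filter_upwards [h1] with h hh hv hmem
        simp [hv, hmem] at hh
      · refine Measurable.ite ?_ ((measurable_one.indicator (hNm k)).comp ?_) measurable_const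
        · simp only [Set.ofPred_forall]
          exact MeasurableSet.iInter fun j =>
            (show Measurable fun h : Hist S A H t => (h (ι j)).2 by fun_prop)
              (measurableSet_visits s a)
        · exact measurable_pi_lambda _ fun j => (measurable_rewardAt s).comp
            (measurable_snd.comp (measurable_pi_apply (ι j)))
  -- The rounds that visit `(s, a)` are random, but there are only finitely many candidate sets of
  -- rounds, so the null events for fixed sets can be united.
  have key' : ∀ᵐ h ∂(historyLaw alg f t), ∀ (k : Fin (t + 1)) (ι : Fin k ↪o Fin t),
      (∀ j, Visits sk s a (h (ι j)).2) → (fun j => rewardAt sk s (h (ι j)).2) ∉ N k :=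
    ae_all_iff.2 fun k => by
      have : Countable (Fin k ↪o Fin t) :=
        (DFunLike.coe_injective (F := Fin k ↪o Fin t)).countable
      exact ae_all_iff.2 fun ι => key k ι
  filter_upwards [key'] with h hh
  let I : Finset (Fin t) := Finset.univ.filter fun i => Visits sk s a (h i).2
  have hcard : I.card < t + 1 := by
    have := Finset.card_le_univ I
    simp only [Fintype.card_fin] at this
    omega
  have h1 := hh ⟨I.card, hcard⟩ (I.orderEmbOfFin rfl) fun j =>
    (Finset.mem_filter.1 (I.orderEmbOfFin_mem rfl j)).2
  have h2 : (fun j => rewardAt sk s (h (I.orderEmbOfFin rfl j)).2) ∉ Bad I.card :=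
    fun hb => h1 (subset_toMeasurable _ _ hb)
  simp only [Bad, Set.mem_ofPred_eq, not_not] at h2
  obtain ⟨g, hg, hmax⟩ := h2
  have hlik : ∀ g : RewardDensity ν, rewardLik sk h s a g =
      ((∏ j, g.dens (rewardAt sk s (h (I.orderEmbOfFin rfl j)).2) : ℝ≥0) : ℝ≥0∞) := fun g => by
    rw [rewardLik, Finset.prod_ite, Finset.prod_const_one, mul_one, ENNReal.ofNNReal_finsetProd]
    have e : I = Finset.univ.map (I.orderEmbOfFin rfl).toEmbedding := by
      rw [Finset.map_orderEmbOfFin_univ]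
    change ∏ x ∈ I, _ = _
    conv_lhs => rw [e]
    rw [Finset.prod_map]
    rfl
  refine ⟨g, hg, fun g' hg' => ?_⟩
  rw [hlik, hlik]
  exact_mod_cast hmax g' hg'

end Model

/-! ### Relative entropies of close instances -/

/-- The lower bound on `x` is used when the logarithm is nonnegative, the upper bound when it is
negative. In the second case `p (ln q - ln p) ≤ q - p` pays for the discrepancy by a multiple of
`q`, and the `q`s sum to one over the successors. No lower bound on `q` is needed, so the estimate
is uniform over alternatives. -/
theorem mul_log_sub_log_ge {ε e x p q : ℝ} (hε : 0 ≤ ε) (he : 0 ≤ e) (hp : 0 < p) (hq : 0 < q)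
    (hx1 : (1 - ε) * (e * p) ≤ x) (hx2 : x ≤ (1 + 2 * ε) * (e * p)) :
    (1 - ε) * (e * (p * (Real.log p - Real.log q))) - 3 * ε * (e * q) ≤
      x * (Real.log p - Real.log q) := by
  rcases le_total 0 (Real.log p - Real.log q) with hd | hd
  · have h1 := mul_le_mul_of_nonneg_right hx1 hd
    have h2 : 0 ≤ 3 * ε * (e * q) := by positivity
    linarith
  · have h1 := mul_le_mul_of_nonpos_right hx2 hd
    have h2 := Real.log_le_sub_one_of_pos (div_pos hq hp)
    rw [Real.log_div hq.ne' hp.ne'] at h2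
    have h3 : p * (Real.log q - Real.log p) ≤ q - p := by
      calc p * (Real.log q - Real.log p) ≤ p * (q / p - 1) := mul_le_mul_of_nonneg_left h2 hp.le
        _ = q - p := by field_simp
    have h4 : 3 * ε * e * (p * (Real.log q - Real.log p)) ≤ 3 * ε * e * q :=
      mul_le_mul_of_nonneg_left (by linarith) (by positivity)
    linarith

theorem neg_two_mul_le_log_one_sub {ε : ℝ} (h0 : 0 ≤ ε) (h1 : ε ≤ 1 / 2) :
    -(2 * ε) ≤ Real.log (1 - ε) := by
  have h2 := Real.one_sub_inv_le_log_of_pos (x := 1 - ε) (by linarith)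
  refine le_trans ?_ h2
  have h3 : 0 < 1 - ε := by linarith
  rw [show 1 - (1 - ε)⁻¹ = -(ε / (1 - ε)) by field_simp; ring, neg_le_neg_iff,
    div_le_iff₀ h3]
  nlinarith

section Model

variable {S A : Type*} [Fintype S] [DecidableEq S] [MeasurableSpace S] [MeasurableSingletonClass S]
  [Fintype A] [DecidableEq A] [MeasurableSpace A] [MeasurableSingletonClass A]
  {H : ℕ} [NeZero H] {sk : Skeleton S H} {ν : Measure ℝ} {𝓡 : Set (RewardDensity ν)}

theorem klTrans_nonneg {f k : MDP A sk ν} {s : S} {a : A}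
    (hac : (sk.layer s : ℕ) + 1 < H → ∀ s', f.trans s a s' ≠ 0 → k.trans s a s' ≠ 0) :
    0 ≤ klTrans f k s a := by
  unfold klTrans
  split_ifs with hh
  · have h1 : ∀ s', (f.trans s a s').toReal - (k.trans s a s').toReal ≤ (f.trans s a s').toReal *
        (Real.log (f.trans s a s').toReal - Real.log (k.trans s a s').toReal) := fun s' => by
      by_cases h0 : f.trans s a s' = 0
      · simp [h0]
      · have hp : 0 < (f.trans s a s').toReal := ENNReal.toReal_pos h0 (PMF.apply_ne_top _ _)
        have hq : 0 < (k.trans s a s').toReal :=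
          ENNReal.toReal_pos (hac hh s' h0) (PMF.apply_ne_top _ _)
        have h2 := Real.log_le_sub_one_of_pos (div_pos hq hp)
        rw [Real.log_div hq.ne' hp.ne'] at h2
        have h3 := mul_le_mul_of_nonneg_left h2 hp.le
        have h4 : (f.trans s a s').toReal * ((k.trans s a s').toReal / (f.trans s a s').toReal - 1)
          = (k.trans s a s').toReal - (f.trans s a s').toReal := by field_simp
        linarith
    have h2 := Finset.sum_le_sum fun s' (_ : s' ∈ Finset.univ) => h1 s'
    rw [Finset.sum_sub_distrib, PMF.sum_toReal, PMF.sum_toReal, sub_self] at h2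
    exact h2
  · exact le_rfl

theorem toReal_trans_le_of_transLE {c : ℝ} (hc : 0 ≤ c) {f g : MDP A sk ν}
    (h : TransLE (ENNReal.ofReal c) f g) {s : S} (hh : (sk.layer s : ℕ) + 1 < H) (a : A) (s' : S) :
    c * (f.trans s a s').toReal ≤ (g.trans s a s').toReal := by
  have h1 := ENNReal.toReal_mono (PMF.apply_ne_top _ _) (h s a s' hh)
  rwa [ENNReal.toReal_mul, ENNReal.toReal_ofReal hc] at h1

/-- Split `x ln (x / q)` into `x ln (p / q)`, which loses `3ε` in total by `mul_log_sub_log_ge`, and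
`x ln (x / p)`, which is at least `-2ε x`. -/
theorem IsClose.klTrans_ge {f g k : MDP A sk ν} {δ ε : ℝ} (hcl : IsClose f g δ ε) (hε : 0 ≤ ε)
    (hε2 : ε ≤ 1 / 2) {s : S} {a : A}
    (hac : (sk.layer s : ℕ) + 1 < H → ∀ s', f.trans s a s' ≠ 0 → k.trans s a s' ≠ 0) :
    (1 - ε) * klTrans f k s a - 5 * ε ≤ klTrans g k s a := by
  unfold klTrans
  split_ifs with hh
  · have h1 : ∀ s', (1 - ε) * ((f.trans s a s').toReal *
        (Real.log (f.trans s a s').toReal - Real.log (k.trans s a s').toReal)) -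
        3 * ε * (k.trans s a s').toReal - 2 * ε * (g.trans s a s').toReal ≤
        (g.trans s a s').toReal *
        (Real.log (g.trans s a s').toReal - Real.log (k.trans s a s').toReal) := fun s' => by
      have c1 := toReal_trans_le_of_transLE (by linarith) hcl.trans_le hh a s'
      have c2 := toReal_trans_le_of_transLE (by linarith) hcl.trans_ge hh a s'
      have hg0 : 0 ≤ (g.trans s a s').toReal := ENNReal.toReal_nonneg
      by_cases h0 : f.trans s a s' = 0
      · rw [h0, ENNReal.toReal_zero] at c2
        have : (g.trans s a s').toReal = 0 := le_antisymm (by nlinarith) hg0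
        rw [h0, this]
        have : 0 ≤ 3 * ε * (k.trans s a s').toReal := by positivity
        simp only [ENNReal.toReal_zero]
        linarith
      · have hp : 0 < (f.trans s a s').toReal := ENNReal.toReal_pos h0 (PMF.apply_ne_top _ _)
        have hq : 0 < (k.trans s a s').toReal :=
          ENNReal.toReal_pos (hac hh s' h0) (PMF.apply_ne_top _ _)
        set p := (f.trans s a s').toReal
        set q := (k.trans s a s').toReal
        set x := (g.trans s a s').toReal
        have hx : 0 < x := lt_of_lt_of_le (by have : 0 < 1 - ε := by linarith
                                              positivity) c1
        have h2 := mul_log_sub_log_ge (e := 1) (x := x) hε zero_le_one hp hq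
          (by linarith) (by
            have : (1 + 2 * ε) * ((1 - ε) * x) ≤ (1 + 2 * ε) * p :=
              mul_le_mul_of_nonneg_left c2 (by linarith)
            have e : (1 + 2 * ε) * ((1 - ε) * x) = x + x * (ε * (1 - 2 * ε)) := by ring
            have : 0 ≤ x * (ε * (1 - 2 * ε)) :=
              mul_nonneg hx.le (mul_nonneg hε (by linarith))
            linarith)
        have h3 : Real.log (1 - ε) + Real.log p ≤ Real.log x := by
          rw [← Real.log_mul (by linarith) hp.ne']
          exact Real.log_le_log (mul_pos (by linarith) hp) c1
        have h4 := neg_two_mul_le_log_one_sub hε hε2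
        have h5 := mul_le_mul_of_nonneg_left (show -(2 * ε) ≤ Real.log x - Real.log p by linarith)
          hx.le
        linarith
    have h2 := Finset.sum_le_sum fun s' (_ : s' ∈ Finset.univ) => h1 s'
    rw [Finset.sum_sub_distrib, Finset.sum_sub_distrib, ← Finset.mul_sum, ← Finset.mul_sum,
      ← Finset.mul_sum, PMF.sum_toReal, PMF.sum_toReal] at h2
    linarith
  · linarith

theorem integrable_logRatio (hR : RewardCondition 𝓡) {g g' : RewardDensity ν} (hg : g ∈ 𝓡)
    (hg' : g' ∈ 𝓡) : Integrable (g.logRatio g') g.law := by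
  obtain ⟨B, -, hB⟩ := hR.exists_moment
  exact ((memLp_two_iff_integrable_sq
    (RewardDensity.measurable_logRatio _ _).aestronglyMeasurable).2
      (hB _ hg _ hg').2.1).integrable one_le_two

theorem integral_logRatio_nonneg (hR : RewardCondition 𝓡) {g g' : RewardDensity ν} (hg : g ∈ 𝓡)
    (hg' : g' ∈ 𝓡) : 0 ≤ ∫ x, g.logRatio g' x ∂g.law := by
  obtain ⟨B, -, hB⟩ := hR.exists_moment
  have hflip : g'.logRatio g = fun x => -(g.logRatio g' x) := funext fun x => by
    simp [RewardDensity.logRatio]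
  have h1 := RewardDensity.integral_logRatio_le (f := g) (g := g')
    ((hB _ hg _ hg').1.mono fun x hx => hx.2) (by
      rw [hflip]; exact (integrable_logRatio hR hg hg').neg)
  rw [hflip, integral_neg] at h1
  have := sq_nonneg (g'.tv g)
  linarith

theorem klReward_nonneg (hR : RewardCondition 𝓡) {f k : MDP A sk ν}
    (hf : ∀ s a, f.reward s a ∈ 𝓡) (hk : ∀ s a, k.reward s a ∈ 𝓡) (s : S) (a : A) :
    0 ≤ klReward f k s a := integral_logRatio_nonneg hR (hf s a) (hk s a)

/-- The mean of a log-ratio under two close reward distributions. -/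
theorem RewardCondition.exists_integral_logRatio_ge (hR : RewardCondition 𝓡) :
    ∃ C : ℝ, 0 ≤ C ∧ ∀ f ∈ 𝓡, ∀ g ∈ 𝓡, ∀ k ∈ 𝓡, ∀ δ : ℝ, 0 < δ → g.tv f ≤ δ →
      |∫ x, g.logRatio k x ∂f.law - ∫ x, g.logRatio k x ∂g.law| ≤ C * Real.sqrt δ ∧
      ∫ x, f.logRatio k x ∂f.law - C * Real.sqrt δ ≤ ∫ x, g.logRatio k x ∂g.law := by
  obtain ⟨B, hB0, hB⟩ := hR.exists_moment
  have key : ∀ f ∈ 𝓡, ∀ g ∈ 𝓡, ∀ k ∈ 𝓡, Integrable (fun x => g.logRatio k x ^ 2) f.law ∧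
      ∫ x, g.logRatio k x ^ 2 ∂f.law ≤ 4 * B := fun f hf g hg k hk => by
    obtain ⟨-, i1, b1⟩ := hB f hf g hg
    obtain ⟨-, i2, b2⟩ := hB f hf k hk
    have hle : ∀ x, g.logRatio k x ^ 2 ≤ 2 * f.logRatio g x ^ 2 + 2 * f.logRatio k x ^ 2 :=
      fun x => by
        have e : g.logRatio k x = f.logRatio k x - f.logRatio g x := by
          simp [RewardDensity.logRatio]
        rw [e]
        nlinarith [sq_nonneg (f.logRatio k x + f.logRatio g x)]
    have i3 : Integrable (fun x => 2 * f.logRatio g x ^ 2 + 2 * f.logRatio k x ^ 2) f.law :=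
      (i1.const_mul 2).add (i2.const_mul 2)
    have i4 : Integrable (fun x => g.logRatio k x ^ 2) f.law :=
      i3.mono' (((RewardDensity.measurable_logRatio g k).pow_const 2).aestronglyMeasurable)
        (ae_of_all _ fun x => by
          rw [Real.norm_of_nonneg (sq_nonneg _)]; exact hle x)
    refine ⟨i4, (integral_mono i4 i3 hle).trans ?_⟩
    rw [integral_add (i1.const_mul 2) (i2.const_mul 2), integral_const_mul, integral_const_mul]
    linarith
  have hkey2 : ∀ f ∈ 𝓡, ∀ g ∈ 𝓡, ∀ u ∈ 𝓡, ∀ k ∈ 𝓡, ∀ δ : ℝ, 0 < δ → g.tv f ≤ δ →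
      |∫ x, u.logRatio k x ∂f.law - ∫ x, u.logRatio k x ∂g.law| ≤ (1 + 8 * B) * Real.sqrt δ :=
    fun f hf g hg u hu k hk δ hδ htv => by
      obtain ⟨i1, b1⟩ := key f hf u hu k hk
      obtain ⟨i2, b2⟩ := key g hg u hu k hk
      have := RewardDensity.abs_integral_sub_le (RewardDensity.measurable_logRatio u k) i1 i2 hδ
        (by rwa [RewardDensity.tv_comm]) (V := 8 * B) (by linarith)
      linarith
  refine ⟨1 + 8 * B, by positivity, fun f hf g hg k hk δ hδ htv =>
    ⟨hkey2 f hf g hg g hg k hk δ hδ htv, ?_⟩⟩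
  -- Under `g`, `ln (g / k)` is `ln (g / f) + ln (f / k)`. The first part has nonnegative mean, and
  -- the mean of the second is compared with its mean under `f` by the change of measure.
  have h1 := (abs_le.1 (hkey2 f hf g hg f hf k hk δ hδ htv)).2
  have h2 := integral_logRatio_nonneg hR hg hf
  have iu : Integrable (f.logRatio k) g.law :=
    ((memLp_two_iff_integrable_sq
      (RewardDensity.measurable_logRatio _ _).aestronglyMeasurable).2
        (key g hg f hf k hk).1).integrable one_le_two
  have e : ∫ x, g.logRatio k x ∂g.law = ∫ x, g.logRatio f x ∂g.law + ∫ x, f.logRatio k x ∂g.law := by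
    rw [← integral_add (integrable_logRatio hR hg hf) iu]
    refine integral_congr_ae (ae_of_all _ fun x => ?_)
    simp [RewardDensity.logRatio]
  linarith

/-- The relative entropy `D_KL(f[π] ‖ k[π])`, provided it is finite. -/
def klReal (f k : MDP A sk ν) (π : Policy S A) : ℝ :=
  ∑ s, ∑ a, f.occ π s a * (klReward f k s a + klTrans f k s a)

variable [SigmaFinite ν]

/-- Two-sided comparison with positive factors preserves both the supports of the transitions and
the set of visited states. -/
theorem IsClose.transAC_iff {f g k : MDP A sk ν} {δ ε : ℝ} (hcl : IsClose f g δ ε) (hε0 : 0 ≤ ε)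
    (hε : ε < 1) {π : Policy S A} : TransAC f k π ↔ TransAC g k π := by
  have hsub : ∀ {f g : MDP A sk ν}, TransLE (ENNReal.ofReal (1 - ε)) f g →
      TransLE (ENNReal.ofReal (1 - ε)) g f → TransAC f k π → TransAC g k π :=
    fun {f g} h1 h2 hac s hs hh s' hs' => by
      have hpos : ENNReal.ofReal (1 - ε) ≠ 0 := by simpa using hε
      refine hac s ?_ hh s' ?_
      · have h3 := h2.visitProb_le (by linarith) (by linarith) π s
        have h4 : 0 < g.visitProb π s := lt_of_le_of_ne (visitProb_nonneg _ _ _) (Ne.symm hs)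
        have : 0 < (1 - ε) ^ H * g.visitProb π s := mul_pos (pow_pos (by linarith) _) h4
        exact (this.trans_le h3).ne'
      · have h3 := h2 s (π s) s' hh
        intro h0
        rw [h0] at h3
        exact (mul_ne_zero hpos hs') (le_antisymm h3 zero_le)
  exact ⟨hsub hcl.trans_le hcl.trans_ge, hsub hcl.trans_ge hcl.trans_le⟩

theorem klReal_term_nonneg (hR : RewardCondition 𝓡) {f k : MDP A sk ν}
    (hf : ∀ s a, f.reward s a ∈ 𝓡) (hk : ∀ s a, k.reward s a ∈ 𝓡) {π : Policy S A}
    (hac : TransAC f k π) (s : S) (a : A) :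
    0 ≤ f.occ π s a * (klReward f k s a + klTrans f k s a) := by
  by_cases h0 : f.occ π s a = 0
  · simp [h0]
  · have hπ : π s = a := by
      by_contra hne; exact h0 (by simp [MDP.occ, hne])
    subst hπ
    refine mul_nonneg (occ_nonneg _ _ _ _) (add_nonneg (klReward_nonneg hR hf hk s _)
      (klTrans_nonneg fun hh s' hs' => hac s (by simpa [MDP.occ] using h0) hh s' hs'))

theorem klReal_nonneg (hR : RewardCondition 𝓡) {f k : MDP A sk ν}
    (hf : ∀ s a, f.reward s a ∈ 𝓡) (hk : ∀ s a, k.reward s a ∈ 𝓡) {π : Policy S A}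
    (hac : TransAC f k π) : 0 ≤ klReal f k π :=
  Finset.sum_nonneg fun s _ => Finset.sum_nonneg fun a _ => klReal_term_nonneg hR hf hk hac s a

/-- Visit probabilities and transitions change by factors near one, so their effect is relative to
the divergence, however large it may be. Only the change of measure in the rewards and the
replacement of one transition logarithm by another lose an additive amount, of order `√δ`. All
constants are uniform in `k`. -/
theorem exists_klReal_ge (hR : RewardCondition 𝓡) (sk : Skeleton S H) :
    ∃ C : ℝ, 0 ≤ C ∧ ∀ f g k : MDP A sk ν, (∀ s a, f.reward s a ∈ 𝓡) → (∀ s a, g.reward s a ∈ 𝓡) →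
      (∀ s a, k.reward s a ∈ 𝓡) → ∀ δ : ℝ, 0 < δ → δ ≤ 1 / 2 → IsClose f g δ δ → ∀ π,
      TransAC f k π → (1 - C * δ) * klReal f k π - C * Real.sqrt δ ≤ klReal g k π := by
  obtain ⟨C, hC, hkey⟩ := hR.exists_integral_logRatio_ge
  set C₂ : ℝ := Fintype.card S * (Fintype.card A * (5 + C)) with hC2
  have hC20 : 0 ≤ C₂ := by positivity
  refine ⟨max (H + 1) C₂, le_max_of_le_right hC20, fun f g k hf hg hk δ hδ hδ2 hcl π hac => ?_⟩
  have hsq : δ ≤ Real.sqrt δ := Real.le_sqrt_of_sq_le (by nlinarith)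
  have hgac := (hcl.transAC_iff hδ.le (by linarith)).1 hac
  have hpow1 : (1 - δ) ^ H ≤ 1 := pow_le_one₀ (by linarith) (by linarith)
  have hpow0 : 0 ≤ (1 - δ) ^ H := pow_nonneg (by linarith) _
  have hterm : ∀ s a, (1 - δ) ^ (H + 1) * (f.occ π s a * (klReward f k s a + klTrans f k s a)) -
      (5 + C) * Real.sqrt δ ≤ g.occ π s a * (klReward g k s a + klTrans g k s a) := fun s a => by
    have hgn := klReal_term_nonneg hR hg hk hgac s a
    have hs0 := Real.sqrt_nonneg δ
    by_cases h0 : f.occ π s a = 0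
    · rw [h0]; nlinarith
    · have hπ : π s = a := by
        by_contra hne; exact h0 (by simp [MDP.occ, hne])
      subst hπ
      have hv : f.visitProb π s ≠ 0 := by simpa [MDP.occ] using h0
      have hac' := hac s hv
      have hocc : (1 - δ) ^ H * f.occ π s (π s) ≤ g.occ π s (π s) := by
        simpa [MDP.occ] using hcl.trans_le.visitProb_le (by linarith) (by linarith) π s
      have r1 := klReward_nonneg hR hf hk s (π s)
      have r2 := klReward_nonneg hR hg hk s (π s)
      have t1 := klTrans_nonneg (f := f) (k := k) (s := s) (a := π s) fun hh s' h' => hac' hh s' h'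
      have r3 : klReward f k s (π s) - C * Real.sqrt δ ≤ klReward g k s (π s) :=
        (hkey _ (hf s (π s)) _ (hg s (π s)) _ (hk s (π s)) δ hδ (hcl.tv_le s (π s))).2
      have t3 := hcl.klTrans_ge hδ.le hδ2 (k := k) (s := s) (a := π s)
        fun hh s' h' => hac' hh s' h'
      have hvg : g.visitProb π s ≠ 0 := by
        intro h00
        have hp := occ_nonneg f π s (π s)
        have : 0 < f.occ π s (π s) := lt_of_le_of_ne hp (Ne.symm h0)
        have h5 : 0 < (1 - δ) ^ H * f.occ π s (π s) := mul_pos (pow_pos (by linarith) _) this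
        have : g.occ π s (π s) = 0 := by simp [MDP.occ, h00]
        linarith
      have t2 := klTrans_nonneg (f := g) (k := k) (s := s) (a := π s)
        fun hh s' h' => hgac s hvg hh s' h'
      have o0 := occ_nonneg f π s (π s)
      have o1 := occ_le_one f π s (π s)
      set D := klReward f k s (π s) + klTrans f k s (π s)
      set D' := klReward g k s (π s) + klTrans g k s (π s)
      have hD : (1 - δ) * D - (5 + C) * Real.sqrt δ ≤ D' := by
        have : δ * klReward f k s (π s) ≥ 0 := mul_nonneg hδ.le r1
        simp only [D, D']
        nlinarith
      have hD' : 0 ≤ D' := add_nonneg r2 t2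
      have hu0 : 0 ≤ (1 - δ) ^ H * f.occ π s (π s) := mul_nonneg hpow0 o0
      have hu1 : (1 - δ) ^ H * f.occ π s (π s) ≤ 1 := mul_le_one₀ hpow1 o0 o1
      calc _ ≤ (1 - δ) ^ H * f.occ π s (π s) * ((1 - δ) * D - (5 + C) * Real.sqrt δ) := by
            rw [pow_succ]
            have : (1 - δ) ^ H * f.occ π s (π s) * ((5 + C) * Real.sqrt δ) ≤
              1 * ((5 + C) * Real.sqrt δ) := mul_le_mul_of_nonneg_right hu1 (by positivity)
            linarith
        _ ≤ (1 - δ) ^ H * f.occ π s (π s) * D' := mul_le_mul_of_nonneg_left hD hu0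
        _ ≤ _ := mul_le_mul_of_nonneg_right hocc hD'
  have hsum := Finset.sum_le_sum fun s (_ : s ∈ Finset.univ) =>
    Finset.sum_le_sum fun a (_ : a ∈ (Finset.univ : Finset A)) => hterm s a
  simp only [Finset.sum_sub_distrib, ← Finset.mul_sum, Finset.sum_const, Finset.card_univ,
    nsmul_eq_mul] at hsum
  have hbern : 1 - (H + 1) * δ ≤ (1 - δ) ^ (H + 1) := by
    have := one_add_mul_le_pow (a := -δ) (by linarith) (H + 1)
    push_cast at this
    have e : 1 + -δ = 1 - δ := by ring
    rw [e] at this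
    linarith
  have hk0 := klReal_nonneg hR hf hk hac
  have h1 : (1 - max (H + 1 : ℝ) C₂ * δ) * klReal f k π ≤ (1 - δ) ^ (H + 1) * klReal f k π := by
    refine mul_le_mul_of_nonneg_right ?_ hk0
    have := mul_le_mul_of_nonneg_right (le_max_left (H + 1 : ℝ) C₂) hδ.le
    linarith
  have h2 := mul_le_mul_of_nonneg_right (le_max_right (H + 1 : ℝ) C₂) (Real.sqrt_nonneg δ)
  have h3 : C₂ * Real.sqrt δ = Fintype.card S * (Fintype.card A * ((5 + C) * Real.sqrt δ)) := by
    rw [hC2]; ring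
  unfold klReal at *
  linarith

theorem klDiv_eq_klReal (hR : RewardCondition 𝓡) {f k : MDP A sk ν}
    (hf : ∀ s a, f.reward s a ∈ 𝓡) (hk : ∀ s a, k.reward s a ∈ 𝓡) {π : Policy S A}
    (hac : TransAC f k π) :
    klDiv (trajLaw f π) (trajLaw k π) = ENNReal.ofReal (klReal f k π) :=
  klDiv_trajLaw hR hf hk hac

theorem klDiv_eq_top_of_not_transAC {f k : MDP A sk ν} {π : Policy S A} (hac : ¬ TransAC f k π) :
    klDiv (trajLaw f π) (trajLaw k π) = ⊤ :=
  klDiv_of_not_ac fun h => hac (transAC_of_ac h)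

theorem exists_klDiv_ge (hR : RewardCondition 𝓡) (sk : Skeleton S H) :
    ∃ C : ℝ, 0 ≤ C ∧ ∀ f g k : MDP A sk ν, (∀ s a, f.reward s a ∈ 𝓡) → (∀ s a, g.reward s a ∈ 𝓡) →
      (∀ s a, k.reward s a ∈ 𝓡) → ∀ δ : ℝ, 0 < δ → δ ≤ 1 / 2 → IsClose f g δ δ → ∀ π,
      ENNReal.ofReal (1 - C * δ) * klDiv (trajLaw f π) (trajLaw k π) ≤
        klDiv (trajLaw g π) (trajLaw k π) + ENNReal.ofReal (C * Real.sqrt δ) := by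
  obtain ⟨C, hC, hkey⟩ := exists_klReal_ge (A := A) hR sk
  refine ⟨C, hC, fun f g k hf hg hk δ hδ hδ2 hcl π => ?_⟩
  by_cases hac : TransAC f k π
  · have hac' := (hcl.transAC_iff hδ.le (by linarith)).1 hac
    rw [klDiv_eq_klReal hR hf hk hac, klDiv_eq_klReal hR hg hk hac',
      ← ENNReal.ofReal_add (klReal_nonneg hR hg hk hac') (by positivity),
      ← ENNReal.ofReal_mul' (klReal_nonneg hR hf hk hac)]
    exact ENNReal.ofReal_le_ofReal (by linarith [hkey f g k hf hg hk δ hδ hδ2 hcl π hac])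
  · rw [klDiv_eq_top_of_not_transAC fun h =>
      hac ((hcl.transAC_iff hδ.le (by linarith)).2 h), top_add]
    exact le_top

/-! ### Values of close instances -/

theorem exists_abs_value_sub_le (hR : RewardCondition 𝓡)
    (hint : ∀ g ∈ 𝓡, Integrable (fun x : ℝ => x) g.law) {f : MDP A sk ν}
    (hf : ∀ s a, f.reward s a ∈ 𝓡) :
    ∃ C c : ℝ, 0 ≤ C ∧ 0 < c ∧ c ≤ 1 ∧ ∀ g : MDP A sk ν, (∀ s a, g.reward s a ∈ 𝓡) →
      ∀ δ : ℝ, 0 < δ → δ ≤ 1 → IsClose f g δ δ → ∀ π, |value f π - value g π| ≤ C * δ ^ c := by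
  obtain ⟨c, hc0, hc1, C, hC⟩ := hR.mean_tv
  obtain ⟨m, hm⟩ : ∃ m : ℝ, ∀ s a, |(f.reward s a).mean| ≤ m := by
    refine ⟨∑ s, ∑ a, |(f.reward s a).mean|, fun s a => ?_⟩
    refine le_trans ?_ (Finset.single_le_sum (f := fun s => ∑ a, |(f.reward s a).mean|)
      (fun s _ => Finset.sum_nonneg fun a _ => abs_nonneg _) (Finset.mem_univ s))
    exact Finset.single_le_sum (f := fun a => |(f.reward s a).mean|)
      (fun a _ => abs_nonneg _) (Finset.mem_univ a)
  refine ⟨Fintype.card S * (H * |m| + |C|), c, by positivity, hc0, hc1,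
    fun g hg δ hδ hδ1 hcl π => ?_⟩
  have h1 := hcl.trans_le.abs_value_sub_le (κ := |C| * δ ^ c) (m := |m|) (by linarith)
    (by linarith) (fun s a => hint _ (hf s a)) (fun s a => hint _ (hg s a))
    (fun s a => (hm s a).trans (le_abs_self m)) (fun s a => by
      rw [abs_sub_comm]
      refine (hC _ (hg s a) _ (hf s a)).trans ?_
      refine (mul_le_mul_of_nonneg_right (le_abs_self C)
        (Real.rpow_nonneg (RewardDensity.tv_nonneg _ _) _)).trans ?_
      exact mul_le_mul_of_nonneg_left (Real.rpow_le_rpow (RewardDensity.tv_nonneg _ _)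
        (hcl.tv_le s a) hc0.le) (abs_nonneg _)) π
  have h2 : δ ≤ δ ^ c := by
    have := Real.rpow_le_rpow_of_exponent_ge hδ hδ1 hc1
    rwa [Real.rpow_one] at this
  refine h1.trans ?_
  have h3 : (H : ℝ) * |m| * δ ≤ H * |m| * δ ^ c := mul_le_mul_of_nonneg_left h2 (by positivity)
  calc (Fintype.card S : ℝ) * (H * (1 - (1 - δ)) * |m| + |C| * δ ^ c)
      = Fintype.card S * (H * |m| * δ + |C| * δ ^ c) := by ring
    _ ≤ Fintype.card S * (H * |m| * δ ^ c + |C| * δ ^ c) := by gcongr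
    _ = _ := by ring

variable [Nonempty A]

theorem exists_isClose_stability (hR : RewardCondition 𝓡)
    (hint : ∀ g ∈ 𝓡, Integrable (fun x : ℝ => x) g.law) {f : MDP A sk ν}
    (hf : f ∈ instances A sk 𝓡) :
    ∃ C c δ₀ : ℝ, 0 ≤ C ∧ 0 < c ∧ 0 < δ₀ ∧ δ₀ ≤ 1 / 2 ∧
      ∀ g : MDP A sk ν, (∀ s a, g.reward s a ∈ 𝓡) →
      ∀ δ : ℝ, 0 < δ → δ ≤ δ₀ → IsClose f g δ δ → g ∈ instances A sk 𝓡 ∧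
        optPolicy g = optPolicy f ∧ ∀ π, |gap f π - gap g π| ≤ C * δ ^ c := by
  obtain ⟨C, c, hC, hc0, hc1, hv⟩ := exists_abs_value_sub_le hR hint hf.1
  obtain ⟨ρ, hρ, hst⟩ := exists_stability hf
  -- For `δ` below this threshold `C δ ^ c ≤ ρ`, within the stability radius; `C + 1` avoids a
  -- division by zero. A gap is a difference of two values, hence the factor two.
  refine ⟨2 * C, c, min (1 / 2) ((ρ / (C + 1)) ^ c⁻¹), by positivity, hc0,
    lt_min (by norm_num) (by positivity), min_le_left _ _, fun g hg δ hδ hδ0 hcl => ?_⟩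
  have hδ1 : δ ≤ 1 := (hδ0.trans (min_le_left _ _)).trans (by norm_num)
  have hδρ : C * δ ^ c ≤ ρ := by
    have h1 : δ ^ c ≤ ρ / (C + 1) := by
      have := Real.rpow_le_rpow hδ.le (hδ0.trans (min_le_right _ _)) hc0.le
      rwa [← Real.rpow_mul (by positivity), inv_mul_cancel₀ hc0.ne', Real.rpow_one] at this
    calc C * δ ^ c ≤ (C + 1) * (ρ / (C + 1)) := by
          refine mul_le_mul (by linarith) h1 (by positivity) (by positivity)
      _ = ρ := by field_simp
  have hvv := hv g hg δ hδ hδ1 hcl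
  obtain ⟨h1, h2⟩ := hst g hg fun π => (hvv π).trans hδρ
  refine ⟨h1, h2, fun π => ?_⟩
  have a1 := abs_le.1 (hvv π)
  have a2 := abs_le.1 (hvv (optPolicy f))
  rw [gap, gap, h2]
  exact abs_le.2 ⟨by linarith [a1.1, a2.1, a1.2, a2.2], by linarith [a1.1, a2.1, a1.2, a2.2]⟩

end Model

section Model

variable {S A : Type*} [Fintype S] [DecidableEq S] [MeasurableSpace S] [MeasurableSingletonClass S]
  [Fintype A] [DecidableEq A] [MeasurableSpace A] [MeasurableSingletonClass A]
  {H : ℕ} [NeZero H] {sk : Skeleton S H} {ν : Measure ℝ} {𝓡 : Set (RewardDensity ν)}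

/-! ### The program -/

theorem exists_mixture (f g : MDP A sk ν) {τ : ℝ} (h0 : 0 ≤ τ) (h1 : τ ≤ 1) :
    ∃ k : MDP A sk ν, k.reward = g.reward ∧ ∀ s a s', (k.trans s a s').toReal =
      (1 - τ) * (g.trans s a s').toReal + τ * (f.trans s a s').toReal := by
  have hsum : ∀ s a, ∑ s', (ENNReal.ofReal (1 - τ) * g.trans s a s' +
      ENNReal.ofReal τ * f.trans s a s') = 1 := fun s a => by
    have hp : ∀ p : PMF S, ∑ s', p s' = 1 := fun p => by
      rw [← tsum_fintype (L := .unconditional S), PMF.tsum_coe]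
    rw [Finset.sum_add_distrib, ← Finset.mul_sum, ← Finset.mul_sum, hp, hp, mul_one, mul_one,
      ← ENNReal.ofReal_add (by linarith) h0]
    simp
  refine ⟨⟨fun s a => PMF.ofFintype _ (hsum s a), g.reward, fun s a s' hh hne => ?_⟩, rfl,
    fun s a s' => ?_⟩
  · rw [PMF.ofFintype_apply] at hne
    by_cases hg : g.trans s a s' = 0
    · by_cases hf : f.trans s a s' = 0
      · simp [hg, hf] at hne
      · exact f.layered s a s' hh hf
    · exact g.layered s a s' hh hg
  · rw [PMF.ofFintype_apply, ENNReal.toReal_add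
      (ENNReal.mul_ne_top ENNReal.ofReal_ne_top (PMF.apply_ne_top _ _))
      (ENNReal.mul_ne_top ENNReal.ofReal_ne_top (PMF.apply_ne_top _ _)),
      ENNReal.toReal_mul, ENNReal.toReal_mul, ENNReal.toReal_ofReal (by linarith),
      ENNReal.toReal_ofReal h0]

/-- The mixture dominates `(1 - τ)` times the transitions of `g`, so every logarithm drops by at
most `-ln (1 - τ)`. -/
theorem klTrans_mixture_le {f g k : MDP A sk ν} {τ : ℝ} (h0 : 0 ≤ τ) (h1 : τ < 1)
    (hk : ∀ s a s', (k.trans s a s').toReal =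
      (1 - τ) * (g.trans s a s').toReal + τ * (f.trans s a s').toReal) {s : S} {a : A}
    (hac : (sk.layer s : ℕ) + 1 < H → ∀ s', f.trans s a s' ≠ 0 → g.trans s a s' ≠ 0) :
    klTrans f k s a ≤ klTrans f g s a - Real.log (1 - τ) := by
  have hl : Real.log (1 - τ) ≤ 0 := Real.log_nonpos (by linarith) (by linarith)
  unfold klTrans
  split_ifs with hh
  · have key : ∀ s', (f.trans s a s').toReal *
        (Real.log (f.trans s a s').toReal - Real.log (k.trans s a s').toReal) ≤
        (f.trans s a s').toReal *
        (Real.log (f.trans s a s').toReal - Real.log (g.trans s a s').toReal) -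
        (f.trans s a s').toReal * Real.log (1 - τ) := fun s' => by
      by_cases hf : f.trans s a s' = 0
      · simp [hf]
      · have hq : 0 < (g.trans s a s').toReal :=
          ENNReal.toReal_pos (hac hh s' hf) (PMF.apply_ne_top _ _)
        have hle : (1 - τ) * (g.trans s a s').toReal ≤ (k.trans s a s').toReal := by
          rw [hk]
          have : 0 ≤ τ * (f.trans s a s').toReal := mul_nonneg h0 ENNReal.toReal_nonneg
          linarith
        have h2 := Real.log_le_log (mul_pos (by linarith) hq) hle
        rw [Real.log_mul (by linarith) hq.ne'] at h2
        rw [← mul_sub]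
        exact mul_le_mul_of_nonneg_left (by linarith) ENNReal.toReal_nonneg
    refine (Finset.sum_le_sum fun s' _ => key s').trans (le_of_eq ?_)
    rw [Finset.sum_sub_distrib, ← Finset.sum_mul, PMF.sum_toReal, one_mul]
  · linarith

variable [SigmaFinite ν] [Nonempty A]

/-- Mix a fraction `τ` of the transitions of `f` into `g` and keep the rewards of `g`. For small `τ`
the optimal decision of `g` survives, every transition of `f` becomes possible, and the finite
divergences grow by a quantity that vanishes with `τ`. -/
theorem exists_mixture_mem_alternatives
    (hint : ∀ g ∈ 𝓡, Integrable (fun x : ℝ => x) g.law) {f g : MDP A sk ν}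
    (hg : g ∈ alternatives 𝓡 f) : ∃ τ₀ : ℝ, 0 < τ₀ ∧ τ₀ < 1 ∧ ∀ τ : ℝ, 0 < τ → τ ≤ τ₀ →
      ∃ k ∈ alternatives 𝓡 f, (∀ π, TransAC f k π) ∧
      ∀ π, TransAC f g π → klReal f k π ≤ klReal f g π +
        Fintype.card S * Fintype.card A * -Real.log (1 - τ) := by
  obtain ⟨ρ, hρ, hst⟩ := exists_stability hg.1
  obtain ⟨m, hm0, hm⟩ : ∃ m : ℝ, 0 ≤ m ∧ ∀ s a, |(g.reward s a).mean| ≤ m := by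
    refine ⟨∑ s, ∑ a, |(g.reward s a).mean|,
      Finset.sum_nonneg fun s _ => Finset.sum_nonneg fun a _ => abs_nonneg _, fun s a => ?_⟩
    refine le_trans ?_ (Finset.single_le_sum (f := fun s => ∑ a, |(g.reward s a).mean|)
      (fun s _ => Finset.sum_nonneg fun a _ => abs_nonneg _) (Finset.mem_univ s))
    exact Finset.single_le_sum (f := fun a => |(g.reward s a).mean|)
      (fun a _ => abs_nonneg _) (Finset.mem_univ a)
  set Q : ℝ := Fintype.card S * (H * m) with hQ
  have hQ0 : 0 ≤ Q := by positivity
  refine ⟨min (1 / 2) (ρ / (Q + 1)), lt_min (by norm_num) (by positivity),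
    (min_le_left _ _).trans_lt (by norm_num), fun τ hτ hτ0 => ?_⟩
  have hτ1 : τ < 1 := (hτ0.trans (min_le_left _ _)).trans_lt (by norm_num)
  have hτρ : Q * τ ≤ ρ := by
    calc Q * τ ≤ (Q + 1) * (ρ / (Q + 1)) :=
          mul_le_mul (by linarith) (hτ0.trans (min_le_right _ _)) hτ.le (by positivity)
      _ = ρ := by field_simp
  obtain ⟨k, hkr, hkt⟩ := exists_mixture f g hτ.le hτ1.le
  have hkR : ∀ s a, k.reward s a ∈ 𝓡 := fun s a => by rw [hkr]; exact hg.1.1 s a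
  have hle : TransLE (ENNReal.ofReal (1 - τ)) g k := fun s a s' _ => by
    rw [← ENNReal.ofReal_toReal (PMF.apply_ne_top (g.trans s a) s'),
      ← ENNReal.ofReal_toReal (PMF.apply_ne_top (k.trans s a) s'),
      ← ENNReal.ofReal_mul (by linarith), hkt]
    refine ENNReal.ofReal_le_ofReal ?_
    have : 0 ≤ τ * (f.trans s a s').toReal := mul_nonneg hτ.le ENNReal.toReal_nonneg
    linarith
  have hv : ∀ π, |value g π - value k π| ≤ ρ := fun π => by
    refine (hle.abs_value_sub_le (by linarith) (by linarith) (fun s a => hint _ (hg.1.1 s a))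
      (fun s a => hint _ (hkR s a)) hm (κ := 0) (fun s a => by simp [hkr]) π).trans
      (le_trans (le_of_eq ?_) hτρ)
    rw [hQ]; ring
  obtain ⟨hk1, hk2⟩ := hst k hkR hv
  refine ⟨k, ⟨hk1, by rw [hk2]; exact hg.2⟩, fun π s _ hh s' hs' h0 => ?_, fun π hac => ?_⟩
  · have h1 := hkt s (π s) s'
    rw [h0, ENNReal.toReal_zero] at h1
    have h2 : 0 < τ * (f.trans s (π s) s').toReal :=
      mul_pos hτ (ENNReal.toReal_pos hs' (PMF.apply_ne_top _ _))
    have h3 : 0 ≤ (1 - τ) * (g.trans s (π s) s').toReal :=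
      mul_nonneg (by linarith) ENNReal.toReal_nonneg
    linarith
  · have hl : Real.log (1 - τ) ≤ 0 := Real.log_nonpos (by linarith) (by linarith)
    have hterm : ∀ s a, f.occ π s a * (klReward f k s a + klTrans f k s a) ≤
        f.occ π s a * (klReward f g s a + klTrans f g s a) + -Real.log (1 - τ) := fun s a => by
      by_cases h0 : f.occ π s a = 0
      · rw [h0]; linarith
      · have hπ : π s = a := by
          by_contra hne; exact h0 (by simp [MDP.occ, hne])
        subst hπ
        have h1 := klTrans_mixture_le hτ.le hτ1 hkt (s := s) (a := π s)
          (hac s (by simpa [MDP.occ] using h0))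
        have h2 : klReward f k s (π s) = klReward f g s (π s) := by simp [klReward, hkr]
        have h3 := occ_nonneg f π s (π s)
        have h4 := occ_le_one f π s (π s)
        rw [h2]
        nlinarith
    have := Finset.sum_le_sum fun s (_ : s ∈ Finset.univ) =>
      Finset.sum_le_sum fun a (_ : a ∈ (Finset.univ : Finset A)) => hterm s a
    simp only [Finset.sum_add_distrib, Finset.sum_const, Finset.card_univ, nsmul_eq_mul] at this
    unfold klReal
    linarith

theorem sum_ofReal_mul_klDiv (hR : RewardCondition 𝓡) {f g : MDP A sk ν}
    (hf : ∀ s a, f.reward s a ∈ 𝓡) (hg : ∀ s a, g.reward s a ∈ 𝓡) {w : Policy S A → ℝ}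
    (hw : ∀ π, 0 ≤ w π) (hac : ∀ π, w π ≠ 0 → TransAC f g π) :
    ∑ π, ENNReal.ofReal (w π) * klDiv (trajLaw f π) (trajLaw g π) =
      ENNReal.ofReal (∑ π, w π * klReal f g π) ∧ ∀ π, 0 ≤ w π * klReal f g π := by
  have h0 : ∀ π, 0 ≤ w π * klReal f g π := fun π => by
    by_cases h : w π = 0
    · simp [h]
    · exact mul_nonneg (hw π) (klReal_nonneg hR hf hg (hac π h))
  refine ⟨?_, h0⟩
  rw [ENNReal.ofReal_sum_of_nonneg fun π _ => h0 π]
  refine Finset.sum_congr rfl fun π _ => ?_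
  by_cases h : w π = 0
  · simp [h]
  · rw [klDiv_eq_klReal hR hf hg (hac π h), ENNReal.ofReal_mul (hw π)]

/-- Only the alternatives at finite relative entropy matter. -/
theorem feasible_iff (hR : RewardCondition 𝓡)
    (hint : ∀ g ∈ 𝓡, Integrable (fun x : ℝ => x) g.law) {f : MDP A sk ν}
    (hf : f ∈ instances A sk 𝓡) {M : ℝ} {w : Policy S A → ℝ} :
    Feasible 𝓡 f M w ↔ (∀ π, 0 ≤ w π ∧ w π ≤ M) ∧
      ∀ g ∈ alternatives 𝓡 f, (∀ π, TransAC f g π) → 1 ≤ ∑ π, w π * klReal f g π := by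
  refine ⟨fun ⟨h1, h2⟩ => ⟨h1, fun g hg hac => ?_⟩, fun ⟨h1, h2⟩ => ⟨h1, fun g hg => ?_⟩⟩
  · have := h2 g hg
    rw [(sum_ofReal_mul_klDiv hR hf.1 hg.1.1 (fun π => (h1 π).1) fun π _ => hac π).1] at this
    exact ENNReal.one_le_ofReal.1 this
  · by_cases hac : ∀ π, w π ≠ 0 → TransAC f g π
    · rw [(sum_ofReal_mul_klDiv hR hf.1 hg.1.1 (fun π => (h1 π).1) hac).1, ENNReal.one_le_ofReal]
      obtain ⟨τ₀, hτ0, hτ1, hmix⟩ := exists_mixture_mem_alternatives hint hg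
      set K : ℝ := ∑ π, w π * (Fintype.card S * Fintype.card A)
      -- A constraint whose divergences are finite for all positive weights is the limit, as `τ →
      -- 0`, of the constraints of the mixtures, which have finite divergence for every decision.
      have hlim : Tendsto (fun τ : ℝ => ∑ π, w π * klReal f g π + K * -Real.log (1 - τ))
          (𝓝[>] 0) (𝓝 (∑ π, w π * klReal f g π)) := by
        have hc : ContinuousAt (fun τ : ℝ =>
            ∑ π, w π * klReal f g π + K * -Real.log (1 - τ)) 0 := by
          refine ContinuousAt.add continuousAt_const (continuousAt_const.mul (ContinuousAt.neg ?_))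
          exact ContinuousAt.log (by fun_prop) (by norm_num)
        have := hc.tendsto
        simp only [sub_zero, Real.log_one, neg_zero, mul_zero, add_zero] at this
        exact this.mono_left nhdsWithin_le_nhds
      refine ge_of_tendsto hlim ?_
      filter_upwards [Ioc_mem_nhdsGT hτ0] with τ hτ
      obtain ⟨k, hk, hkac, hkle⟩ := hmix τ hτ.1 hτ.2
      refine (h2 k hk hkac).trans ?_
      rw [Finset.sum_mul, ← Finset.sum_add_distrib]
      refine Finset.sum_le_sum fun π _ => ?_
      by_cases h : w π = 0
      · simp [h]
      · have := mul_le_mul_of_nonneg_left (hkle π (hac π h)) (h1 π).1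
        linarith
    -- A positive weight on an infinite divergence satisfies the constraint trivially.
    · push Not at hac
      obtain ⟨π, hπ, hn⟩ := hac
      refine le_trans ?_ (Finset.single_le_sum (f := fun π =>
        ENNReal.ofReal (w π) * klDiv (trajLaw f π) (trajLaw g π)) (fun _ _ => zero_le)
        (Finset.mem_univ π))
      have hpos : ENNReal.ofReal (w π) ≠ 0 := by
        simpa using lt_of_le_of_ne (h1 π).1 (Ne.symm hπ)
      simp only [klDiv_eq_top_of_not_transAC hn, ENNReal.mul_top hpos, le_top]

/-- A feasible program has a solution. -/
theorem exists_isSolution (hR : RewardCondition 𝓡)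
    (hint : ∀ g ∈ 𝓡, Integrable (fun x : ℝ => x) g.law) {f : MDP A sk ν}
    (hf : f ∈ instances A sk 𝓡) {M : ℝ} {w : Policy S A → ℝ} (hw : Feasible 𝓡 f M w) :
    ∃ w, IsSolution 𝓡 f M w := by
  let F : Set (Policy S A → ℝ) := {w | Feasible 𝓡 f M w}
  -- Once the infinite divergences are discarded, the feasible set is a box cut by closed
  -- half-spaces. In the original form, `0 * ∞ = 0` makes closedness unclear.
  have hF : F = Set.Icc 0 (fun _ => M) ∩ ⋂ g ∈ alternatives 𝓡 f, ⋂ (_ : ∀ π, TransAC f g π),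
      {w | 1 ≤ ∑ π, w π * klReal f g π} := by
    ext w
    simp only [F, Set.mem_ofPred_eq, feasible_iff hR hint hf, Set.mem_inter_iff, Set.mem_Icc,
      Set.mem_iInter, Pi.le_def, Pi.zero_apply, forall_and]
  have hc : IsCompact F := by
    rw [hF]
    refine isCompact_Icc.inter_right (isClosed_iInter fun g => isClosed_iInter fun _ =>
      isClosed_iInter fun _ => isClosed_le continuous_const (by fun_prop))
  obtain ⟨w₀, h1, h2⟩ := hc.exists_isMinOn (f := cost f) ⟨w, hw⟩ (by unfold cost; fun_prop)
  exact ⟨w₀, h1, fun w' hw' => h2 hw'⟩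

theorem cost_nonneg (f : MDP A sk ν) {w : Policy S A → ℝ} (hw : ∀ π, 0 ≤ w π) : 0 ≤ cost f w :=
  Finset.sum_nonneg fun π _ => mul_nonneg (hw π) (gap_nonneg f π)

/-- A larger box has more feasible points, so the limit is an infimum and a strict upper bound is
beaten by one feasible point in one box. -/
theorem exists_feasible_of_complexity_lt {f : MDP A sk ν} {K : ℝ≥0∞}
    (h : complexity 𝓡 f < K) :
    ∃ (n : ℕ) (w : Policy S A → ℝ), Feasible 𝓡 f n w ∧ ENNReal.ofReal (cost f w) < K := by
  have hanti : Antitone fun n : ℕ => complexityAt 𝓡 f n := fun n m hnm => by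
    refine le_iInf₂ fun w hw => iInf₂_le w ⟨fun π => ⟨(hw.1 π).1, (hw.1 π).2.trans ?_⟩, hw.2⟩
    exact_mod_cast hnm
  rw [complexity, (tendsto_atTop_iInf hanti).limUnder_eq, iInf_lt_iff] at h
  obtain ⟨n, hn⟩ := h
  simp only [complexityAt, iInf_lt_iff] at hn
  obtain ⟨w, hw, hK⟩ := hn
  exact ⟨n, w, hw, hK⟩

/-- A slight multiple of a feasible point is feasible for every close instance. -/
theorem exists_feasible_smul (hR : RewardCondition 𝓡)
    (hint : ∀ g ∈ 𝓡, Integrable (fun x : ℝ => x) g.law) {f : MDP A sk ν}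
    (hf : f ∈ instances A sk 𝓡) {M₀ θ : ℝ} {w : Policy S A → ℝ} (hw : Feasible 𝓡 f M₀ w)
    (hθ : 0 < θ) : ∃ δ₀ : ℝ, 0 < δ₀ ∧ ∀ g : MDP A sk ν, (∀ s a, g.reward s a ∈ 𝓡) →
      ∀ δ : ℝ, 0 < δ → δ ≤ δ₀ → IsClose f g δ δ → ∀ M, (1 + θ) * M₀ ≤ M →
      Feasible 𝓡 g M fun π => (1 + θ) * w π := by
  obtain ⟨C, c, δ₁, -, -, hδ1, hδ12, hst⟩ := exists_isClose_stability hR hint hf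
  obtain ⟨D, hD, hkl⟩ := exists_klDiv_ge (A := A) hR sk
  set W : ℝ := ∑ π, w π with hW
  have hW0 : 0 ≤ W := Finset.sum_nonneg fun π _ => (hw.1 π).1
  have hlim : Tendsto (fun δ : ℝ => (1 + θ) * (1 - D * δ - D * Real.sqrt δ * W)) (𝓝[>] 0)
      (𝓝 (1 + θ)) := by
    have hc : Continuous fun δ : ℝ => (1 + θ) * (1 - D * δ - D * Real.sqrt δ * W) := by fun_prop
    have := hc.tendsto 0
    simp only [mul_zero, sub_zero, Real.sqrt_zero, zero_mul, mul_one] at this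
    exact this.mono_left nhdsWithin_le_nhds
  -- The slack `θ` pays for the relative and the additive loss in the divergences, where `W` is the
  -- total weight.
  have hev := hlim.eventually (lt_mem_nhds (show (1 : ℝ) < 1 + θ by linarith))
  obtain ⟨δ₂, hδ2, hsub⟩ := mem_nhdsGT_iff_exists_Ioc_subset.1 hev
  refine ⟨min δ₁ δ₂, lt_min hδ1 hδ2, fun g hg δ hδ hδ0 hcl M hM => ⟨fun π => ⟨?_, ?_⟩, ?_⟩⟩
  · exact mul_nonneg (by linarith) (hw.1 π).1
  · exact (mul_le_mul_of_nonneg_left (hw.1 π).2 (by linarith)).trans hM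
  intro k hk
  obtain ⟨hgi, hopt, -⟩ := hst g hg δ hδ (hδ0.trans (min_le_left _ _)) hcl
  have hδ12' : δ ≤ 1 / 2 := (hδ0.trans (min_le_left _ _)).trans hδ12
  have hk' : k ∈ alternatives 𝓡 f := ⟨hk.1, by rw [← hopt]; exact hk.2⟩
  have hlow := hw.2 k hk'
  have h1 : (1 : ℝ) < (1 + θ) * (1 - D * δ - D * Real.sqrt δ * W) :=
    hsub ⟨hδ, hδ0.trans (min_le_right _ _)⟩
  set X := ∑ π, ENNReal.ofReal (w π) * klDiv (trajLaw g π) (trajLaw k π) with hX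
  have h2 : ENNReal.ofReal (1 - D * δ) ≤ X + ENNReal.ofReal (D * Real.sqrt δ * W) := by
    calc ENNReal.ofReal (1 - D * δ) ≤ ENNReal.ofReal (1 - D * δ) *
          ∑ π, ENNReal.ofReal (w π) * klDiv (trajLaw f π) (trajLaw k π) := by
          simpa using mul_le_mul' (le_refl (ENNReal.ofReal (1 - D * δ))) hlow
      _ = ∑ π, ENNReal.ofReal (w π) *
          (ENNReal.ofReal (1 - D * δ) * klDiv (trajLaw f π) (trajLaw k π)) := by
          rw [Finset.mul_sum]
          exact Finset.sum_congr rfl fun π _ => by ring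
      _ ≤ ∑ π, ENNReal.ofReal (w π) *
          (klDiv (trajLaw g π) (trajLaw k π) + ENNReal.ofReal (D * Real.sqrt δ)) := by
          gcongr with π _
          exact hkl f g k hf.1 hg hk.1.1 δ hδ hδ12' hcl π
      _ = _ := by
          simp only [mul_add, Finset.sum_add_distrib, ← Finset.sum_mul]
          rw [← ENNReal.ofReal_sum_of_nonneg fun π _ => (hw.1 π).1,
            ENNReal.ofReal_mul' hW0, mul_comm (ENNReal.ofReal (∑ π, w π))]
  have h3 : ENNReal.ofReal (1 - D * δ - D * Real.sqrt δ * W) ≤ X := by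
    rw [ENNReal.ofReal_sub _ (by positivity)]
    exact tsub_le_iff_right.2 h2
  calc (1 : ℝ≥0∞) ≤ ENNReal.ofReal ((1 + θ) * (1 - D * δ - D * Real.sqrt δ * W)) :=
        ENNReal.one_le_ofReal.2 h1.le
    _ = ENNReal.ofReal (1 + θ) * ENNReal.ofReal (1 - D * δ - D * Real.sqrt δ * W) :=
        ENNReal.ofReal_mul (by linarith)
    _ ≤ ENNReal.ofReal (1 + θ) * X := by gcongr
    _ = _ := by
        rw [hX, Finset.mul_sum]
        refine Finset.sum_congr rfl fun π _ => ?_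
        rw [ENNReal.ofReal_mul (by linarith), mul_assoc]

/-- The solutions of the program of a close instance are feasible and almost optimal. -/
theorem exists_cost_le (hR : RewardCondition 𝓡)
    (hint : ∀ g ∈ 𝓡, Integrable (fun x : ℝ => x) g.law) {f : MDP A sk ν}
    (hf : f ∈ instances A sk 𝓡) {K : ℝ} (hK : complexity 𝓡 f < ENNReal.ofReal K) :
    ∃ C c δ₀ M₀ : ℝ, 0 ≤ C ∧ 0 < c ∧ 0 < δ₀ ∧ δ₀ ≤ 1 / 2 ∧ 1 ≤ M₀ ∧
      ∀ g : MDP A sk ν, (∀ s a, g.reward s a ∈ 𝓡) →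
      ∀ δ : ℝ, 0 < δ → δ ≤ δ₀ → IsClose f g δ δ → ∀ M, M₀ ≤ M →
      (∃ w, IsSolution 𝓡 g M w) ∧
      ∀ w, IsSolution 𝓡 g M w → cost f w ≤ K + C * (M * δ ^ c) := by
  obtain ⟨n, w, hw, hwK⟩ := exists_feasible_of_complexity_lt hK
  have hw0 : ∀ π, 0 ≤ w π := fun π => (hw.1 π).1
  have hK0 : 0 < K := ENNReal.ofReal_pos.1 (zero_le.trans_lt hK)
  have hcK : cost f w < K := (ENNReal.ofReal_lt_ofReal_iff hK0).1 hwK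
  have hc0 := cost_nonneg f hw0
  -- The strict inequality `cost f w < K` leaves room for the factor `1 + θ`; the denominator is
  -- shifted by one because the cost may be zero.
  obtain ⟨θ, hθ, hθK⟩ : ∃ θ : ℝ, 0 < θ ∧ (1 + θ) * cost f w ≤ K := by
    refine ⟨(K - cost f w) / (cost f w + 1), by
      have : 0 < K - cost f w := by linarith
      positivity, ?_⟩
    have : (K - cost f w) / (cost f w + 1) * cost f w ≤ K - cost f w := by
      rw [div_mul_eq_mul_div, div_le_iff₀ (by linarith)]
      nlinarith
    linarith
  obtain ⟨C, c, δ₁, hC, hc, hδ1, hδ12, hst⟩ := exists_isClose_stability hR hint hf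
  obtain ⟨δ₂, hδ2, hfe⟩ := exists_feasible_smul hR hint hf hw hθ
  refine ⟨2 * (Fintype.card (Policy S A) * C), c, min δ₁ δ₂, max 1 ((1 + θ) * n), by positivity,
    hc, lt_min hδ1 hδ2, (min_le_left _ _).trans hδ12, le_max_left _ _,
    fun g hg δ hδ hδ0 hcl M hM => ?_⟩
  obtain ⟨hgi, hopt, hgap⟩ := hst g hg δ hδ (hδ0.trans (min_le_left _ _)) hcl
  have hfeas := hfe g hg δ hδ (hδ0.trans (min_le_right _ _)) hcl M ((le_max_right _ _).trans hM)
  refine ⟨exists_isSolution hR hint hgi hfeas, fun v hv => ?_⟩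
  have hdiff : ∀ u : Policy S A → ℝ, (∀ π, 0 ≤ u π ∧ u π ≤ M) →
      |cost f u - cost g u| ≤ Fintype.card (Policy S A) * C * (M * δ ^ c) := fun u hu => by
    rw [cost, cost, ← Finset.sum_sub_distrib]
    refine (Finset.abs_sum_le_sum_abs _ _).trans ?_
    have : ∀ π ∈ Finset.univ, |u π * gap f π - u π * gap g π| ≤ C * (M * δ ^ c) := fun π _ => by
      rw [← mul_sub, abs_mul, abs_of_nonneg (hu π).1]
      calc u π * |gap f π - gap g π| ≤ M * (C * δ ^ c) :=
            mul_le_mul (hu π).2 (hgap π) (abs_nonneg _) ((hu π).1.trans (hu π).2)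
        _ = _ := by ring
    refine (Finset.sum_le_card_nsmul _ _ _ this).trans (le_of_eq ?_)
    rw [Finset.card_univ, nsmul_eq_mul]
    ring
  -- Compare `v` under `f` and `g`, use its optimality under `g` against `(1 + θ) w`, and go back to
  -- `f`. The two changes of instance explain the factor two.
  have h1 := (abs_le.1 (hdiff v hv.1.1)).2
  have h2 := (abs_le.1 (hdiff _ hfeas.1)).1
  have h3 := hv.2 _ hfeas
  have h4 : cost f (fun π => (1 + θ) * w π) = (1 + θ) * cost f w := by
    simp only [cost, Finset.mul_sum, mul_assoc]
  linarith

end Model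

section Model

variable {S A : Type*} [Fintype S] [DecidableEq S] [MeasurableSpace S] [MeasurableSingletonClass S]
  [Fintype A] [DecidableEq A] [MeasurableSpace A] [MeasurableSingletonClass A]
  {H : ℕ} [NeZero H] {sk : Skeleton S H} {ν : Measure ℝ} {𝓡 : Set (RewardDensity ν)}

/-! ### The test accepts good estimates -/

/-- The log-likelihood of the rewards and transitions at `(s, a)`. -/
def logLik (f : MDP A sk ν) {t : ℕ} (h : Hist S A H t) (s : S) (a : A) : ℝ :=
  sumVisits sk h s a (fun x => Real.log ((f.reward s a).dens x)) +
    ∑ s', cntMoves sk h s a s' * Real.log (f.trans s a s').toReal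

variable [SigmaFinite ν] [Nonempty A]

theorem log_likelihood {f g : MDP A sk ν} {η : ℝ} {t : ℕ} {h : Hist S A H t}
    (hg : GoodHist 𝓡 f η h) (hgR : ∀ s a, g.reward s a ∈ 𝓡)
    (hT : ∀ s a, transLik sk h s a (g.trans s a) ≠ 0) :
    likelihood g h ≠ 0 ∧ likelihood g h ≠ ⊤ ∧
      Real.log (likelihood g h).toReal = ∑ s, ∑ a, logLik g h s a := by
  have hr := fun s a => log_rewardLik (sk := sk) (h := h) (s := s) (a := a) (g := g.reward s a)
    fun i hv => hg.pos i s a hv _ (hgR s a)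
  have ht : ∀ s a, 0 < (transLik sk h s a (g.trans s a)).toReal := fun s a =>
    ENNReal.toReal_pos (hT s a) (transLik_ne_top _ _ _ _)
  have h1 : likelihood g h ≠ 0 := by
    rw [likelihood_eq hg.dens]
    exact Finset.prod_ne_zero_iff.2 fun z _ =>
      mul_ne_zero (fun h0 => by have := (hr z.1 z.2).1; rw [h0] at this; simp at this) (hT _ _)
  refine ⟨h1, likelihood_ne_top _ _, ?_⟩
  rw [likelihood_eq hg.dens, ENNReal.toReal_prod, Real.log_prod, Fintype.sum_prod_type]
  · refine Finset.sum_congr rfl fun s _ => Finset.sum_congr rfl fun a _ => ?_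
    rw [ENNReal.toReal_mul, Real.log_mul (hr s a).1.ne' (ht s a).ne', (hr s a).2, logLik,
      toReal_transLik, Real.log_prod]
    · simp only [Real.log_pow]
    · intro s' _ h0
      have := ht s a
      rw [toReal_transLik] at this
      exact Finset.prod_ne_zero_iff.1 this.ne' s' (Finset.mem_univ _) h0
  · intro z _
    rw [ENNReal.toReal_mul]
    exact mul_ne_zero (hr _ _).1.ne' (ht _ _).ne'

/-- The ratio of `g` to `k` is a difference of two log-ratios against `f`. A good history controls
both uniformly over the family, although `g` was estimated and `k` is arbitrary. What remains is to
replace the mean under `f` by the mean under `g`. -/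
theorem logLik_rewards_ge (hR : RewardCondition 𝓡) {C : ℝ} (hC : ∀ f ∈ 𝓡, ∀ g ∈ 𝓡, ∀ k ∈ 𝓡,
      ∀ δ : ℝ, 0 < δ → g.tv f ≤ δ →
      |∫ x, g.logRatio k x ∂f.law - ∫ x, g.logRatio k x ∂g.law| ≤ C * Real.sqrt δ)
    {f g k : MDP A sk ν} (hf : ∀ s a, f.reward s a ∈ 𝓡) (hg : ∀ s a, g.reward s a ∈ 𝓡)
    (hk : ∀ s a, k.reward s a ∈ 𝓡) {δ η : ℝ} (hδ : 0 < δ) {s : S} {a : A}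
    (htv : (g.reward s a).tv (f.reward s a) ≤ δ) {t : ℕ} {h : Hist S A H t}
    (hgood : GoodHist 𝓡 f η h) :
    expVisits f h s a * (klReward g k s a - C * Real.sqrt δ) - 2 * η * t ≤
      sumVisits sk h s a (fun x => Real.log ((g.reward s a).dens x)) -
        sumVisits sk h s a (fun x => Real.log ((k.reward s a).dens x)) := by
  have e1 : sumVisits sk h s a (fun x => Real.log ((g.reward s a).dens x)) -
        sumVisits sk h s a (fun x => Real.log ((k.reward s a).dens x)) =
      sumVisits sk h s a ((g.reward s a).logRatio (f.reward s a)) -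
        sumVisits sk h s a ((k.reward s a).logRatio (f.reward s a)) := by
    rw [← sumVisits_sub, ← sumVisits_sub]
    congr 1
    funext x
    simp [RewardDensity.logRatio]
  have hint : ∀ k ∈ 𝓡, Integrable (k.logRatio (f.reward s a)) (f.reward s a).law := fun k hk => by
    refine ((integrable_logRatio hR (hf s a) hk).neg).congr (ae_of_all _ fun x => ?_)
    simp [RewardDensity.logRatio]
  have e2 : ∫ x, (g.reward s a).logRatio (k.reward s a) x ∂(f.reward s a).law =
      ∫ x, (g.reward s a).logRatio (f.reward s a) x ∂(f.reward s a).law -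
      ∫ x, (k.reward s a).logRatio (f.reward s a) x ∂(f.reward s a).law := by
    rw [← integral_sub (hint _ (hg s a)) (hint _ (hk s a))]
    refine integral_congr_ae (ae_of_all _ fun x => ?_)
    simp [RewardDensity.logRatio]
  have h1 := (abs_le.1 (hgood.rewards s a _ (hg s a))).1
  have h2 := (abs_le.1 (hgood.rewards s a _ (hk s a))).2
  have h3 := (abs_le.1 (hC _ (hf s a) _ (hg s a) _ (hk s a) δ hδ htv)).1
  have h4 := mul_le_mul_of_nonneg_left (show klReward g k s a - C * Real.sqrt δ ≤
    ∫ x, (g.reward s a).logRatio (k.reward s a) x ∂(f.reward s a).law by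
      unfold klReward; linarith) (expVisits_nonneg f h s a)
  rw [e2, mul_sub] at h4
  rw [e1]
  linarith

/-- With relative errors below one, every possible transition has actually been observed. An
alternative of nonzero likelihood must therefore allow it, which makes its divergence finite. -/
theorem trans_ne_zero_of_transLik {f g k : MDP A sk ν} {δ u : ℝ} (hδ1 : δ < 1)
    (hcl : IsClose f g δ δ) {t : ℕ} {h : Hist S A H t} {s : S} {a : A} (hu1 : u < 1)
    (he : 0 < expVisits f h s a) (hh : (sk.layer s : ℕ) + 1 < H)
    (hcnt : ∀ s', |(cntMoves sk h s a s' : ℝ) - expVisits f h s a * (f.trans s a s').toReal| ≤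
      expVisits f h s a * (u * (f.trans s a s').toReal))
    (hT : transLik sk h s a (k.trans s a) ≠ 0) {s' : S} (hs' : g.trans s a s' ≠ 0) :
    k.trans s a s' ≠ 0 := by
  have h1 := toReal_trans_le_of_transLE (by linarith) hcl.trans_ge hh a s'
  have h2 : 0 < (g.trans s a s').toReal := ENNReal.toReal_pos hs' (PMF.apply_ne_top _ _)
  have h3 : 0 < (f.trans s a s').toReal :=
    lt_of_lt_of_le (mul_pos (by linarith) h2) h1
  have h4 := (abs_le.1 (hcnt s')).1
  have h5 : 0 < expVisits f h s a * ((1 - u) * (f.trans s a s').toReal) :=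
    mul_pos he (mul_pos (by linarith) h3)
  have h6 : (0 : ℝ) < cntMoves sk h s a s' := by linarith
  intro h0
  have h7 := Finset.prod_ne_zero_iff.1 hT s' (Finset.mem_univ _)
  rw [h0, zero_pow (by exact_mod_cast h6.ne')] at h7
  exact h7 rfl

/-- The counts follow `f`, and `f` is close to `g`, so the counts agree with the prediction of `g`
up to factors `1 - (u + 2δ)` and `(1 + u) (1 + 2δ)`. Apply `mul_log_sub_log_ge` to each successor
state and sum. -/
theorem logLik_trans_ge {f g k : MDP A sk ν} {δ u : ℝ} (hδ : 0 ≤ δ) (hδ2 : δ ≤ 1 / 2)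
    (hcl : IsClose f g δ δ) {t : ℕ} {h : Hist S A H t} {s : S} {a : A} (hu : 0 ≤ u)
    (he : 0 ≤ expVisits f h s a)
    (hcnt : (sk.layer s : ℕ) + 1 < H → ∀ s', |(cntMoves sk h s a s' : ℝ) -
      expVisits f h s a * (f.trans s a s').toReal| ≤
      expVisits f h s a * (u * (f.trans s a s').toReal))
    (hac : (sk.layer s : ℕ) + 1 < H → ∀ s', g.trans s a s' ≠ 0 → k.trans s a s' ≠ 0) :
    (1 - (u + 2 * δ)) * (expVisits f h s a * klTrans g k s a) -
      3 * (u + 2 * δ) * expVisits f h s a ≤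
      ∑ s', cntMoves sk h s a s' * Real.log (g.trans s a s').toReal -
        ∑ s', cntMoves sk h s a s' * Real.log (k.trans s a s').toReal := by
  set e := expVisits f h s a
  by_cases hh : (sk.layer s : ℕ) + 1 < H
  · have key : ∀ s', (1 - (u + 2 * δ)) * (e * ((g.trans s a s').toReal *
        (Real.log (g.trans s a s').toReal - Real.log (k.trans s a s').toReal))) -
        3 * (u + 2 * δ) * (e * (k.trans s a s').toReal) ≤ cntMoves sk h s a s' *
        (Real.log (g.trans s a s').toReal - Real.log (k.trans s a s').toReal) := fun s' => by
      have c1 := toReal_trans_le_of_transLE (by linarith) hcl.trans_le hh a s'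
      have c2 := toReal_trans_le_of_transLE (by linarith) hcl.trans_ge hh a s'
      have c3 := abs_le.1 (hcnt hh s')
      by_cases h0 : g.trans s a s' = 0
      · have hp0 : 0 ≤ (f.trans s a s').toReal := ENNReal.toReal_nonneg
        rw [h0, ENNReal.toReal_zero] at c1
        have hp : (f.trans s a s').toReal = 0 := by nlinarith
        rw [hp] at c3
        have : (cntMoves sk h s a s' : ℝ) = 0 := by linarith [c3.1, c3.2]
        have : 0 ≤ 3 * (u + 2 * δ) * (e * (k.trans s a s').toReal) := by positivity
        simp only [h0, ENNReal.toReal_zero, zero_mul, mul_zero, *]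
        linarith
      · have hp : 0 < (g.trans s a s').toReal := ENNReal.toReal_pos h0 (PMF.apply_ne_top _ _)
        have hq : 0 < (k.trans s a s').toReal :=
          ENNReal.toReal_pos (hac hh s' h0) (PMF.apply_ne_top _ _)
        set p := (g.trans s a s').toReal
        set r := (f.trans s a s').toReal
        have hr : 0 < r := lt_of_lt_of_le (mul_pos (by linarith) hp) c2
        have hr2 : r ≤ (1 + 2 * δ) * p := by
          have : (1 + 2 * δ) * ((1 - δ) * r) ≤ (1 + 2 * δ) * p :=
            mul_le_mul_of_nonneg_left c1 (by linarith)
          have e : (1 + 2 * δ) * ((1 - δ) * r) = r + r * (δ * (1 - 2 * δ)) := by ring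
          have : 0 ≤ r * (δ * (1 - 2 * δ)) := mul_nonneg hr.le (mul_nonneg hδ (by linarith))
          linarith
        -- If the error exceeds one, the required lower bound on the count is nonpositive and holds
        -- trivially.
        by_cases hu1 : u + 2 * δ ≤ 1
        · refine mul_log_sub_log_ge (by positivity) he hp hq ?_ ?_
          · calc (1 - (u + 2 * δ)) * (e * p) ≤ e * ((1 - u) * ((1 - δ) * p)) := by
                  have : 0 ≤ e * p * (δ + u * δ) := by positivity
                  linarith
              _ ≤ e * ((1 - u) * r) := mul_le_mul_of_nonneg_left
                  (mul_le_mul_of_nonneg_left c2 (by linarith)) he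
              _ ≤ _ := by linarith [c3.1]
          · calc (cntMoves sk h s a s' : ℝ) ≤ e * ((1 + u) * r) := by linarith [c3.2]
              _ ≤ e * ((1 + u) * ((1 + 2 * δ) * p)) := mul_le_mul_of_nonneg_left
                  (mul_le_mul_of_nonneg_left hr2 (by linarith)) he
              _ ≤ _ := by
                  have : 0 ≤ e * p * (u * (1 - 2 * δ) + 2 * δ) :=
                    mul_nonneg (mul_nonneg he hp.le) (add_nonneg
                      (mul_nonneg hu (by linarith)) (by linarith))
                  linarith
        · refine mul_log_sub_log_ge (by positivity) he hp hq ?_ ?_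
          · have : (1 - (u + 2 * δ)) * (e * p) ≤ 0 :=
              mul_nonpos_of_nonpos_of_nonneg (by linarith) (mul_nonneg he hp.le)
            exact this.trans (Nat.cast_nonneg _)
          · calc (cntMoves sk h s a s' : ℝ) ≤ e * ((1 + u) * r) := by linarith [c3.2]
              _ ≤ e * ((1 + u) * ((1 + 2 * δ) * p)) := mul_le_mul_of_nonneg_left
                  (mul_le_mul_of_nonneg_left hr2 (by linarith)) he
              _ ≤ _ := by
                  have : 0 ≤ e * p * (u * (1 - 2 * δ) + 2 * δ) :=
                    mul_nonneg (mul_nonneg he hp.le) (add_nonneg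
                      (mul_nonneg hu (by linarith)) (by linarith))
                  linarith
    have h2 := Finset.sum_le_sum fun s' (_ : s' ∈ Finset.univ) => key s'
    simp only [Finset.sum_sub_distrib, ← Finset.mul_sum, PMF.sum_toReal, mul_one, mul_sub] at h2
    rw [klTrans, if_pos hh]
    simp only [mul_sub, Finset.sum_sub_distrib]
    linarith
  · simp only [klTrans, if_neg hh, cntMoves_eq_zero hh]
    have : 0 ≤ 3 * (u + 2 * δ) * e := by positivity
    simp only [Nat.cast_zero, zero_mul, Finset.sum_const_zero, mul_zero]
    linarith

/-- In its use, `R` and `T` are the reward and transition divergences at a pair, `e` the expected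
visits under `f`, `O` those under `g`, `x = η / κ`, `r = √δ` and `K = H δ`. Errors that multiply a
divergence are kept as a relative loss, since `R` and `T` have no upper bound; the others are
collected in a multiple of `t`. -/
theorem log_lik_arith {e O R T x r t η δ c q C K LR LT : ℝ} (hR : 0 ≤ R) (hT : 0 ≤ T)
    (he0 : 0 ≤ e) (het : e ≤ t) (hO : 0 ≤ O) (hK : 0 ≤ K) (hδ : 0 ≤ δ) (hr : δ ≤ r) (hx : 0 ≤ x)
    (hq : 0 < q) (hC : 0 ≤ C) (hη : η ≤ x) (hsm : c * (x + δ) < 1)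
    (hloss : 1 / q * x + 2 * δ + K ≤ c * (x + δ)) (hocc : (1 - K) * O ≤ e)
    (h1 : e * (R - C * r) - 2 * η * t ≤ LR)
    (h2 : (1 - (1 / q * x + 2 * δ)) * (e * T) - 3 * (1 / q * x + 2 * δ) * e ≤ LT) :
    (1 - c * (x + δ)) * (O * (R + T)) - t * ((3 / q + 6 + C + 2) * (x + r)) ≤ LR + LT := by
  have ht : 0 ≤ t := he0.trans het
  have hr0 : 0 ≤ r := hδ.trans hr
  have hv0 : 0 ≤ 1 / q * x + 2 * δ := by positivity
  have h5 : (1 - c * (x + δ)) * (O * (R + T)) ≤ (1 - (1 / q * x + 2 * δ)) * (e * (R + T)) := by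
    have a1 : (1 - c * (x + δ)) * O ≤ (1 - (1 / q * x + 2 * δ)) * ((1 - K) * O) := by
      rw [← mul_assoc]
      refine mul_le_mul_of_nonneg_right ?_ hO
      have : 0 ≤ (1 / q * x + 2 * δ) * K := mul_nonneg hv0 hK
      linarith only [this, hloss]
    have a2 : (1 - (1 / q * x + 2 * δ)) * ((1 - K) * O) ≤ (1 - (1 / q * x + 2 * δ)) * e :=
      mul_le_mul_of_nonneg_left hocc (by linarith only [hsm, hloss, hK])
    have a3 := mul_le_mul_of_nonneg_right (a1.trans a2) (add_nonneg hR hT)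
    linarith only [a3]
  have h6 : (1 - (1 / q * x + 2 * δ)) * (e * R) ≤ e * R := by
    have : 0 ≤ (1 / q * x + 2 * δ) * (e * R) := by positivity
    linarith only [this]
  have h7 : e * (3 * (1 / q * x + 2 * δ) + C * r) + 2 * η * t ≤
      t * ((3 / q + 6 + C + 2) * (x + r)) := by
    have b1 : 3 * (1 / q * x + 2 * δ) + C * r ≤ 3 / q * x + (6 + C) * r := by
      have : 3 * (1 / q * x) = 3 / q * x := by ring
      linarith only [this, hr]
    have b2 : e * (3 * (1 / q * x + 2 * δ) + C * r) ≤ t * (3 / q * x + (6 + C) * r) :=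
      mul_le_mul het b1 (by positivity) ht
    have b3 : η * t ≤ x * t := mul_le_mul_of_nonneg_right hη ht
    have b4 : 0 ≤ t * (3 / q * r + (6 + C) * x + 2 * r) := by positivity
    linarith only [b2, b3, b4]
  linarith only [h1, h2, h5, h6, h7]

/-- A lower bound on the log-likelihood ratio between an estimate and any other instance. -/
theorem exists_log_likelihood_ge (hR : RewardCondition 𝓡) {f : MDP A sk ν}
    (hf : ∀ s a, f.reward s a ∈ 𝓡) :
    ∃ C : ℝ, 0 < C ∧ ∀ g k : MDP A sk ν, (∀ s a, g.reward s a ∈ 𝓡) →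
      (∀ s a, k.reward s a ∈ 𝓡) → ∀ δ : ℝ, 0 < δ → δ ≤ 1 / 2 → IsClose f g δ δ →
      ∀ κ η : ℝ, 0 < κ → κ ≤ 1 → 0 < η → C * (η / κ + δ) < 1 →
      ∀ (t : ℕ), 0 < t → ∀ h : Hist S A H t, GoodHist 𝓡 f η h →
      (∀ s a, κ * t ≤ expVisits f h s a) → likelihood k h ≠ 0 →
      (∀ π, TransAC g k π) ∧ likelihood g h ≠ 0 ∧
      (1 - C * (η / κ + δ)) * ∑ i, klReal g k (h i).1 - C * t * (η / κ + Real.sqrt δ) ≤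
        Real.log (likelihood g h).toReal - Real.log (likelihood k h).toReal := by
  obtain ⟨q, hq0, hq1, hq⟩ := exists_min_trans f
  obtain ⟨C₁, hC1, hCr⟩ := hR.exists_integral_logRatio_ge
  set c : ℝ := 1 / q + 2 + H with hc
  set SA : ℝ := Fintype.card S * Fintype.card A with hSA
  have hSA0 : 0 ≤ SA := by positivity
  refine ⟨c + SA * (3 / q + 6 + C₁ + 2), by positivity, fun g k hg hk δ hδ hδ2 hcl κ η hκ hκ1 hη
    hsmall t ht h hgood hvis hLk => ?_⟩
  have htr : (0 : ℝ) < t := by exact_mod_cast ht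
  have hsq : δ ≤ Real.sqrt δ := Real.le_sqrt_of_sq_le (by nlinarith)
  have hs0 := Real.sqrt_nonneg δ
  have hηκ : 0 < η / κ := by positivity
  have hηκ' : η ≤ η / κ := by rw [le_div_iff₀ hκ]; nlinarith
  set u : ℝ := η / (κ * q) with hu
  have hu' : u = 1 / q * (η / κ) := by rw [hu]; field_simp
  have hu0 : 0 ≤ u := by positivity
  have hcC : c ≤ c + SA * (3 / q + 6 + C₁ + 2) := by
    have : 0 ≤ SA * (3 / q + 6 + C₁ + 2) := by positivity
    linarith
  have hloss : u + 2 * δ + H * δ ≤ c * (η / κ + δ) := by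
    rw [hu', hc]
    have : 0 ≤ (2 + H : ℝ) * (η / κ) := by positivity
    have : 0 ≤ 1 / q * δ := by positivity
    linarith
  have hloss2 : c * (η / κ + δ) ≤ (c + SA * (3 / q + 6 + C₁ + 2)) * (η / κ + δ) :=
    mul_le_mul_of_nonneg_right hcC (by positivity)
  have hu1 : u < 1 := by
    have : 0 ≤ (2 : ℝ) * δ + H * δ := by positivity
    linarith
  have hepos : ∀ s a, 0 < expVisits f h s a := fun s a =>
    lt_of_lt_of_le (by positivity) (hvis s a)
  have hcnt := fun s a hh => (hgood.abs_cntMoves_sub_le hκ hη.le hq0 hq (hvis s a) hh).1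
  have hTk : ∀ s a, transLik sk h s a (k.trans s a) ≠ 0 := fun s a => by
    rw [likelihood_eq hgood.dens] at hLk
    exact right_ne_zero_of_mul (Finset.prod_ne_zero_iff.1 hLk (s, a) (Finset.mem_univ _))
  have hac : ∀ s a, (sk.layer s : ℕ) + 1 < H → ∀ s', g.trans s a s' ≠ 0 → k.trans s a s' ≠ 0 :=
    fun s a hh s' hs' => trans_ne_zero_of_transLik (by linarith) hcl hu1 (hepos s a) hh
      (hcnt s a hh) (hTk s a) hs'
  have hTg : ∀ s a, transLik sk h s a (g.trans s a) ≠ 0 := fun s a => by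
    refine Finset.prod_ne_zero_iff.2 fun s' _ => ?_
    by_cases h0 : cntMoves sk h s a s' = 0
    · simp [h0]
    · refine pow_ne_zero _ fun hg0 => ?_
      obtain ⟨i, hi⟩ := Finset.card_pos.1 (Nat.pos_of_ne_zero h0)
      have hm := (Finset.mem_filter.1 hi).2
      have hfne := trans_ne_zero_of_moves (hgood.dens i) hm
      have hh : (sk.layer s : ℕ) + 1 < H := by
        by_contra hh
        exact h0 (cntMoves_eq_zero hh a s')
      have := hcl.trans_le s a s' hh
      rw [hg0, nonpos_iff_eq_zero, mul_eq_zero] at this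
      rcases this with h1 | h1
      · rw [ENNReal.ofReal_eq_zero] at h1; linarith
      · exact hfne h1
  obtain ⟨hLg, -, elg⟩ := log_likelihood hgood hg hTg
  obtain ⟨-, -, elk⟩ := log_likelihood hgood hk hTk
  have hgac : ∀ π, TransAC g k π := fun π s _ hh s' hs' => hac s (π s) hh s' hs'
  refine ⟨hgac, hLg, ?_⟩
  rw [elg, elk, ← Finset.sum_sub_distrib]
  simp only [← Finset.sum_sub_distrib]
  have hD : ∀ s a, 0 ≤ klReward g k s a + klTrans g k s a := fun s a =>
    add_nonneg (klReward_nonneg hR hg hk s a) (klTrans_nonneg (hac s a))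
  have hterm : ∀ s a, (1 - c * (η / κ + δ)) *
      (∑ i, g.occ (h i).1 s a * (klReward g k s a + klTrans g k s a)) -
      t * ((3 / q + 6 + C₁ + 2) * (η / κ + Real.sqrt δ)) ≤
      logLik g h s a - logLik k h s a := fun s a => by
    have h1 := logLik_rewards_ge hR (fun f hf g hg k hk δ hδ htv => (hCr f hf g hg k hk δ hδ htv).1)
      hf hg hk hδ (hcl.tv_le s a) hgood
    have h2 := logLik_trans_ge hδ.le hδ2 hcl hu0 (hepos s a).le (hcnt s a) (hac s a)
    have h3 := expVisits_le f h s a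
    have h4 := klReward_nonneg hR hg hk s a
    have hocc : (1 - H * δ) * ∑ i, g.occ (h i).1 s a ≤ expVisits f h s a := by
      rw [expVisits, Finset.mul_sum]
      refine Finset.sum_le_sum fun i _ => ?_
      have b1 := hcl.trans_ge.visitProb_le (by linarith) (by linarith) (h i).1 s
      have b2 : 1 - H * δ ≤ (1 - δ) ^ H := by
        have := one_add_mul_le_pow (a := -δ) (by linarith) H
        have e : 1 + -δ = 1 - δ := by ring
        rw [e] at this
        linarith
      unfold MDP.occ
      split_ifs
      · exact (mul_le_mul_of_nonneg_right b2 (visitProb_nonneg _ _ _)).trans b1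
      · simp
    rw [← Finset.sum_mul]
    rw [hu'] at h2 hloss
    have h5 := log_lik_arith h4 (klTrans_nonneg (hac s a)) (hepos s a).le h3
      (Finset.sum_nonneg fun i _ => occ_nonneg g (h i).1 s a) (by positivity) hδ.le hsq hηκ.le hq0
      hC1 hηκ' (lt_of_le_of_lt hloss2 hsmall) hloss hocc h1 h2
    unfold logLik
    linarith only [h5]
  have hsum := Finset.sum_le_sum fun s (_ : s ∈ Finset.univ) =>
    Finset.sum_le_sum fun a (_ : a ∈ (Finset.univ : Finset A)) => hterm s a
  simp only [Finset.sum_sub_distrib, Finset.sum_const, Finset.card_univ, nsmul_eq_mul,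
    ← Finset.mul_sum] at hsum
  have hkl : ∑ i, klReal g k (h i).1 =
      ∑ s, ∑ a, ∑ i, g.occ (h i).1 s a * (klReward g k s a + klTrans g k s a) := by
    unfold klReal
    rw [Finset.sum_comm]
    refine Finset.sum_congr rfl fun s _ => ?_
    rw [Finset.sum_comm]
  have hkl0 : 0 ≤ ∑ i, klReal g k (h i).1 :=
    Finset.sum_nonneg fun i _ => klReal_nonneg hR hg hk (hgac _)
  rw [← hkl] at hsum
  have h8 : (1 - (c + SA * (3 / q + 6 + C₁ + 2)) * (η / κ + δ)) * ∑ i, klReal g k (h i).1 ≤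
      (1 - c * (η / κ + δ)) * ∑ i, klReal g k (h i).1 :=
    mul_le_mul_of_nonneg_right (by linarith) hkl0
  have h9 : (Fintype.card S : ℝ) * (Fintype.card A *
      (t * ((3 / q + 6 + C₁ + 2) * (η / κ + Real.sqrt δ)))) ≤
      (c + SA * (3 / q + 6 + C₁ + 2)) * t * (η / κ + Real.sqrt δ) := by
    have : 0 ≤ c * t * (η / κ + Real.sqrt δ) := by positivity
    rw [hSA]
    linarith
  simp only [Finset.sum_sub_distrib]
  linarith

/-- The test accepts a good estimate after enough plays. -/
theorem exists_accepts (hR : RewardCondition 𝓡)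
    (hint : ∀ g ∈ 𝓡, Integrable (fun x : ℝ => x) g.law) {f : MDP A sk ν}
    (hf : ∀ s a, f.reward s a ∈ 𝓡) :
    ∃ C : ℝ, 0 < C ∧ ∀ g ∈ instances A sk 𝓡, ∀ δ : ℝ, 0 < δ → δ ≤ 1 / 2 → IsClose f g δ δ →
      ∀ κ η : ℝ, 0 < κ → κ ≤ 1 → 0 < η → C * (η / κ + δ) < 1 →
      ∀ (M : ℝ) (w : Policy S A → ℝ), Feasible 𝓡 g M w →
      ∀ (n t : ℕ), 0 < n → 0 < t → ∀ θ : ℝ, 0 ≤ θ → ∀ h : Hist S A H t, GoodHist 𝓡 f η h →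
      (∀ s a, κ * t ≤ expVisits f h s a) →
      (∀ π, (1 + θ) * w π * Real.log n ≤ (Finset.univ.filter fun i => (h i).1 = π).card) →
      Real.log n ≤ (1 - C * (η / κ + δ)) * ((1 + θ) * Real.log n) -
        C * t * (η / κ + Real.sqrt δ) →
      Accepts 𝓡 n g h := by
  obtain ⟨C, hC, hmain⟩ := exists_log_likelihood_ge hR hf
  refine ⟨C, hC, fun g hg δ hδ hδ2 hcl κ η hκ hκ1 hη hsmall M w hw n t hn ht θ hθ h hgood hvis
    hplays hlog k hk => ?_⟩
  by_cases hL : likelihood k h = 0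
  · simp [hL]
  obtain ⟨hac, hLg, hge⟩ := hmain g k hg.1 hk.1.1 δ hδ hδ2 hcl κ η hκ hκ1 hη hsmall t ht h hgood
    hvis hL
  have hfe := ((feasible_iff hR hint hg).1 hw).2 k hk hac
  have hln : 0 ≤ Real.log n := Real.log_natCast_nonneg n
  -- Grouping the rounds by decision turns the prescribed numbers of plays into `ln n` times the
  -- constraint of the program.
  have h1 : (1 + θ) * Real.log n ≤ ∑ i, klReal g k (h i).1 := by
    have e : ∑ i, klReal g k (h i).1 =
        ∑ π, ((Finset.univ.filter fun i => (h i).1 = π).card : ℝ) * klReal g k π := by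
      rw [← Finset.sum_fiberwise Finset.univ (fun i => (h i).1)]
      refine Finset.sum_congr rfl fun π _ => ?_
      rw [Finset.sum_congr rfl (g := fun _ => klReal g k π) fun i hi => by
        rw [(Finset.mem_filter.1 hi).2], Finset.sum_const, nsmul_eq_mul]
    rw [e]
    calc (1 + θ) * Real.log n ≤ (1 + θ) * Real.log n * ∑ π, w π * klReal g k π :=
          le_mul_of_one_le_right (by positivity) hfe
      _ = ∑ π, (1 + θ) * w π * Real.log n * klReal g k π := by
          rw [Finset.mul_sum]
          exact Finset.sum_congr rfl fun π _ => by ring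
      _ ≤ _ := Finset.sum_le_sum fun π _ =>
          mul_le_mul_of_nonneg_right (hplays π) (klReal_nonneg hR hg.1 hk.1.1 (hac π))
  have h2 := mul_le_mul_of_nonneg_left h1 (show 0 ≤ 1 - C * (η / κ + δ) by linarith)
  have h3 : Real.log n + Real.log (likelihood k h).toReal ≤ Real.log (likelihood g h).toReal := by
    linarith
  have hk0 : 0 < (likelihood k h).toReal := ENNReal.toReal_pos hL (likelihood_ne_top _ _)
  have hg0 : 0 < (likelihood g h).toReal := ENNReal.toReal_pos hLg (likelihood_ne_top _ _)
  have hn0 : (0 : ℝ) < n := by exact_mod_cast hn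
  rw [← Real.log_mul hn0.ne' hk0.ne', Real.log_le_log_iff (by positivity) hg0] at h3
  rw [← ENNReal.ofReal_toReal (likelihood_ne_top k h), ← ENNReal.ofReal_toReal
    (likelihood_ne_top g h), ← ENNReal.ofReal_natCast, ← ENNReal.ofReal_mul hn0.le]
  exact ENNReal.ofReal_le_ofReal h3

end Model

/-! ### The regret of the upper confidence bound algorithm -/

/-- The width of the confidence interval after `s` plays. -/
def confWidth (V b x s : ℝ) : ℝ := Real.sqrt (2 * V * x / s) + 2 * b * x / s

/-- Bernstein's choice: the minimizer `l = √(2x / (V s))` if it lies in the admissible range, and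
otherwise its end point `1 / b`. The square-root part of the width serves the first case, the linear
part the second. -/
theorem exists_chernoff {V b x s : ℝ} (hV : 0 ≤ V) (hb : 0 ≤ b) (hVb : V ≠ 0 ∨ b ≠ 0)
    (hx : 0 ≤ x) (hs : 0 < s) :
    ∃ l : ℝ, 0 ≤ l ∧ l * b ≤ 1 ∧ x ≤ l * (s * confWidth V b x s) - s * (V * l ^ 2 / 2) := by
  unfold confWidth
  by_cases h1 : V ≠ 0 ∧ Real.sqrt (2 * x / (V * s)) * b ≤ 1
  · have hV0 : 0 < V := lt_of_le_of_ne hV (Ne.symm h1.1)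
    refine ⟨Real.sqrt (2 * x / (V * s)), Real.sqrt_nonneg _, h1.2, ?_⟩
    have e1 : Real.sqrt (2 * x / (V * s)) * Real.sqrt (2 * V * x / s) = 2 * x / s := by
      rw [← Real.sqrt_mul (by positivity)]
      rw [show 2 * x / (V * s) * (2 * V * x / s) = (2 * x / s) ^ 2 by field_simp]
      exact Real.sqrt_sq (by positivity)
    rw [Real.sq_sqrt (by positivity)]
    have e2 : s * (V * (2 * x / (V * s)) / 2) = x := by field_simp
    have e3 : Real.sqrt (2 * x / (V * s)) * (s * (Real.sqrt (2 * V * x / s) + 2 * b * x / s)) =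
        2 * x + Real.sqrt (2 * x / (V * s)) * (s * (2 * b * x / s)) := by
      rw [mul_add, mul_add]
      congr 1
      rw [mul_left_comm, e1]; field_simp
    rw [e2, e3]
    have : 0 ≤ Real.sqrt (2 * x / (V * s)) * (s * (2 * b * x / s)) := by positivity
    linarith
  · have hb0 : 0 < b := by
      refine lt_of_le_of_ne hb fun h0 => h1 ⟨?_, ?_⟩
      · rcases hVb with h | h
        · exact h
        · exact absurd h0.symm h
      · rw [← h0]; simp
    refine ⟨1 / b, by positivity, by field_simp; exact le_rfl, ?_⟩
    have e1 : 1 / b * (s * (Real.sqrt (2 * V * x / s) + 2 * b * x / s)) =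
        1 / b * s * Real.sqrt (2 * V * x / s) + 2 * x := by field_simp
    have h2 : s * (V * (1 / b) ^ 2 / 2) ≤ x := by
      by_cases hV0 : V = 0
      · simp [hV0, hx]
      · have hV1 : 0 < V := lt_of_le_of_ne hV (Ne.symm hV0)
        have h3 : 1 < Real.sqrt (2 * x / (V * s)) * b := by
          by_contra h4; exact h1 ⟨hV0, not_lt.1 h4⟩
        have h4 : 1 / b ≤ Real.sqrt (2 * x / (V * s)) := by
          rw [div_le_iff₀ hb0]; exact h3.le
        have h5 := pow_le_pow_left₀ (by positivity) h4 2
        rw [Real.sq_sqrt (by positivity)] at h5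
        calc s * (V * (1 / b) ^ 2 / 2) ≤ s * (V * (2 * x / (V * s)) / 2) := by gcongr
          _ = x := by field_simp
    have h3 : 0 ≤ 1 / b * s * Real.sqrt (2 * V * x / s) := by positivity
    rw [e1]
    linarith

section Model

variable {S A : Type*} [Fintype S] [DecidableEq S] [MeasurableSpace S] [MeasurableSingletonClass S]
  [Fintype A] [DecidableEq A] [MeasurableSpace A] [MeasurableSingletonClass A]
  {H : ℕ} [NeZero H] {sk : Skeleton S H} {ν : Measure ℝ} {𝓡 : Set (RewardDensity ν)}

/-- The number of plays of a decision. -/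
def numPlays {t : ℕ} (h : Hist S A H t) (π : Policy S A) : ℕ :=
  (Finset.univ.filter fun i => (h i).1 = π).card

/-- The sum of the rewards collected by a decision. -/
def sumPlays {t : ℕ} (h : Hist S A H t) (π : Policy S A) : ℝ :=
  ∑ i ∈ Finset.univ.filter fun i => (h i).1 = π, totalReward (h i).2

theorem numPlays_le {t : ℕ} (h : Hist S A H t) (π : Policy S A) : numPlays h π ≤ t := by
  have := Finset.card_filter_le (Finset.univ : Finset (Fin t)) fun i => (h i).1 = π
  simpa [numPlays] using this

theorem numPlays_snoc {t : ℕ} (h : Hist S A H t) (z : Policy S A × Traj S A H)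
    (π : Policy S A) :
    numPlays (Fin.snoc (α := fun _ => Policy S A × Traj S A H) h z : Hist S A H (t + 1)) π =
      numPlays h π + if z.1 = π then 1 else 0 := by
  unfold numPlays
  rw [Finset.card_filter, Finset.card_filter, Fin.sum_univ_castSucc]
  simp only [Fin.snoc_castSucc, Fin.snoc_last]

theorem measurable_numPlays (t : ℕ) (π : Policy S A) :
    Measurable fun h : Hist S A H t => numPlays h π := by
  have h1 : Measurable fun h : Hist S A H t => ∑ i, if (h i).1 = π then 1 else 0 := by
    refine Finset.measurable_sum _ fun i _ => ?_
    exact (Measurable.of_discrete (f := fun p : Policy S A => if p = π then 1 else 0)).comp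
      (measurable_fst.comp (measurable_pi_apply i))
  refine (congrArg Measurable (funext fun h => ?_)).mpr h1
  rw [numPlays, Finset.card_filter]

variable [SigmaFinite ν] [Nonempty A]

theorem lintegral_prod_le_one {alg : Algorithm S A H} (ha : ∀ t, Measurable (alg t))
    (f : MDP A sk ν) {F : Policy S A → Traj S A H → ℝ≥0∞} (hF : ∀ π, Measurable (F π))
    (h1 : ∀ π, ∫⁻ o, F π o ∂(trajLaw f π) ≤ 1) (t : ℕ) :
    ∫⁻ h, ∏ i, F (h i).1 (h i).2 ∂(historyLaw alg f t) ≤ 1 := by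
  have hFm : Measurable fun z : Policy S A × Traj S A H => F z.1 z.2 :=
    measurable_from_prod_countable_right hF
  induction t with
  | zero =>
    have := isProbabilityMeasure_historyLaw ha f 0
    simp
  | succ t ih =>
    have hP : Measurable fun h : Hist S A H (t + 1) => ∏ i, F (h i).1 (h i).2 :=
      Finset.measurable_prod _ fun i _ => hFm.comp (measurable_pi_apply i)
    rw [lintegral_historyLaw_succ (ha t) f hP]
    refine le_trans (lintegral_mono fun h => ?_) ih
    simp only [Fin.prod_univ_castSucc, Fin.snoc_castSucc, Fin.snoc_last]
    rw [lintegral_const_mul _ (hF _)]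
    exact mul_le_of_le_one_right zero_le (h1 _)

theorem measurable_totalReward : Measurable (totalReward : Traj S A H → ℝ) := by
  unfold totalReward
  fun_prop

/-- Chernoff's bound with an exponential factor in the rounds that play `π` and the factor one in
the others, so no stopping times are needed. The sign `σ` selects the tail. -/
theorem measure_sumPlays_le {alg : Algorithm S A H} (ha : ∀ t, Measurable (alg t))
    {f : MDP A sk ν} {V b : ℝ} (hse : ∀ (π : Policy S A) (l : ℝ), |l| * b ≤ 1 →
      ∫⁻ o, ENNReal.ofReal (Real.exp (l * (totalReward o - value f π))) ∂(trajLaw f π)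
        ≤ ENNReal.ofReal (Real.exp (V * l ^ 2 / 2))) (t s : ℕ) (π : Policy S A) {x d l σ : ℝ}
    (hσ : |σ| = 1) (hl : 0 ≤ l) (hlb : l * b ≤ 1) (hx : x ≤ l * d - s * (V * l ^ 2 / 2)) :
    historyLaw alg f t {h | numPlays h π = s ∧ d < σ * (sumPlays h π - s * value f π)} ≤
      ENNReal.ofReal (Real.exp (-x)) := by
  have hσ2 : σ ^ 2 = 1 := by rw [← sq_abs, hσ, one_pow]
  let F : Policy S A → Traj S A H → ℝ≥0∞ := fun π' o => if π' = π then
    ENNReal.ofReal (Real.exp (σ * l * (totalReward o - value f π) - V * l ^ 2 / 2)) else 1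
  have hF : ∀ π', Measurable (F π') := fun π' => by
    by_cases h : π' = π
    · simp only [F, if_pos h]
      have := measurable_totalReward (S := S) (A := A) (H := H)
      fun_prop
    · simp only [F, if_neg h]; exact measurable_const
  have h1 : ∀ π', ∫⁻ o, F π' o ∂(trajLaw f π') ≤ 1 := fun π' => by
    by_cases h : π' = π
    · subst h
      simp only [F, if_pos rfl]
      have e : ∀ o : Traj S A H, ENNReal.ofReal
          (Real.exp (σ * l * (totalReward o - value f π') - V * l ^ 2 / 2)) =
          ENNReal.ofReal (Real.exp (-(V * l ^ 2 / 2))) *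
            ENNReal.ofReal (Real.exp (σ * l * (totalReward o - value f π'))) := fun o => by
        rw [← ENNReal.ofReal_mul (Real.exp_nonneg _), ← Real.exp_add]
        congr 2; ring
      simp only [e]
      rw [lintegral_const_mul' _ _ ENNReal.ofReal_ne_top]
      refine (mul_le_mul_right (hse π' (σ * l) (by
        rw [abs_mul, hσ, one_mul, abs_of_nonneg hl]; exact hlb)) _).trans ?_
      rw [← ENNReal.ofReal_mul (Real.exp_nonneg _), ← Real.exp_add, mul_pow, hσ2, one_mul,
        neg_add_cancel, Real.exp_zero, ENNReal.ofReal_one]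
    · simp only [F, if_neg h]; simp
  have h2 := lintegral_prod_le_one ha f hF h1 t
  have hFm : Measurable fun z : Policy S A × Traj S A H => F z.1 z.2 :=
    measurable_from_prod_countable_right hF
  have h3 := (mul_meas_ge_le_lintegral (μ := historyLaw alg f t) (f := fun h : Hist S A H t =>
    ∏ i, F (h i).1 (h i).2) (Finset.measurable_prod _ fun i _ =>
      hFm.comp (measurable_pi_apply i)) (ENNReal.ofReal (Real.exp x))).trans h2
  have hsub : {h : Hist S A H t | numPlays h π = s ∧ d < σ * (sumPlays h π - s * value f π)} ⊆
      {h | ENNReal.ofReal (Real.exp x) ≤ ∏ i, F (h i).1 (h i).2} := by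
    rintro h ⟨e1, e2⟩
    simp only [Set.mem_ofPred_eq, F]
    rw [Finset.prod_ite, Finset.prod_const_one, mul_one,
      ← ENNReal.ofReal_prod_of_nonneg fun _ _ => Real.exp_nonneg _, ← Real.exp_sum]
    refine ENNReal.ofReal_le_ofReal (Real.exp_le_exp.2 ?_)
    rw [Finset.sum_sub_distrib, ← Finset.mul_sum, Finset.sum_sub_distrib, Finset.sum_const,
      Finset.sum_const, nsmul_eq_mul, nsmul_eq_mul]
    have e3 : (Finset.univ.filter fun i => (h i).1 = π).card = s := e1
    rw [e3]
    have e4 := mul_le_mul_of_nonneg_left e2.le hl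
    unfold sumPlays at e4
    linarith
  have h4 : ENNReal.ofReal (Real.exp x) * historyLaw alg f t
      {h | numPlays h π = s ∧ d < σ * (sumPlays h π - s * value f π)} ≤ 1 :=
    (mul_le_mul_right (measure_mono hsub) _).trans h3
  calc _ = ENNReal.ofReal (Real.exp (-x)) * (ENNReal.ofReal (Real.exp x) * historyLaw alg f t
      {h | numPlays h π = s ∧ d < σ * (sumPlays h π - s * value f π)}) := by
        rw [← mul_assoc, ← ENNReal.ofReal_mul (Real.exp_nonneg _), ← Real.exp_add,
          neg_add_cancel, Real.exp_zero, ENNReal.ofReal_one, one_mul]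
    _ ≤ _ := mul_le_of_le_one_right zero_le h4

theorem measure_confWidth_le {alg : Algorithm S A H} (ha : ∀ t, Measurable (alg t))
    {f : MDP A sk ν} {V b : ℝ} (hV : 0 ≤ V) (hb : 0 ≤ b)
    (hse : ∀ (π : Policy S A) (l : ℝ), |l| * b ≤ 1 →
      ∫⁻ o, ENNReal.ofReal (Real.exp (l * (totalReward o - value f π))) ∂(trajLaw f π)
        ≤ ENNReal.ofReal (Real.exp (V * l ^ 2 / 2))) (t s : ℕ) (hs : 0 < s) (π : Policy S A)
    {x σ : ℝ} (hx : 0 ≤ x) (hσ : |σ| = 1) :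
    historyLaw alg f t {h | numPlays h π = s ∧
      s * confWidth V b x s < σ * (sumPlays h π - s * value f π)} ≤
      ENNReal.ofReal (Real.exp (-x)) := by
  have hs0 : (0 : ℝ) < s := by exact_mod_cast hs
  by_cases hVb : V ≠ 0 ∨ b ≠ 0
  · obtain ⟨l, hl, hlb, hx'⟩ := exists_chernoff hV hb hVb hx hs0
    exact measure_sumPlays_le ha hse t s π hσ hl hlb hx'
  -- With `V = b = 0` the confidence width is zero and `l` is unrestricted. Deviations above `1 / (k
  -- + 1)` are bounded with `l = x (k + 1)`, and the increasing union over `k` keeps the same bound.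
  · push Not at hVb
    obtain ⟨rfl, rfl⟩ := hVb
    let E : ℕ → Set (Hist S A H t) := fun k => {h | numPlays h π = s ∧
      1 / ((k : ℝ) + 1) < σ * (sumPlays h π - s * value f π)}
    have hE : Monotone E := fun j k hjk h hh => by
      refine ⟨hh.1, lt_of_le_of_lt ?_ hh.2⟩
      have : (j : ℝ) ≤ k := by exact_mod_cast hjk
      exact one_div_le_one_div_of_le (by positivity) (by linarith)
    have hsub : {h | numPlays h π = s ∧
        s * confWidth 0 0 x s < σ * (sumPlays h π - s * value f π)} ⊆ ⋃ k, E k := by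
      rintro h ⟨h1, h2⟩
      simp only [confWidth, mul_zero, zero_mul, zero_div, Real.sqrt_zero, add_zero] at h2
      obtain ⟨k, hk⟩ := exists_nat_one_div_lt h2
      exact Set.mem_iUnion.2 ⟨k, h1, hk⟩
    refine (measure_mono hsub).trans ?_
    rw [hE.measure_iUnion]
    refine iSup_le fun k => ?_
    refine measure_sumPlays_le ha hse t s π hσ (l := x * (k + 1)) (by positivity) (by simp) ?_
    have : x * ((k : ℝ) + 1) * (1 / (k + 1)) = x := by field_simp
    rw [this]; simp

/-- All confidence intervals contain the expected rewards. -/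
def ConfValid (V b x : ℝ) (f : MDP A sk ν) {t : ℕ} (h : Hist S A H t) : Prop :=
  ∀ π, numPlays h π ≠ 0 →
    |sumPlays h π / numPlays h π - value f π| ≤ confWidth V b x (numPlays h π)

theorem measure_not_confValid_le {alg : Algorithm S A H} (ha : ∀ t, Measurable (alg t))
    {f : MDP A sk ν} {V b : ℝ} (hV : 0 ≤ V) (hb : 0 ≤ b)
    (hse : ∀ (π : Policy S A) (l : ℝ), |l| * b ≤ 1 →
      ∫⁻ o, ENNReal.ofReal (Real.exp (l * (totalReward o - value f π))) ∂(trajLaw f π)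
        ≤ ENNReal.ofReal (Real.exp (V * l ^ 2 / 2))) (t : ℕ) {x : ℝ} (hx : 0 ≤ x) :
    historyLaw alg f t {h | ¬ ConfValid V b x f h} ≤
      ENNReal.ofReal (2 * Fintype.card (Policy S A) * t * Real.exp (-x)) := by
  let E : Policy S A → Fin t → ℝ → Set (Hist S A H t) := fun π s σ =>
    {h | numPlays h π = (s : ℕ) + 1 ∧ ((s + 1 : ℕ) : ℝ) * confWidth V b x ((s + 1 : ℕ) : ℝ) <
      σ * (sumPlays h π - ((s + 1 : ℕ) : ℝ) * value f π)}
  have hsub : {h : Hist S A H t | ¬ ConfValid V b x f h} ⊆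
      ⋃ π, ⋃ s : Fin t, (E π s 1 ∪ E π s (-1)) := by
    intro h hh
    simp only [ConfValid, Set.mem_ofPred_eq, not_forall, not_le] at hh
    obtain ⟨π, h0, hlt⟩ := hh
    have hN := numPlays_le h π
    refine Set.mem_iUnion.2 ⟨π, Set.mem_iUnion.2 ⟨⟨numPlays h π - 1, by omega⟩, ?_⟩⟩
    have e : numPlays h π - 1 + 1 = numPlays h π := by omega
    have hNr : (0 : ℝ) < numPlays h π := by exact_mod_cast Nat.pos_of_ne_zero h0
    simp only [E, Set.mem_union, Set.mem_ofPred_eq, e, true_and]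
    have e2 : (numPlays h π : ℝ) * (sumPlays h π / numPlays h π - value f π) =
        sumPlays h π - numPlays h π * value f π := by field_simp
    rcases lt_abs.1 hlt with h1 | h1
    · left
      have := mul_lt_mul_of_pos_left h1 hNr
      rw [e2] at this
      linarith
    · right
      have := mul_lt_mul_of_pos_left h1 hNr
      rw [mul_neg, e2] at this
      linarith
  refine (measure_mono hsub).trans ?_
  refine (measure_iUnion_fintype_le _ _).trans ?_
  have hE : ∀ π s σ, |σ| = 1 → historyLaw alg f t (E π s σ) ≤ ENNReal.ofReal (Real.exp (-x)) :=
    fun π s σ hσ => measure_confWidth_le ha hV hb hse t ((s : ℕ) + 1) (Nat.succ_pos _) π hx hσ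
  refine (Finset.sum_le_sum fun π _ => (measure_iUnion_fintype_le _ _).trans
    (Finset.sum_le_sum fun s _ => (measure_union_le _ _).trans (add_le_add
      (hE π s 1 (by simp)) (hE π s (-1) (by simp))))).trans ?_
  simp only [Finset.sum_const, Finset.card_univ, Fintype.card_fin, nsmul_eq_mul]
  rw [← ENNReal.ofReal_add (Real.exp_nonneg _) (Real.exp_nonneg _), ← ENNReal.ofReal_natCast,
    ← ENNReal.ofReal_natCast, ← ENNReal.ofReal_mul (by positivity),
    ← ENNReal.ofReal_mul (by positivity)]
  refine ENNReal.ofReal_le_ofReal (le_of_eq (by ring))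

/-- While the confidence intervals are valid, a sub-optimal decision is played rarely. -/
theorem numPlays_le_of_confValid {V b : ℝ} {alg : Algorithm S A H} (hucb : IsUCB V b alg)
    (hV : 0 ≤ V) (hb : 0 ≤ b) (f : MDP A sk ν) {t : ℕ} {h : Hist S A H t}
    (hval : ConfValid V b (4 * Real.log (t + 1)) f h) (hgap : 0 < gap f (alg t h)) :
    (numPlays h (alg t h) : ℝ) ≤ (32 * V / gap f (alg t h) ^ 2 + 8 * b / gap f (alg t h)) *
      (4 * Real.log (t + 1)) := by
  set π := alg t h with hπ
  set x := 4 * Real.log ((t : ℝ) + 1) with hxdef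
  have hx : 0 ≤ x := mul_nonneg (by norm_num) (Real.log_nonneg (by
    have : (0 : ℝ) ≤ t := Nat.cast_nonneg t
    linarith))
  set Δ := gap f π with hΔ
  by_cases h0 : numPlays h π = 0
  · rw [h0, Nat.cast_zero]; positivity
  have hNr : (0 : ℝ) < numPlays h π := by exact_mod_cast Nat.pos_of_ne_zero h0
  have hidx := hucb.2 t h (optPolicy f)
  rw [← hπ] at hidx
  have e : ∀ π', numPlays h π' ≠ 0 → ucbIndex V b h π' =
      ((sumPlays h π' / numPlays h π' + confWidth V b x (numPlays h π') : ℝ) : EReal) :=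
    fun π' h' => by
      have h'' : (Finset.univ.filter fun i => (h i).1 = π').card ≠ 0 := h'
      simp only [ucbIndex, if_neg h'', sumPlays, numPlays, confWidth, x, add_assoc]
  rw [e π h0] at hidx
  have h1 : numPlays h (optPolicy f) ≠ 0 := fun h1 => by
    have h'' : (Finset.univ.filter fun i => (h i).1 = optPolicy f).card = 0 := h1
    simp only [ucbIndex, if_pos h''] at hidx
    exact EReal.coe_ne_top _ (top_le_iff.1 hidx)
  rw [e _ h1, EReal.coe_le_coe_iff] at hidx
  have h2 := (abs_le.1 (hval _ h1)).1
  have h3 := (abs_le.1 (hval _ h0)).2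
  have h4 : Δ ≤ 2 * confWidth V b x (numPlays h π) := by
    rw [hΔ, gap]; linarith
  by_contra hcon
  rw [not_le] at hcon
  have h5 : 32 * V / Δ ^ 2 * x ≤ numPlays h π := by
    have : 0 ≤ 8 * b / Δ * x := by positivity
    linarith
  have h6 : 2 * b * x / numPlays h π ≤ Δ / 4 := by
    have : 0 ≤ 32 * V / Δ ^ 2 * x := by positivity
    have h7 : 8 * b / Δ * x ≤ numPlays h π := by linarith
    rw [div_le_iff₀ hNr]
    calc 2 * b * x = Δ / 4 * (8 * b / Δ * x) := by field_simp; ring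
      _ ≤ _ := by gcongr
  have h7 : Real.sqrt (2 * V * x / numPlays h π) ≤ Δ / 4 := by
    refine Real.sqrt_le_iff.2 ⟨by positivity, ?_⟩
    rw [div_le_iff₀ hNr]
    calc 2 * V * x = (Δ / 4) ^ 2 * (32 * V / Δ ^ 2 * x) := by field_simp; ring
      _ ≤ _ := by gcongr
  have h8 : 32 * V / Δ ^ 2 * x + 8 * b / Δ * x < numPlays h π := by linarith
  -- Both parts of the width are at most `Δ / 4`, while optimism gives `Δ ≤ 2 * width`. For a
  -- contradiction one inequality must be strict: either the linear part is zero, or the slack in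
  -- the number of plays makes the square-root part strictly smaller.
  rcases eq_or_lt_of_le (show 0 ≤ 8 * b / Δ * x by positivity) with h9 | h9
  · have h10 : 2 * b * x / numPlays h π = 0 := by
      have : b * x = 0 := by
        have h11 : 8 * b / Δ * x = b * x * (8 / Δ) := by ring
        rw [h11] at h9
        rcases mul_eq_zero.1 h9.symm with h | h
        · exact h
        · exact absurd h (by positivity)
      rw [mul_assoc, this]; simp
    unfold confWidth at h4
    linarith
  · have h10 : Real.sqrt (2 * V * x / numPlays h π) < Δ / 4 := by
      rw [Real.sqrt_lt' (by positivity), div_lt_iff₀ hNr]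
      calc 2 * V * x = (Δ / 4) ^ 2 * (32 * V / Δ ^ 2 * x) := by field_simp; ring
        _ < _ := by
            refine mul_lt_mul_of_pos_left ?_ (by positivity)
            linarith
    unfold confWidth at h4
    linarith

/-- The expected number of rounds in which a rarely played decision is played. -/
theorem sum_lintegral_numPlays_le {alg : Algorithm S A H} (ha : ∀ t, Measurable (alg t))
    (f : MDP A sk ν) (π : Policy S A) (L n : ℕ) :
    ∑ t ∈ Finset.range n, ∫⁻ h, (if alg t h = π ∧ numPlays h π ≤ L then 1 else 0)
      ∂(historyLaw alg f t) ≤ (L + 1 : ℕ) := by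
  -- The expected number of plays, truncated at `L + 1`, is a potential: it grows by exactly the
  -- probability of a play counted on the left, and never exceeds `L + 1`.
  let Φ : ℕ → ℝ≥0∞ := fun t =>
    ∫⁻ h, (min (numPlays h π) (L + 1) : ℕ) ∂(historyLaw alg f t)
  have hmin : ∀ t, Measurable fun h : Hist S A H t => ((min (numPlays h π) (L + 1) : ℕ) : ℝ≥0∞) :=
    fun t => (Measurable.of_discrete (f := fun k : ℕ => ((min k (L + 1) : ℕ) : ℝ≥0∞))).comp
      (measurable_numPlays t π)
  have hstep : ∀ t, Φ (t + 1) = Φ t + ∫⁻ h, (if alg t h = π ∧ numPlays h π ≤ L then 1 else 0)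
      ∂(historyLaw alg f t) := fun t => by
    simp only [Φ]
    rw [lintegral_historyLaw_succ (ha t) f (hmin _), ← lintegral_add_left (hmin t)]
    refine lintegral_congr fun h => ?_
    have hp : IsProbabilityMeasure (trajLaw f (alg t h)) := inferInstance
    simp only [numPlays_snoc, lintegral_const, measure_univ, mul_one]
    by_cases h1 : alg t h = π
    · by_cases h2 : numPlays h π ≤ L
      · simp only [h1, h2, if_true, and_self]
        rw [min_eq_left (by omega), min_eq_left (by omega)]
        push_cast
        simp
      · simp only [h1, h2, if_true, and_false, if_false, add_zero]
        rw [min_eq_right (by omega), min_eq_right (by omega)]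
        simp
    · simp [h1]
  have hsum : ∀ n, ∑ t ∈ Finset.range n, ∫⁻ h, (if alg t h = π ∧ numPlays h π ≤ L then 1 else 0)
      ∂(historyLaw alg f t) ≤ Φ n := fun n => by
    induction n with
    | zero => simp
    | succ n ih => rw [Finset.sum_range_succ, hstep]; exact add_le_add ih le_rfl
  refine (hsum n).trans ?_
  have := isProbabilityMeasure_historyLaw ha f n
  calc Φ n ≤ ∫⁻ _, ((L + 1 : ℕ) : ℝ≥0∞) ∂(historyLaw alg f n) :=
        lintegral_mono fun h => Nat.cast_le.2 (min_le_right _ _)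
    _ = _ := by simp

/-- The summands are `t / (t + 1) ^ 4`, at most the telescoping `1 / ((t + 1) (t + 2))`. This is why
the confidence level uses four logarithms. -/
theorem sum_mul_exp_le (n : ℕ) :
    ∑ t ∈ Finset.range n, (t : ℝ) * Real.exp (-(4 * Real.log (t + 1))) ≤ 1 - 1 / (n + 1) := by
  induction n with
  | zero => simp
  | succ n ih =>
    rw [Finset.sum_range_succ]
    have h0 : (0 : ℝ) ≤ n := Nat.cast_nonneg n
    have h1 : Real.exp (-(4 * Real.log ((n : ℝ) + 1))) = 1 / ((n : ℝ) + 1) ^ 4 := by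
      rw [Real.exp_neg, mul_comm, Real.exp_mul, Real.exp_log (by positivity)]
      norm_cast
      rw [one_div]
    have h2 : (n : ℝ) * (1 / ((n : ℝ) + 1) ^ 4) ≤ 1 / ((n + 1) * (n + 2)) := by
      rw [mul_one_div, div_le_div_iff₀ (by positivity) (by positivity)]
      have : 0 ≤ ((n : ℝ) + 1) * ((n : ℝ) ^ 3 + 2 * n ^ 2 + n + 1) := by positivity
      linarith
    have h3 : 1 / (((n : ℝ) + 1) * (n + 2)) = 1 / (n + 1) - 1 / (n + 2) := by field_simp; ring
    rw [h1]
    push_cast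
    rw [show (n : ℝ) + 1 + 1 = n + 2 by ring]
    linarith

/-- Rounds with an invalid confidence interval have summable probability. In the others a
sub-optimal decision can be played only while its number of plays is below a multiple of `ln n`. -/
theorem hasLogRegret_of_isUCB {V b : ℝ} {alg : Algorithm S A H} (hV : 0 ≤ V) (hb : 0 ≤ b)
    (hse : SubExponentialRewards (A := A) sk 𝓡 V b) (hucb : IsUCB V b alg) {f : MDP A sk ν}
    (hf : f ∈ instances A sk 𝓡) : HasLogRegret alg f := by
  have ha := hucb.1
  set G : ℝ := ∑ π, gap f π with hG
  have hG0 : 0 ≤ G := Finset.sum_nonneg fun π _ => gap_nonneg f π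
  have hGle : ∀ π, gap f π ≤ G := fun π =>
    Finset.single_le_sum (fun π _ => gap_nonneg f π) (Finset.mem_univ π)
  let c : Policy S A → ℝ := fun π => 32 * V / gap f π ^ 2 + 8 * b / gap f π
  have hc : ∀ π, 0 ≤ c π := fun π => by have := gap_nonneg f π; positivity
  set P : ℝ := (Fintype.card (Policy S A) : ℝ)
  refine ⟨G * (2 * P) + ∑ π, gap f π * (c π * 4 + 1), ?_⟩
  filter_upwards [eventually_ge_atTop 3] with n hn
  have hlog : 1 ≤ Real.log n := by
    rw [Real.le_log_iff_exp_le (by positivity)]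
    have : (3 : ℝ) ≤ n := by exact_mod_cast hn
    linarith [Real.exp_one_lt_d9]
  let L : Policy S A → ℕ := fun π => ⌊c π * (4 * Real.log n)⌋₊
  let B : (t : ℕ) → Set (Hist S A H t) := fun t =>
    toMeasurable (historyLaw alg f t) {h | ¬ ConfValid V b (4 * Real.log (t + 1)) f h}
  have hpt : ∀ t < n, ∀ h : Hist S A H t, ENNReal.ofReal (gap f (alg t h)) ≤
      ENNReal.ofReal G * (B t).indicator 1 h + ∑ π, ENNReal.ofReal (gap f π) *
        (if alg t h = π ∧ numPlays h π ≤ L π then 1 else 0) := fun t ht h => by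
    by_cases hB : h ∈ B t
    · rw [Set.indicator_of_mem hB, Pi.one_apply, mul_one]
      exact (ENNReal.ofReal_le_ofReal (hGle _)).trans le_self_add
    · have hval : ConfValid V b (4 * Real.log (t + 1)) f h := by
        by_contra hcon
        exact hB (subset_toMeasurable _ _ hcon)
      rcases eq_or_lt_of_le (gap_nonneg f (alg t h)) with h0 | h0
      · rw [← h0]; simp
      · have h1 := numPlays_le_of_confValid hucb hV hb f hval h0
        have h2 : numPlays h (alg t h) ≤ L (alg t h) := by
          refine Nat.le_floor (h1.trans ?_)
          refine mul_le_mul_of_nonneg_left ?_ (hc _)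
          have : ((t : ℝ) + 1) ≤ n := by exact_mod_cast ht
          have := Real.log_le_log (by positivity) this
          linarith
        refine le_trans ?_ le_add_self
        refine le_trans ?_ (Finset.single_le_sum (f := fun π => ENNReal.ofReal (gap f π) *
          (if alg t h = π ∧ numPlays h π ≤ L π then (1 : ℝ≥0∞) else 0)) (fun _ _ => zero_le)
          (Finset.mem_univ (alg t h)))
        simp [h2]
  have hBm : ∀ t, Measurable fun h : Hist S A H t => (B t).indicator (1 : Hist S A H t → ℝ≥0∞) h :=
    fun t => measurable_one.indicator (measurableSet_toMeasurable _ _)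
  have hIm : ∀ t π, Measurable fun h : Hist S A H t =>
      (if alg t h = π ∧ numPlays h π ≤ L π then (1 : ℝ≥0∞) else 0) := fun t π => by
    refine Measurable.ite ?_ measurable_const measurable_const
    exact ((ha t) (measurableSet_singleton π)).inter
      ((measurable_numPlays t π) (measurableSet_Iic (a := L π)))
  have hBle : ∀ t, historyLaw alg f t (B t) ≤
      ENNReal.ofReal (2 * P * (t * Real.exp (-(4 * Real.log (t + 1))))) := fun t => by
    rw [measure_toMeasurable]
    refine (measure_not_confValid_le ha hV hb (hse f hf) t (mul_nonneg (by norm_num)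
      (Real.log_nonneg (by have : (0 : ℝ) ≤ t := Nat.cast_nonneg t
                           linarith)))).trans
      (ENNReal.ofReal_le_ofReal (le_of_eq (by ring)))
  have hround : ∀ t < n, ∫⁻ h, ENNReal.ofReal (gap f (alg t h)) ∂(historyLaw alg f t) ≤
      ENNReal.ofReal G * ENNReal.ofReal (2 * P * (t * Real.exp (-(4 * Real.log (t + 1))))) +
      ∑ π, ENNReal.ofReal (gap f π) * ∫⁻ h, (if alg t h = π ∧ numPlays h π ≤ L π then 1 else 0)
        ∂(historyLaw alg f t) := fun t ht => by
    refine (lintegral_mono (hpt t ht)).trans ?_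
    rw [lintegral_add_left ((hBm t).const_mul _), lintegral_const_mul _ (hBm t),
      lintegral_indicator_one (measurableSet_toMeasurable _ _),
      lintegral_finsetSum _ fun π _ => (hIm t π).const_mul _]
    simp only [lintegral_const_mul _ (hIm t _)]
    gcongr
    exact hBle t
  have hreg : regret alg f n ≤ ENNReal.ofReal G * ENNReal.ofReal (2 * P) +
      ∑ π, ENNReal.ofReal (gap f π) * ((L π + 1 : ℕ) : ℝ≥0∞) := by
    refine (Finset.sum_le_sum fun t ht => hround t (Finset.mem_range.1 ht)).trans ?_
    rw [Finset.sum_add_distrib, ← Finset.mul_sum, Finset.sum_comm]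
    simp only [← Finset.mul_sum]
    gcongr with π _
    · rw [← ENNReal.ofReal_sum_of_nonneg fun t _ => by positivity, ← Finset.mul_sum]
      refine ENNReal.ofReal_le_ofReal ?_
      refine mul_le_of_le_one_right (by positivity) ((sum_mul_exp_le n).trans ?_)
      have : (0 : ℝ) ≤ 1 / (n + 1) := by positivity
      linarith
    · exact sum_lintegral_numPlays_le ha f π (L π) n
  refine hreg.trans ?_
  have e1 : ∀ π, ENNReal.ofReal (gap f π) * ((L π + 1 : ℕ) : ℝ≥0∞) ≤
      ENNReal.ofReal (gap f π * (c π * 4 + 1) * Real.log n) := fun π => by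
    rw [← ENNReal.ofReal_natCast, ← ENNReal.ofReal_mul (gap_nonneg f π)]
    refine ENNReal.ofReal_le_ofReal ?_
    rw [mul_assoc]
    refine mul_le_mul_of_nonneg_left ?_ (gap_nonneg f π)
    have h1 : (L π : ℝ) ≤ c π * (4 * Real.log n) :=
      Nat.floor_le (mul_nonneg (hc π) (by linarith))
    push_cast
    linarith
  refine (add_le_add_right (Finset.sum_le_sum fun π _ => e1 π) _).trans ?_
  rw [← ENNReal.ofReal_mul hG0, ← ENNReal.ofReal_sum_of_nonneg fun π _ =>
    mul_nonneg (mul_nonneg (gap_nonneg f π) (by linarith [hc π])) (by linarith),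
    ← ENNReal.ofReal_add (by positivity) (Finset.sum_nonneg fun π _ =>
      mul_nonneg (mul_nonneg (gap_nonneg f π) (by linarith [hc π])) (by linarith))]
  refine ENNReal.ofReal_le_ofReal ?_
  rw [← Finset.sum_mul, add_mul]
  have : G * (2 * P) ≤ G * (2 * P) * Real.log n := le_mul_of_one_le_right (by positivity) hlog
  linarith

end Model

section Model

variable {S A : Type*} [Fintype S] [DecidableEq S] [MeasurableSpace S] [MeasurableSingletonClass S]
  [Fintype A] [DecidableEq A] [MeasurableSpace A] [MeasurableSingletonClass A]
  {H : ℕ} [NeZero H] {sk : Skeleton S H} {ν : Measure ℝ} {𝓡 : Set (RewardDensity ν)}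

/-! ### Playing a list of decisions -/

theorem sum_playList {X : Type*} [AddCommMonoid X] (c : Policy S A → ℕ) (φ : Policy S A → X) :
    ∑ i : Fin (playList c).length, φ (playList c)[i] = ∑ π, c π • φ π := by
  refine (Fin.sum_univ_fun_getElem (playList c) φ).trans ?_
  rw [playList, List.map_flatMap, List.flatMap_def, List.sum_flatten, List.map_map]
  simp only [Function.comp_def, List.map_replicate, List.sum_replicate]
  exact Finset.sum_map_toList _ _

theorem length_playList (c : Policy S A → ℕ) : (playList c).length = ∑ π, c π := by
  have := sum_playList c fun _ => 1
  simpa using this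

variable [SigmaFinite ν] [Nonempty A]

theorem regret_playList {alg : Algorithm S A H} (ha : ∀ t, Measurable (alg t)) (f : MDP A sk ν)
    (c : Policy S A → ℕ) (hw : ∀ (s : ℕ) (hs : s < (playList c).length) h,
      alg s h = (playList c)[s]) :
    regret alg f (playList c).length = ∑ π, ENNReal.ofReal (c π * gap f π) := by
  unfold regret
  rw [Finset.sum_range]
  have h1 : ∀ i : Fin (playList c).length,
      ∫⁻ h, ENNReal.ofReal (gap f (alg i h)) ∂(historyLaw alg f i) =
      ENNReal.ofReal (gap f (playList c)[i]) := fun i => by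
    have := isProbabilityMeasure_historyLaw ha f i
    simp only [hw i i.2]
    simp
  simp only [h1]
  rw [sum_playList c fun π => ENNReal.ofReal (gap f π)]
  refine Finset.sum_congr rfl fun π _ => ?_
  rw [ENNReal.ofReal_mul (Nat.cast_nonneg _), ENNReal.ofReal_natCast, nsmul_eq_mul]

theorem ae_numPlays_playList {alg : Algorithm S A H} (ha : ∀ t, Measurable (alg t))
    (f : MDP A sk ν) (c : Policy S A → ℕ) (hw : ∀ (s : ℕ) (hs : s < (playList c).length) h,
      alg s h = (playList c)[s]) :
    ∀ᵐ h ∂(historyLaw alg f (playList c).length), ∀ π, numPlays h π = c π := by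
  have π₀ : Policy S A := Classical.arbitrary _
  have h1 := ae_historyLaw_fst ha f (fun s => (playList c).getD s π₀) (playList c).length
    fun s hs h => by rw [hw s hs h, List.getD_eq_getElem _ _ hs]
  filter_upwards [h1] with h hh π
  have h2 : numPlays h π = ∑ i : Fin (playList c).length, if (playList c)[i] = π then 1 else 0 := by
    rw [numPlays, Finset.card_filter]
    refine Finset.sum_congr rfl fun i _ => ?_
    rw [hh i, List.getD_eq_getElem _ _ i.2]
    rfl
  rw [h2, sum_playList c fun π' => if π' = π then 1 else 0]
  simp

/-! ### The three phases of Test-to-Commit -/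

variable {n : ℕ} {est : Estimator A sk ν n} {plan : MDP A sk ν → Policy S A → ℝ}
  {ucb : Algorithm S A H}

theorem testToCommit_init {s : ℕ} (hs : s < (initList S A n).length) (h : Hist S A H s) :
    testToCommit 𝓡 n est plan ucb s h = (initList S A n)[s] := by
  simp [testToCommit, hs]

theorem shift_testToCommit_ident (x : Hist S A H (initList S A n).length) {s : ℕ}
    (hs : s < (identList n (plan (est x))).length) (h : Hist S A H s) :
    shift (testToCommit 𝓡 n est plan ucb) _ x s h = (identList n (plan (est x)))[s] := by
  have e : (fun i : Fin (initList S A n).length =>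
      (Fin.append x h : Hist S A H _) ⟨i, by omega⟩) = x := by
    funext i
    exact Fin.append_left x h i
  simp only [shift, testToCommit]
  rw [dif_neg (by omega)]
  simp only [e]
  rw [dif_pos (by omega)]
  simp

-- The history is compared with the initialization data `x` coordinate by coordinate, so the
-- data-dependent phase lengths can be written in terms of `x`.
open Classical in
theorem testToCommit_late {t : ℕ} (h : Hist S A H t) (x : Hist S A H (initList S A n).length)
    (ht₀ : (initList S A n).length ≤ t)
    (ht : (initList S A n).length + (identList n (plan (est x))).length ≤ t)
    (hx : ∀ i : Fin (initList S A n).length, h ⟨i, i.2.trans_le ht₀⟩ = x i) :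
    testToCommit 𝓡 n est plan ucb t h =
      if Accepts 𝓡 n (est x) fun i : Fin (identList n (plan (est x))).length =>
        h ⟨(initList S A n).length + i, by omega⟩ then optPolicy (est x)
      else ucb (t - ((initList S A n).length + (identList n (plan (est x))).length)) fun i =>
        h ⟨(initList S A n).length + (identList n (plan (est x))).length + i, by omega⟩ := by
  obtain rfl : (fun i : Fin (initList S A n).length => h ⟨i, i.2.trans_le ht₀⟩) = x := funext hx
  rw [testToCommit, dif_neg (by omega)]
  exact dif_neg (by omega)

open Classical in
theorem shift_shift_testToCommit (x : Hist S A H (initList S A n).length)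
    (z : Hist S A H (identList n (plan (est x))).length) :
    shift (shift (testToCommit 𝓡 n est plan ucb) _ x) _ z =
      if Accepts 𝓡 n (est x) z then fun _ _ => optPolicy (est x) else ucb := by
  funext s h
  have e2 : (fun i : Fin (identList n (plan (est x))).length =>
      (Fin.append x (Fin.append z h) : Hist S A H _)
        ⟨(initList S A n).length + i, by omega⟩) = z := by
    funext i
    refine (Fin.append_right x (Fin.append z h) (Fin.castAdd s i)).trans ?_
    exact Fin.append_left z h i
  have e3 : ∀ (k : ℕ) (hk : k = s) (u : Hist S A H k), (∀ i, u i = h (Fin.cast hk i)) →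
      ucb k u = ucb s h := fun k hk u hu => by
    subst hk
    congr 1
    funext i
    exact hu i
  have e1 := testToCommit_late (𝓡 := 𝓡) (plan := plan) (est := est) (ucb := ucb)
    (Fin.append x (Fin.append z h)) x
    (by omega) (by omega) fun i => Fin.append_left x (Fin.append z h) i
  rw [e2] at e1
  refine e1.trans ?_
  split_ifs with hacc
  · rfl
  · refine e3 _ (by omega) _ fun i => ?_
    have hi : (i : ℕ) < s := by have := i.2; omega
    have h1 := Fin.append_right x (Fin.append z h)
      (Fin.natAdd (identList n (plan (est x))).length ⟨i, hi⟩)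
    rw [Fin.append_right z h ⟨i, hi⟩] at h1
    refine Eq.trans ?_ h1
    congr 1
    ext
    simp [add_assoc]

/-! ### Measurability -/

/-- The numbers of plays in the identification step. -/
def identCount (n : ℕ) (w : Policy S A → ℝ) (π : Policy S A) : ℕ :=
  ⌈((1 + 1 / bound n) * w π + 1 / bound n) * Real.log n⌉₊

theorem identList_eq (n : ℕ) (w : Policy S A → ℝ) : identList n w = playList (identCount n w) := rfl

theorem measurable_testToCommit (hm : MeasurableChoices 𝓡 n est plan)
    (hu : ∀ t, Measurable (ucb t)) (t : ℕ) :
    Measurable (testToCommit 𝓡 n est plan ucb t) := by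
  classical
  by_cases ht : t < (initList S A n).length
  · have : testToCommit 𝓡 n est plan ucb t = fun _ => (initList S A n)[t] := by
      funext h; exact testToCommit_init ht h
    rw [this]; exact measurable_const
  let r : Hist S A H t → Hist S A H (initList S A n).length := fun h i => h ⟨i, by omega⟩
  have hr : Measurable r := by fun_prop
  -- The length of the identification phase depends on the data, but only through a vector of
  -- natural numbers. For each fixed vector the choice is measurable, and there are countably many
  -- vectors.
  let G : (Policy S A → ℕ) → Hist S A H t → Policy S A := fun c h =>
    if h₂ : t < (initList S A n).length + (playList c).length then
      (playList c)[t - (initList S A n).length]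
    else if Accepts 𝓡 n (est (r h)) (fun i : Fin (playList c).length =>
      h ⟨(initList S A n).length + i, by omega⟩) then optPolicy (est (r h))
    else ucb (t - ((initList S A n).length + (playList c).length)) fun i =>
      h ⟨(initList S A n).length + (playList c).length + i, by omega⟩
  have hG : ∀ c, Measurable (G c) := fun c => by
    by_cases h₂ : t < (initList S A n).length + (playList c).length
    · simp only [G, dif_pos h₂]; exact measurable_const
    · simp only [G, dif_neg h₂]
      refine Measurable.ite ?_ (hm.2.1.comp hr) ?_
      · have h1 : Measurable fun h : Hist S A H t => (r h, fun i : Fin (playList c).length =>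
            h ⟨(initList S A n).length + i, by omega⟩) := hr.prodMk (by fun_prop)
        exact h1 (hm.2.2 _)
      · refine (hu _).comp ?_
        fun_prop
  have hc : Measurable fun h : Hist S A H t => identCount n (plan (est (r h))) := by
    refine measurable_pi_lambda _ fun π => ?_
    refine Nat.measurable_ceil.comp ?_
    have := (hm.1 π).comp hr
    exact ((this.const_mul _).add_const _).mul_const _
  have e : testToCommit 𝓡 n est plan ucb t =
      fun h => (fun z : (Policy S A → ℕ) × Hist S A H t => G z.1 z.2)
        (identCount n (plan (est (r h))), h) := by
    funext h
    simp only [testToCommit, dif_neg ht]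
    rfl
  rw [e]
  exact (measurable_from_prod_countable_right
    (f := fun z : (Policy S A → ℕ) × Hist S A H t => G z.1 z.2) hG).comp (hc.prodMk measurable_id)

/-! ### Decomposition of the regret -/

theorem gap_le_sum (f : MDP A sk ν) (π : Policy S A) : gap f π ≤ ∑ π, gap f π :=
  Finset.single_le_sum (fun π _ => gap_nonneg f π) (Finset.mem_univ π)

theorem regret_const (f : MDP A sk ν) (π : Policy S A) (N : ℕ) :
    regret (fun _ _ => π : Algorithm S A H) f N = N * ENNReal.ofReal (gap f π) := by
  unfold regret
  have h1 : ∀ t, ∫⁻ h : Hist S A H t, ENNReal.ofReal (gap f π)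
      ∂(historyLaw (fun _ _ => π : Algorithm S A H) f t) = ENNReal.ofReal (gap f π) := fun t => by
    have := isProbabilityMeasure_historyLaw (alg := (fun _ _ => π : Algorithm S A H))
      (fun _ => measurable_const) f t
    simp
  simp [h1]

/-- For any initialization data the cost is that of the plan, plus `O(1)` for a wrong commitment,
plus the fallback regret weighted by the probability of rejection. Closeness of the estimate is not
used here. -/
theorem regret_shift_testToCommit_le (hm : MeasurableChoices 𝓡 n est plan)
    (hu : ∀ t, Measurable (ucb t)) {f : MDP A sk ν} (hf : f ∈ instances A sk 𝓡)
    (x : Hist S A H (initList S A n).length) :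
    regret (shift (testToCommit 𝓡 n est plan ucb) _ x) f n ≤
      ∑ π, ENNReal.ofReal (identCount n (plan (est x)) π * gap f π) +
      ENNReal.ofReal (∑ π, gap f π) +
      historyLaw (shift (testToCommit 𝓡 n est plan ucb) _ x) f
        (identList n (plan (est x))).length {z | ¬ Accepts 𝓡 n (est x) z} * regret ucb f n := by
  classical
  set alg := shift (testToCommit 𝓡 n est plan ucb) _ x with halg
  have ha : ∀ t, Measurable (alg t) := measurable_shift (measurable_testToCommit hm hu) _ x
  set m := (identList n (plan (est x))).length with hmdef
  have hacc : MeasurableSet {z : Hist S A H m | Accepts 𝓡 n (est x) z} :=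
    (measurable_const.prodMk measurable_id :
      Measurable fun z : Hist S A H m => (x, z)) (hm.2.2 m)
  have hprob := isProbabilityMeasure_historyLaw ha f m
  -- Counting `n` rounds after the phase, rather than the remaining ones, only enlarges the regret.
  have h1 : regret alg f n ≤ regret alg f (m + n) := regret_mono alg f (by omega)
  refine h1.trans ?_
  rw [regret_add ha f m n, add_assoc]
  refine add_le_add (le_of_eq (regret_playList ha f _ fun s hs h =>
    shift_testToCommit_ident x hs h)) ?_
  have h2 : ∀ z : Hist S A H m, regret (shift alg m z) f n ≤
      {z : Hist S A H m | Accepts 𝓡 n (est x) z}.indicator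
        (fun _ => n * ENNReal.ofReal (gap f (optPolicy (est x)))) z +
      {z : Hist S A H m | ¬ Accepts 𝓡 n (est x) z}.indicator (fun _ => regret ucb f n) z :=
    fun z => by
      rw [halg, shift_shift_testToCommit x z]
      by_cases hz : Accepts 𝓡 n (est x) z
      · rw [if_pos hz, regret_const, Set.indicator_of_mem (by exact hz)]
        exact le_self_add
      · rw [if_neg hz, Set.indicator_of_mem (s := {z | ¬ Accepts 𝓡 n (est x) z}) (by exact hz)]
        exact le_add_self
  refine (lintegral_mono h2).trans ?_
  rw [lintegral_add_left (measurable_const.indicator hacc), lintegral_indicator_const hacc,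
    lintegral_indicator_const (by exact hacc.compl)]
  refine add_le_add ?_ (le_of_eq (mul_comm _ _))
  -- A correct commitment is free. For a wrong one, `f` is an alternative to the estimate, so
  -- acceptance implies that the estimate is `n` times as likely as the truth; the probability `1 /
  -- n` cancels the `n` rounds.
  by_cases hopt : optPolicy (est x) = optPolicy f
  · rw [hopt]
    simp [gap]
  · have hsub : {z : Hist S A H m | Accepts 𝓡 n (est x) z} ⊆
        {z | (n : ℝ≥0∞) * likelihood f z ≤ likelihood (est x) z} :=
      fun z hz => hz f ⟨hf, Ne.symm hopt⟩
    calc _ = ENNReal.ofReal (gap f (optPolicy (est x))) * (n * historyLaw alg f m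
          {z | Accepts 𝓡 n (est x) z}) := by ring
      _ ≤ ENNReal.ofReal (∑ π, gap f π) * 1 := by
          refine mul_le_mul' (ENNReal.ofReal_le_ofReal (gap_le_sum f _)) ?_
          exact (mul_le_mul_right (measure_mono hsub) _).trans
            (measure_likelihood_ratio_le ha f (est x) m n)
      _ = _ := mul_one _

/-- The regret, if the data of the initialization step are good up to a small probability. -/
theorem regret_testToCommit_le (hm : MeasurableChoices 𝓡 n est plan)
    (hu : ∀ t, Measurable (ucb t)) {f : MDP A sk ν} (hf : f ∈ instances A sk 𝓡)
    {a b ρ ε : ℝ≥0∞} {E : Set (Hist S A H (initList S A n).length)}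
    (hE : historyLaw (testToCommit 𝓡 n est plan ucb) f (initList S A n).length Eᶜ ≤ ε)
    (hb : ∀ x, ∑ π, ENNReal.ofReal (identCount n (plan (est x)) π * gap f π) ≤ b)
    (ha : ∀ x ∈ E, ∑ π, ENNReal.ofReal (identCount n (plan (est x)) π * gap f π) ≤ a)
    (hacc : ∀ x ∈ E, historyLaw (shift (testToCommit 𝓡 n est plan ucb) _ x) f
        (identList n (plan (est x))).length {z | ¬ Accepts 𝓡 n (est x) z} ≤ ρ) :
    regret (testToCommit 𝓡 n est plan ucb) f n ≤
      ENNReal.ofReal ((initList S A n).length * ∑ π, gap f π) + a + ENNReal.ofReal (∑ π, gap f π) +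
        ρ * regret ucb f n + ε * (b + regret ucb f n) := by
  set T := testToCommit 𝓡 n est plan ucb with hT
  have hTm : ∀ t, Measurable (T t) := measurable_testToCommit hm hu
  have hprob := isProbabilityMeasure_historyLaw hTm f (initList S A n).length
  refine (regret_mono T f (show n ≤ (initList S A n).length + n by omega)).trans ?_
  rw [regret_add hTm f (initList S A n).length n]
  have h1 : regret T f (initList S A n).length ≤ ENNReal.ofReal ((initList S A n).length * ∑ π, gap f π) := by
    unfold regret
    have : ∀ t ∈ Finset.range (initList S A n).length, ∫⁻ h, ENNReal.ofReal (gap f (T t h)) ∂(historyLaw T f t) ≤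
        ENNReal.ofReal (∑ π, gap f π) := fun t _ => by
      have := isProbabilityMeasure_historyLaw hTm f t
      refine (lintegral_mono fun h => ENNReal.ofReal_le_ofReal (gap_le_sum f _)).trans ?_
      simp
    refine (Finset.sum_le_sum this).trans (le_of_eq ?_)
    rw [Finset.sum_const, Finset.card_range, nsmul_eq_mul, ENNReal.ofReal_mul (Nat.cast_nonneg _),
      ENNReal.ofReal_natCast]
  -- Data outside `E` are charged the worst plan and the whole fallback regret; the hull is used
  -- because `E` is not assumed measurable.
  have h2 : ∀ x, regret (shift T (initList S A n).length x) f n ≤ (a + ENNReal.ofReal (∑ π, gap f π) +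
      ρ * regret ucb f n) + (toMeasurable (historyLaw T f (initList S A n).length) Eᶜ).indicator
        (fun _ => b + regret ucb f n) x := fun x => by
    refine (regret_shift_testToCommit_le hm hu hf x).trans ?_
    by_cases hx : x ∈ E
    · refine le_trans ?_ le_self_add
      gcongr
      · exact ha x hx
      · exact hacc x hx
    · rw [Set.indicator_of_mem (subset_toMeasurable _ _ hx)]
      have hp := isProbabilityMeasure_historyLaw (measurable_shift hTm (initList S A n).length x) f
        (identList n (plan (est x))).length
      calc _ ≤ b + ENNReal.ofReal (∑ π, gap f π) + 1 * regret ucb f n := by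
            gcongr
            · exact hb x
            · exact prob_le_one
        _ = ENNReal.ofReal (∑ π, gap f π) + (b + regret ucb f n) := by ring
        _ ≤ _ := by
            gcongr
            exact le_add_self.trans le_self_add
  calc _ ≤ ENNReal.ofReal ((initList S A n).length * ∑ π, gap f π) + ∫⁻ x, ((a + ENNReal.ofReal (∑ π, gap f π) +
      ρ * regret ucb f n) + (toMeasurable (historyLaw T f (initList S A n).length) Eᶜ).indicator
        (fun _ => b + regret ucb f n) x) ∂(historyLaw T f (initList S A n).length) :=
        add_le_add h1 (lintegral_mono h2)
    _ ≤ _ := by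
        rw [lintegral_add_left measurable_const,
          lintegral_indicator_const (measurableSet_toMeasurable _ _), measure_toMeasurable]
        simp only [lintegral_const, measure_univ, mul_one]
        rw [mul_comm (b + regret ucb f n)]
        calc _ ≤ ENNReal.ofReal ((initList S A n).length * ∑ π, gap f π) + (a + ENNReal.ofReal (∑ π, gap f π) +
              ρ * regret ucb f n + ε * (b + regret ucb f n)) := by gcongr
          _ = _ := by ring

end Model

section Model

variable {S A : Type*} [Fintype S] [DecidableEq S] [MeasurableSpace S] [MeasurableSingletonClass S]
  [Fintype A] [DecidableEq A] [MeasurableSpace A] [MeasurableSingletonClass A]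
  {H : ℕ} [NeZero H] {sk : Skeleton S H} {ν : Measure ℝ} {𝓡 : Set (RewardDensity ν)}

/-! ### The two exploration phases -/

theorem IsClose.mono {f g : MDP A sk ν} {δ ε δ' ε' : ℝ} (h : IsClose f g δ ε) (hδ : δ ≤ δ')
    (hε : ε ≤ ε') : IsClose f g δ' ε' := by
  have hle : ENNReal.ofReal (1 - ε') ≤ ENNReal.ofReal (1 - ε) :=
    ENNReal.ofReal_le_ofReal (by linarith)
  exact ⟨fun s a => (h.tv_le s a).trans hδ,
    fun s a s' hh => (mul_le_mul_left hle _).trans (h.trans_le s a s' hh),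
    fun s a s' hh => (mul_le_mul_left hle _).trans (h.trans_ge s a s' hh)⟩

theorem expVisits_eq_sum (f : MDP A sk ν) {t : ℕ} (h : Hist S A H t) (s : S) (a : A) :
    expVisits f h s a = ∑ π, numPlays h π * f.occ π s a := by
  rw [expVisits, ← Finset.sum_fiberwise Finset.univ (fun i => (h i).1)]
  refine Finset.sum_congr rfl fun π _ => ?_
  rw [Finset.sum_congr rfl (g := fun _ => f.occ π s a) fun i hi => by
    rw [(Finset.mem_filter.1 hi).2], Finset.sum_const, nsmul_eq_mul, numPlays]

variable [SigmaFinite ν]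

theorem mul_le_expVisits (f : MDP A sk ν) {t : ℕ} {h : Hist S A H t} {s : S} {a : A} {q c : ℝ}
    (hq0 : 0 ≤ q) (hq : ∃ π, q ≤ f.occ π s a) (hc : ∀ π, c ≤ numPlays h π) :
    c * q ≤ expVisits f h s a := by
  obtain ⟨π, hπ⟩ := hq
  rw [expVisits_eq_sum]
  calc c * q ≤ numPlays h π * f.occ π s a := mul_le_mul (hc π) hπ hq0 (Nat.cast_nonneg _)
    _ ≤ _ := Finset.single_le_sum (f := fun π => (numPlays h π : ℝ) * f.occ π s a)
      (fun π _ => mul_nonneg (Nat.cast_nonneg _) (occ_nonneg _ _ _ _)) (Finset.mem_univ π)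

variable [Nonempty A]

/-- After the initialization, the estimate is close to the true instance. -/
theorem exists_measure_not_isClose_le [Nontrivial A] (hR : RewardCondition 𝓡)
    (hint : ∀ g ∈ 𝓡, Integrable (fun x : ℝ => x) g.law) (hmle : HasRewardMLE 𝓡)
    {f : MDP A sk ν} (hf : f ∈ instances A sk 𝓡) {C : ℝ} {p : ℕ}
    (hC : ∀ (alg : Algorithm S A H), (∀ t, Measurable (alg t)) →
      ∀ (t : ℕ), 0 < t → ∀ η : ℝ, 0 < η → η ≤ 1 →
      historyLaw alg f t {h | ¬ GoodHist 𝓡 f η h} ≤ ENNReal.ofReal (C * (1 / η) ^ p / t)) :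
    ∃ D η₀ : ℝ, 0 < D ∧ 0 < η₀ ∧ η₀ ≤ 1 ∧ ∀ η : ℝ, 0 < η → η ≤ η₀ →
      ∀ (n : ℕ) (est : Estimator A sk ν n), IsMLE 𝓡 est → 0 < (initList S A n).length →
      ∀ alg : Algorithm S A H, (∀ t, Measurable (alg t)) →
      (∀ (s : ℕ) (hs : s < (initList S A n).length) h, alg s h = (initList S A n)[s]) →
      historyLaw alg f (initList S A n).length
        {x | IsClose f (est x) (D * Real.sqrt η) (D * Real.sqrt η)}ᶜ ≤
        ENNReal.ofReal (C * (1 / η) ^ p / (initList S A n).length) := by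
  obtain ⟨q, hq0, hq⟩ := exists_occ_pos (fun s a => hint _ (hf.1 s a)) hf
  obtain ⟨Cs, cs, δ₀, hCs, hcs, hδ0, hδ1, hst⟩ := exists_isClose_stability hR hint hf
  set P : ℝ := (Fintype.card (Policy S A) : ℝ) with hP
  have hP0 : 0 < P := by rw [hP]; exact_mod_cast Fintype.card_pos
  -- All `P` decisions are played equally often, and each pair has occupancy at least `q` under one
  -- of them.
  set κ : ℝ := q / P with hκ
  have hκ0 : 0 < κ := by positivity
  obtain ⟨C₁, hC1, hcl⟩ := exists_isClose_of_goodHist hR hf.1 hκ0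
  set D : ℝ := 1 / Real.sqrt κ + C₁ with hD
  have hD0 : 0 < D := by positivity
  refine ⟨D, min (1 / 2) (min ((δ₀ / D) ^ 2) (1 / (2 * C₁))), hD0, by positivity,
    (min_le_left _ _).trans (by norm_num), fun η hη hη0 n est hest hm alg ha hlist => ?_⟩
  have hη1 : η ≤ 1 := (hη0.trans (min_le_left _ _)).trans (by norm_num)
  have hηδ : D * Real.sqrt η ≤ δ₀ := by
    have h1 : η ≤ (δ₀ / D) ^ 2 := hη0.trans ((min_le_right _ _).trans (min_le_left _ _))
    have h2 := Real.sqrt_le_sqrt h1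
    rw [Real.sqrt_sq (by positivity), le_div_iff₀ hD0] at h2
    linarith
  have hηC : C₁ * η < 1 := by
    have h1 : η ≤ 1 / (2 * C₁) := hη0.trans ((min_le_right _ _).trans (min_le_right _ _))
    rw [le_div_iff₀ (by positivity)] at h1
    linarith
  have hη2 : η ≤ Real.sqrt η := Real.le_sqrt_of_sq_le (by nlinarith)
  have hs0 := Real.sqrt_nonneg η
  have hd1 : Real.sqrt (η / κ) ≤ D * Real.sqrt η := by
    rw [Real.sqrt_div hη.le, hD]
    have : 0 ≤ C₁ * Real.sqrt η := by positivity
    have e : Real.sqrt η / Real.sqrt κ = 1 / Real.sqrt κ * Real.sqrt η := by ring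
    linarith
  have hd2 : C₁ * η ≤ D * Real.sqrt η := by
    have h1 : 0 ≤ 1 / Real.sqrt κ * Real.sqrt η := by positivity
    have h2 := mul_le_mul_of_nonneg_left hη2 hC1.le
    rw [hD]; linarith
  refine le_trans (measure_mono_ae ?_) (hC alg ha _ hm η hη hη1)
  filter_upwards [ae_numPlays_playList ha f _ hlist, ae_exists_rewardLik_max hmle ha hf.1
    (initList S A n).length] with x hx1 hx2 hx3
  by_contra hgood
  have hgood' : GoodHist 𝓡 f η x := by
    by_contra h; exact hgood h
  refine hx3 ?_
  have hlen : ((initList S A n).length : ℝ) =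
      P * (⌈Real.log n / Real.log (Real.log n)⌉₊ : ℝ) := by
    rw [initList, length_playList, Finset.sum_const, Finset.card_univ, hP]
    simp
  have hvis : ∀ s a, κ * ((initList S A n).length : ℝ) ≤ expVisits f x s a := fun s a => by
    have h1 := mul_le_expVisits f hq0.le (hq s a) (h := x)
      (c := (⌈Real.log n / Real.log (Real.log n)⌉₊ : ℝ)) fun π => by rw [show numPlays x π = _ from hx1 π]
    refine le_trans (le_of_eq ?_) h1
    rw [hlen, hκ]; field_simp
  obtain ⟨f', hf'R, hmax, hclose⟩ := hcl η hη hηC _ hm x hgood' hvis hx2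
  have hc' := (hclose f' hf'R le_rfl).mono hd1 hd2
  -- The unconstrained maximizer is close to `f` and hence has a unique optimal decision. So the
  -- maximum over the class exists and equals the unconstrained one, and the estimate inherits the
  -- closeness.
  have hf' : f' ∈ instances A sk 𝓡 := (hst f' hf'R _ (by positivity) hηδ hc').1
  obtain ⟨he1, he2⟩ := hest x
  have hle := he2 ⟨f', hf', fun g hg => hmax g hg.1⟩ f' hf'
  exact (hclose _ he1.1 hle).mono hd1 hd2

theorem identCount_bounds {n : ℕ} {w : Policy S A → ℝ} (hM : 1 ≤ bound n)
    (hy : 1 ≤ Real.log n) (hw : ∀ π, 0 ≤ w π ∧ w π ≤ bound n) (π : Policy S A) :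
    (1 + 1 / bound n) * w π * Real.log n ≤ identCount n w π ∧
      Real.log n / bound n ≤ identCount n w π ∧
      (identCount n w π : ℝ) ≤ ((1 + 1 / bound n) * w π + 1 / bound n) * Real.log n + 1 ∧
      (identCount n w π : ℝ) ≤ 4 * (bound n * Real.log n) := by
  set M := bound n
  set y := Real.log n
  have hM0 : 0 < M := by linarith
  have h1M : 1 / M ≤ 1 := by rw [div_le_one hM0]; exact hM
  have hiM : 0 < 1 / M := by positivity
  obtain ⟨hw0, hw1⟩ := hw π
  have h1 : ((1 + 1 / M) * w π + 1 / M) * y ≤ identCount n w π := Nat.le_ceil _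
  have h2 : (identCount n w π : ℝ) < ((1 + 1 / M) * w π + 1 / M) * y + 1 :=
    Nat.ceil_lt_add_one (by positivity)
  have h3 : 0 ≤ (1 + 1 / M) * w π * y := by positivity
  have h4 : 0 ≤ 1 / M * y := by positivity
  have h5 : y / M = 1 / M * y := by ring
  refine ⟨by linarith, by linarith, h2.le, h2.le.trans ?_⟩
  have h6 : (1 + 1 / M) * w π ≤ 2 * M := mul_le_mul (by linarith) hw1 hw0 (by norm_num)
  have h7 : ((1 + 1 / M) * w π + 1 / M) * y ≤ 3 * M * y :=
    mul_le_mul_of_nonneg_right (by linarith) (by linarith)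
  have h8 : 1 ≤ M * y := one_le_mul_of_one_le_of_one_le hM hy
  linarith

/-- After the identification, a good estimate is accepted. -/
theorem exists_measure_not_accepts_le [Nontrivial A] (hR : RewardCondition 𝓡)
    (hint : ∀ g ∈ 𝓡, Integrable (fun x : ℝ => x) g.law)
    {f : MDP A sk ν} (hf : f ∈ instances A sk 𝓡) {C : ℝ} (hC0 : 0 ≤ C) {p : ℕ}
    (hC : ∀ (alg : Algorithm S A H), (∀ t, Measurable (alg t)) →
      ∀ (t : ℕ), 0 < t → ∀ η : ℝ, 0 < η → η ≤ 1 →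
      historyLaw alg f t {h | ¬ GoodHist 𝓡 f η h} ≤ ENNReal.ofReal (C * (1 / η) ^ p / t)) :
    ∃ B : ℝ, 0 < B ∧ ∀ g ∈ instances A sk 𝓡, ∀ δ : ℝ, 0 < δ → δ ≤ 1 / 2 → IsClose f g δ δ →
      ∀ (n : ℕ) (w : Policy S A → ℝ), 1 ≤ bound n → 1 ≤ Real.log n → Feasible 𝓡 g (bound n) w →
      ∀ η : ℝ, 0 < η → η ≤ 1 →
      B * (bound n ^ 2 * (bound n ^ 2 * η + Real.sqrt δ)) ≤ 1 →
      ∀ alg : Algorithm S A H, (∀ t, Measurable (alg t)) →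
      (∀ (s : ℕ) (hs : s < (identList n w).length) h, alg s h = (identList n w)[s]) →
      historyLaw alg f (identList n w).length {z | ¬ Accepts 𝓡 n g z} ≤
        ENNReal.ofReal (C * (1 / η) ^ p * (bound n / Real.log n)) := by
  obtain ⟨q, hq0, hq⟩ := exists_occ_pos (fun s a => hint _ (hf.1 s a)) hf
  obtain ⟨Ca, hCa, hacc⟩ := exists_accepts hR hint hf.1
  have hq1 : q ≤ 1 := by
    obtain ⟨π, hπ⟩ := hq sk.init (Classical.arbitrary A)
    exact hπ.trans (occ_le_one _ _ _ _)
  set P : ℝ := (Fintype.card (Policy S A) : ℝ) with hP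
  have hP1 : 1 ≤ P := by rw [hP]; exact_mod_cast Nat.one_le_iff_ne_zero.2 Fintype.card_ne_zero
  have hP0 : 0 < P := by linarith
  set c₀ : ℝ := 4 * P / q + 1 with hc0
  have hc00 : 0 < c₀ := by positivity
  refine ⟨6 * (Ca * P * c₀), by positivity, fun g hg δ hδ hδ2 hcl n w hM hy hw η hη hη1 hsmall alg
    ha hlist => ?_⟩
  set M := bound n with hMdef
  set y := Real.log n with hydef
  have hM0 : 0 < M := by linarith
  have hy0 : 0 < y := by linarith
  have hn : 0 < n := by
    rcases Nat.eq_zero_or_pos n with h | h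
    · rw [hydef, h] at hy0; simp at hy0
    · exact h
  have hcnt := identCount_bounds hM hy hw.1
  have hlen : ((identList n w).length : ℝ) = ∑ π, (identCount n w π : ℝ) := by
    rw [identList_eq, length_playList]; push_cast; rfl
  have hlen1 : ((identList n w).length : ℝ) ≤ 4 * P * (M * y) := by
    rw [hlen]
    refine (Finset.sum_le_sum fun π _ => (hcnt π).2.2.2).trans (le_of_eq ?_)
    rw [Finset.sum_const, Finset.card_univ, nsmul_eq_mul, hP]; ring
  have hlen2 : y / M ≤ ((identList n w).length : ℝ) := by
    rw [hlen]
    refine (hcnt (Classical.arbitrary _)).2.1.trans ?_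
    exact Finset.single_le_sum (f := fun π => (identCount n w π : ℝ))
      (fun _ _ => Nat.cast_nonneg _) (Finset.mem_univ _)
  have hyM : 0 < y / M := by positivity
  have hlenpos : 0 < (identList n w).length := by
    have : (0 : ℝ) < (identList n w).length := by linarith
    exact_mod_cast this
  set m := (identList n w).length with hm
  have hmr : (0 : ℝ) < m := by exact_mod_cast hlenpos
  -- There are at most `4 P M ln n` rounds, and every decision is played at least `ln n / M` times
  -- thanks to the additive `1 / M` in the plan; `κ` is `q` times the quotient.
  set κ : ℝ := q / (4 * P * M ^ 2) with hκ
  have hκ0 : 0 < κ := by positivity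
  have hM2 : 1 ≤ M ^ 2 := one_le_pow₀ hM
  have hPM : 1 ≤ P * M ^ 2 := one_le_mul_of_one_le_of_one_le hP1 hM2
  have hκ1 : κ ≤ 1 := by
    rw [hκ, div_le_one (by positivity)]
    linarith
  have hsq : δ ≤ Real.sqrt δ := Real.le_sqrt_of_sq_le (by nlinarith)
  have hs0 := Real.sqrt_nonneg δ
  set R : ℝ := M ^ 2 * η + Real.sqrt δ with hRdef
  have hR0 : 0 ≤ R := by positivity
  have hηκ : η / κ = 4 * P / q * (M ^ 2 * η) := by rw [hκ]; field_simp
  have hx2 : η / κ + Real.sqrt δ ≤ c₀ * R := by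
    rw [hηκ, hc0, hRdef]
    have : 0 ≤ 4 * P / q * Real.sqrt δ := by positivity
    have : 0 ≤ M ^ 2 * η := by positivity
    linarith
  have hx1 : η / κ + δ ≤ c₀ * R := by linarith
  set Z : ℝ := Ca * c₀ * R with hZ
  have hZ0 : 0 ≤ Z := by positivity
  have hZ1 : 6 * (P * M ^ 2) * Z ≤ 1 := by
    rw [hZ]; refine le_trans (le_of_eq ?_) hsmall; ring
  have hZ2 : Z ≤ P * M ^ 2 * Z := le_mul_of_one_le_left hZ0 hPM
  have he1 : Ca * (η / κ + δ) ≤ Z := by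
    have := mul_le_mul_of_nonneg_left hx1 hCa.le
    rw [hZ]; linarith
  have he2 : Ca * m * (η / κ + Real.sqrt δ) ≤ 4 * P * (M * y) * Z := by
    calc Ca * m * (η / κ + Real.sqrt δ) ≤ Ca * (4 * P * (M * y)) * (c₀ * R) := by gcongr
      _ = _ := by rw [hZ]; ring
  have hnum : y ≤ (1 - Ca * (η / κ + δ)) * ((1 + 1 / M) * y) -
      Ca * m * (η / κ + Real.sqrt δ) := by
    have h1 : (1 - Z) * ((1 + 1 / M) * y) ≤ (1 - Ca * (η / κ + δ)) * ((1 + 1 / M) * y) :=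
      mul_le_mul_of_nonneg_right (by linarith) (by positivity)
    -- The excess `1 / M` of the plan must cover the relative and the additive error. After
    -- multiplication by `M` these are at most `2 P M² Z` and `4 P M² Z`, whence the constant six.
    have h2 : Z * (1 + 1 / M) + 4 * P * M * Z ≤ 1 / M := by
      rw [le_div_iff₀ hM0]
      have e : (Z * (1 + 1 / M) + 4 * P * M * Z) * M = Z * (M + 1) + 4 * (P * M ^ 2) * Z := by
        field_simp
      rw [e]
      have h3 : M + 1 ≤ 2 * (P * M ^ 2) := by nlinarith
      have h4 := mul_le_mul_of_nonneg_left h3 hZ0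
      linarith
    have h5 := mul_le_mul_of_nonneg_right h2 hy0.le
    linarith
  refine le_trans (measure_mono_ae ?_) ((hC alg ha _ hlenpos η hη hη1).trans
    (ENNReal.ofReal_le_ofReal ?_))
  · filter_upwards [ae_numPlays_playList ha f (identCount n w) hlist] with z hz hrej
    by_contra hgood
    have hgood' : GoodHist 𝓡 f η z := by
      by_contra h; exact hgood h
    refine hrej (hacc g hg δ hδ hδ2 hcl κ η hκ0 hκ1 hη (by linarith) M w hw n m hn hlenpos (1 / M)
      (by positivity) z hgood' (fun s a => ?_) (fun π => ?_) hnum)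
    · have h1 := mul_le_expVisits f hq0.le (hq s a) (h := z) (c := y / M) fun π => by
        rw [show numPlays z π = _ from hz π]; exact (hcnt π).2.1
      refine le_trans ?_ h1
      calc κ * m ≤ κ * (4 * P * (M * y)) := by gcongr
        _ = y / M * q := by rw [hκ]; field_simp
    · have : numPlays z π = _ := hz π
      rw [numPlays] at this
      rw [this]
      exact (hcnt π).1
  · rw [div_eq_mul_inv]
    refine mul_le_mul_of_nonneg_left ?_ (by positivity)
    rw [inv_le_comm₀ hmr (by positivity), inv_div]
    exact hlen2

end Model

/-! ### Asymptotics of the regret bound -/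

theorem tendsto_log_natCast : Tendsto (fun n : ℕ => Real.log n) atTop atTop :=
  Real.tendsto_log_atTop.comp tendsto_natCast_atTop_atTop

theorem tendsto_loglog_natCast : Tendsto (fun n : ℕ => Real.log (Real.log n)) atTop atTop :=
  Real.tendsto_log_atTop.comp tendsto_log_natCast

theorem tendsto_bound : Tendsto bound atTop atTop :=
  (tendsto_rpow_atTop (by norm_num : (0 : ℝ) < 1 / 4)).comp tendsto_loglog_natCast

/-- The bound is a power of `ln ln n`, so any negative power of `ln n` beats its powers. -/
theorem tendsto_bound_pow_mul_rpow (j : ℕ) {r : ℝ} (hr : 0 < r) :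
    Tendsto (fun n : ℕ => bound n ^ j * Real.log n ^ (-r)) atTop (𝓝 0) := by
  have h1 := ((isLittleO_log_rpow_rpow_atTop (1 / 4 * j : ℝ) hr).tendsto_div_nhds_zero).comp
    tendsto_log_natCast
  refine h1.congr' ?_
  filter_upwards [tendsto_log_natCast.eventually_ge_atTop 1] with n hn
  have h0 : 0 ≤ Real.log (Real.log n) := Real.log_nonneg hn
  simp only [Function.comp_apply, bound]
  rw [Real.rpow_neg (by linarith), ← Real.rpow_mul_natCast h0, div_eq_mul_inv]

theorem bound_pow_four {n : ℕ} (hn : 1 ≤ Real.log n) : bound n ^ 4 = Real.log (Real.log n) := by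
  rw [bound, ← Real.rpow_mul_natCast (Real.log_nonneg hn)]
  norm_num

section Model

variable {S A : Type*} [Fintype S] [DecidableEq S] [MeasurableSpace S] [MeasurableSingletonClass S]
  [Fintype A] [DecidableEq A] [MeasurableSpace A] [MeasurableSingletonClass A] [Nonempty A]
  {H : ℕ} [NeZero H] {sk : Skeleton S H} {ν : Measure ℝ} {𝓡 : Set (RewardDensity ν)}

theorem length_initList_bounds {n : ℕ} (hl : 0 < Real.log (Real.log n)) (hy : 0 < Real.log n) :
    Real.log n / Real.log (Real.log n) ≤ (initList S A n).length ∧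
      ((initList S A n).length : ℝ) ≤
        Fintype.card (Policy S A) * (Real.log n / Real.log (Real.log n) + 1) := by
  have hlen : ((initList S A n).length : ℝ) =
      Fintype.card (Policy S A) * (⌈Real.log n / Real.log (Real.log n)⌉₊ : ℝ) := by
    rw [initList, length_playList, Finset.sum_const, Finset.card_univ]
    simp
  have hP : (1 : ℝ) ≤ Fintype.card (Policy S A) := by exact_mod_cast Fintype.card_pos
  have h0 : 0 < Real.log n / Real.log (Real.log n) := by positivity
  have h1 := Nat.le_ceil (Real.log n / Real.log (Real.log n))
  have h2 := Nat.ceil_lt_add_one h0.le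
  rw [hlen]
  exact ⟨by nlinarith, by gcongr⟩

variable [SigmaFinite ν]

theorem sum_identCount_mul_gap_le {n : ℕ} {w : Policy S A → ℝ} (hM : 1 ≤ bound n)
    (hy : 1 ≤ Real.log n) (hw : ∀ π, 0 ≤ w π ∧ w π ≤ bound n) (f : MDP A sk ν) :
    ∑ π, ENNReal.ofReal (identCount n w π * gap f π) ≤
        ENNReal.ofReal (4 * (bound n * Real.log n) * ∑ π, gap f π) ∧
      ∑ π, ENNReal.ofReal (identCount n w π * gap f π) ≤
        ENNReal.ofReal ((1 + 1 / bound n) * cost f w * Real.log n +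
          (Real.log n / bound n + 1) * ∑ π, gap f π) := by
  have h0 : ∀ π, 0 ≤ gap f π := gap_nonneg f
  rw [← ENNReal.ofReal_sum_of_nonneg fun π _ => mul_nonneg (Nat.cast_nonneg _) (h0 π)]
  constructor <;> refine ENNReal.ofReal_le_ofReal ?_
  · rw [Finset.mul_sum]
    exact Finset.sum_le_sum fun π _ =>
      mul_le_mul_of_nonneg_right (identCount_bounds hM hy hw π).2.2.2 (h0 π)
  · calc ∑ π, (identCount n w π : ℝ) * gap f π
        ≤ ∑ π, (((1 + 1 / bound n) * w π + 1 / bound n) * Real.log n + 1) * gap f π :=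
          Finset.sum_le_sum fun π _ =>
            mul_le_mul_of_nonneg_right (identCount_bounds hM hy hw π).2.2.1 (h0 π)
      _ = ∑ π, ((1 + 1 / bound n) * Real.log n * (w π * gap f π) +
            (Real.log n / bound n + 1) * gap f π) :=
          Finset.sum_congr rfl fun π _ => by ring
      _ = _ := by
          rw [Finset.sum_add_distrib, ← Finset.mul_sum, ← Finset.mul_sum, cost]
          ring

/-- All constants precede `n`, `η` and `δ`, so the accuracy may be chosen as a function of `n`
afterwards. The terms are, in order, initialization, the plan of a close estimate, a wrong
commitment, rejection of a close estimate, and a bad estimate. -/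
theorem exists_regret_testToCommit_le [Nontrivial A] (hR : RewardCondition 𝓡)
    (hint : ∀ g ∈ 𝓡, Integrable (fun x : ℝ => x) g.law) (hmle : HasRewardMLE 𝓡)
    {f : MDP A sk ν} (hf : f ∈ instances A sk 𝓡) {K : ℝ}
    (hK : complexity 𝓡 f < ENNReal.ofReal K) :
    ∃ (C D B C₂ c η₀ δ₀ M₀ : ℝ) (p : ℕ), 0 ≤ C ∧ 0 < D ∧ 0 ≤ C₂ ∧ 0 < c ∧ 0 < η₀ ∧ 0 < δ₀ ∧
      ∀ (n : ℕ) (est : Estimator A sk ν n) (plan : MDP A sk ν → Policy S A → ℝ)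
        (ucb : Algorithm S A H), IsMLE 𝓡 est → IsPlan 𝓡 n plan → MeasurableChoices 𝓡 n est plan →
      (∀ t, Measurable (ucb t)) → ∀ η δ U : ℝ, 0 < η → η ≤ η₀ → δ = D * Real.sqrt η → δ ≤ δ₀ →
      M₀ ≤ bound n → 1 ≤ bound n → 1 ≤ Real.log n →
      B * (bound n ^ 2 * (bound n ^ 2 * η + Real.sqrt δ)) ≤ 1 → 0 ≤ U →
      regret ucb f n ≤ ENNReal.ofReal U →
      regret (testToCommit 𝓡 n est plan ucb) f n ≤ ENNReal.ofReal
        ((Fintype.card (Policy S A) * (Real.log n / bound n ^ 4 + 1)) * ∑ π, gap f π +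
          ((1 + 1 / bound n) * (K + C₂ * (bound n * δ ^ c)) * Real.log n +
            (Real.log n / bound n + 1) * ∑ π, gap f π) + ∑ π, gap f π +
          C * (1 / η) ^ p * (bound n / Real.log n) * U +
          C * (1 / η) ^ p * (bound n ^ 4 / Real.log n) *
            (4 * (bound n * Real.log n) * (∑ π, gap f π) + U)) := by
  obtain ⟨C, p, hC0, hC⟩ := exists_measure_not_goodHist_le hR f hf.1
  obtain ⟨D, η₀, hD, hη₀, hη1, hest⟩ := exists_measure_not_isClose_le hR hint hmle hf hC
  obtain ⟨B, -, hacc⟩ := exists_measure_not_accepts_le hR hint hf hC0 hC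
  obtain ⟨C₂, c, δ₀, M₀, hC2, hc, hδ₀, hδ2, hM₀, hcost⟩ := exists_cost_le hR hint hf hK
  refine ⟨C, D, B, C₂, c, η₀, δ₀, M₀, p, hC0, hD, hC2, hc, hη₀, hδ₀,
    fun n est plan ucb he hp hm hu η δ U hη hηη hδ hδδ hMM hM hy hB hU hreg => ?_⟩
  have hy0 : 0 < Real.log n := by linarith
  have hM0 : 0 < bound n := by linarith
  have hl := bound_pow_four hy
  have hl0 : 0 < Real.log (Real.log n) := by rw [← hl]; positivity
  have hδ0 : 0 < δ := by rw [hδ]; positivity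
  have hG : 0 ≤ ∑ π, gap f π := Finset.sum_nonneg fun π _ => gap_nonneg f π
  have hK0 : 0 ≤ K := (ENNReal.ofReal_pos.1 (zero_le.trans_lt hK)).le
  obtain ⟨hm1, hm2⟩ := length_initList_bounds (S := S) (A := A) hl0 hy0
  have hm0 : (0 : ℝ) < (initList S A n).length := lt_of_lt_of_le (by positivity) hm1
  have hbox := fun x => (hp (est x) (he x).1).1
  have hTm : ∀ t, Measurable (testToCommit 𝓡 n est plan ucb t) := measurable_testToCommit hm hu
  have key := regret_testToCommit_le (ucb := ucb) hm hu hf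
    (hest η hη hηη n est he (by exact_mod_cast hm0) _ hTm fun s hs h => testToCommit_init hs h)
    (fun x => (sum_identCount_mul_gap_le hM hy (hbox x) f).1)
    (a := ENNReal.ofReal ((1 + 1 / bound n) * (K + C₂ * (bound n * δ ^ c)) * Real.log n +
          (Real.log n / bound n + 1) * ∑ π, gap f π))
    (ρ := ENNReal.ofReal (C * (1 / η) ^ p * (bound n / Real.log n)))
    (fun x hx => by
      rw [← hδ] at hx
      obtain ⟨hex, hle⟩ := hcost (est x) (he x).1.1 δ hδ0 hδδ hx (bound n) hMM
      refine (sum_identCount_mul_gap_le hM hy (hbox x) f).2.trans (ENNReal.ofReal_le_ofReal ?_)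
      have := hle _ ((hp (est x) (he x).1).2 hex)
      gcongr)
    (fun x hx => by
      rw [← hδ] at hx
      obtain ⟨hex, -⟩ := hcost (est x) (he x).1.1 δ hδ0 hδδ hx (bound n) hMM
      exact hacc (est x) (he x).1 δ hδ0 (hδδ.trans hδ2) hx n _ hM hy
        ((hp (est x) (he x).1).2 hex).1 η hη (hηη.trans hη1) hB _ (measurable_shift hTm _ x)
        fun s hs h => shift_testToCommit_ident x hs h)
  refine key.trans ?_
  have hX : 0 ≤ C * (1 / η) ^ p := by positivity
  have hε : C * (1 / η) ^ p / (initList S A n).length ≤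
      C * (1 / η) ^ p * (bound n ^ 4 / Real.log n) := by
    rw [div_eq_mul_inv]
    refine mul_le_mul_of_nonneg_left ?_ hX
    rw [inv_le_comm₀ hm0 (by positivity), inv_div, hl]
    exact hm1
  rw [← hl] at hm2
  have hδc : 0 ≤ δ ^ c := Real.rpow_nonneg hδ0.le c
  have hQ : 0 ≤ (1 + 1 / bound n) * (K + C₂ * (bound n * δ ^ c)) * Real.log n +
    (Real.log n / bound n + 1) * ∑ π, gap f π := by positivity
  generalize (1 + 1 / bound n) * (K + C₂ * (bound n * δ ^ c)) * Real.log n +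
    (Real.log n / bound n + 1) * ∑ π, gap f π = Q at hQ ⊢
  rw [ENNReal.ofReal_add (by positivity) (by positivity), ENNReal.ofReal_add (by positivity)
    (by positivity), ENNReal.ofReal_add (by positivity) hG, ENNReal.ofReal_add (by positivity)
    (by positivity), ENNReal.ofReal_mul (p := C * (1 / η) ^ p * (bound n / Real.log n))
    (by positivity), ENNReal.ofReal_mul (p := C * (1 / η) ^ p * (bound n ^ 4 / Real.log n))
    (by positivity), ENNReal.ofReal_add (p := 4 * (bound n * Real.log n) * ∑ π, gap f π)
    (by positivity) hU]
  gcongr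

/-- The regret bound of Test-to-Commit. -/
theorem limsup_regret_testToCommit_le [Nontrivial A] (hR : RewardCondition 𝓡)
    (hint : ∀ g ∈ 𝓡, Integrable (fun x : ℝ => x) g.law) (hmle : HasRewardMLE 𝓡)
    {est : (n : ℕ) → Estimator A sk ν n} {plan : ℕ → MDP A sk ν → Policy S A → ℝ}
    (hest : ∀ n, IsMLE 𝓡 (est n)) (hplan : ∀ n, IsPlan 𝓡 n (plan n))
    (hmeas : ∀ n, MeasurableChoices 𝓡 n (est n) (plan n))
    {f : MDP A sk ν} (hf : f ∈ instances A sk 𝓡) {ucb : Algorithm S A H}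
    (hu : ∀ t, Measurable (ucb t)) (hlog : HasLogRegret ucb f) :
    limsup (fun n : ℕ => regret (testToCommit 𝓡 n (est n) (plan n) ucb) f n
      / ENNReal.ofReal (Real.log n)) atTop ≤ complexity 𝓡 f := by
  -- It suffices to beat every `k` above the complexity; for infinite complexity there is none. A
  -- real `K` strictly between makes the program feasible with room to spare.
  refine le_of_forall_gt_imp_ge_of_dense fun k hk => ?_
  obtain ⟨K, hK0, hK, hKk⟩ := ENNReal.lt_iff_exists_real_btwn.1 hk
  refine le_trans ?_ hKk.le
  obtain ⟨C, D, B, C₂, c, η₀, δ₀, M₀, p, hC, hD, hC2, hc, hη₀, hδ₀, hmain⟩ :=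
    exists_regret_testToCommit_le hR hint hmle hf hK
  obtain ⟨Cu', hCu'⟩ := hlog
  set Cu := max Cu' 0
  set G := ∑ π, gap f π
  set P : ℝ := (Fintype.card (Policy S A) : ℝ)
  -- With `η = (ln n) ^ (-a)` the factor `η ^ (-p)` is `(ln n) ^ (a p)` and `a p < 1`. The failure
  -- probabilities then decay like `(ln n) ^ (-r)`, up to powers of the bound.
  set a : ℝ := 1 / (2 * (p + 1)) with ha
  have ha0 : 0 < a := by positivity
  set r : ℝ := 1 - a * p with hr
  have hr0 : 0 < r := by
    have : a * p < 1 := by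
      rw [ha, div_mul_eq_mul_div, one_mul, div_lt_one (by positivity)]
      linarith [(Nat.cast_nonneg p : (0 : ℝ) ≤ p)]
    linarith
  let η : ℕ → ℝ := fun n => Real.log n ^ (-a)
  let δ : ℕ → ℝ := fun n => D * Real.sqrt (η n)
  let F : ℕ → ℝ := fun n => P * ((bound n ^ 4)⁻¹ + (Real.log n)⁻¹) * G +
    ((1 + (bound n)⁻¹) * (K + C₂ * (D ^ c * (bound n ^ 1 * Real.log n ^ (-(a / 2 * c))))) +
      ((bound n)⁻¹ + (Real.log n)⁻¹) * G) + (Real.log n)⁻¹ * G +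
    C * Cu * (bound n ^ 1 * Real.log n ^ (-r)) +
    (C * 4 * G * (bound n ^ 5 * Real.log n ^ (-r)) + C * Cu * (bound n ^ 4 * Real.log n ^ (-r)))
  have hyinv : Tendsto (fun n : ℕ => (Real.log n)⁻¹) atTop (𝓝 0) :=
    tendsto_inv_atTop_zero.comp tendsto_log_natCast
  have hMinv : Tendsto (fun n : ℕ => (bound n)⁻¹) atTop (𝓝 0) :=
    tendsto_inv_atTop_zero.comp tendsto_bound
  have hM4inv : Tendsto (fun n : ℕ => (bound n ^ 4)⁻¹) atTop (𝓝 0) := by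
    simpa using hMinv.pow 4
  have hF : Tendsto F atTop (𝓝 K) := by
    have h := (((((hM4inv.add hyinv).const_mul P).mul_const G).add
      (((hMinv.const_add 1).mul ((((tendsto_bound_pow_mul_rpow 1
        (by positivity : 0 < a / 2 * c)).const_mul (D ^ c)).const_mul C₂).const_add K)).add
        ((hMinv.add hyinv).mul_const G))).add (hyinv.mul_const G)).add
      ((tendsto_bound_pow_mul_rpow 1 hr0).const_mul (C * Cu))
    have h' := h.add (((tendsto_bound_pow_mul_rpow 5 hr0).const_mul (C * 4 * G)).add
      ((tendsto_bound_pow_mul_rpow 4 hr0).const_mul (C * Cu)))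
    simpa [F] using h'
  have hsqrt : ∀ n : ℕ, 1 ≤ Real.log n → Real.sqrt (η n) = Real.log n ^ (-(a / 2)) := fun n hn => by
    rw [Real.sqrt_eq_rpow, ← Real.rpow_mul (by linarith)]
    congr 1; ring
  have hηlim : Tendsto η atTop (𝓝 0) := by
    simpa using tendsto_bound_pow_mul_rpow 0 ha0
  have hδlim : Tendsto δ atTop (𝓝 0) := by
    simpa using (hηlim.sqrt).const_mul D
  have hBlim : Tendsto (fun n => B * (bound n ^ 2 * (bound n ^ 2 * η n + Real.sqrt (δ n))))
      atTop (𝓝 0) := by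
    have h := ((tendsto_bound_pow_mul_rpow 4 ha0).add ((tendsto_bound_pow_mul_rpow 2
      (by positivity : 0 < a / 4)).const_mul (Real.sqrt D))).const_mul B
    simp only [mul_zero, add_zero] at h
    refine h.congr' ?_
    filter_upwards [tendsto_log_natCast.eventually_ge_atTop 1] with n hn
    have : Real.sqrt (δ n) = Real.sqrt D * Real.log n ^ (-(a / 4)) := by
      simp only [δ]
      rw [Real.sqrt_mul hD.le, hsqrt n hn, Real.sqrt_eq_rpow (_ ^ _), ← Real.rpow_mul (by linarith)]
      congr 2; ring
    rw [this]
    simp only [η]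
    ring
  have hlim := ENNReal.tendsto_ofReal hF
  rw [← hlim.limsup_eq]
  refine limsup_le_limsup ?_
  filter_upwards [hCu', tendsto_log_natCast.eventually_ge_atTop 1,
    tendsto_bound.eventually_ge_atTop 1, tendsto_bound.eventually_ge_atTop M₀,
    hηlim.eventually_le_const hη₀, hδlim.eventually_le_const hδ₀,
    hBlim.eventually_le_const one_pos] with n hn hy hM hMM hη hδ hB
  have hy0 : 0 < Real.log n := by linarith
  have hM0 : 0 < bound n := by linarith
  have hη0 : 0 < η n := Real.rpow_pos_of_pos hy0 _
  have hU : regret ucb f n ≤ ENNReal.ofReal (Cu * Real.log n) :=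
    hn.trans (ENNReal.ofReal_le_ofReal (mul_le_mul_of_nonneg_right (le_max_left _ _) hy0.le))
  have key := hmain n (est n) (plan n) ucb (hest n) (hplan n) (hmeas n) hu (η n) (δ n) _ hη0 hη rfl
    hδ hMM hM hy hB (mul_nonneg (le_max_right _ _) hy0.le) hU
  refine (ENNReal.div_le_div_right key _).trans ?_
  rw [← ENNReal.ofReal_div_of_pos hy0]
  refine ENNReal.ofReal_le_ofReal (le_of_eq ?_)
  have e1 : (1 / η n) ^ p = Real.log n * Real.log n ^ (-r) := by
    simp only [η]
    rw [Real.rpow_neg hy0.le, one_div, inv_inv, ← Real.rpow_mul_natCast hy0.le,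
      show Real.log n * Real.log n ^ (-r) = Real.log n ^ (1 + -r) by
        rw [Real.rpow_add hy0, Real.rpow_one]]
    congr 1; rw [hr]; ring
  have e2 : δ n ^ c = D ^ c * Real.log n ^ (-(a / 2 * c)) := by
    simp only [δ]
    rw [hsqrt n hy, Real.mul_rpow hD.le (Real.rpow_nonneg hy0.le _), ← Real.rpow_mul hy0.le]
    congr 2; ring
  simp only [F]
  rw [e1, e2]
  field_simp
  ring

end Model

end T2C

end

theorem mainTheorem5 {S A : Type*}
    [Fintype S] [DecidableEq S] [MeasurableSpace S] [MeasurableSingletonClass S]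
    [Fintype A] [DecidableEq A] [MeasurableSpace A] [MeasurableSingletonClass A] [Nonempty A]
    {H : ℕ} [NeZero H] (sk : T2C.Skeleton S H) (ν : Measure ℝ) [SigmaFinite ν]
    (𝓡 : Set (T2C.RewardDensity ν))
    (hint : ∀ g ∈ 𝓡, Integrable (fun x : ℝ => x) g.law)
    (hcond : T2C.RewardCondition 𝓡) (hmle : T2C.HasRewardMLE 𝓡)
    (est : (n : ℕ) → T2C.Estimator A sk ν n)
    (plan : ℕ → T2C.MDP A sk ν → T2C.Policy S A → ℝ)
    (hest : ∀ n, T2C.IsMLE 𝓡 (est n)) (hplan : ∀ n, T2C.IsPlan 𝓡 n (plan n))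
    (hmeas : ∀ n, T2C.MeasurableChoices 𝓡 n (est n) (plan n))
    (fstar : T2C.MDP A sk ν) (hfstar : fstar ∈ T2C.instances A sk 𝓡) :
    (∀ (V b : ℝ) (ucb : T2C.Algorithm S A H), 0 ≤ V → 0 ≤ b →
      T2C.SubExponentialRewards (A := A) sk 𝓡 V b → T2C.IsUCB V b ucb →
      limsup (fun n : ℕ => T2C.regret (T2C.testToCommit 𝓡 n (est n) (plan n) ucb) fstar n
        / ENNReal.ofReal (Real.log n)) atTop ≤ T2C.complexity 𝓡 fstar) ∧
    (∀ ucb : T2C.Algorithm S A H, (∀ t, Measurable (ucb t)) →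
      (∀ f ∈ T2C.instances A sk 𝓡, T2C.HasLogRegret ucb f) →
      limsup (fun n : ℕ => T2C.regret (T2C.testToCommit 𝓡 n (est n) (plan n) ucb) fstar n
        / ENNReal.ofReal (Real.log n)) atTop ≤ T2C.complexity 𝓡 fstar) := by
  -- With one action there is one decision and the regret vanishes; this case is separate because
  -- unreachable states are compatible with uniqueness there.
  rcases subsingleton_or_nontrivial A with hA | hA
  · have h0 : ∀ alg : ℕ → T2C.Algorithm S A H, limsup (fun n : ℕ => T2C.regret (alg n) fstar n
        / ENNReal.ofReal (Real.log n)) atTop ≤ T2C.complexity 𝓡 fstar := fun alg => by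
      simp [T2C.regret, T2C.gap_eq_zero_of_subsingleton]
    exact ⟨fun V b ucb _ _ _ _ => h0 _, fun ucb _ _ => h0 _⟩
  · exact ⟨fun V b ucb hV hb hse hucb =>
        T2C.limsup_regret_testToCommit_le hcond hint hmle hest hplan hmeas hfstar hucb.1
          (T2C.hasLogRegret_of_isUCB hV hb hse hucb hfstar),
      fun ucb hu hlog => T2C.limsup_regret_testToCommit_le hcond hint hmle hest hplan hmeas hfstar hu
        (hlog fstar hfstar)⟩
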